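/- **Theorem 4.1.** Let $n\ge 1$, write $x=(x',x_n)\in\mathbb R^n$ and $\mathbb R^n_\pm=\{x:\pm x_n>0\}$. All functions are complex valued and functions equal almost everywhere are identified. Let $\mathrm{BMO}=\mathrm{BMO}(\mathbb R^n)$ be the classical space of locally integrable $f$ with $\sup_Q\frac1{|Q|}\int_Q|f-f_Q|\,dx<\infty$ (supremum over all cubes $Q$, $f_Q$ the mean of $f$ on $Q$). For an open set $\Omega$, the Neumann (Dirichlet) Laplacian on $\Omega$ is the nonnegative self-adjoint operator on $L^2(\Omega)$ of the form $\int_\Omega\nabla u\cdot\overline{\nabla v}\,dx$ with form domain $W^{1,2}(\Omega)$ (respectively $W^{1,2}_0(\Omega)$). Let $\Delta_N$ (respectively $\Delta_D$) be the operator on $L^2(\mathbb R^n)$ acting as the Neumann (respectively Dirichlet) Laplacian separately on $\mathbb R^n_+$ and on $\mathbb R^n_-$, and let $\Delta_{DN}$ act as the Neumann Laplacian on $\mathbb R^n_+$ and as the Dirichlet Laplacian on $\mathbb R^n_-$. For $L\in\{\Delta_D,\Delta_N,\Delta_{DN}\}$ the semigroup $e^{-tL}$ has a kernel with Gaussian upper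 bounds, $|p_t(x,y)|\le Ct^{-n/2}e^{-c|x-y|^2/t}$, by which $e^{-tL}$ extends to $$\mathcal M=\Big\{f\in L^1_{\rm loc}(\mathbb R^n):\ \int_{\mathbb R^n}\frac{|f(x)|^2}{1+|x|^{n+d}}\,dx<\infty\ \text{ for some } d>0\Big\}.$$ Put $$\mathrm{BMO}_L=\Big\{f\in\mathcal M:\ \sup_{y\in\mathbb R^n,\,r>0}\frac1{|B(y,r)|}\int_{B(y,r)}|f-e^{-r^2L}f|\,dx<\infty\Big\},\qquad \mathcal K_L=\{f\in\mathcal M:\ e^{-tL}f=f\ \text{ for all } t>0\}.$$ Elements of $\mathrm{BMO}_L$ are considered modulo $\mathcal K_L$, the space of functions of $\mathrm{BMO}_L$-seminorm zero; accordingly $\mathrm{BMO}$ is compared with $\mathrm{BMO}_L$ through the set $\mathrm{BMO}+\mathcal K_L$ of functions that are congruent modulo $\mathcal K_L$ to a function in $\mathrm{BMO}$. Then: 1. $\mathrm{BMO}_{\Delta_D}\subsetneq\mathrm{BMO}+\mathcal K_{\Delta_D}$; the function $\log|x_n|$ belongs to $\mathrm{BMO}$ but not to $\mathrm{BMO}_{\Delta_D}$.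 2. $\mathrm{BMO}\subseteq\mathrm{BMO}_{\Delta_N}$ and $\mathrm{BMO}+\mathcal K_{\Delta_N}\subsetneq\mathrm{BMO}_{\Delta_N}$; with $H=\mathbf 1_{[0,\infty)}$, the function $H(x_n)\log|x_n|$ belongs to $\mathrm{BMO}_{\Delta_N}$ but not to $\mathrm{BMO}+\mathcal K_{\Delta_N}$. 3. $\mathrm{BMO}\not\subseteq\mathrm{BMO}_{\Delta_{DN}}$ and $\mathrm{BMO}_{\Delta_{DN}}\not\subseteq\mathrm{BMO}+\mathcal K_{\Delta_{DN}}$; the function $\log|x_n|$ does not belong to $\mathrm{BMO}_{\Delta_{DN}}$, and $H(x_n)\log|x_n|$ belongs to $\mathrm{BMO}_{\Delta_{DN}}$ but not to $\mathrm{BMO}+\mathcal K_{\Delta_{DN}}$. -/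

import Mathlib

open MeasureTheory Set
open scoped ContDiff ENNReal Pointwise

noncomputable section

namespace SplitBMO

/-- The Euclidean space of dimension `n + 1 ≥ 1`. -/
abbrev E (n : ℕ) : Type := EuclideanSpace ℝ (Fin (n + 1))

/-- The last coordinate, whose zero set is the splitting hyperplane. -/
def lastCoord {n : ℕ} (x : E n) : ℝ := x (Fin.last n)

/-- The open upper half space. -/
def upperHalf (n : ℕ) : Set (E n) := {x | 0 < lastCoord x}

/-- The open lower half space. -/
def lowerHalf (n : ℕ) : Set (E n) := {x | lastCoord x < 0}

/-! ### Classical BMO -/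

/-- The cube with sides parallel to the axes, centre `c` and side length `l`. -/
def cube {n : ℕ} (c : E n) (l : ℝ) : Set (E n) := {x | ∀ i, |x i - c i| ≤ l / 2}

/-- The classical space of (locally integrable, complex valued) functions of bounded mean
oscillation, as a set of functions. -/
def BMO (n : ℕ) : Set (E n → ℂ) :=
  {f | LocallyIntegrable f volume ∧
    ∃ C : ℝ, ∀ (c : E n) (l : ℝ), 0 < l →
      ⨍ x in cube c l, ‖f x - ⨍ y in cube c l, f y‖ ≤ C}

/-! ### Sobolev spaces -/

/-- The partial derivative of `φ` at `x` in the `i`-th coordinate direction. -/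
def partialDeriv {n : ℕ} {F : Type} [NormedAddCommGroup F] [NormedSpace ℝ F]
    (i : Fin (n + 1)) (φ : E n → F) (x : E n) : F :=
  fderiv ℝ φ x (EuclideanSpace.single i 1)

/-- `φ` is smooth with compact support contained in `Ω`. -/
def IsTestFunction {n : ℕ} {F : Type} [NormedAddCommGroup F] [NormedSpace ℝ F]
    (Ω : Set (E n)) (φ : E n → F) : Prop :=
  ContDiff ℝ ∞ φ ∧ HasCompactSupport φ ∧ tsupport φ ⊆ Ω

/-- `u` (restricted to `Ω`) belongs to `W^{1,2}(Ω)`, with weak gradient `G` (restricted to `Ω`). -/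
def MemW12 {n : ℕ} (Ω : Set (E n)) (u : E n → ℂ) (G : Fin (n + 1) → E n → ℂ) : Prop :=
  MemLp u 2 (volume.restrict Ω) ∧
  (∀ i, MemLp (G i) 2 (volume.restrict Ω)) ∧
  ∀ i, ∀ φ : E n → ℝ, IsTestFunction Ω φ →
    ∫ x in Ω, u x * ((partialDeriv i φ x : ℝ) : ℂ) = - ∫ x in Ω, G i x * (φ x : ℂ)

/-- `u` belongs to `W_0^{1,2}(Ω)`, the closure of the test functions in `W^{1,2}(Ω)`, with weak
gradient `G`. -/
def MemW120 {n : ℕ} (Ω : Set (E n)) (u : E n → ℂ) (G : Fin (n + 1) → E n → ℂ) : Prop :=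
  MemW12 Ω u G ∧
  ∀ ε : ℝ, 0 < ε → ∃ φ : E n → ℂ, IsTestFunction Ω φ ∧
    eLpNorm (fun x => u x - φ x) 2 (volume.restrict Ω) ≤ ENNReal.ofReal ε ∧
    ∀ i, eLpNorm (fun x => G i x - partialDeriv i φ x) 2 (volume.restrict Ω) ≤ ENNReal.ofReal ε

/-! ### Dirichlet and Neumann Laplacians

Operators are given by their graphs: `L u g` means that `u` is in the domain of `L` and `L u = g`.
The sign is the one for which the Laplacians are nonnegative. -/

/-- The self-adjoint operator on `L²(Ω)` of the closed form `∫_Ω ∇u · conj ∇v` whose form domain is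
given by `V` (`V u G` says that `u` is in the form domain and has weak gradient `G`). -/
def IsFormOperator {n : ℕ} (Ω : Set (E n)) (V : (E n → ℂ) → (Fin (n + 1) → E n → ℂ) → Prop)
    (u g : E n → ℂ) : Prop :=
  MemLp g 2 (volume.restrict Ω) ∧
  ∃ G, V u G ∧ ∀ v Gv, V v Gv →
    ∑ i, ∫ x in Ω, G i x * star (Gv i x) = ∫ x in Ω, g x * star (v x)

/-- The Neumann Laplacian on `Ω`: form domain `W^{1,2}(Ω)`. -/
def neumannOn {n : ℕ} (Ω : Set (E n)) (u g : E n → ℂ) : Prop :=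
  IsFormOperator Ω (MemW12 Ω) u g

/-- The Dirichlet Laplacian on `Ω`: form domain `W_0^{1,2}(Ω)`. -/
def dirichletOn {n : ℕ} (Ω : Set (E n)) (u g : E n → ℂ) : Prop :=
  IsFormOperator Ω (MemW120 Ω) u g

/-- The Neumann Laplacian on the whole space, split across the hyperplane. -/
def lapN (n : ℕ) (u g : E n → ℂ) : Prop :=
  neumannOn (upperHalf n) u g ∧ neumannOn (lowerHalf n) u g

/-- The Dirichlet Laplacian on the whole space, split across the hyperplane. -/
def lapD (n : ℕ) (u g : E n → ℂ) : Prop :=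
  dirichletOn (upperHalf n) u g ∧ dirichletOn (lowerHalf n) u g

/-- The mixed Dirichlet-Neumann Laplacian: Neumann on the upper half space, Dirichlet on the lower
one. -/
def lapDN (n : ℕ) (u g : E n → ℂ) : Prop :=
  neumannOn (upperHalf n) u g ∧ dirichletOn (lowerHalf n) u g

/-! ### Heat semigroup and heat kernel -/

/-- `u t = exp (-t L) f` in `L²` for all `t ≥ 0`: the function `u` is the solution, continuous on
`[0, ∞)` and differentiable on `(0, ∞)`, of `u' = - L u`, `u 0 = f`. (For a nonnegative
self-adjoint `L` this solution exists and is unique.) -/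
def IsHeatFlow {n : ℕ} (L : (E n → ℂ) → (E n → ℂ) → Prop) (f : Lp ℂ 2 (volume : Measure (E n)))
    (u : ℝ → Lp ℂ 2 (volume : Measure (E n))) : Prop :=
  ContinuousOn u (Ici 0) ∧ u 0 = f ∧
  ∀ t : ℝ, 0 < t → ∃ g : Lp ℂ 2 (volume : Measure (E n)), L (u t) g ∧ HasDerivAt u (-g) t

/-- The action of the integral kernel `p t` on a function. -/
def kernelApply {n : ℕ} (p : ℝ → E n → E n → ℝ) (t : ℝ) (f : E n → ℂ) (x : E n) : ℂ :=
  ∫ y, (p t x y : ℂ) * f y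

/-- `p t` is, for every `t > 0`, the kernel of `exp (-t L)` on `L²`, and `p` satisfies Gaussian
upper bounds. For given `L` and `t` such a kernel is unique up to null sets of pairs `(x, y)`. -/
def IsHeatKernel {n : ℕ} (L : (E n → ℂ) → (E n → ℂ) → Prop) (p : ℝ → E n → E n → ℝ) : Prop :=
  (∀ t : ℝ, 0 < t → Measurable (fun z : E n × E n => p t z.1 z.2)) ∧
  (∃ C c : ℝ, 0 < C ∧ 0 < c ∧ ∀ t : ℝ, 0 < t → ∀ x y : E n,
    |p t x y| ≤ C / t ^ (((n : ℝ) + 1) / 2) * Real.exp (-(c * ‖x - y‖ ^ 2 / t))) ∧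
  ∀ f : Lp ℂ 2 (volume : Measure (E n)), ∃ u, IsHeatFlow L f u ∧
    ∀ t : ℝ, 0 < t → (u t : E n → ℂ) =ᵐ[volume] kernelApply p t f

/-! ### BMO spaces associated with operators -/

/-- The class of locally integrable functions of (quadratic mean) polynomial growth, to which
semigroups with Gaussian bounds extend. -/
def classM (n : ℕ) : Set (E n → ℂ) :=
  {f | LocallyIntegrable f volume ∧
    ∃ d : ℝ, 0 < d ∧ Integrable (fun x => ‖f x‖ ^ 2 / (1 + ‖x‖ ^ ((n : ℝ) + 1 + d))) volume}

/-- The space `BMO_L` as a set of functions (before dividing by the kernel space of `L`). -/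
def BMOL {n : ℕ} (L : (E n → ℂ) → (E n → ℂ) → Prop) : Set (E n → ℂ) :=
  {f | f ∈ classM n ∧ ∃ p, IsHeatKernel L p ∧
    ∃ C : ℝ, ∀ (y : E n) (r : ℝ), 0 < r →
      ⨍ x in Metric.ball y r, ‖f x - kernelApply p (r ^ 2) f x‖ ≤ C}

/-- The kernel space `K_L = {f ∈ M : exp (-t L) f = f for all t > 0}`, the space of functions of
`BMO_L` seminorm zero; elements of `BMO_L` are identified modulo `K_L`. -/
def kerL {n : ℕ} (L : (E n → ℂ) → (E n → ℂ) → Prop) : Set (E n → ℂ) :=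
  {f | f ∈ classM n ∧ ∃ p, IsHeatKernel L p ∧
    ∀ t : ℝ, 0 < t → kernelApply p t f =ᵐ[volume] f}

/-- The set of functions that are congruent modulo `K_L` to a function of classical BMO. -/
def BMOmod {n : ℕ} (L : (E n → ℂ) → (E n → ℂ) → Prop) : Set (E n → ℂ) := BMO n + kerL L

/-! ### The two logarithms -/

/-- The function `log |x_n|`. -/
def logE (n : ℕ) (x : E n) : ℂ := (Real.log |lastCoord x| : ℝ)

/-- The function `H(x_n) log |x_n|`, with `H` the Heaviside function. -/
def logH (n : ℕ) (x : E n) : ℂ :=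
  ((if 0 ≤ lastCoord x then 1 else 0) * Real.log |lastCoord x| : ℝ)

end SplitBMO

end

open SplitBMO

/-! The proof rests on the method of images. On a half space the heat kernel is g_t(x - y) + σ g_t(x
- Ry), where g is the Gaussian, R the reflection in the hyperplane, σ = 1 for the Neumann and σ = -1
for the Dirichlet condition. So on each side the semigroup is Gaussian convolution applied to the
even or odd extension of the data from that side (`pk`, `IsSplit`). The spaces are defined through
an unspecified heat kernel. Hence the explicit kernel must be shown to generate the flow of the
operator defined by the form (`isHeatKernel_pk`), and to be the only candidate up to null sets
(`IsHeatFlow.unique`, `IsHeatKernel.ae_eq`). After `mem_BMOL_iff` and `mem_kerL_iff` only Gaussian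
estimates remain.

Neumann side. The Neumann semigroup fixes constants, so f - exp(-r²L)f does not change when the mean
of f over a cube of side 2r is subtracted from f, and the Gaussian mean of the oscillation at scale
r is bounded (`HasOsc.gmean_le`); this gives `BMO_subset_BMOL_lapN`. That such f belongs to the
growth class needs an L² bound for the oscillation, a weak John-Nirenberg inequality
(`HasOsc.exists_sq_bound`, `BMO_subset_classM`). The two sides do not interact, so a function of
bounded mean oscillation may be replaced by zero on the lower side (`indicator_mem_BMOL`); applied
to the logarithm this puts `logH` into both spaces with a Neumann condition above.

Dirichlet side. By parabolic scaling, (1 - exp(-r²L)) log|x_n| at the point rx equals log r times (1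
- exp(-L)1)(x) plus a function independent of r. The Dirichlet semigroup loses mass, so the factor
of log r is not zero on the lower side and the averages over B(0, r) are unbounded
(`logE_notMem_BMOL`).

Truncated logarithm against BMO + K. If `logH` = h + k with h in BMO and k in the kernel space, then
k has less than linear growth. Being fixed by the semigroup, which has Lipschitz constant of order
t^(-1/2) on each side, k is constant on each side (`exists_ae_eq_const_of_mem_kerL`). Then h is a
constant below and log x_n minus a constant above, which has unbounded oscillation on small cubes
about the origin (`logH_notMem_BMOmod`).

Dirichlet inclusion. For f in the Dirichlet space the increments of s ↦ exp(-sL)f(x) over [s, s + δ]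
with δ ≤ s are O(|x_n|/√s), because exp(-sL) is applied to f - exp(-δL)f, which has bounded
averages, and the Dirichlet kernel vanishes on the hyperplane. Hence exp(-sL)f converges to a
function k fixed by the semigroup (`exists_dsg_limit`, `dsg_eq_self_of_limit`). On a cube of side l
and with s of order l², f - exp(-sL)f has bounded mean and k - exp(-sL)f is within a bounded
distance of a constant, so f - k is in BMO (`sub_limit_mem_BMO`). -/

noncomputable section

/-! ### Reflection and Gaussian estimates. -/

namespace SplitBMO

variable {n : ℕ}

/-! ### The reflection -/

/-- The reflection in the hyperplane `x_n = 0`. -/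
def refl (n : ℕ) : E n ≃ₗᵢ[ℝ] E n :=
  LinearIsometryEquiv.piLpCongrRight 2 (fun i =>
    if i = Fin.last n then LinearIsometryEquiv.neg ℝ else LinearIsometryEquiv.refl ℝ ℝ)

lemma refl_apply_last (x : E n) : refl n x (Fin.last n) = - x (Fin.last n) := by
  simp [refl]

lemma refl_apply_ne (x : E n) {i : Fin (n + 1)} (h : i ≠ Fin.last n) : refl n x i = x i := by
  simp [refl, h]

@[simp] lemma refl_refl (x : E n) : refl n (refl n x) = x := by
  ext i
  by_cases h : i = Fin.last n
  · subst h; simp [refl_apply_last]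
  · simp [refl_apply_ne _ h]

@[simp] lemma lastCoord_refl (x : E n) : lastCoord (refl n x) = - lastCoord x :=
  refl_apply_last x

lemma continuous_lastCoord : Continuous (lastCoord (n := n)) := by
  unfold lastCoord; fun_prop

lemma measurable_lastCoord : Measurable (lastCoord (n := n)) := continuous_lastCoord.measurable

lemma lastCoord_smul (c : ℝ) (x : E n) : lastCoord (c • x) = c * lastCoord x := rfl

lemma abs_coord_le_norm (x : E n) (i : Fin (n + 1)) : |x i| ≤ ‖x‖ := by
  simpa using PiLp.norm_apply_le x i

lemma abs_lastCoord_le (x : E n) : |lastCoord x| ≤ ‖x‖ := abs_coord_le_norm x _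

lemma norm_refl (x : E n) : ‖refl n x‖ = ‖x‖ := (refl n).norm_map x

lemma norm_sub_refl (x y : E n) : ‖x - refl n y‖ = ‖refl n x - y‖ := by
  rw [← norm_refl (x - refl n y), map_sub, refl_refl]

lemma norm_refl_sub_refl (x y : E n) : ‖refl n x - refl n y‖ = ‖x - y‖ := by
  rw [← map_sub, norm_refl]

/-- Only the last coordinate changes, and there (a + b)² = (a - b)² + 4ab. The sign of the product
tells whether x is nearer to y or to its mirror image. -/
lemma norm_sub_refl_sq (x y : E n) :
    ‖x - refl n y‖ ^ 2 = ‖x - y‖ ^ 2 + 4 * (lastCoord x * lastCoord y) := by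
  rw [EuclideanSpace.norm_sq_eq, EuclideanSpace.norm_sq_eq, Fin.sum_univ_castSucc,
    Fin.sum_univ_castSucc]
  have : ∀ i : Fin n, ‖(x - refl n y) (Fin.castSucc i)‖ ^ 2
      = ‖(x - y) (Fin.castSucc i)‖ ^ 2 := by
    intro i
    simp [refl_apply_ne y (Fin.castSucc_lt_last i).ne]
  simp only [this, add_assoc]
  congr 1
  simp only [PiLp.sub_apply, refl_apply_last, Real.norm_eq_abs, sq_abs, lastCoord]
  ring

lemma norm_sub_le_norm_sub_refl {x y : E n} (h : 0 ≤ lastCoord x * lastCoord y) :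
    ‖x - y‖ ≤ ‖x - refl n y‖ := by
  have := norm_sub_refl_sq x y
  exact abs_le_of_sq_le_sq' (by nlinarith) (norm_nonneg _) |>.2

lemma norm_sub_refl_self (x : E n) : ‖x - refl n x‖ = 2 * |lastCoord x| := by
  have := norm_sub_refl_sq x x
  have h2 : ‖x - refl n x‖ ^ 2 = (2 * |lastCoord x|) ^ 2 := by
    rw [this, mul_pow, sq_abs]; simp; ring
  exact (sq_eq_sq₀ (norm_nonneg _) (by positivity)).1 h2

lemma measurePreserving_refl : MeasurePreserving (refl n) (volume : Measure (E n)) volume :=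
  (refl n).measurePreserving

lemma measurableEmbedding_refl : MeasurableEmbedding (refl n) :=
  (refl n).toHomeomorph.measurableEmbedding

/-! ### The Gaussian -/

/-- The heat kernel of the whole space. -/
def gauss (t : ℝ) (z : E n) : ℝ :=
  (4 * Real.pi * t) ^ (-(((n : ℝ) + 1) / 2)) * Real.exp (-(‖z‖ ^ 2 / (4 * t)))

lemma gauss_pos {t : ℝ} (ht : 0 < t) (z : E n) : 0 < gauss t z := by
  unfold gauss; positivity

lemma gauss_nonneg {t : ℝ} (ht : 0 < t) (z : E n) : 0 ≤ gauss t z := (gauss_pos ht z).le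

lemma continuous_gauss (t : ℝ) : Continuous (gauss (n := n) t) := by
  unfold gauss; fun_prop

lemma gauss_congr_norm (t : ℝ) {u v : E n} (h : ‖u‖ = ‖v‖) : gauss t u = gauss t v := by
  simp [gauss, h]

lemma gauss_le_of_norm_le {t : ℝ} (ht : 0 < t) {u v : E n} (h : ‖v‖ ≤ ‖u‖) :
    gauss t u ≤ gauss t v := by
  unfold gauss
  gcongr

lemma finrank_E : (Module.finrank ℝ (E n) : ℝ) = (n : ℝ) + 1 := by simp

lemma integral_gauss {t : ℝ} (ht : 0 < t) : ∫ z : E n, gauss t z = 1 := by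
  unfold gauss
  rw [integral_const_mul]
  have h := GaussianFourier.integral_rexp_neg_mul_sq_norm (V := E n) (b := 1 / (4 * t))
    (by positivity)
  rw [finrank_E] at h
  have e : (fun z : E n => Real.exp (-(‖z‖ ^ 2 / (4 * t))))
      = fun z : E n => Real.exp (-(1 / (4 * t)) * ‖z‖ ^ 2) := by
    ext z; congr 1; ring
  rw [e, h]
  have e2 : Real.pi / (1 / (4 * t)) = 4 * Real.pi * t := by field_simp
  rw [e2, ← Real.rpow_add (by positivity)]
  simp

lemma integrable_gauss {t : ℝ} (ht : 0 < t) : Integrable (gauss (n := n) t) := by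
  by_contra h
  have := integral_gauss (n := n) ht
  rw [integral_undef h] at this
  exact zero_ne_one this

lemma integral_gauss_sub {t : ℝ} (ht : 0 < t) (x : E n) : ∫ y : E n, gauss t (x - y) = 1 := by
  rw [integral_sub_left_eq_self (fun z => gauss t z) volume x, integral_gauss ht]

lemma integrable_gauss_sub {t : ℝ} (ht : 0 < t) (x : E n) :
    Integrable (fun y => gauss t (x - y)) := (integrable_gauss ht).comp_sub_left x

/-- The exponential factor increases with time, so only the normalising factors are lost. -/
lemma gauss_le_gauss {s t : ℝ} (hs : 0 < s) (hst : s ≤ t) (z : E n) :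
    gauss s z ≤ (t / s) ^ (((n : ℝ) + 1) / 2) * gauss t z := by
  have ht : 0 < t := hs.trans_le hst
  unfold gauss
  rw [← mul_assoc]
  have e : (t / s) ^ (((n : ℝ) + 1) / 2) * (4 * Real.pi * t) ^ (-(((n : ℝ) + 1) / 2))
      = (4 * Real.pi * s) ^ (-(((n : ℝ) + 1) / 2)) := by
    rw [Real.rpow_neg (by positivity), Real.rpow_neg (by positivity), ← div_eq_mul_inv,
      ← Real.div_rpow (by positivity) (by positivity), ← Real.inv_rpow (by positivity)]
    congr 1
    field_simp
  rw [e]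
  gcongr

/-- The exponent is halved: one half makes a Gaussian at time 2t, the other is kept in reserve to
absorb polynomial factors or shifts of the centre. -/
lemma gauss_eq_double {t : ℝ} (ht : 0 < t) (z : E n) :
    gauss t z = 2 ^ (((n : ℝ) + 1) / 2) * Real.exp (-(‖z‖ ^ 2 / (8 * t))) * gauss (2 * t) z := by
  unfold gauss
  have e : (4 * Real.pi * t) ^ (-(((n : ℝ) + 1) / 2))
      = 2 ^ (((n : ℝ) + 1) / 2) * (4 * Real.pi * (2 * t)) ^ (-(((n : ℝ) + 1) / 2)) := by
    rw [Real.rpow_neg (by positivity), Real.rpow_neg (by positivity), ← div_eq_mul_inv,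
      ← Real.div_rpow (by positivity) (by positivity), ← Real.inv_rpow (by positivity)]
    congr 1
    field_simp
  have e2 : Real.exp (-(‖z‖ ^ 2 / (4 * t)))
      = Real.exp (-(‖z‖ ^ 2 / (8 * t))) * Real.exp (-(‖z‖ ^ 2 / (4 * (2 * t)))) := by
    rw [← Real.exp_add]; congr 1; field_simp; ring
  rw [e, e2]; ring

/-- Polynomial factors are absorbed by doubling the time. -/
lemma gauss_moment (n m : ℕ) : ∃ C : ℝ, 0 < C ∧ ∀ t : ℝ, 0 < t → ∀ z : E n,
    (‖z‖ ^ 2 / t) ^ m * gauss t z ≤ C * gauss (2 * t) z := by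
  refine ⟨2 ^ (((n : ℝ) + 1) / 2) * (m.factorial * 8 ^ m), by positivity, fun t ht z => ?_⟩
  rw [gauss_eq_double ht]
  have h1 : (‖z‖ ^ 2 / t) ^ m * Real.exp (-(‖z‖ ^ 2 / (8 * t))) ≤ m.factorial * 8 ^ m := by
    have h2 := Real.pow_div_factorial_le_exp (‖z‖ ^ 2 / (8 * t)) (by positivity) m
    rw [div_le_iff₀ (by positivity)] at h2
    rw [Real.exp_neg, ← div_eq_mul_inv, div_le_iff₀ (Real.exp_pos _)]
    have e : (‖z‖ ^ 2 / t) ^ m = 8 ^ m * (‖z‖ ^ 2 / (8 * t)) ^ m := by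
      rw [← mul_pow]; congr 1; field_simp
    rw [e]
    calc 8 ^ m * (‖z‖ ^ 2 / (8 * t)) ^ m
        ≤ 8 ^ m * (Real.exp (‖z‖ ^ 2 / (8 * t)) * m.factorial) := by gcongr
      _ = _ := by ring
  have hg := gauss_nonneg (n := n) (mul_pos two_pos ht) z
  calc (‖z‖ ^ 2 / t) ^ m * (2 ^ (((n : ℝ) + 1) / 2) * Real.exp (-(‖z‖ ^ 2 / (8 * t)))
        * gauss (2 * t) z)
      = 2 ^ (((n : ℝ) + 1) / 2) * ((‖z‖ ^ 2 / t) ^ m * Real.exp (-(‖z‖ ^ 2 / (8 * t))))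
        * gauss (2 * t) z := by ring
    _ ≤ 2 ^ (((n : ℝ) + 1) / 2) * (m.factorial * 8 ^ m) * gauss (2 * t) z := by gcongr

/-- Since ‖v‖² ≤ 2‖u‖² + 2t, a shift by at most √t costs only a constant and a doubling of time.
This is what allows ball averages inside Gaussian means. -/
lemma gauss_shift {t : ℝ} (ht : 0 < t) {u v : E n} (h : ‖u - v‖ ^ 2 ≤ t) :
    gauss t u ≤ Real.exp (1 / 4) * 2 ^ (((n : ℝ) + 1) / 2) * gauss (2 * t) v := by
  have h1 : ‖v‖ ^ 2 / 2 - t ≤ ‖u‖ ^ 2 := by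
    have h2 : ‖v‖ ≤ ‖u‖ + ‖u - v‖ := by
      have := norm_sub_le u (u - v); simpa using this
    nlinarith [norm_nonneg u, norm_nonneg v, norm_nonneg (u - v), sq_nonneg (‖u‖ - ‖u - v‖)]
  have e := gauss_eq_double ht v
  have h3 : gauss t u ≤ Real.exp (1 / 4 + ‖v‖ ^ 2 / (8 * t)) * gauss t v := by
    unfold gauss
    rw [mul_left_comm, ← Real.exp_add]
    gcongr
    have : (‖v‖ ^ 2 / 2 - t) / (4 * t) ≤ ‖u‖ ^ 2 / (4 * t) := by gcongr
    have e3 : (‖v‖ ^ 2 / 2 - t) / (4 * t) = ‖v‖ ^ 2 / (8 * t) - 1 / 4 := by field_simp; ring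
    have e4 : ‖v‖ ^ 2 / (4 * t) = ‖v‖ ^ 2 / (8 * t) + ‖v‖ ^ 2 / (8 * t) := by field_simp; ring
    linarith
  refine h3.trans (le_of_eq ?_)
  rw [e, Real.exp_add]
  have : Real.exp (‖v‖ ^ 2 / (8 * t)) * Real.exp (-(‖v‖ ^ 2 / (8 * t))) = 1 := by
    rw [← Real.exp_add]; simp
  linear_combination Real.exp (1 / 4) * 2 ^ (((n : ℝ) + 1) / 2) * gauss (2 * t) v * this

/-- Mean value inequality on [a, b]: half of the exponent absorbs the linear factor of the
derivative, and the other half is largest at the left endpoint. -/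
lemma exp_radial_lip {t : ℝ} (ht : 0 < t) {a b : ℝ} (ha : 0 ≤ a) (hab : a ≤ b) :
    |Real.exp (-(b ^ 2 / (4 * t))) - Real.exp (-(a ^ 2 / (4 * t)))|
      ≤ (1 / √t * Real.exp (-(a ^ 2 / (8 * t)))) * |b - a| := by
  have hd : ∀ r : ℝ, HasDerivAt (fun r : ℝ => Real.exp (-(r ^ 2 / (4 * t))))
      (Real.exp (-(r ^ 2 / (4 * t))) * (-(2 * r / (4 * t)))) r := by
    intro r
    have := ((((hasDerivAt_id r).pow 2).div_const (4 * t)).neg).exp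
    simpa using this
  refine Convex.norm_image_sub_le_of_norm_deriv_le (𝕜 := ℝ) (s := Icc a b)
    (f := fun r : ℝ => Real.exp (-(r ^ 2 / (4 * t))))
    (fun r _ => (hd r).differentiableAt) (fun r hr => ?_) (convex_Icc a b)
    (left_mem_Icc.2 hab) (right_mem_Icc.2 hab)
  rw [(hd r).deriv]
  have hr0 : 0 ≤ r := ha.trans hr.1
  have hs : 0 < √t := Real.sqrt_pos.2 ht
  have hst : √t ^ 2 = t := Real.sq_sqrt ht.le
  rw [norm_mul, norm_neg, Real.norm_of_nonneg (Real.exp_pos _).le,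
    Real.norm_of_nonneg (by positivity)]
  have e : Real.exp (-(r ^ 2 / (4 * t)))
      = Real.exp (-(r ^ 2 / (8 * t))) * Real.exp (-(r ^ 2 / (8 * t))) := by
    rw [← Real.exp_add]; congr 1; field_simp; ring
  have h1 : Real.exp (-(r ^ 2 / (8 * t))) * (2 * r / (4 * t)) ≤ 1 / √t := by
    rw [Real.exp_neg, inv_mul_le_iff₀ (Real.exp_pos _)]
    have h2 : 1 + r ^ 2 / (8 * t) ≤ Real.exp (r ^ 2 / (8 * t)) := by
      linarith [Real.add_one_le_exp (r ^ 2 / (8 * t))]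
    refine le_trans ?_ (mul_le_mul_of_nonneg_right h2 (by positivity))
    have e3 : t = √t ^ 2 := hst.symm
    set q := √t
    rw [e3]
    rw [div_le_iff₀ (by positivity)]
    have : (1 + r ^ 2 / (8 * q ^ 2)) * (1 / q) * (4 * q ^ 2) = (8 * q ^ 2 + r ^ 2) / (2 * q) := by
      field_simp; ring
    rw [this, le_div_iff₀ (by positivity)]
    nlinarith [sq_nonneg (r - 2 * q), sq_nonneg q]
  calc _ = (Real.exp (-(r ^ 2 / (8 * t))) * (2 * r / (4 * t))) * Real.exp (-(r ^ 2 / (8 * t))) := by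
        rw [e]; ring
    _ ≤ 1 / √t * Real.exp (-(a ^ 2 / (8 * t))) := by
        gcongr
        exact hr.1

/-- The Gaussian is radial, so the radial estimate at the shorter vector suffices; the sum on the
right makes the bound symmetric. With v a reflected point it measures vanishing at the hyperplane,
with v a nearby point it gives Lipschitz regularity. -/
lemma gauss_lip {t : ℝ} (ht : 0 < t) (u v : E n) :
    |gauss t u - gauss t v| ≤ 2 ^ (((n : ℝ) + 1) / 2) * (‖u - v‖ / √t)
      * (gauss (2 * t) u + gauss (2 * t) v) := by
  wlog h : ‖v‖ ≤ ‖u‖ generalizing u v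
  · have := this v u (le_of_not_ge h)
    rwa [abs_sub_comm, norm_sub_rev, add_comm (gauss _ v)] at this
  have h1 := exp_radial_lip ht (norm_nonneg v) h
  have h2 : |‖u‖ - ‖v‖| ≤ ‖u - v‖ := abs_norm_sub_norm_le u v
  have hc : 0 < (4 * Real.pi * t) ^ (-(((n : ℝ) + 1) / 2)) := by positivity
  have h3 : 2 ^ (((n : ℝ) + 1) / 2) * gauss (2 * t) v
      = (4 * Real.pi * t) ^ (-(((n : ℝ) + 1) / 2)) * Real.exp (-(‖v‖ ^ 2 / (8 * t))) := by
    have := gauss_eq_double ht v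
    have e : Real.exp (-(‖v‖ ^ 2 / (8 * t))) * Real.exp (-(‖v‖ ^ 2 / (8 * t)))
      = Real.exp (-(‖v‖ ^ 2 / (4 * t))) := by
      rw [← Real.exp_add]; congr 1; field_simp; ring
    have h5 : gauss t v = (4 * Real.pi * t) ^ (-(((n : ℝ) + 1) / 2))
      * Real.exp (-(‖v‖ ^ 2 / (8 * t))) * Real.exp (-(‖v‖ ^ 2 / (8 * t))) := by
      rw [mul_assoc, e]; rfl
    have hp := Real.exp_pos (-(‖v‖ ^ 2 / (8 * t)))
    rw [h5] at this
    apply mul_right_cancel₀ hp.ne'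
    rw [this]; ring
  calc |gauss t u - gauss t v|
      = (4 * Real.pi * t) ^ (-(((n : ℝ) + 1) / 2)) *
        |Real.exp (-(‖u‖ ^ 2 / (4 * t))) - Real.exp (-(‖v‖ ^ 2 / (4 * t)))| := by
        unfold gauss
        rw [← mul_sub, abs_mul, abs_of_pos hc]
    _ ≤ (4 * Real.pi * t) ^ (-(((n : ℝ) + 1) / 2)) *
        ((1 / √t * Real.exp (-(‖v‖ ^ 2 / (8 * t)))) * ‖u - v‖) := by
        gcongr
        exact h1.trans (by gcongr)
    _ = (‖u - v‖ / √t) * (2 ^ (((n : ℝ) + 1) / 2) * gauss (2 * t) v) := by rw [h3]; ring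
    _ ≤ (‖u - v‖ / √t) * (2 ^ (((n : ℝ) + 1) / 2) * (gauss (2 * t) u + gauss (2 * t) v)) := by
        gcongr
        linarith [gauss_nonneg (mul_pos two_pos ht) u]
    _ = _ := by ring

/-- Completing the square in y: the exponent splits into -‖x‖²/(4(s + t)) and a multiple of the
squared distance from y to (t/(s + t))x. -/
lemma gauss_semigroup {s t : ℝ} (hs : 0 < s) (ht : 0 < t) (x : E n) :
    ∫ y, gauss s (x - y) * gauss t y = gauss (s + t) x := by
  have hst : 0 < s + t := add_pos hs ht
  set b : ℝ := (s + t) / (4 * s * t) with hb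
  have hbp : 0 < b := by positivity
  have key : ∀ y : E n, gauss s (x - y) * gauss t y =
      ((4 * Real.pi * s) ^ (-(((n : ℝ) + 1) / 2)) * (4 * Real.pi * t) ^ (-(((n : ℝ) + 1) / 2))
        * Real.exp (-(‖x‖ ^ 2 / (4 * (s + t)))))
        * Real.exp (-b * ‖y - (t / (s + t)) • x‖ ^ 2) := by
    intro y
    have h1 : ‖x - y‖ ^ 2 = ‖x‖ ^ 2 - 2 * inner ℝ x y + ‖y‖ ^ 2 := norm_sub_sq_real x y
    have h2 : ‖y - (t / (s + t)) • x‖ ^ 2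
        = ‖y‖ ^ 2 - 2 * ((t / (s + t)) * inner ℝ x y) + (t / (s + t)) ^ 2 * ‖x‖ ^ 2 := by
      rw [norm_sub_sq_real, inner_smul_right, norm_smul, mul_pow, Real.norm_eq_abs, sq_abs,
        real_inner_comm]
    unfold gauss
    have e : Real.exp (-(‖x - y‖ ^ 2 / (4 * s))) * Real.exp (-(‖y‖ ^ 2 / (4 * t)))
        = Real.exp (-(‖x‖ ^ 2 / (4 * (s + t))))
          * Real.exp (-b * ‖y - (t / (s + t)) • x‖ ^ 2) := by
      rw [← Real.exp_add, ← Real.exp_add]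
      congr 1
      rw [h1, h2, hb]
      field_simp
      ring
    linear_combination (4 * Real.pi * s) ^ (-(((n : ℝ) + 1) / 2))
      * (4 * Real.pi * t) ^ (-(((n : ℝ) + 1) / 2)) * e
  simp_rw [key]
  rw [integral_const_mul, integral_sub_right_eq_self (fun y : E n => Real.exp (-b * ‖y‖ ^ 2)),
    GaussianFourier.integral_rexp_neg_mul_sq_norm hbp, finrank_E]
  unfold gauss
  have e : (4 * Real.pi * s) ^ (-(((n : ℝ) + 1) / 2)) * (4 * Real.pi * t) ^ (-(((n : ℝ) + 1) / 2))
      * (Real.pi / b) ^ (((n : ℝ) + 1) / 2) = (4 * Real.pi * (s + t)) ^ (-(((n : ℝ) + 1) / 2)) := by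
    rw [Real.rpow_neg (by positivity), Real.rpow_neg (by positivity), Real.rpow_neg (by positivity),
      ← Real.inv_rpow (by positivity), ← Real.inv_rpow (by positivity),
      ← Real.inv_rpow (by positivity),
      ← Real.mul_rpow (by positivity) (by positivity),
      ← Real.mul_rpow (by positivity) (by positivity)]
    congr 1
    rw [hb]
    field_simp
  linear_combination Real.exp (-(‖x‖ ^ 2 / (4 * (s + t)))) * e

lemma gauss_semigroup_sub {s t : ℝ} (hs : 0 < s) (ht : 0 < t) (x z : E n) :
    ∫ y, gauss s (x - y) * gauss t (y - z) = gauss (s + t) (x - z) := by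
  rw [← gauss_semigroup hs ht (x - z), ← integral_add_right_eq_self _ z]
  congr 1; ext y
  congr 2 <;> abel

end SplitBMO

end

/-! ### Gaussian convolution on L² and the heat flow of the whole space. -/

noncomputable section

namespace SplitBMO

variable {n : ℕ}

/-! ### Square integrals -/

lemma eLpNorm_two_sq {α F : Type*} [MeasurableSpace α] [NormedAddCommGroup F] (f : α → F)
    (μ : Measure α) : eLpNorm f 2 μ ^ 2 = ∫⁻ x, ‖f x‖ₑ ^ 2 ∂μ := by
  have := eLpNorm_nnreal_pow_eq_lintegral (f := f) (μ := μ) (p := 2) two_ne_zero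
  simpa using this

/-- Cauchy-Schwarz for the factorisation kφ = k^(1/2) · (k^(1/2) φ). -/
lemma lintegral_mul_sq_le {α : Type*} [MeasurableSpace α] (μ : Measure α) {k φ : α → ℝ≥0∞}
    (hk : AEMeasurable k μ) (hφ : AEMeasurable φ μ) :
    (∫⁻ x, k x * φ x ∂μ) ^ 2 ≤ (∫⁻ x, k x ∂μ) * ∫⁻ x, k x * φ x ^ 2 ∂μ := by
  have h := ENNReal.lintegral_mul_le_Lp_mul_Lq μ (p := 2) (q := 2)
    ⟨by norm_num, by norm_num, by norm_num⟩
    (f := fun x => k x ^ (1 / 2 : ℝ)) (g := fun x => k x ^ (1 / 2 : ℝ) * φ x)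
    (hk.pow_const _) ((hk.pow_const _).mul hφ)
  have e0 : ∀ a : ℝ≥0∞, a ^ (1 / 2 : ℝ) * a ^ (1 / 2 : ℝ) = a := by
    intro a
    rw [← ENNReal.rpow_add_of_nonneg _ _ (by norm_num) (by norm_num)]; norm_num
  have e1 : ∀ a : ℝ≥0∞, (a ^ (1 / 2 : ℝ)) ^ (2 : ℝ) = a := by
    intro a; rw [← ENNReal.rpow_mul]; norm_num
  have e2 : ∀ x, ((fun x => k x ^ (1 / 2 : ℝ)) * fun x => k x ^ (1 / 2 : ℝ) * φ x) x
      = k x * φ x := by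
    intro x; simp only [Pi.mul_apply]; rw [← mul_assoc, e0]
  have e3 : ∀ x, (k x ^ (1 / 2 : ℝ) * φ x) ^ (2 : ℝ) = k x * φ x ^ 2 := by
    intro x; rw [ENNReal.mul_rpow_of_nonneg _ _ (by norm_num), e1]; norm_num
  simp only [e1, e2, e3] at h
  calc (∫⁻ x, k x * φ x ∂μ) ^ 2
      ≤ ((∫⁻ x, k x ∂μ) ^ (1 / 2 : ℝ) * (∫⁻ x, k x * φ x ^ 2 ∂μ) ^ (1 / 2 : ℝ)) ^ 2 := by
        gcongr
    _ = _ := by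
        rw [mul_pow, sq, sq, e0, e0]

/-- Weighted averages contract square integrals. -/
lemma lintegral_average_sq_le {k : E n → ℝ≥0∞} {Φ : E n → E n → ℝ≥0∞}
    (hk : Measurable k) (hΦ : Measurable (Function.uncurry Φ)) :
    ∫⁻ x, (∫⁻ w, k w * Φ x w) ^ 2 ≤ (∫⁻ w, k w) * ∫⁻ w, k w * ∫⁻ x, Φ x w ^ 2 := by
  calc ∫⁻ x, (∫⁻ w, k w * Φ x w) ^ 2
      ≤ ∫⁻ x, (∫⁻ w, k w) * ∫⁻ w, k w * Φ x w ^ 2 :=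
        lintegral_mono fun x => lintegral_mul_sq_le _ hk.aemeasurable
          (hΦ.of_uncurry_left).aemeasurable
    _ = (∫⁻ w, k w) * ∫⁻ x, ∫⁻ w, k w * Φ x w ^ 2 := by
        rw [lintegral_const_mul]
        exact Measurable.lintegral_prod_right (f := fun x w => k w * Φ x w ^ 2)
          ((hk.comp measurable_snd).mul (hΦ.pow_const 2))
    _ = (∫⁻ w, k w) * ∫⁻ w, ∫⁻ x, k w * Φ x w ^ 2 := by
        rw [lintegral_lintegral_swap]
        exact ((hk.comp measurable_snd).mul (hΦ.pow_const 2)).aemeasurable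
    _ = _ := by
        congr 2; ext w
        rw [lintegral_const_mul]
        exact (hΦ.of_uncurry_right).pow_const 2

/-! ### Convolution with kernels dominated by Gaussians -/

/-- The convolution of a real kernel with a complex function. -/
def gconv (k : E n → ℝ) (F : E n → ℂ) (x : E n) : ℂ := ∫ y, (k (x - y) : ℂ) * F y

/-- Continuous kernels dominated by a multiple of a Gaussian. -/
structure GaussBdd (k : E n → ℝ) : Prop where
  cont : Continuous k
  bound : ∃ C s : ℝ, 0 < s ∧ ∀ z, |k z| ≤ C * gauss s z

lemma GaussBdd.integrable {k : E n → ℝ} (hk : GaussBdd k) : Integrable k := by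
  obtain ⟨C, s, hs, h⟩ := hk.bound
  exact ((integrable_gauss hs).const_mul C).mono' hk.cont.aestronglyMeasurable
    (Filter.Eventually.of_forall h)

lemma gauss_le_const (t : ℝ) (ht : 0 < t) (z : E n) :
    gauss t z ≤ (4 * Real.pi * t) ^ (-(((n : ℝ) + 1) / 2)) := by
  unfold gauss
  have : Real.exp (-(‖z‖ ^ 2 / (4 * t))) ≤ 1 := Real.exp_le_one_iff.2 (by
    have : 0 ≤ ‖z‖ ^ 2 / (4 * t) := by positivity
    linarith)
  exact mul_le_of_le_one_right (by positivity) this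

lemma memLp_of_bounded_integrable {k : E n → ℝ} (hk : Integrable k) {M : ℝ}
    (hM : ∀ z, |k z| ≤ M) : MemLp k 2 := by
  rw [memLp_two_iff_integrable_sq hk.aestronglyMeasurable]
  refine (hk.norm.mul_const M).mono' (hk.aestronglyMeasurable.pow 2)
    (Filter.Eventually.of_forall fun z => ?_)
  rw [norm_pow, sq, Real.norm_eq_abs]
  exact mul_le_mul_of_nonneg_left (hM z) (abs_nonneg _)

lemma GaussBdd.exists_bound {k : E n → ℝ} (hk : GaussBdd k) : ∃ M, ∀ z, |k z| ≤ M := by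
  obtain ⟨C, s, hs, h⟩ := hk.bound
  refine ⟨|C| * (4 * Real.pi * s) ^ (-(((n : ℝ) + 1) / 2)), fun z => (h z).trans ?_⟩
  calc C * gauss s z ≤ |C| * gauss s z := by
        gcongr
        · exact gauss_nonneg hs z
        · exact le_abs_self C
    _ ≤ _ := by gcongr; exact gauss_le_const s hs z

lemma GaussBdd.memLp {k : E n → ℝ} (hk : GaussBdd k) : MemLp k 2 := by
  obtain ⟨M, hM⟩ := hk.exists_bound
  exact memLp_of_bounded_integrable hk.integrable hM

lemma gaussBdd_gauss {t : ℝ} (ht : 0 < t) : GaussBdd (gauss (n := n) t) :=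
  ⟨continuous_gauss t, 1, t, ht, fun z => by rw [abs_of_nonneg (gauss_nonneg ht z), one_mul]⟩

lemma GaussBdd.add {k l : E n → ℝ} (hk : GaussBdd k) (hl : GaussBdd l) :
    GaussBdd (fun z => k z + l z) := by
  obtain ⟨C, s, hs, h⟩ := hk.bound
  obtain ⟨D, t, ht, h'⟩ := hl.bound
  refine ⟨hk.cont.add hl.cont, |C| * (max s t / s) ^ (((n : ℝ) + 1) / 2)
    + |D| * (max s t / t) ^ (((n : ℝ) + 1) / 2), max s t, lt_max_of_lt_left hs, fun z => ?_⟩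
  have h1 : |k z| ≤ |C| * ((max s t / s) ^ (((n : ℝ) + 1) / 2) * gauss (max s t) z) :=
    (h z).trans (mul_le_mul (le_abs_self C) (gauss_le_gauss hs (le_max_left _ _) z)
      (gauss_nonneg hs z) (abs_nonneg _))
  have h2 : |l z| ≤ |D| * ((max s t / t) ^ (((n : ℝ) + 1) / 2) * gauss (max s t) z) :=
    (h' z).trans (mul_le_mul (le_abs_self D) (gauss_le_gauss ht (le_max_right _ _) z)
      (gauss_nonneg ht z) (abs_nonneg _))
  calc |k z + l z| ≤ |k z| + |l z| := abs_add_le _ _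
    _ ≤ _ := by linarith

lemma GaussBdd.const_mul {k : E n → ℝ} (hk : GaussBdd k) (c : ℝ) :
    GaussBdd (fun z => c * k z) := by
  obtain ⟨C, s, hs, h⟩ := hk.bound
  refine ⟨continuous_const.mul hk.cont, |c| * C, s, hs, fun z => ?_⟩
  rw [abs_mul, mul_assoc]
  exact mul_le_mul_of_nonneg_left (h z) (abs_nonneg c)

lemma GaussBdd.sub {k l : E n → ℝ} (hk : GaussBdd k) (hl : GaussBdd l) :
    GaussBdd (fun z => k z - l z) := by
  have := hk.add (hl.const_mul (-1))
  simpa [sub_eq_add_neg] using this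

lemma GaussBdd.integrable_mul {k : E n → ℝ} (hk : GaussBdd k) {F : E n → ℂ} (hF : MemLp F 2)
    (x : E n) : Integrable (fun y => (k (x - y) : ℂ) * F y) := by
  have h1 : MemLp (fun y => (k (x - y) : ℂ)) 2 :=
    (hk.memLp.comp_measurePreserving (Measure.measurePreserving_sub_left volume x)).ofReal
  exact h1.integrable_mul hF

lemma measurable_gconv {k : E n → ℝ} (hk : Measurable k) {F : E n → ℂ} (hF : Measurable F) :
    Measurable (gconv k F) := by
  unfold gconv
  apply StronglyMeasurable.measurable
  apply StronglyMeasurable.integral_prod_right' (f := fun p : E n × E n => (k (p.1 - p.2) : ℂ) * F p.2)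
  apply Measurable.stronglyMeasurable
  fun_prop

/-- Young's inequality for L¹ and L²: after the substitution w = x - y the convolution is a weighted
average of translates of F, each of the same norm. -/
lemma eLpNorm_gconv_le {k : E n → ℝ} (hk : Measurable k) {F : E n → ℂ} (hF : Measurable F) :
    eLpNorm (gconv k F) 2 volume ≤ (∫⁻ z, ‖k z‖ₑ) * eLpNorm F 2 volume := by
  rw [← ENNReal.pow_le_pow_left_iff two_ne_zero, mul_pow, eLpNorm_two_sq, eLpNorm_two_sq]
  calc ∫⁻ x, ‖gconv k F x‖ₑ ^ 2
      ≤ ∫⁻ x, (∫⁻ w, ‖k w‖ₑ * ‖F (x - w)‖ₑ) ^ 2 := by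
        refine lintegral_mono fun x => ?_
        gcongr
        refine (enorm_integral_le_lintegral_enorm _).trans (le_of_eq ?_)
        rw [← lintegral_sub_left_eq_self _ x]
        refine lintegral_congr fun y => ?_
        rw [enorm_mul, sub_sub_cancel]
        congr 1
        rw [← ofReal_norm, ← ofReal_norm, Complex.norm_real]
    _ ≤ (∫⁻ w, ‖k w‖ₑ) * ∫⁻ w, ‖k w‖ₑ * ∫⁻ x, ‖F (x - w)‖ₑ ^ 2 :=
        lintegral_average_sq_le (Φ := fun x w => ‖F (x - w)‖ₑ) hk.enorm
          (hF.comp (measurable_fst.sub measurable_snd)).enorm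
    _ = (∫⁻ w, ‖k w‖ₑ) * ∫⁻ w, ‖k w‖ₑ * ∫⁻ x, ‖F x‖ₑ ^ 2 := by
        congr 2; ext w
        rw [lintegral_sub_right_eq_self (fun x => ‖F x‖ₑ ^ 2) w]
    _ = _ := by
        rw [lintegral_mul_const _ hk.enorm]; ring

lemma GaussBdd.memLp_gconv {k : E n → ℝ} (hk : GaussBdd k) {F : E n → ℂ} (hF : Measurable F)
    (hF2 : MemLp F 2) : MemLp (gconv k F) 2 := by
  refine ⟨(measurable_gconv hk.cont.measurable hF).aestronglyMeasurable, ?_⟩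
  refine (eLpNorm_gconv_le hk.cont.measurable hF).trans_lt ?_
  exact ENNReal.mul_lt_top hk.integrable.hasFiniteIntegral hF2.eLpNorm_lt_top

/-- The kernel of a Gaussian bounded convolution, paired with two square integrable functions, is
integrable on the product. -/
lemma GaussBdd.integrable_prod {k : E n → ℝ} (hk : GaussBdd k) {F V : E n → ℂ}
    (hF : MemLp F 2) (hV : MemLp V 2) :
    Integrable (fun p : E n × E n => (k (p.1 - p.2) : ℂ) * F p.2 * V p.1)
      (volume.prod volume) := by
  have hF' : Integrable (fun y => ‖F y‖ ^ 2) := (memLp_two_iff_integrable_sq_norm hF.1).1 hF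
  have hV' : Integrable (fun y => ‖V y‖ ^ 2) := (memLp_two_iff_integrable_sq_norm hV.1).1 hV
  have h1 : Integrable (fun p : E n × E n => ‖F p.2‖ ^ 2 * ‖k (p.1 - p.2)‖)
      (volume.prod volume) := hF'.convolution_integrand (ContinuousLinearMap.mul ℝ ℝ)
        hk.integrable.norm
  have hk' : Integrable (fun z => ‖k (-z)‖) := hk.integrable.comp_neg.norm
  have h2 : Integrable (fun p : E n × E n => ‖V p.2‖ ^ 2 * ‖k (-(p.1 - p.2))‖)
      (volume.prod volume) := hV'.convolution_integrand (ContinuousLinearMap.mul ℝ ℝ) hk'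
  have h3 := h2.swap
  -- The majorant comes from |k||F||V| ≤ |k|(|F|² + |V|²)/2.
  refine ((h1.add h3).const_mul (1 / 2)).mono' ?_ (Filter.Eventually.of_forall fun p => ?_)
  · refine ((Continuous.aestronglyMeasurable ?_).mul hF.1.comp_snd).mul hV.1.comp_fst
    exact Complex.continuous_ofReal.comp (hk.cont.comp (continuous_fst.sub continuous_snd))
  · simp only [Pi.add_apply, Function.comp_apply, Prod.fst_swap, Prod.snd_swap, neg_sub, norm_mul,
      Complex.norm_real]
    have : 0 ≤ ‖k (p.1 - p.2)‖ * (‖F p.2‖ - ‖V p.1‖) ^ 2 := by positivity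
    nlinarith

lemma gconv_sub {k : E n → ℝ} (hk : GaussBdd k) {F G : E n → ℂ}
    (hF : MemLp F 2) (hG : MemLp G 2) (x : E n) :
    gconv k (fun y => F y - G y) x = gconv k F x - gconv k G x := by
  unfold gconv
  rw [← integral_sub (hk.integrable_mul hF x) (hk.integrable_mul hG x)]
  congr 1; ext y; ring

/-! ### Time derivative of the Gaussian -/

/-- The time derivative of the Gaussian. -/
def dgauss (t : ℝ) (z : E n) : ℝ :=
  gauss t z * (‖z‖ ^ 2 / (4 * t ^ 2) - ((n : ℝ) + 1) / (2 * t))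

lemma hasDerivAt_gauss {t : ℝ} (ht : 0 < t) (z : E n) :
    HasDerivAt (fun s => gauss s z) (dgauss t z) t := by
  have h1 : HasDerivAt (fun s : ℝ => 4 * Real.pi * s) (4 * Real.pi) t := by
    simpa using (hasDerivAt_id t).const_mul (4 * Real.pi)
  have h2 := h1.rpow_const (p := -(((n : ℝ) + 1) / 2)) (Or.inl (by positivity))
  have h3 : HasDerivAt (fun s : ℝ => -(‖z‖ ^ 2 / (4 * s))) (‖z‖ ^ 2 / (4 * t ^ 2)) t := by
    have h4 : HasDerivAt (fun s : ℝ => 4 * s) 4 t := by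
      simpa using (hasDerivAt_id t).const_mul (4 : ℝ)
    have := (h4.fun_inv (by positivity)).const_mul (-‖z‖ ^ 2)
    refine (this.congr_deriv ?_).congr_of_eventuallyEq (Filter.Eventually.of_forall fun s => ?_)
    · field_simp
    · simp only [div_eq_mul_inv]; ring
  have h4 := h2.mul h3.exp
  refine h4.congr_deriv ?_
  unfold dgauss gauss
  rw [Real.rpow_sub_one (by positivity)]
  field_simp
  ring

lemma continuous_dgauss (t : ℝ) : Continuous (dgauss (n := n) t) := by
  unfold dgauss
  exact (continuous_gauss t).mul (by fun_prop)

lemma dgauss_bound (n : ℕ) : ∃ C : ℝ, 0 < C ∧ ∀ t : ℝ, 0 < t → ∀ z : E n,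
    |dgauss t z| ≤ C / t * gauss (2 * t) z := by
  obtain ⟨C₁, hC₁, h₁⟩ := gauss_moment n 1
  obtain ⟨C₀, hC₀, h₀⟩ := gauss_moment n 0
  refine ⟨C₁ + (n + 1) * C₀, by positivity, fun t ht z => ?_⟩
  have a := h₁ t ht z
  have b := h₀ t ht z
  simp only [pow_one, pow_zero, one_mul] at a b
  have hg := gauss_nonneg ht z
  have hg2 := gauss_nonneg (n := n) (mul_pos two_pos ht) z
  unfold dgauss
  rw [abs_mul, abs_of_nonneg hg]
  have h3 : |‖z‖ ^ 2 / (4 * t ^ 2) - ((n : ℝ) + 1) / (2 * t)|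
      ≤ ((‖z‖ ^ 2 / t) + (n + 1)) / t := by
    refine (abs_sub _ _).trans ?_
    rw [abs_of_nonneg (by positivity), abs_of_nonneg (by positivity),
      add_div (‖z‖ ^ 2 / t), div_div, ← sq]
    gcongr
    · nlinarith [sq_nonneg t]
    · linarith
  calc gauss t z * |‖z‖ ^ 2 / (4 * t ^ 2) - ((n : ℝ) + 1) / (2 * t)|
      ≤ gauss t z * (((‖z‖ ^ 2 / t) + (n + 1)) / t) := by gcongr
    _ = ((‖z‖ ^ 2 / t) * gauss t z + (n + 1) * gauss t z) / t := by ring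
    _ ≤ (C₁ * gauss (2 * t) z + (n + 1) * (C₀ * gauss (2 * t) z)) / t := by gcongr
    _ = _ := by ring

lemma gaussBdd_dgauss {t : ℝ} (ht : 0 < t) : GaussBdd (dgauss (n := n) t) := by
  obtain ⟨C, _, h⟩ := dgauss_bound n
  exact ⟨continuous_dgauss t, C / t, 2 * t, by positivity, h t ht⟩

/-- The difference quotient of the Gaussian in time, minus the derivative. -/
def qgauss (t h : ℝ) (z : E n) : ℝ := h⁻¹ * (gauss (t + h) z - gauss t z) - dgauss t z

lemma gaussBdd_qgauss {t h : ℝ} (ht : 0 < t) (hh : |h| < t) : GaussBdd (qgauss (n := n) t h) :=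
  (((gaussBdd_gauss (by linarith [neg_abs_le h])).sub (gaussBdd_gauss ht)).const_mul _).sub
    (gaussBdd_dgauss ht)

/-- Mean value inequality on (t/2, 2t), where one Gaussian at time 4t dominates all time
derivatives. The bound is uniform in h, as dominated convergence requires. -/
lemma qgauss_bound (n : ℕ) {t : ℝ} (ht : 0 < t) : ∃ C : ℝ, ∀ h : ℝ, |h| < t / 2 → ∀ z : E n,
    |qgauss t h z| ≤ C * gauss (4 * t) z := by
  obtain ⟨C, hC, hd⟩ := dgauss_bound n
  have key : ∀ s, t / 2 < s → s < 2 * t → ∀ z : E n, |dgauss s z|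
      ≤ C / (t / 2) * (4 ^ (((n : ℝ) + 1) / 2) * gauss (4 * t) z) := by
    intro s h1 h2 z
    have hs : 0 < s := by linarith
    refine (hd s hs z).trans ?_
    have h3 := gauss_le_gauss (n := n) (s := 2 * s) (t := 4 * t) (by linarith) (by linarith) z
    have h4 : (4 * t / (2 * s)) ^ (((n : ℝ) + 1) / 2) ≤ 4 ^ (((n : ℝ) + 1) / 2) := by
      gcongr
      rw [div_le_iff₀ (by positivity)]; linarith
    have hg := gauss_nonneg (n := n) (t := 4 * t) (by positivity) z
    calc C / s * gauss (2 * s) z ≤ C / (t / 2) * gauss (2 * s) z := by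
          gcongr
          exact gauss_nonneg (by positivity) z
      _ ≤ C / (t / 2) * ((4 * t / (2 * s)) ^ (((n : ℝ) + 1) / 2) * gauss (4 * t) z) := by gcongr
      _ ≤ _ := by gcongr
  refine ⟨2 * (C / (t / 2) * 4 ^ (((n : ℝ) + 1) / 2)), fun h hh z => ?_⟩
  have hh' := abs_lt.1 hh
  have hb := key t (by linarith) (by linarith) z
  have hq : |h⁻¹ * (gauss (t + h) z - gauss t z)|
      ≤ C / (t / 2) * (4 ^ (((n : ℝ) + 1) / 2) * gauss (4 * t) z) := by
    have hm := Convex.norm_image_sub_le_of_norm_deriv_le (𝕜 := ℝ) (f := fun s => gauss s z)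
      (s := Ioo (t / 2) (2 * t)) (x := t) (y := t + h)
      (C := C / (t / 2) * (4 ^ (((n : ℝ) + 1) / 2) * gauss (4 * t) z))
      (fun s hs => (hasDerivAt_gauss (by linarith [hs.1]) z).differentiableAt)
      (fun s hs => by
        rw [(hasDerivAt_gauss (by linarith [hs.1]) z).deriv]
        exact key s hs.1 hs.2 z)
      (convex_Ioo _ _) ⟨by linarith, by linarith⟩ ⟨by linarith, by linarith⟩
    have hnn : 0 ≤ C / (t / 2) * (4 ^ (((n : ℝ) + 1) / 2) * gauss (4 * t) z) :=
      (abs_nonneg _).trans hb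
    rw [add_sub_cancel_left, Real.norm_eq_abs, Real.norm_eq_abs] at hm
    rw [abs_mul, abs_inv]
    rcases eq_or_ne h 0 with rfl | h0
    · simpa using hnn
    · rw [inv_mul_le_iff₀ (abs_pos.2 h0), mul_comm]; exact hm
  unfold qgauss
  calc _ ≤ |h⁻¹ * (gauss (t + h) z - gauss t z)| + |dgauss t z| := abs_sub _ _
    _ ≤ _ := by linarith

/-- Convergence of the difference quotients in L¹; Young's inequality turns it into
differentiability of the heat flow in the norm of L². -/
lemma tendsto_lintegral_qgauss {t : ℝ} (ht : 0 < t) :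
    Filter.Tendsto (fun h => ∫⁻ z : E n, ‖qgauss t h z‖ₑ) (nhdsWithin 0 {0}ᶜ) (nhds 0) := by
  obtain ⟨C, hC⟩ := qgauss_bound n ht
  have hev : ∀ᶠ h in nhdsWithin (0 : ℝ) {0}ᶜ, |h| < t / 2 := by
    apply mem_nhdsWithin_of_mem_nhds
    have := Metric.ball_mem_nhds (0 : ℝ) (half_pos ht)
    filter_upwards [this] with h hh
    simpa using hh
  have := tendsto_lintegral_filter_of_dominated_convergence (μ := (volume : Measure (E n)))
    (l := nhdsWithin (0 : ℝ) {0}ᶜ) (F := fun h z => ‖qgauss t h z‖ₑ) (f := fun _ => 0)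
    (fun z => ENNReal.ofReal (C * gauss (4 * t) z)) ?_ ?_ ?_ ?_
  · simpa using this
  · filter_upwards [hev] with h hh
    exact ((gaussBdd_qgauss ht (by linarith)).cont.measurable).enorm
  · filter_upwards [hev] with h hh
    refine Filter.Eventually.of_forall fun z => ?_
    rw [Real.enorm_eq_ofReal_abs]
    exact ENNReal.ofReal_le_ofReal (hC h hh z)
  · exact (((integrable_gauss (by positivity)).const_mul C).lintegral_lt_top).ne
  · refine Filter.Eventually.of_forall fun z => ?_
    have h1 := (hasDerivAt_gauss ht z).tendsto_slope_zero
    have h2 : Filter.Tendsto (fun h => qgauss t h z) (nhdsWithin 0 {0}ᶜ) (nhds 0) := by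
      have := h1.sub_const (dgauss t z)
      simpa [qgauss] using this
    simpa using h2.enorm

/-! ### The heat semigroup on `L²` of the whole space -/

abbrev L2 (n : ℕ) : Type := Lp ℂ 2 (volume : Measure (E n))

lemma L2.measurable (F : L2 n) : Measurable F := (Lp.stronglyMeasurable F).measurable

/-- Convolution with a Gaussian bounded kernel as a map of `L²`. -/
def gconvLp {k : E n → ℝ} (hk : GaussBdd k) (F : L2 n) : L2 n :=
  (hk.memLp_gconv F.measurable (Lp.memLp F)).toLp

lemma coe_gconvLp {k : E n → ℝ} (hk : GaussBdd k) (F : L2 n) :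
    gconvLp hk F =ᵐ[volume] gconv k F := MemLp.coeFn_toLp _

lemma norm_gconvLp_le {k : E n → ℝ} (hk : GaussBdd k) (F : L2 n) :
    ‖gconvLp hk F‖ ≤ (∫⁻ z, ‖k z‖ₑ).toReal * ‖F‖ := by
  rw [gconvLp, Lp.norm_toLp, Lp.norm_def, ← ENNReal.toReal_mul]
  refine ENNReal.toReal_mono ?_ (eLpNorm_gconv_le hk.cont.measurable F.measurable)
  exact (ENNReal.mul_lt_top hk.integrable.hasFiniteIntegral (Lp.memLp F).eLpNorm_lt_top).ne

/-- The heat flow of the whole space. -/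
def heatLp (F : L2 n) (t : ℝ) : L2 n :=
  if h : 0 < t then gconvLp (gaussBdd_gauss h) F else F

lemma heatLp_zero (F : L2 n) : heatLp F 0 = F := by simp [heatLp]

lemma heatLp_of_pos (F : L2 n) {t : ℝ} (ht : 0 < t) : heatLp F t = gconvLp (gaussBdd_gauss ht) F := by
  simp [heatLp, ht]

lemma hasDerivAt_heatLp (F : L2 n) {t : ℝ} (ht : 0 < t) :
    HasDerivAt (heatLp F) (gconvLp (gaussBdd_dgauss ht) F) t := by
  rw [hasDerivAt_iff_tendsto_slope_zero, tendsto_iff_norm_sub_tendsto_zero]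
  have hlim : Filter.Tendsto (fun h => (∫⁻ z : E n, ‖qgauss t h z‖ₑ).toReal * ‖F‖)
      (nhdsWithin 0 {0}ᶜ) (nhds 0) := by
    have := (ENNReal.tendsto_toReal ENNReal.zero_ne_top).comp (tendsto_lintegral_qgauss (n := n) ht)
    simpa using this.mul_const ‖F‖
  refine squeeze_zero' (Filter.Eventually.of_forall fun _ => norm_nonneg _) ?_ hlim
  have hev : ∀ᶠ h in nhdsWithin (0 : ℝ) {0}ᶜ, |h| < t := by
    apply mem_nhdsWithin_of_mem_nhds
    filter_upwards [Metric.ball_mem_nhds (0 : ℝ) ht] with h hh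
    simpa using hh
  filter_upwards [hev] with h hh
  have hth : 0 < t + h := by linarith [neg_abs_le h]
  refine le_trans (le_of_eq ?_) (norm_gconvLp_le (gaussBdd_qgauss ht hh) F)
  congr 1
  rw [heatLp_of_pos F hth, heatLp_of_pos F ht]
  apply Lp.ext
  filter_upwards [coe_gconvLp (gaussBdd_qgauss ht hh) F, coe_gconvLp (gaussBdd_dgauss ht) F,
    coe_gconvLp (gaussBdd_gauss hth) F, coe_gconvLp (gaussBdd_gauss ht) F,
    Lp.coeFn_sub (h⁻¹ • (gconvLp (gaussBdd_gauss hth) F - gconvLp (gaussBdd_gauss ht) F))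
      (gconvLp (gaussBdd_dgauss ht) F),
    Lp.coeFn_smul h⁻¹ (gconvLp (gaussBdd_gauss hth) F - gconvLp (gaussBdd_gauss ht) F),
    Lp.coeFn_sub (gconvLp (gaussBdd_gauss hth) F) (gconvLp (gaussBdd_gauss ht) F)]
    with x h1 h2 h3 h4 h5 h6 h7
  rw [h5, Pi.sub_apply, h6, Pi.smul_apply, h7, Pi.sub_apply, h1, h2, h3, h4]
  have hm := Lp.memLp F
  have e : ∀ y, ((qgauss t h (x - y) : ℝ) : ℂ) * F y
      = h⁻¹ • (((gauss (t + h) (x - y) : ℝ) : ℂ) * F y - ((gauss t (x - y) : ℝ) : ℂ) * F y)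
        - ((dgauss t (x - y) : ℝ) : ℂ) * F y := by
    intro y
    simp only [qgauss, Complex.real_smul]
    push_cast; ring
  unfold gconv
  simp_rw [e]
  have i1 := (gaussBdd_gauss hth).integrable_mul hm x
  have i2 := (gaussBdd_gauss ht).integrable_mul hm x
  have i3 := (gaussBdd_dgauss ht).integrable_mul hm x
  have i4 : Integrable (fun y => h⁻¹ • (((gauss (t + h) (x - y) : ℝ) : ℂ) * F y
      - ((gauss t (x - y) : ℝ) : ℂ) * F y)) := (i1.sub i2).smul h⁻¹
  rw [integral_sub i4 i3, integral_smul, integral_sub i1 i2]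

/-- Continuity of translations in `L²`. -/
lemma tendsto_translation (F : L2 n) :
    Filter.Tendsto (fun w : E n => ∫⁻ x, ‖F (x - w) - F x‖ₑ ^ 2) (nhds 0) (nhds 0) := by
  let g : E n → C(E n, E n) := fun w => ⟨fun x => x - w, by fun_prop⟩
  have hg : Continuous g := by
    apply ContinuousMap.continuous_of_continuous_uncurry
    simp only [g, Function.uncurry_def, ContinuousMap.coe_mk]
    fun_prop
  have hgm : ∀ w, MeasurePreserving (g w) (volume : Measure (E n)) volume :=
    fun w => measurePreserving_sub_right volume w
  have hc := (Continuous.compMeasurePreservingLp (p := 2) (f := fun _ : E n => F)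
    continuous_const hg hgm (by simp)).tendsto 0
  have h0 : Lp.compMeasurePreserving (g 0) (hgm 0) F = F := by
    apply Lp.ext
    filter_upwards [Lp.coeFn_compMeasurePreserving F (hgm 0)] with x hx
    rw [hx]; simp [g]
  rw [h0, Lp.tendsto_Lp_iff_tendsto_eLpNorm'] at hc
  have h2 := (ENNReal.continuous_pow 2).tendsto _ |>.comp hc
  simp only [Function.comp_def] at h2
  rw [zero_pow two_ne_zero] at h2
  refine h2.congr fun w => ?_
  rw [eLpNorm_two_sq]
  apply lintegral_congr_ae
  filter_upwards [Lp.coeFn_compMeasurePreserving F (hgm w)] with x hx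
  rw [Pi.sub_apply, hx]; simp [g]

lemma lintegral_gauss {t : ℝ} (ht : 0 < t) : ∫⁻ z : E n, ENNReal.ofReal (gauss t z) = 1 := by
  rw [← ofReal_integral_eq_lintegral_ofReal (integrable_gauss ht)
    (Filter.Eventually.of_forall (gauss_nonneg ht)), integral_gauss ht, ENNReal.ofReal_one]

/-- The Gaussians form an approximate identity. -/
lemma tendsto_lintegral_gauss_mul {om : E n → ℝ≥0∞} {M : ℝ≥0∞} (hM : M ≠ ⊤) (homM : ∀ w, om w ≤ M)
    (hom : Filter.Tendsto om (nhds 0) (nhds 0)) :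
    Filter.Tendsto (fun t => ∫⁻ z : E n, ENNReal.ofReal (gauss t z) * om z) (nhdsWithin 0 (Ioi 0))
      (nhds 0) := by
  obtain ⟨C, hC, hmom⟩ := gauss_moment n 1
  simp only [pow_one] at hmom
  rw [ENNReal.tendsto_nhds_zero]
  intro ε hε
  have hε2 : 0 < ε / 2 := ENNReal.half_pos hε.ne'
  obtain ⟨δ, hδ, hball⟩ := Metric.eventually_nhds_iff.1 ((ENNReal.tendsto_nhds_zero.1 hom) _ hε2)
  -- Near the origin `om` is small. Outside the ball of radius δ the factor ‖z‖²/δ² ≥ 1 may be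
  -- inserted, and the second moment bound yields O(t/δ²) times a Gaussian at time 2t.
  have hpt : ∀ t : ℝ, 0 < t → ∀ z : E n, ENNReal.ofReal (gauss t z) * om z ≤
      ENNReal.ofReal (gauss t z) * (ε / 2)
        + ENNReal.ofReal (gauss (2 * t) z) * (M * ENNReal.ofReal (C * t / δ ^ 2)) := by
    intro t ht z
    by_cases hz : ‖z‖ < δ
    · exact (mul_le_mul_right (hball (by simpa using hz)) _).trans le_self_add
    · push Not at hz
      refine le_trans ?_ le_add_self
      have h1 : gauss t z ≤ gauss (2 * t) z * (C * t / δ ^ 2) := by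
        have h2 := hmom t ht z
        have h3 : δ ^ 2 / t * gauss t z ≤ C * gauss (2 * t) z := by
          refine le_trans ?_ h2
          gcongr
          exact gauss_nonneg ht z
        calc gauss t z = (t / δ ^ 2) * (δ ^ 2 / t * gauss t z) := by field_simp
          _ ≤ (t / δ ^ 2) * (C * gauss (2 * t) z) := by gcongr
          _ = _ := by ring
      calc ENNReal.ofReal (gauss t z) * om z
          ≤ ENNReal.ofReal (gauss (2 * t) z * (C * t / δ ^ 2)) * M := by
            gcongr; exact homM z
        _ = _ := by
            rw [ENNReal.ofReal_mul (gauss_nonneg (by positivity) z)]; ring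
  have hlim : Filter.Tendsto (fun t : ℝ => M * ENNReal.ofReal (C * t / δ ^ 2))
      (nhdsWithin 0 (Ioi 0)) (nhds 0) := by
    have h1 : Filter.Tendsto (fun t : ℝ => C * t / δ ^ 2) (nhdsWithin 0 (Ioi 0)) (nhds 0) := by
      have : Continuous (fun t : ℝ => C * t / δ ^ 2) := by fun_prop
      have := this.tendsto 0
      simp only [mul_zero, zero_div] at this
      exact this.mono_left nhdsWithin_le_nhds
    have h2 := ENNReal.tendsto_ofReal h1
    rw [ENNReal.ofReal_zero] at h2
    simpa using ENNReal.Tendsto.const_mul h2 (Or.inr hM)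
  filter_upwards [(ENNReal.tendsto_nhds_zero.1 hlim) _ hε2, self_mem_nhdsWithin] with t h1 ht
  have ht : 0 < t := ht
  calc ∫⁻ z : E n, ENNReal.ofReal (gauss t z) * om z
      ≤ ∫⁻ z : E n, (ENNReal.ofReal (gauss t z) * (ε / 2)
        + ENNReal.ofReal (gauss (2 * t) z) * (M * ENNReal.ofReal (C * t / δ ^ 2))) :=
        lintegral_mono (hpt t ht)
    _ = ε / 2 + M * ENNReal.ofReal (C * t / δ ^ 2) := by
        have m : ∀ t : ℝ, Measurable (fun z : E n => ENNReal.ofReal (gauss t z)) :=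
          fun t => (continuous_gauss t).measurable.ennreal_ofReal
        rw [lintegral_add_left ((m t).mul_const _), lintegral_mul_const _ (m t),
          lintegral_mul_const _ (m (2 * t)), lintegral_gauss ht, lintegral_gauss (by positivity),
          one_mul, one_mul]
    _ ≤ ε / 2 + ε / 2 := by gcongr
    _ = ε := ENNReal.add_halves ε

/-- The Gaussian has mass one, so the error is a Gaussian average of F(· - w) - F. Its squared norm
is at most the Gaussian average of the squared translation modulus, which is bounded and tends to 0
at w = 0. -/
lemma tendsto_heatLp_zero (F : L2 n) :
    Filter.Tendsto (heatLp F) (nhdsWithin 0 (Ioi 0)) (nhds F) := by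
  rw [Lp.tendsto_Lp_iff_tendsto_eLpNorm']
  have hFm := F.measurable
  have hom := tendsto_translation F
  have hM : ∀ w, ∫⁻ x, ‖F (x - w) - F x‖ₑ ^ 2 ≤ 4 * ∫⁻ x, ‖F x‖ₑ ^ 2 := by
    intro w
    rw [← eLpNorm_two_sq (fun x => F (x - w) - F x), ← eLpNorm_two_sq]
    have h1 : eLpNorm (fun x => F (x - w) - F x) 2 volume ≤ 2 * eLpNorm F 2 volume := by
      have := eLpNorm_sub_le (f := fun x => F (x - w)) (g := F) (p := 2) (μ := volume)
        (hFm.comp (measurable_sub_const w)).aestronglyMeasurable hFm.aestronglyMeasurable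
        (by norm_num)
      rw [show (fun x => F (x - w)) = F ∘ (fun x => x - w) from rfl,
        eLpNorm_comp_measurePreserving hFm.aestronglyMeasurable
          (measurePreserving_sub_right volume w), ← two_mul] at this
      exact this
    calc _ ≤ (2 * eLpNorm F 2 volume) ^ 2 := by gcongr
      _ = _ := by rw [mul_pow]; norm_num
  have hMf : 4 * ∫⁻ x, ‖F x‖ₑ ^ 2 ≠ ⊤ := by
    rw [← eLpNorm_two_sq]
    exact ENNReal.mul_ne_top (by simp) (ENNReal.pow_ne_top (Lp.eLpNorm_ne_top F))
  have hlim := tendsto_lintegral_gauss_mul hMf hM hom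
  have hlim2 := (ENNReal.continuous_rpow_const (y := 1 / 2)).tendsto _ |>.comp hlim
  rw [ENNReal.zero_rpow_of_pos (by norm_num)] at hlim2
  refine tendsto_of_tendsto_of_tendsto_of_le_of_le' tendsto_const_nhds hlim2
    (Filter.Eventually.of_forall fun _ => zero_le) ?_
  filter_upwards [self_mem_nhdsWithin] with t ht
  have ht : 0 < t := ht
  simp only [Function.comp_apply]
  rw [one_div, ENNReal.le_rpow_inv_iff (by norm_num), ENNReal.rpow_two, eLpNorm_two_sq]
  have hm : Measurable (fun z : E n => ENNReal.ofReal (gauss t z)) :=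
    (continuous_gauss t).measurable.ennreal_ofReal
  calc ∫⁻ x, ‖(heatLp F t - F : E n → ℂ) x‖ₑ ^ 2
      ≤ ∫⁻ x, (∫⁻ w, ENNReal.ofReal (gauss t w) * ‖F (x - w) - F x‖ₑ) ^ 2 := by
        apply lintegral_mono_ae
        rw [heatLp_of_pos F ht]
        filter_upwards [coe_gconvLp (gaussBdd_gauss ht) F] with x hx
        gcongr
        rw [Pi.sub_apply, hx]
        have e : gconv (gauss t) F x - F x = ∫ y, (((gauss t (x - y) : ℝ) : ℂ) * (F y - F x)) := by
          have i1 := (gaussBdd_gauss ht).integrable_mul (Lp.memLp F) x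
          have i2 : Integrable (fun y => ((gauss t (x - y) : ℝ) : ℂ) * F x) :=
            (integrable_gauss_sub ht x).ofReal.mul_const _
          simp_rw [mul_sub]
          rw [integral_sub i1 i2, integral_mul_const, integral_complex_ofReal,
            integral_gauss_sub ht, Complex.ofReal_one, one_mul]
          rfl
        rw [e]
        refine (enorm_integral_le_lintegral_enorm _).trans (le_of_eq ?_)
        rw [← lintegral_sub_left_eq_self _ x]
        refine lintegral_congr fun y => ?_
        rw [sub_sub_cancel, enorm_mul]
        congr 1
        rw [← ofReal_norm, Complex.norm_real, Real.norm_of_nonneg (gauss_nonneg ht _)]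
    _ ≤ (∫⁻ w, ENNReal.ofReal (gauss t w)) * ∫⁻ w, ENNReal.ofReal (gauss t w)
          * ∫⁻ x, ‖F (x - w) - F x‖ₑ ^ 2 :=
        lintegral_average_sq_le (Φ := fun x w => ‖F (x - w) - F x‖ₑ) hm
          ((hFm.comp (measurable_fst.sub measurable_snd)).sub (hFm.comp measurable_fst)).enorm
    _ = _ := by rw [lintegral_gauss ht, one_mul]

lemma continuousOn_heatLp (F : L2 n) : ContinuousOn (heatLp F) (Ici 0) := by
  intro t ht
  rcases eq_or_lt_of_le (mem_Ici.1 ht) with rfl | h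
  · rw [← continuousWithinAt_Ioi_iff_Ici]
    unfold ContinuousWithinAt
    rw [heatLp_zero]
    exact tendsto_heatLp_zero F
  · exact (hasDerivAt_heatLp F h).continuousAt.continuousWithinAt

end SplitBMO

end

/-! ### Spatial derivatives of the Gaussian; cutoffs exhausting a half space. -/

noncomputable section

namespace SplitBMO

variable {n : ℕ}

/-! ### Partial derivatives -/

lemma partialDeriv_mul (i : Fin (n + 1)) {φ ψ : E n → ℝ} {x : E n}
    (hφ : DifferentiableAt ℝ φ x) (hψ : DifferentiableAt ℝ ψ x) :
    partialDeriv i (fun y => φ y * ψ y) x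
      = φ x * partialDeriv i ψ x + partialDeriv i φ x * ψ x := by
  unfold partialDeriv
  rw [fderiv_fun_mul hφ hψ]
  simp; ring

lemma partialDeriv_smul (i : Fin (n + 1)) {φ : E n → ℝ} {W : E n → ℂ} {x : E n}
    (hφ : DifferentiableAt ℝ φ x) (hW : DifferentiableAt ℝ W x) :
    partialDeriv i (fun y => φ y • W y) x
      = φ x • partialDeriv i W x + partialDeriv i φ x • W x := by
  unfold partialDeriv
  rw [fderiv_fun_smul hφ hW]
  simp

lemma continuous_partialDeriv {F : Type} [NormedAddCommGroup F] [NormedSpace ℝ F]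
    (i : Fin (n + 1)) {φ : E n → F} (hφ : ContDiff ℝ ∞ φ) : Continuous (partialDeriv i φ) :=
  (hφ.continuous_fderiv (by simp)).clm_apply continuous_const

lemma partialDeriv_hasCompactSupport {F : Type} [NormedAddCommGroup F] [NormedSpace ℝ F]
    (i : Fin (n + 1)) {φ : E n → F} (hφ : HasCompactSupport φ) :
    HasCompactSupport (partialDeriv i φ) := hφ.fderiv_apply (𝕜 := ℝ) _

lemma partialDeriv_eq_zero {F : Type} [NormedAddCommGroup F] [NormedSpace ℝ F]
    (i : Fin (n + 1)) {φ : E n → F} {x : E n} (hx : x ∉ tsupport φ) : partialDeriv i φ x = 0 := by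
  unfold partialDeriv
  rw [fderiv_of_notMem_tsupport ℝ hx]; simp

/-- The spatial first derivatives of the Gaussian. -/
def pgauss (i : Fin (n + 1)) (t : ℝ) (z : E n) : ℝ := -(z i / (2 * t)) * gauss t z

/-- The pure second derivatives of the Gaussian. -/
def ppgauss (i : Fin (n + 1)) (t : ℝ) (z : E n) : ℝ :=
  (z i ^ 2 / (4 * t ^ 2) - 1 / (2 * t)) * gauss t z

lemma contDiff_gauss (t : ℝ) : ContDiff ℝ ∞ (gauss (n := n) t) := by
  unfold gauss
  exact contDiff_const.mul (((contDiff_norm_sq ℝ).div_const _).neg.exp)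

lemma contDiff_coord (i : Fin (n + 1)) : ContDiff ℝ ∞ (fun z : E n => z i) :=
  (EuclideanSpace.proj (𝕜 := ℝ) i).contDiff

lemma contDiff_pgauss (i : Fin (n + 1)) (t : ℝ) : ContDiff ℝ ∞ (pgauss i t) := by
  unfold pgauss
  exact ((contDiff_coord i).div_const _).neg.mul (contDiff_gauss t)

lemma continuous_ppgauss (i : Fin (n + 1)) (t : ℝ) : Continuous (ppgauss i t) := by
  unfold ppgauss
  exact ((((contDiff_coord i).continuous.pow 2).div_const _).sub continuous_const).mul
    (continuous_gauss t)

lemma partialDeriv_gauss (i : Fin (n + 1)) (t : ℝ) (z : E n) :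
    partialDeriv i (gauss t) z = pgauss i t z := by
  have h := ((((hasStrictFDerivAt_norm_sq (F := E n) z).hasFDerivAt.mul_const
    (1 / (4 * t))).neg).exp).const_mul ((4 * Real.pi * t) ^ (-(((n : ℝ) + 1) / 2)))
  have e : (fun x : E n => (4 * Real.pi * t) ^ (-(((n : ℝ) + 1) / 2)) *
      Real.exp (-(‖x‖ ^ 2 * (1 / (4 * t))))) = gauss t := by
    ext x; unfold gauss; congr 3; ring
  have h' : HasFDerivAt (gauss (n := n) t) _ z := e ▸ h
  unfold partialDeriv
  rw [h'.fderiv]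
  simp only [smul_apply, neg_apply, Pi.neg_apply,
    innerSL_apply_apply, EuclideanSpace.inner_single_right, smul_eq_mul, nsmul_eq_mul]
  simp only [pgauss, gauss, conj_trivial, one_mul]
  rw [show ‖z‖ ^ 2 * (1 / (4 * t)) = ‖z‖ ^ 2 / (4 * t) by ring]
  push_cast
  ring

lemma partialDeriv_coord (i : Fin (n + 1)) (z : E n) :
    partialDeriv i (fun z : E n => z i) z = 1 := by
  unfold partialDeriv
  have : HasFDerivAt (fun z : E n => z i) (EuclideanSpace.proj (𝕜 := ℝ) i) z :=
    (EuclideanSpace.proj (𝕜 := ℝ) i).hasFDerivAt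
  rw [this.fderiv]; simp

lemma partialDeriv_const_mul (i : Fin (n + 1)) (c : ℝ) {φ : E n → ℝ} {x : E n}
    (hφ : DifferentiableAt ℝ φ x) :
    partialDeriv i (fun y => c * φ y) x = c * partialDeriv i φ x := by
  unfold partialDeriv
  rw [fderiv_const_mul hφ]; simp

lemma partialDeriv_pgauss (i : Fin (n + 1)) (t : ℝ) (z : E n) :
    partialDeriv i (pgauss i t) z = ppgauss i t z := by
  have hc : DifferentiableAt ℝ (fun z : E n => z i) z :=
    ((contDiff_coord i).differentiable (by simp)).differentiableAt
  have hg : DifferentiableAt ℝ (gauss t) z :=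
    ((contDiff_gauss t).differentiable (by simp)).differentiableAt
  have e : (pgauss i t : E n → ℝ) = fun y => (-1 / (2 * t)) * (y i * gauss t y) := by
    ext y; unfold pgauss; ring
  rw [e, partialDeriv_const_mul i _ (φ := fun y => y i * gauss t y) (hc.mul hg), partialDeriv_mul i hc hg, partialDeriv_gauss,
    partialDeriv_coord]
  unfold pgauss ppgauss
  rcases eq_or_ne t 0 with rfl | h
  · simp
  · field_simp; ring

/-- The heat equation for the Gaussian. -/
lemma sum_ppgauss {t : ℝ} (z : E n) : ∑ i, ppgauss i t z = dgauss t z := by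
  unfold ppgauss dgauss
  rw [← Finset.sum_mul, Finset.sum_sub_distrib, ← Finset.sum_div, EuclideanSpace.norm_sq_eq]
  simp only [Real.norm_eq_abs, sq_abs, Finset.sum_const, Finset.card_univ, Fintype.card_fin,
    nsmul_eq_mul]
  push_cast
  ring

lemma gaussBdd_pgauss (i : Fin (n + 1)) {t : ℝ} (ht : 0 < t) : GaussBdd (pgauss i t) := by
  obtain ⟨C₁, hC₁, h₁⟩ := gauss_moment n 1
  obtain ⟨C₀, hC₀, h₀⟩ := gauss_moment n 0
  refine ⟨(contDiff_pgauss i t).continuous, (C₁ + C₀ / t), 2 * t, by positivity, fun z => ?_⟩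
  have a := h₁ t ht z
  have b := h₀ t ht z
  simp only [pow_one, pow_zero, one_mul] at a b
  have hg := gauss_nonneg ht z
  unfold pgauss
  rw [abs_mul, abs_neg, abs_of_nonneg hg, abs_div, abs_of_pos (by positivity : 0 < 2 * t)]
  have hz := abs_coord_le_norm z i
  have h3 : |z i| / (2 * t) ≤ ‖z‖ ^ 2 / t + 1 / t := by
    rw [← add_div, div_le_div_iff₀ (by positivity) ht]
    nlinarith [sq_nonneg (‖z‖ - 1), norm_nonneg z]
  calc |z i| / (2 * t) * gauss t z ≤ (‖z‖ ^ 2 / t + 1 / t) * gauss t z := by gcongr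
    _ = ‖z‖ ^ 2 / t * gauss t z + gauss t z / t := by ring
    _ ≤ C₁ * gauss (2 * t) z + C₀ * gauss (2 * t) z / t := by gcongr
    _ = _ := by ring

lemma gaussBdd_ppgauss (i : Fin (n + 1)) {t : ℝ} (ht : 0 < t) : GaussBdd (ppgauss i t) := by
  obtain ⟨C₁, hC₁, h₁⟩ := gauss_moment n 1
  obtain ⟨C₀, hC₀, h₀⟩ := gauss_moment n 0
  refine ⟨continuous_ppgauss i t, (C₁ + C₀) / t, 2 * t, by positivity, fun z => ?_⟩
  have a := h₁ t ht z
  have b := h₀ t ht z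
  simp only [pow_one, pow_zero, one_mul] at a b
  have hg := gauss_nonneg ht z
  unfold ppgauss
  rw [abs_mul, abs_of_nonneg hg]
  have hz := abs_coord_le_norm z i
  have hz2 : z i ^ 2 ≤ ‖z‖ ^ 2 := by rw [← sq_abs]; gcongr
  have h3 : |z i ^ 2 / (4 * t ^ 2) - 1 / (2 * t)| ≤ (‖z‖ ^ 2 / t + 1) / t := by
    refine (abs_sub _ _).trans ?_
    rw [abs_of_nonneg (by positivity), abs_of_nonneg (by positivity), add_div, div_div, ← sq]
    gcongr
    · nlinarith [sq_nonneg t]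
    · linarith
  calc |z i ^ 2 / (4 * t ^ 2) - 1 / (2 * t)| * gauss t z
      ≤ ((‖z‖ ^ 2 / t + 1) / t) * gauss t z := by gcongr
    _ = (‖z‖ ^ 2 / t * gauss t z + gauss t z) / t := by ring
    _ ≤ (C₁ * gauss (2 * t) z + C₀ * gauss (2 * t) z) / t := by gcongr
    _ = _ := by ring

/-! ### Half spaces and cutoff functions -/

/-- The half space `ε x_n > 0`. -/
def hs (n : ℕ) (ε : ℝ) : Set (E n) := {x | 0 < ε * lastCoord x}

lemma isOpen_hs (ε : ℝ) : IsOpen (hs n ε) :=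
  isOpen_lt continuous_const (continuous_const.mul continuous_lastCoord)

lemma measurableSet_hs (ε : ℝ) : MeasurableSet (hs n ε) := (isOpen_hs ε).measurableSet

lemma upperHalf_eq : upperHalf n = hs n 1 := by ext x; simp [upperHalf, hs]

lemma lowerHalf_eq : lowerHalf n = hs n (-1) := by ext x; simp [lowerHalf, hs]

/-- The bound on η'(s)s is invariant under dilation: every rescaled step s ↦ η(κs) has derivative at
most M/|s|, uniformly in κ. -/
lemma exists_smooth_step : ∃ (η : ℝ → ℝ) (M : ℝ), 0 ≤ M ∧ ContDiff ℝ ∞ η ∧ (∀ s, |η s| ≤ 1) ∧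
    (∀ s ≤ 1, η s = 0) ∧ (∀ s, 2 ≤ s → η s = 1) ∧ (deriv η 0 = 0) ∧ ∀ s, |deriv η s * s| ≤ M := by
  set η : ℝ → ℝ := fun s => Real.smoothTransition (s - 1) with hη
  have hsm : ContDiff ℝ ∞ η := Real.smoothTransition.contDiff.comp (contDiff_id.sub contDiff_const)
  have h0 : ∀ s ≤ 1, η s = 0 := fun s hs => Real.smoothTransition.zero_of_nonpos (by linarith)
  have h1 : ∀ s, 2 ≤ s → η s = 1 := fun s hs => Real.smoothTransition.one_of_one_le (by linarith)
  have d0 : ∀ s < 1, deriv η s = 0 := by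
    intro s hs
    have : η =ᶠ[nhds s] fun _ => 0 := by
      filter_upwards [gt_mem_nhds hs] with u hu using h0 u (le_of_lt hu)
    rw [this.deriv_eq]; simp
  have d1 : ∀ s, 2 < s → deriv η s = 0 := by
    intro s hs
    have : η =ᶠ[nhds s] fun _ => 1 := by
      filter_upwards [lt_mem_nhds hs] with u hu using h1 u (le_of_lt hu)
    rw [this.deriv_eq]; simp
  have hc : Continuous (fun s => deriv η s * s) :=
    (hsm.continuous_deriv (by simp)).mul continuous_id
  obtain ⟨M, hM⟩ := (isCompact_Icc (a := (1 : ℝ)) (b := 2)).exists_bound_of_continuousOn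
    hc.continuousOn
  refine ⟨η, |M|, abs_nonneg _, hsm, fun s => ?_, h0, h1, d0 0 (by norm_num), fun s => ?_⟩
  · rw [abs_of_nonneg (Real.smoothTransition.nonneg _)]
    exact Real.smoothTransition.le_one _
  · by_cases hs : s ∈ Icc (1 : ℝ) 2
    · exact (hM s hs).trans (le_abs_self M)
    · rw [mem_Icc, not_and_or, not_le, not_le] at hs
      rcases hs with hs | hs
      · rw [d0 s hs]; simp
      · rw [d1 s hs]; simp

/-- Smooth cutoff functions exhausting a half space. -/
lemma exists_cutoff (n : ℕ) (ε : ℝ) : ∃ (ζ : ℕ → E n → ℝ) (M : ℝ), 0 ≤ M ∧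
    (∀ k, IsTestFunction (hs n ε) (ζ k)) ∧ (∀ k x, |ζ k x| ≤ 1) ∧
    (∀ x ∈ hs n ε, ∀ᶠ k in Filter.atTop, ζ k =ᶠ[nhds x] fun _ => 1) ∧
    ∀ k x i, |partialDeriv i (ζ k) x|
      ≤ M * (1 + if i = Fin.last n then |lastCoord x|⁻¹ else 0) := by
  obtain ⟨η, M₁, hM₁, hη, hη1, hη0, hη2, hd0, hd⟩ := exists_smooth_step
  let χ : ContDiffBump (0 : E n) := ⟨1, 2, one_pos, one_lt_two⟩
  have hχ : ContDiff ℝ ∞ χ := χ.contDiff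
  have hχb : ∃ M₂ : ℝ, ∀ z i, |partialDeriv i χ z| ≤ M₂ := by
    have : ∀ i : Fin (n + 1), ∃ C, ∀ z, |partialDeriv i χ z| ≤ C := fun i =>
      (continuous_partialDeriv i hχ).bounded_above_of_compact_support
        (partialDeriv_hasCompactSupport i χ.hasCompactSupport)
    choose C hC using this
    refine ⟨∑ i, |C i|, fun z i => (hC i z).trans ((le_abs_self _).trans ?_)⟩
    exact Finset.single_le_sum (f := fun i => |C i|) (fun _ _ => abs_nonneg _) (Finset.mem_univ i)
  obtain ⟨M₂, hM₂⟩ := hχb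
  have hM₂0 : 0 ≤ M₂ := (abs_nonneg _).trans (hM₂ 0 0)
  let κ : ℕ → ℝ := fun k => k + 1
  have hκ : ∀ k, 1 ≤ κ k := fun k => by simp [κ]
  have hκ0 : ∀ k, 0 < κ k := fun k => by linarith [hκ k]
  -- The factor `a k` keeps the support away from the hyperplane, the factor `b k` makes it bounded.
  -- Only the normal derivative of `a k` is unbounded in k.
  let a : ℕ → E n → ℝ := fun k x => η (κ k * ε * lastCoord x)
  let b : ℕ → E n → ℝ := fun k x => χ ((κ k)⁻¹ • x)
  have ha : ∀ k, ContDiff ℝ ∞ (a k) := fun k =>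
    hη.comp (contDiff_const.mul (contDiff_coord (Fin.last n)))
  have hb : ∀ k, ContDiff ℝ ∞ (b k) := fun k => hχ.comp (contDiff_const_smul _)
  have hsupp : ∀ k x, a k x * b k x ≠ 0 → 1 ≤ κ k * ε * lastCoord x ∧ ‖x‖ ≤ 2 * κ k := by
    intro k x hx
    constructor
    · by_contra h
      exact hx (by simp only [a, hη0 _ (not_le.1 h).le, zero_mul])
    · have : (κ k)⁻¹ • x ∈ Function.support χ := fun h => hx (by simp only [b, h, mul_zero])
      rw [χ.support_eq] at this
      simp only [mem_ball_zero_iff, norm_smul, norm_inv, Real.norm_eq_abs, abs_of_pos (hκ0 k)]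
        at this
      have h2 : (κ k)⁻¹ * ‖x‖ < 2 := this
      rw [inv_mul_lt_iff₀ (hκ0 k)] at h2
      linarith
  refine ⟨fun k x => a k x * b k x, M₁ + M₂, by positivity, fun k => ⟨(ha k).mul (hb k), ?_, ?_⟩,
    fun k x => ?_, fun x hx => ?_, fun k x i => ?_⟩
  · refine HasCompactSupport.intro (isCompact_closedBall (0 : E n) (2 * κ k)) fun x hx => ?_
    by_contra h
    exact hx (by simpa using (hsupp k x h).2)
  · have hcl : IsClosed {x : E n | 1 ≤ κ k * ε * lastCoord x} :=
      isClosed_le continuous_const (continuous_const.mul continuous_lastCoord)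
    refine (closure_minimal (fun x hx => (hsupp k x hx).1) hcl).trans fun x hx => ?_
    have h1 : 1 ≤ κ k * (ε * lastCoord x) := by
      rw [← mul_assoc]; exact hx
    have := hκ0 k
    show 0 < ε * lastCoord x
    by_contra h
    nlinarith [not_lt.1 h]
  · rw [abs_mul]
    refine mul_le_one₀ (hη1 _) (abs_nonneg _) ?_
    rw [abs_of_nonneg χ.nonneg]; exact χ.le_one
  · have hx' : 0 < ε * lastCoord x := hx
    obtain ⟨N₁, hN₁⟩ := exists_nat_gt (2 / (ε * lastCoord x))
    obtain ⟨N₂, hN₂⟩ := exists_nat_gt ‖x‖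
    filter_upwards [Filter.eventually_ge_atTop (max N₁ N₂)] with k hk
    have k1 : (N₁ : ℝ) ≤ k := by exact_mod_cast (le_max_left _ _).trans hk
    have k2 : (N₂ : ℝ) ≤ k := by exact_mod_cast (le_max_right _ _).trans hk
    have o1 : {y : E n | 2 < κ k * ε * lastCoord y} ∈ nhds x := by
      refine (isOpen_lt continuous_const (continuous_const.mul continuous_lastCoord)).mem_nhds ?_
      show 2 < κ k * ε * lastCoord x
      rw [div_lt_iff₀ hx'] at hN₁
      simp only [κ]; nlinarith
    have o2 : {y : E n | ‖y‖ < κ k} ∈ nhds x := by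
      refine (isOpen_lt continuous_norm continuous_const).mem_nhds ?_
      show ‖x‖ < κ k
      simp only [κ]; linarith
    filter_upwards [o1, o2] with y h1 h2
    have e1 : a k y = 1 := hη2 _ (le_of_lt h1)
    have e2 : b k y = 1 := χ.one_of_mem_closedBall (by
      have h2 : ‖y‖ < κ k := h2
      simp only [mem_closedBall_zero_iff, norm_smul, norm_inv, Real.norm_eq_abs,
        abs_of_pos (hκ0 k)]
      show (κ k)⁻¹ * ‖y‖ ≤ 1
      rw [inv_mul_le_iff₀ (hκ0 k)]; linarith)
    rw [e1, e2, one_mul]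
  · have hda : DifferentiableAt ℝ (a k) x := ((ha k).differentiable (by simp)).differentiableAt
    have hdb : DifferentiableAt ℝ (b k) x := ((hb k).differentiable (by simp)).differentiableAt
    rw [partialDeriv_mul i hda hdb]
    have pa : partialDeriv i (a k) x = deriv η (κ k * ε * lastCoord x) * (κ k * ε *
        (if i = Fin.last n then 1 else 0)) := by
      have h1 : HasFDerivAt (fun x : E n => κ k * ε * lastCoord x)
          ((κ k * ε) • (EuclideanSpace.proj (𝕜 := ℝ) (Fin.last n))) x :=
        ((EuclideanSpace.proj (𝕜 := ℝ) (Fin.last n)).hasFDerivAt (x := x)).const_mul (κ k * ε)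
      have h2 := ((hη.differentiable (by simp)).differentiableAt
        (x := κ k * ε * lastCoord x)).hasDerivAt.comp_hasFDerivAt x h1
      unfold partialDeriv
      rw [show a k = η ∘ fun x : E n => κ k * ε * lastCoord x from rfl, h2.fderiv]
      by_cases hi : i = Fin.last n
      · subst hi; simp
      · simp [hi, Ne.symm hi]
    have pb : partialDeriv i (b k) x = (κ k)⁻¹ * partialDeriv i χ ((κ k)⁻¹ • x) := by
      have h1 : HasFDerivAt (fun x : E n => (κ k)⁻¹ • x)
          ((κ k)⁻¹ • ContinuousLinearMap.id ℝ (E n)) x := (hasFDerivAt_id x).fun_const_smul _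
      have h2 := ((hχ.differentiable (by simp)).differentiableAt
        (x := (κ k)⁻¹ • x)).hasFDerivAt.comp x h1
      unfold partialDeriv
      rw [show b k = χ ∘ fun x : E n => (κ k)⁻¹ • x from rfl, h2.fderiv]
      simp
    have ba : |partialDeriv i (a k) x| ≤ M₁ * (if i = Fin.last n then |lastCoord x|⁻¹ else 0) := by
      rw [pa]
      by_cases hi : i = Fin.last n
      · simp only [hi, if_true, mul_one]
        -- On the hyperplane the inverse of 0 is 0, so the bound there needs η'(0) = 0.
        rcases eq_or_ne (lastCoord x) 0 with h0 | h0
        · simp [h0, hd0]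
        · have := hd (κ k * ε * lastCoord x)
          rw [← div_eq_mul_inv, le_div_iff₀ (abs_pos.2 h0), ← abs_mul, mul_assoc]
          exact this
      · simp [hi]
    have bb : |partialDeriv i (b k) x| ≤ M₂ := by
      rw [pb, abs_mul, abs_of_pos (inv_pos.2 (hκ0 k))]
      calc (κ k)⁻¹ * |partialDeriv i χ ((κ k)⁻¹ • x)| ≤ 1 * M₂ := by
            gcongr
            · exact inv_le_one_of_one_le₀ (hκ k)
            · exact hM₂ _ _
        _ = M₂ := one_mul _
    have a1 : |a k x| ≤ 1 := hη1 _
    have b1 : |b k x| ≤ 1 := by rw [abs_of_nonneg χ.nonneg]; exact χ.le_one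
    set w : ℝ := if i = Fin.last n then |lastCoord x|⁻¹ else 0 with hw
    have hw0 : 0 ≤ w := by rw [hw]; split_ifs <;> positivity
    calc |a k x * partialDeriv i (b k) x + partialDeriv i (a k) x * b k x|
        ≤ |a k x| * |partialDeriv i (b k) x| + |partialDeriv i (a k) x| * |b k x| := by
          rw [← abs_mul, ← abs_mul]; exact abs_add_le _ _
      _ ≤ 1 * M₂ + (M₁ * w) * 1 := by gcongr
      _ ≤ (M₁ + M₂) * (1 + w) := by nlinarith [mul_nonneg hM₂0 hw0]

end SplitBMO

end

/-! ### Integration by parts on half spaces. -/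

noncomputable section

namespace SplitBMO

variable {n : ℕ}

/-! ### Integration by parts -/

lemma GaussBdd.memLp_sub {k : E n → ℝ} (hk : GaussBdd k) (y : E n) :
    MemLp (fun x => k (x - y)) 2 :=
  hk.memLp.comp_measurePreserving (measurePreserving_sub_right volume y)

lemma enorm_integral_mul_le {α : Type*} [MeasurableSpace α] {μ : Measure α} {f g : α → ℂ}
    (hf : AEStronglyMeasurable f μ) (hg : AEStronglyMeasurable g μ) :
    ‖∫ x, f x * g x ∂μ‖ₑ ≤ eLpNorm f 2 μ * eLpNorm g 2 μ := by
  refine (enorm_integral_le_lintegral_enorm _).trans ?_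
  have h := ENNReal.lintegral_mul_le_Lp_mul_Lq μ (p := 2) (q := 2)
    ⟨by norm_num, by norm_num, by norm_num⟩ hf.enorm hg.enorm
  rw [eLpNorm_eq_lintegral_rpow_enorm_toReal (by norm_num) (by norm_num),
    eLpNorm_eq_lintegral_rpow_enorm_toReal (by norm_num) (by norm_num)]
  simpa [enorm_mul] using h

lemma integrable_mul_of_memLp {α : Type*} [MeasurableSpace α] {μ : Measure α} {f g : α → ℂ}
    (hf : MemLp f 2 μ) (hg : MemLp g 2 μ) : Integrable (fun x => f x * g x) μ :=
  hf.integrable_mul hg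

lemma ENNReal_eq_zero_of_forall_le_mul {a K : ℝ≥0∞} (hK : K ≠ ⊤)
    (h : ∀ ε : ℝ, 0 < ε → a ≤ ENNReal.ofReal ε * K) : a = 0 := by
  by_contra ha
  lift K to NNReal using hK
  have ha' : a ≠ ⊤ := ((h 1 one_pos).trans_lt (by simp)).ne
  lift a to NNReal using ha'
  have ha0 : 0 < a := by
    rw [pos_iff_ne_zero]; rintro rfl; simp at ha
  have hp : (0 : ℝ) < a / (2 * (K + 1)) := by positivity
  have h1 := h _ hp
  rw [ENNReal.ofReal, ← ENNReal.coe_mul, ENNReal.coe_le_coe, ← NNReal.coe_le_coe,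
    NNReal.coe_mul, Real.coe_toNNReal _ hp.le] at h1
  have : (a : ℝ) / (2 * (K + 1)) * K < a := by
    rw [div_mul_eq_mul_div, div_lt_iff₀ (by positivity)]
    nlinarith [K.coe_nonneg, NNReal.coe_pos.2 ha0, mul_nonneg a.coe_nonneg K.coe_nonneg]
  linarith

lemma gconv_pair_integrable {k : E n → ℝ} (hk : GaussBdd k) {F V : E n → ℂ} (hF : MemLp F 2)
    {Ω : Set (E n)} (hΩ : MeasurableSet Ω) (hV : MemLp V 2 (volume.restrict Ω)) :
    Integrable (fun y => F y * ∫ x in Ω, (k (x - y) : ℂ) * V x) := by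
  have hV' : MemLp (Ω.indicator V) 2 := (memLp_indicator_iff_restrict hΩ).2 hV
  have h := (hk.integrable_prod hF hV').integral_prod_right
  refine h.congr (Filter.Eventually.of_forall fun y => ?_)
  simp only
  rw [← integral_indicator hΩ, ← integral_const_mul]
  congr 1; ext x
  by_cases hx : x ∈ Ω
  · simp only [indicator_of_mem hx]; ring
  · simp [indicator_of_notMem hx]

/-- Fubini. It reduces weak identities for convolutions to identities for the kernel at a fixed y.
-/
lemma gconv_pair {k : E n → ℝ} (hk : GaussBdd k) {F V : E n → ℂ} (hF : MemLp F 2)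
    {Ω : Set (E n)} (hΩ : MeasurableSet Ω) (hV : MemLp V 2 (volume.restrict Ω)) :
    ∫ x in Ω, gconv k F x * V x = ∫ y, F y * ∫ x in Ω, (k (x - y) : ℂ) * V x := by
  have hV' : MemLp (Ω.indicator V) 2 := (memLp_indicator_iff_restrict hΩ).2 hV
  have h := integral_integral_swap (f := fun x y => (k (x - y) : ℂ) * F y * Ω.indicator V x)
    (hk.integrable_prod hF hV')
  have e1 : ∀ x, ∫ y, (k (x - y) : ℂ) * F y * Ω.indicator V x
      = Ω.indicator (fun x => gconv k F x * V x) x := by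
    intro x
    rw [integral_mul_const]
    by_cases hx : x ∈ Ω
    · simp only [indicator_of_mem hx]; rfl
    · simp [indicator_of_notMem hx]
  have e2 : ∀ y, ∫ x, (k (x - y) : ℂ) * F y * Ω.indicator V x
      = F y * ∫ x in Ω, (k (x - y) : ℂ) * V x := by
    intro y
    rw [← integral_indicator hΩ, ← integral_const_mul]
    congr 1; ext x
    by_cases hx : x ∈ Ω
    · simp only [indicator_of_mem hx]; ring
    · simp [indicator_of_notMem hx]
  simp only [e1, e2] at h
  rw [← h, integral_indicator hΩ]

lemma IsTestFunction.memLp {F : Type} [NormedAddCommGroup F] [NormedSpace ℝ F] {Ω : Set (E n)}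
    {φ : E n → F} (h : IsTestFunction Ω φ) (μ : Measure (E n)) [IsFiniteMeasureOnCompacts μ] :
    MemLp φ 2 μ :=
  h.1.continuous.memLp_of_hasCompactSupport h.2.1

lemma IsTestFunction.memLp_partialDeriv {F : Type} [NormedAddCommGroup F] [NormedSpace ℝ F]
    {Ω : Set (E n)} {φ : E n → F} (h : IsTestFunction Ω φ) (i : Fin (n + 1)) (μ : Measure (E n))
    [IsFiniteMeasureOnCompacts μ] : MemLp (partialDeriv i φ) 2 μ :=
  (continuous_partialDeriv i h.1).memLp_of_hasCompactSupport
    (partialDeriv_hasCompactSupport i h.2.1)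

lemma partialDeriv_comp_sub {F : Type} [NormedAddCommGroup F] [NormedSpace ℝ F]
    (i : Fin (n + 1)) (φ : E n → F) (x y : E n) :
    partialDeriv i (fun x => φ (x - y)) x = partialDeriv i φ (x - y) := by
  unfold partialDeriv; rw [fderiv_comp_sub]

lemma partialDeriv_ofReal (i : Fin (n + 1)) {φ : E n → ℝ} {x : E n}
    (h : DifferentiableAt ℝ φ x) :
    partialDeriv i (fun y => (φ y : ℂ)) x
      = ((partialDeriv i φ x : ℝ) : ℂ) := by
  unfold partialDeriv
  have := (Complex.ofRealCLM.hasFDerivAt (x := φ x)).comp x h.hasFDerivAt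
  have e : (fun y => (φ y : ℂ)) = Complex.ofRealCLM ∘ φ := rfl
  rw [e, this.fderiv]
  simp

/-- Convolution commutes with weak differentiation. -/
lemma memW12_gconv {k : E n → ℝ} {k' : Fin (n + 1) → E n → ℝ} (hk : GaussBdd k)
    (hk' : ∀ i, GaussBdd (k' i)) (hks : ContDiff ℝ ∞ k)
    (hd : ∀ i z, partialDeriv i k z = k' i z) {F : E n → ℂ} (hF : Measurable F)
    (hF2 : MemLp F 2) {Ω : Set (E n)} (hΩ : MeasurableSet Ω) :
    MemW12 Ω (gconv k F) (fun i => gconv (k' i) F) := by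
  refine ⟨(hk.memLp_gconv hF hF2).restrict Ω, fun i => ((hk' i).memLp_gconv hF hF2).restrict Ω,
    fun i φ hφ => ?_⟩
  have m1 : MemLp (fun x => ((partialDeriv i φ x : ℝ) : ℂ)) 2 (volume.restrict Ω) :=
    (hφ.memLp_partialDeriv i volume).restrict Ω |>.ofReal
  have m2 : MemLp (fun x => (φ x : ℂ)) 2 (volume.restrict Ω) :=
    (hφ.memLp volume).restrict Ω |>.ofReal
  rw [gconv_pair hk hF2 hΩ m1, gconv_pair (hk' i) hF2 hΩ m2, ← integral_neg]
  congr 1; ext y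
  rw [← mul_neg]
  congr 1
  rw [setIntegral_eq_integral_of_forall_compl_eq_zero (fun x hx => by
      rw [partialDeriv_eq_zero i (fun h => hx (hφ.2.2 h))]; simp),
    setIntegral_eq_integral_of_forall_compl_eq_zero (fun x hx => by
      rw [image_eq_zero_of_notMem_tsupport (fun h => hx (hφ.2.2 h))]; simp)]
  have d1 : ∀ x, fderiv ℝ (fun x => k (x - y)) x (EuclideanSpace.single i 1) = k' i (x - y) := by
    intro x
    rw [← hd i (x - y), ← partialDeriv_comp_sub]; rfl
  have hkd : Differentiable ℝ (fun x => k (x - y)) :=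
    (hks.differentiable (by simp)).comp (differentiable_id.sub_const y)
  have hφd : Differentiable ℝ φ := hφ.1.differentiable (by simp)
  have h := integral_mul_fderiv_eq_neg_fderiv_mul_of_integrable (μ := (volume : Measure (E n)))
    (f := fun x => k (x - y)) (g := φ) (v := EuclideanSpace.single i 1) ?_ ?_ ?_
    (fun x _ => hkd x) (fun x _ => hφd x)
  · simp only [d1] at h
    have h' := congrArg (fun r : ℝ => (r : ℂ)) h
    simp only [Complex.ofReal_neg, ← integral_complex_ofReal, Complex.ofReal_mul] at h'
    exact h'
  · simp only [d1]
    exact ((hk' i).memLp_sub y).integrable_mul (hφ.memLp volume)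
  · exact (hk.memLp_sub y).integrable_mul (hφ.memLp_partialDeriv i volume)
  · exact (hk.memLp_sub y).integrable_mul (hφ.memLp volume)

/-- Integration by parts against functions of `W^{1,2}` of a half space, where in the normal
direction the smooth function has to vanish on the boundary. -/
lemma MemW12.integral_mul_partialDeriv {ε : ℝ} {v : E n → ℂ} {Gv : Fin (n + 1) → E n → ℂ}
    (hv : MemW12 (hs n ε) v Gv) (i : Fin (n + 1)) {ψ m : E n → ℝ} (hψ : ContDiff ℝ ∞ ψ)
    (hψ2 : MemLp ψ 2) (hdψ : MemLp (partialDeriv i ψ) 2) (hm : MemLp m 2)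
    (hψm : i = Fin.last n → ∀ x, |ψ x| ≤ |lastCoord x| * |m x|) :
    ∫ x in hs n ε, v x * ((partialDeriv i ψ x : ℝ) : ℂ) = - ∫ x in hs n ε, Gv i x * (ψ x : ℂ) := by
  obtain ⟨ζ, M, hM, hζt, hζ1, hζe, hζd⟩ := exists_cutoff n ε
  have hζc : ∀ k, Differentiable ℝ (ζ k) := fun k => (hζt k).1.differentiable (by simp)
  have hψd : Differentiable ℝ ψ := hψ.differentiable (by simp)
  have htest : ∀ k, IsTestFunction (hs n ε) (fun x => ζ k x * ψ x) := fun k =>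
    ⟨(hζt k).1.mul hψ, (hζt k).2.1.mul_right, (closure_mono (by
      intro x hx h0; simp [h0] at hx)).trans (hζt k).2.2⟩
  have hid := fun k => hv.2.2 i _ (htest k)
  have hpd : ∀ k x, partialDeriv i (fun x => ζ k x * ψ x) x
      = ζ k x * partialDeriv i ψ x + partialDeriv i (ζ k) x * ψ x := fun k x =>
    partialDeriv_mul i (hζc k x) (hψd x)
  -- In the normal direction the cutoff contributes up to M(1 + 1/|x_n|), and |ψ| ≤ |x_n||m|
  -- compensates for it. The resulting square integrable majorant does not depend on k.
  have hbd : ∀ k x, |partialDeriv i (ζ k) x * ψ x| ≤ M * (|ψ x| + |m x|) := by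
    intro k x
    rw [abs_mul]
    by_cases hi : i = Fin.last n
    · have h1 := hζd k x i
      rw [if_pos hi] at h1
      have h2 := hψm hi x
      have h3 : |lastCoord x|⁻¹ * |ψ x| ≤ |m x| := by
        rcases eq_or_ne (lastCoord x) 0 with h0 | h0
        · simp [h0]
        · rw [inv_mul_le_iff₀ (abs_pos.2 h0)]; exact h2
      calc _ ≤ M * (1 + |lastCoord x|⁻¹) * |ψ x| := by gcongr
        _ = M * (|ψ x| + |lastCoord x|⁻¹ * |ψ x|) := by ring
        _ ≤ _ := by gcongr
    · have h1 := hζd k x i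
      rw [if_neg hi, add_zero, mul_one] at h1
      calc _ ≤ M * |ψ x| := by gcongr
        _ ≤ _ := by
          gcongr
          linarith [abs_nonneg (m x)]
  have hmeas : ∀ k, Continuous (partialDeriv i (fun x => ζ k x * ψ x)) := fun k =>
    continuous_partialDeriv i (htest k).1
  have l1 : Filter.Tendsto (fun k => ∫ x in hs n ε,
      v x * ((partialDeriv i (fun x => ζ k x * ψ x) x : ℝ) : ℂ)) Filter.atTop
      (nhds (∫ x in hs n ε, v x * ((partialDeriv i ψ x : ℝ) : ℂ))) := by
    refine tendsto_integral_of_dominated_convergence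
      (fun x => ‖v x‖ * (|partialDeriv i ψ x| + M * (|ψ x| + |m x|))) (fun k => ?_) ?_
      (fun k => Filter.Eventually.of_forall fun x => ?_) ?_
    · exact hv.1.1.mul (Complex.continuous_ofReal.comp (hmeas k)).aestronglyMeasurable
    · have : MemLp (fun x => |partialDeriv i ψ x| + M * (|ψ x| + |m x|)) 2
          (volume.restrict (hs n ε)) :=
        ((hdψ.norm).add ((hψ2.norm.add hm.norm).const_mul M)).restrict _
      exact hv.1.norm.integrable_mul this
    · rw [norm_mul, Complex.norm_real, hpd]
      gcongr
      calc |ζ k x * partialDeriv i ψ x + partialDeriv i (ζ k) x * ψ x|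
          ≤ |ζ k x * partialDeriv i ψ x| + |partialDeriv i (ζ k) x * ψ x| := abs_add_le _ _
        _ ≤ 1 * |partialDeriv i ψ x| + M * (|ψ x| + |m x|) := by
            gcongr
            · rw [abs_mul]; gcongr; exact hζ1 k x
            · exact hbd k x
        _ = _ := by rw [one_mul]
    · filter_upwards [ae_restrict_mem (measurableSet_hs ε)] with x hx
      refine Filter.Tendsto.congr' ?_ tendsto_const_nhds
      filter_upwards [hζe x hx] with k hk
      have : partialDeriv i (ζ k) x = 0 := by
        unfold partialDeriv; rw [hk.fderiv_eq]; simp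
      rw [hpd, this, hk.self_of_nhds]; simp
  have l2 : Filter.Tendsto (fun k => - ∫ x in hs n ε, Gv i x * ((ζ k x * ψ x : ℝ) : ℂ))
      Filter.atTop (nhds (- ∫ x in hs n ε, Gv i x * (ψ x : ℂ))) := by
    refine Filter.Tendsto.neg (tendsto_integral_of_dominated_convergence
      (fun x => ‖Gv i x‖ * |ψ x|) (fun k => ?_) ?_
      (fun k => Filter.Eventually.of_forall fun x => ?_) ?_)
    · exact (hv.2.1 i).1.mul
        (Complex.continuous_ofReal.comp (htest k).1.continuous).aestronglyMeasurable
    · exact (hv.2.1 i).norm.integrable_mul (hψ2.norm.restrict _)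
    · rw [norm_mul, Complex.norm_real, Real.norm_eq_abs, abs_mul]
      gcongr
      exact mul_le_of_le_one_left (abs_nonneg _) (hζ1 k x)
    · filter_upwards [ae_restrict_mem (measurableSet_hs ε)] with x hx
      refine Filter.Tendsto.congr' ?_ tendsto_const_nhds
      filter_upwards [hζe x hx] with k hk
      rw [hk.self_of_nhds]; simp
  simp only [hid] at l1
  exact tendsto_nhds_unique l1 l2

lemma integral_partialDeriv_mul_test {Ω : Set (E n)} {φ : E n → ℂ} (hφ : IsTestFunction Ω φ)
    (i : Fin (n + 1)) {ψ : E n → ℝ} (hψ : ContDiff ℝ ∞ ψ)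
    (hψ2 : MemLp ψ 2) (hdψ : MemLp (partialDeriv i ψ) 2) :
    ∫ x in Ω, φ x * ((partialDeriv i ψ x : ℝ) : ℂ)
      = - ∫ x in Ω, partialDeriv i φ x * (ψ x : ℂ) := by
  rw [setIntegral_eq_integral_of_forall_compl_eq_zero (fun x hx => by
      rw [image_eq_zero_of_notMem_tsupport (fun h => hx (hφ.2.2 h))]; simp),
    setIntegral_eq_integral_of_forall_compl_eq_zero (fun x hx => by
      rw [partialDeriv_eq_zero i (fun h => hx (hφ.2.2 h))]; simp)]
  have hψd : Differentiable ℝ ψ := hψ.differentiable (by simp)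
  have hφd : Differentiable ℝ φ := hφ.1.differentiable (by simp)
  have hψc : Differentiable ℝ (fun x => (ψ x : ℂ)) :=
    Complex.ofRealCLM.differentiable.comp hψd
  have e : ∀ x, fderiv ℝ (fun x => (ψ x : ℂ)) x (EuclideanSpace.single i 1)
      = ((partialDeriv i ψ x : ℝ) : ℂ) := fun x => partialDeriv_ofReal i (hψd x)
  have h := integral_mul_fderiv_eq_neg_fderiv_mul_of_integrable (μ := (volume : Measure (E n)))
    (f := φ) (g := fun x => (ψ x : ℂ)) (v := EuclideanSpace.single i 1) ?_ ?_ ?_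
    (fun x _ => hφd x) (fun x _ => hψc x)
  · simp only [e] at h
    exact h
  · exact (hφ.memLp_partialDeriv i volume).integrable_mul hψ2.ofReal
  · simp only [e]
    exact (hφ.memLp volume).integrable_mul hdψ.ofReal
  · exact (hφ.memLp volume).integrable_mul hψ2.ofReal

/-- Integration by parts against functions of `W_0^{1,2}`. -/
lemma MemW120.integral_mul_partialDeriv {Ω : Set (E n)} {v : E n → ℂ}
    {Gv : Fin (n + 1) → E n → ℂ}
    (hv : MemW120 Ω v Gv) (i : Fin (n + 1)) {ψ : E n → ℝ} (hψ : ContDiff ℝ ∞ ψ)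
    (hψ2 : MemLp ψ 2) (hdψ : MemLp (partialDeriv i ψ) 2) :
    ∫ x in Ω, v x * ((partialDeriv i ψ x : ℝ) : ℂ) = - ∫ x in Ω, Gv i x * (ψ x : ℂ) := by
  set μ := (volume : Measure (E n)).restrict Ω
  have mψ : MemLp (fun x => (ψ x : ℂ)) 2 μ := (hψ2.restrict Ω).ofReal
  have mdψ : MemLp (fun x => ((partialDeriv i ψ x : ℝ) : ℂ)) 2 μ := (hdψ.restrict Ω).ofReal
  rw [← add_eq_zero_iff_eq_neg, ← enorm_eq_zero]
  set K := eLpNorm (fun x => ((partialDeriv i ψ x : ℝ) : ℂ)) 2 μ + eLpNorm (fun x => (ψ x : ℂ)) 2 μ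
  have hK : K ≠ ⊤ := ENNReal.add_ne_top.2 ⟨mdψ.eLpNorm_ne_top, mψ.eLpNorm_ne_top⟩
  have key : ∀ ε : ℝ, 0 < ε → ‖∫ x, v x * ((partialDeriv i ψ x : ℝ) : ℂ) ∂μ
      + ∫ x, Gv i x * (ψ x : ℂ) ∂μ‖ₑ ≤ ENNReal.ofReal ε * K := by
    intro ε hε
    obtain ⟨φ, hφ, h1, h2⟩ := hv.2 ε hε
    -- The identity is exact for the test function φ, so only the errors v - φ and Gv - ∂φ, each of
    -- norm at most ε, are paired with ψ and its derivative.
    have hφL : MemLp φ 2 μ := hφ.memLp μ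
    have hφL' : MemLp (partialDeriv i φ) 2 μ := hφ.memLp_partialDeriv i μ
    have e := integral_partialDeriv_mul_test hφ i hψ hψ2 hdψ
    have e2 : ∫ x, v x * ((partialDeriv i ψ x : ℝ) : ℂ) ∂μ + ∫ x, Gv i x * (ψ x : ℂ) ∂μ
        = ∫ x, (v x - φ x) * ((partialDeriv i ψ x : ℝ) : ℂ) ∂μ
          + ∫ x, (Gv i x - partialDeriv i φ x) * (ψ x : ℂ) ∂μ := by
      simp_rw [sub_mul]
      rw [integral_sub (integrable_mul_of_memLp hv.1.1 mdψ) (integrable_mul_of_memLp hφL mdψ),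
        integral_sub (integrable_mul_of_memLp (hv.1.2.1 i) mψ) (integrable_mul_of_memLp hφL' mψ),
        e]
      ring
    rw [e2]
    calc _ ≤ ‖∫ x, (v x - φ x) * ((partialDeriv i ψ x : ℝ) : ℂ) ∂μ‖ₑ
          + ‖∫ x, (Gv i x - partialDeriv i φ x) * (ψ x : ℂ) ∂μ‖ₑ := enorm_add_le _ _
      _ ≤ ENNReal.ofReal ε * eLpNorm (fun x => ((partialDeriv i ψ x : ℝ) : ℂ)) 2 μ
          + ENNReal.ofReal ε * eLpNorm (fun x => (ψ x : ℂ)) 2 μ := by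
          gcongr
          · exact (enorm_integral_mul_le (hv.1.1.1.sub hφL.1) mdψ.1).trans (mul_le_mul_left h1 _)
          · exact (enorm_integral_mul_le ((hv.1.2.1 i).1.sub hφL'.1) mψ.1).trans
              (mul_le_mul_left (h2 i) _)
      _ = _ := by rw [← mul_add]
  exact ENNReal_eq_zero_of_forall_le_mul hK key

end SplitBMO

end

/-! ### Reflected heat flows solve the Neumann and Dirichlet problems. -/

noncomputable section

namespace SplitBMO

variable {n : ℕ}

/-! ### The form identity -/

/-- Against a function of parity σ, X and σ X∘R have the same integral. The pairing therefore sees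
only X + σ X∘R, and it suffices to compare the symmetrised functions. -/
lemma integral_mul_symm {σ : ℝ} (hσ : σ = 1 ∨ σ = -1) {F A B : E n → ℂ}
    (hF : ∀ᵐ y, F (refl n y) = σ * F y) (hA : Integrable (fun y => F y * A y))
    (hB : Integrable (fun y => F y * B y))
    (h : ∀ y, B y + σ * B (refl n y) = -(A y + σ * A (refl n y))) :
    ∫ y, F y * A y = - ∫ y, F y * B y := by
  have hσ2 : (σ : ℂ) * σ = 1 := by rcases hσ with rfl | rfl <;> norm_num
  have key : ∀ X : E n → ℂ, Integrable (fun y => F y * X y) →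
      Integrable (fun y => F y * (σ * X (refl n y))) ∧
      ∫ y, F y * (σ * X (refl n y)) = ∫ y, F y * X y := by
    intro X hX
    have hc : Integrable (fun y => F (refl n y) * X (refl n y)) :=
      (measurePreserving_refl.integrable_comp_emb measurableEmbedding_refl).2 hX
    have hae : (fun y => F (refl n y) * X (refl n y))
        =ᵐ[volume] fun y => F y * (σ * X (refl n y)) := by
      filter_upwards [hF] with y hy
      rw [hy]; ring
    refine ⟨hc.congr hae, ?_⟩
    rw [← integral_congr_ae hae]
    exact measurePreserving_refl.integral_comp measurableEmbedding_refl (fun y => F y * X y)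
  obtain ⟨iA, eA⟩ := key A hA
  obtain ⟨iB, eB⟩ := key B hB
  have h2 : ∫ y, (F y * A y + F y * (σ * A (refl n y)))
      = - ∫ y, (F y * B y + F y * (σ * B (refl n y))) := by
    rw [← integral_neg]
    congr 1; ext y
    linear_combination (F y) * h y
  rw [integral_add hA iA, integral_add hB iB, eA, eB] at h2
  linear_combination h2 / 2

lemma gconv_dgauss {t : ℝ} (ht : 0 < t) {F : E n → ℂ} (hF : MemLp F 2) (x : E n) :
    gconv (dgauss t) F x = ∑ i, gconv (ppgauss i t) F x := by
  unfold gconv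
  rw [← integral_finsetSum _ fun i _ => (gaussBdd_ppgauss i ht).integrable_mul hF x]
  congr 1; ext y
  rw [← sum_ppgauss, ← Finset.sum_mul]
  push_cast; rfl

/-- Fubini and the parity of F reduce the weak heat equation to integration by parts for the
symmetrised kernel at each fixed y. The hypothesis `hibp` is the only place where the boundary
condition enters. -/
lemma form_identity {σ : ℝ} (hσ : σ = 1 ∨ σ = -1) {t : ℝ} (ht : 0 < t) {F : E n → ℂ}
    (hFm : Measurable F) (hF : MemLp F 2) (hsym : ∀ᵐ y, F (refl n y) = σ * F y)
    {Ω : Set (E n)} (hΩ : MeasurableSet Ω) {v : E n → ℂ} {Gv : Fin (n + 1) → E n → ℂ}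
    (hv : MemLp v 2 (volume.restrict Ω)) (hGv : ∀ i, MemLp (Gv i) 2 (volume.restrict Ω))
    (hibp : ∀ i y, ∫ x in Ω, v x * ((ppgauss i t (x - y) + σ * ppgauss i t (x - refl n y) : ℝ) : ℂ)
      = - ∫ x in Ω, Gv i x * ((pgauss i t (x - y) + σ * pgauss i t (x - refl n y) : ℝ) : ℂ)) :
    ∑ i, ∫ x in Ω, gconv (pgauss i t) F x * star (Gv i x)
      = ∫ x in Ω, -gconv (dgauss t) F x * star (v x) := by
  have hsv : MemLp (fun x => star (v x)) 2 (volume.restrict Ω) := hv.star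
  have hsG : ∀ i, MemLp (fun x => star (Gv i x)) 2 (volume.restrict Ω) := fun i => (hGv i).star
  have split : ∀ {k : E n → ℝ} (_ : GaussBdd k) {w : E n → ℂ}
      (_ : MemLp w 2 (volume.restrict Ω)) (y : E n),
      ∫ x in Ω, w x * ((k (x - y) + σ * k (x - refl n y) : ℝ) : ℂ)
        = star ((∫ x in Ω, (k (x - y) : ℂ) * star (w x))
          + σ * ∫ x in Ω, (k (x - refl n y) : ℂ) * star (w x)) := by
    intro k hk w hw y
    have hi : ∀ y, Integrable (fun x => (k (x - y) : ℂ) * star (w x)) (volume.restrict Ω) :=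
      fun y => integrable_mul_of_memLp ((hk.memLp_sub y).restrict Ω).ofReal hw.star
    have i2 : Integrable (fun x => (σ : ℂ) * ((k (x - refl n y) : ℂ) * star (w x)))
      (volume.restrict Ω) := (hi (refl n y)).const_mul _
    rw [← integral_const_mul, ← integral_add (hi y) i2]
    change _ = (starRingEnd ℂ) _
    rw [← integral_conj]
    congr 1; ext x
    simp only [map_add, map_mul, Complex.conj_ofReal, RCLike.star_def, Complex.conj_conj]
    push_cast; ring
  have key : ∀ i, ∫ x in Ω, gconv (pgauss i t) F x * star (Gv i x)
      = - ∫ x in Ω, gconv (ppgauss i t) F x * star (v x) := by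
    intro i
    have k1 := gaussBdd_pgauss i ht
    have k2 := gaussBdd_ppgauss i ht
    rw [gconv_pair k1 hF hΩ (hsG i), gconv_pair k2 hF hΩ hsv]
    refine integral_mul_symm hσ hsym (gconv_pair_integrable k1 hF hΩ (hsG i))
      (gconv_pair_integrable k2 hF hΩ hsv) fun y => ?_
    have h := hibp i y
    rw [split k2 hv y, split k1 (hGv i) y, ← star_neg] at h
    exact star_injective h
  simp only [key, Finset.sum_neg_distrib, neg_mul, integral_neg]
  congr 1
  rw [← integral_finsetSum _ fun i _ => integrable_mul_of_memLp
    (((gaussBdd_ppgauss i ht).memLp_gconv hFm hF).restrict Ω) hsv]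
  congr 1; ext x
  rw [gconv_dgauss ht hF, Finset.sum_mul]

/-! ### The heat flow solves the Neumann and Dirichlet problems -/

/-- Reflecting y amounts to reflecting x, and x and its mirror image are 2|x_n| apart. -/
lemma gauss_refl_lip {t : ℝ} (ht : 0 < t) (x y : E n) :
    |gauss t (x - y) - gauss t (x - refl n y)| ≤ 2 ^ (((n : ℝ) + 1) / 2) * (2 * |lastCoord x| / √t)
      * (gauss (2 * t) (x - y) + gauss (2 * t) (x - refl n y)) := by
  have e : ∀ s, gauss s (x - refl n y) = gauss s (refl n x - y) := fun s =>
    gauss_congr_norm s (norm_sub_refl x y)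
  rw [e, e]
  have := gauss_lip ht (x - y) (refl n x - y)
  rwa [sub_sub_sub_cancel_right, norm_sub_refl_self] at this

lemma partialDeriv_pgauss_symm (σ : ℝ) (i : Fin (n + 1)) (t : ℝ) (y x : E n) :
    partialDeriv i (fun x => pgauss i t (x - y) + σ * pgauss i t (x - refl n y)) x
      = ppgauss i t (x - y) + σ * ppgauss i t (x - refl n y) := by
  have hd : ∀ y, DifferentiableAt ℝ (fun x => pgauss i t (x - y)) x := fun y =>
    (((contDiff_pgauss i t).differentiable (by simp)).comp
      (differentiable_id.sub_const y)).differentiableAt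
  have h1 : partialDeriv i (fun x => pgauss i t (x - y) + σ * pgauss i t (x - refl n y)) x
      = partialDeriv i (fun x => pgauss i t (x - y)) x
        + partialDeriv i (fun x => σ * pgauss i t (x - refl n y)) x := by
    unfold partialDeriv
    rw [fderiv_fun_add (hd y) ((hd _).const_mul σ)]; simp
  rw [h1, partialDeriv_const_mul i σ (hd _), partialDeriv_comp_sub, partialDeriv_comp_sub,
    partialDeriv_pgauss, partialDeriv_pgauss]

lemma contDiff_pgauss_symm (σ : ℝ) (i : Fin (n + 1)) (t : ℝ) (y : E n) :
    ContDiff ℝ ∞ (fun x => pgauss i t (x - y) + σ * pgauss i t (x - refl n y)) := by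
  have : ∀ y, ContDiff ℝ ∞ (fun x => pgauss i t (x - y)) := fun y =>
    (contDiff_pgauss i t).comp (contDiff_id.sub contDiff_const)
  exact (this y).add (contDiff_const.mul (this _))

lemma memLp_symm {k : E n → ℝ} (hk : GaussBdd k) (σ : ℝ) (y : E n) :
    MemLp (fun x => k (x - y) + σ * k (x - refl n y)) 2 :=
  (hk.memLp_sub y).add ((hk.memLp_sub _).const_mul σ)

/-- For even data the normal derivative of the symmetrised Gaussian vanishes linearly at the
hyperplane. Hence there is no boundary term, even against competitors v without boundary condition.
-/
lemma isFormOperator_neumann {ε t : ℝ} (ht : 0 < t) {F : E n → ℂ}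
    (hFm : Measurable F) (hF : MemLp F 2) (hsym : ∀ᵐ y, F (refl n y) = F y) :
    IsFormOperator (hs n ε) (MemW12 (hs n ε)) (gconv (gauss t) F)
      (fun x => -gconv (dgauss t) F x) := by
  have hΩ := measurableSet_hs (n := n) ε
  refine ⟨(((gaussBdd_dgauss ht).memLp_gconv hFm hF).restrict _).neg,
    fun i => gconv (pgauss i t) F,
    memW12_gconv (gaussBdd_gauss ht) (fun i => gaussBdd_pgauss i ht) (contDiff_gauss t)
      (fun i z => partialDeriv_gauss i t z) hFm hF hΩ, fun v Gv hv => ?_⟩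
  refine form_identity (σ := 1) (Or.inl rfl) ht hFm hF (by simpa using hsym) hΩ hv.1 hv.2.1
    fun i y => ?_
  have hg := gaussBdd_gauss (n := n) ht
  have hg2 := gaussBdd_gauss (n := n) (mul_pos two_pos ht)
  have h := hv.integral_mul_partialDeriv i (contDiff_pgauss_symm 1 i t y)
    (memLp_symm (gaussBdd_pgauss i ht) 1 y)
    (by
      have e := funext (partialDeriv_pgauss_symm 1 i t y)
      rw [e]; exact memLp_symm (gaussBdd_ppgauss i ht) 1 y)
    (m := fun x => (1 / (2 * t)) * ((gauss t (x - y) + 1 * gauss t (x - refl n y))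
      + |lastCoord y| * (2 ^ (((n : ℝ) + 1) / 2) * (2 / √t))
        * (gauss (2 * t) (x - y) + 1 * gauss (2 * t) (x - refl n y))))
    (((memLp_symm hg 1 y).add ((memLp_symm hg2 1 y).const_mul _)).const_mul _) ?_
  · simp only [partialDeriv_pgauss_symm] at h
    exact h
  · rintro rfl x
    have p1 := gauss_nonneg ht (x - y)
    have p2 := gauss_nonneg ht (x - refl n y)
    have p3 := gauss_nonneg (n := n) (mul_pos two_pos ht) (x - y)
    have p4 := gauss_nonneg (n := n) (mul_pos two_pos ht) (x - refl n y)
    have hst : 0 < √t := Real.sqrt_pos.2 ht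
    -- The normal derivative consists of x_n times a sum of Gaussians and y_n times their
    -- difference; the latter is again O(|x_n|).
    have e : pgauss (Fin.last n) t (x - y) + 1 * pgauss (Fin.last n) t (x - refl n y)
        = -(1 / (2 * t)) * (lastCoord x * (gauss t (x - y) + gauss t (x - refl n y))
          - lastCoord y * (gauss t (x - y) - gauss t (x - refl n y))) := by
      unfold pgauss
      simp only [PiLp.sub_apply, refl_apply_last, lastCoord]
      field_simp; ring
    rw [e, abs_mul, abs_neg, abs_of_pos (by positivity : 0 < 1 / (2 * t)),
      abs_of_nonneg (a := 1 / (2 * t) * _) (by positivity), mul_left_comm]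
    gcongr
    calc _ ≤ |lastCoord x * (gauss t (x - y) + gauss t (x - refl n y))|
          + |lastCoord y * (gauss t (x - y) - gauss t (x - refl n y))| := abs_sub _ _
      _ ≤ |lastCoord x| * (gauss t (x - y) + gauss t (x - refl n y))
          + |lastCoord y| * (2 ^ (((n : ℝ) + 1) / 2) * (2 * |lastCoord x| / √t)
            * (gauss (2 * t) (x - y) + gauss (2 * t) (x - refl n y))) := by
          rw [abs_mul, abs_mul, abs_of_nonneg (add_nonneg p1 p2)]
          gcongr
          exact gauss_refl_lip ht x y
      _ = _ := by ring

/-- The boundary terms disappear because the competitor v lies in W_0^{1,2}. What remains to be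
shown separately is that the flow itself lies there. -/
lemma isFormOperator_dirichlet_of_memW120 {ε t : ℝ} (ht : 0 < t) {F : E n → ℂ}
    (hFm : Measurable F) (hF : MemLp F 2) (hsym : ∀ᵐ y, F (refl n y) = - F y)
    (hW : MemW120 (hs n ε) (gconv (gauss t) F) (fun i => gconv (pgauss i t) F)) :
    IsFormOperator (hs n ε) (MemW120 (hs n ε)) (gconv (gauss t) F)
      (fun x => -gconv (dgauss t) F x) := by
  have hΩ := measurableSet_hs (n := n) ε
  refine ⟨(((gaussBdd_dgauss ht).memLp_gconv hFm hF).restrict _).neg,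
    fun i => gconv (pgauss i t) F, hW, fun v Gv hv => ?_⟩
  refine form_identity (σ := -1) (Or.inr rfl) ht hFm hF (by simpa using hsym) hΩ hv.1.1 hv.1.2.1
    fun i y => ?_
  have h := hv.integral_mul_partialDeriv i (contDiff_pgauss_symm (-1) i t y)
    (memLp_symm (gaussBdd_pgauss i ht) (-1) y)
    (by
      have e := funext (partialDeriv_pgauss_symm (-1) i t y)
      rw [e]; exact memLp_symm (gaussBdd_ppgauss i ht) (-1) y)
  simp only [partialDeriv_pgauss_symm] at h
  exact h

/-! ### Odd data lead to `W_0^{1,2}` -/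

/-- Odd square integrable functions are approximated by odd test functions. -/
lemma exists_odd_test {F : E n → ℂ} (hF : MemLp F 2) (hsym : ∀ᵐ y, F (refl n y) = - F y)
    {δ : ℝ} (hδ : 0 < δ) : ∃ Φ : E n → ℂ, ContDiff ℝ ∞ Φ ∧ HasCompactSupport Φ ∧
      (∀ y, Φ (refl n y) = - Φ y) ∧
      eLpNorm (fun x => F x - Φ x) 2 volume ≤ ENNReal.ofReal δ := by
  have : Fact ((1 : ℝ≥0∞) ≤ 2) := ⟨by norm_num⟩
  obtain ⟨f, ⟨g, hfg, hgc, hgs⟩, hd⟩ := (Lp.dense_hasCompactSupport_contDiff (E := E n) (F := ℂ)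
    (μ := volume) (p := 2) (by simp)).exists_dist_lt hF.toLp hδ
  have h1 : eLpNorm (fun x => F x - g x) 2 volume ≤ ENNReal.ofReal δ := by
    rw [dist_eq_norm, Lp.norm_def] at hd
    have h2 : eLpNorm (↑↑(hF.toLp - f) : E n → ℂ) 2 volume = eLpNorm (fun x => F x - g x) 2 volume := by
      apply eLpNorm_congr_ae
      filter_upwards [Lp.coeFn_sub hF.toLp f, hF.coeFn_toLp, hfg] with x a b c
      rw [a, Pi.sub_apply, b, c]
    rw [h2] at hd
    exact (ENNReal.le_ofReal_iff_toReal_le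
      (h2 ▸ Lp.eLpNorm_ne_top _) hδ.le).2 hd.le
  have hRs : ContDiff ℝ ∞ (fun y => g (refl n y)) := hgs.comp (refl n).contDiff
  have hRc : HasCompactSupport (fun y => g (refl n y)) :=
    hgc.comp_homeomorph (refl n).toHomeomorph
  -- Taking odd parts fixes F and does not increase the L² norm, so the odd part of the approximant
  -- is as close to F as the approximant.
  refine ⟨fun y => (1 / 2 : ℂ) * (g y - g (refl n y)), contDiff_const.mul (hgs.sub hRs),
    (hgc.sub hRc).mul_left, fun y => by simp; ring, ?_⟩
  have hgm : MemLp g 2 volume := hgs.continuous.memLp_of_hasCompactSupport hgc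
  have h3 : (fun x => F x - (1 / 2 : ℂ) * (g x - g (refl n x)))
      =ᵐ[volume] (1 / 2 : ℂ) • ((fun x => F x - g x) - (fun x => F x - g x) ∘ refl n) := by
    filter_upwards [hsym] with x hx
    simp only [Pi.smul_apply, Pi.sub_apply, Function.comp_apply, hx, smul_eq_mul]
    ring
  rw [eLpNorm_congr_ae h3, eLpNorm_const_smul]
  have hsm : AEStronglyMeasurable (fun x => F x - g x) volume := hF.1.sub hgm.1
  have h4 := eLpNorm_sub_le (p := 2) hsm (hsm.comp_measurePreserving measurePreserving_refl)
    (by norm_num)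
  rw [eLpNorm_comp_measurePreserving hsm measurePreserving_refl] at h4
  have h5 : ‖(1 / 2 : ℂ)‖ₑ = ENNReal.ofReal (1 / 2) := by
    rw [← ofReal_norm]; norm_num
  rw [h5]
  calc _ ≤ ENNReal.ofReal (1 / 2) * (ENNReal.ofReal δ + ENNReal.ofReal δ) := by
        gcongr
        exact h4.trans (add_le_add h1 h1)
    _ = _ := by
        rw [← ENNReal.ofReal_add hδ.le hδ.le, ← ENNReal.ofReal_mul (by norm_num)]
        congr 1; ring

lemma gconv_eq_convolution (k : E n → ℝ) (Φ : E n → ℂ) :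
    gconv k Φ = convolution k Φ (ContinuousLinearMap.lsmul ℝ ℝ) volume := by
  ext x
  unfold gconv convolution
  rw [← integral_sub_left_eq_self _ volume x]
  congr 1; ext y
  simp

lemma contDiff_gconv_gauss {t : ℝ} (ht : 0 < t) {Φ : E n → ℂ} (hΦ : ContDiff ℝ ∞ Φ)
    (hc : HasCompactSupport Φ) : ContDiff ℝ ∞ (gconv (gauss t) Φ) := by
  rw [gconv_eq_convolution]
  exact hc.contDiff_convolution_right _ (integrable_gauss ht).locallyIntegrable hΦ

lemma partialDeriv_gconv_gauss {t : ℝ} (ht : 0 < t) {Φ : E n → ℂ} (hΦ : ContDiff ℝ ∞ Φ)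
    (hc : HasCompactSupport Φ) (i : Fin (n + 1)) (x : E n) :
    partialDeriv i (gconv (gauss t) Φ) x = gconv (pgauss i t) Φ x := by
  have hmΦ : MemLp Φ 2 volume := hΦ.continuous.memLp_of_hasCompactSupport hc
  have hmd : MemLp (partialDeriv i Φ) 2 volume :=
    (continuous_partialDeriv i hΦ).memLp_of_hasCompactSupport (partialDeriv_hasCompactSupport i hc)
  have h1 : partialDeriv i (gconv (gauss t) Φ) x = gconv (gauss t) (partialDeriv i Φ) x := by
    rw [gconv_eq_convolution, gconv_eq_convolution]
    have := hc.hasFDerivAt_convolution_right (𝕜 := ℝ) (ContinuousLinearMap.lsmul ℝ ℝ)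
      (integrable_gauss (n := n) ht).locallyIntegrable (hΦ.of_le (by simp)) x
    rw [partialDeriv, this.fderiv, convolution_precompR_apply _
      (integrable_gauss (n := n) ht).locallyIntegrable (hc.fderiv ℝ)
      (hΦ.continuous_fderiv (by simp))]
    rfl
  rw [h1]
  have hgd : Differentiable ℝ (fun y => gauss t (x - y)) :=
    ((contDiff_gauss t).differentiable (by simp)).comp (differentiable_id.const_sub x)
  have hgc : Differentiable ℝ (fun y => ((gauss t (x - y) : ℝ) : ℂ)) :=
    Complex.ofRealCLM.differentiable.comp hgd
  have e : ∀ y, fderiv ℝ (fun y => ((gauss t (x - y) : ℝ) : ℂ)) y (EuclideanSpace.single i 1)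
      = - ((pgauss i t (x - y) : ℝ) : ℂ) := by
    intro y
    have a := partialDeriv_ofReal i (hgd y)
    unfold partialDeriv at a
    rw [a, ← partialDeriv_gauss]
    have b := (((contDiff_gauss t).differentiable (by simp)) (x - y)).hasFDerivAt.comp y
      ((hasFDerivAt_id y).const_sub x)
    have b' : HasFDerivAt (fun y => gauss t (x - y)) _ y := b
    rw [b'.fderiv]
    simp [partialDeriv]
  have h := integral_mul_fderiv_eq_neg_fderiv_mul_of_integrable (μ := (volume : Measure (E n)))
    (f := fun y => ((gauss t (x - y) : ℝ) : ℂ)) (g := Φ) (v := EuclideanSpace.single i 1) ?_ ?_ ?_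
    (fun x _ => hgc x) (fun x _ => hΦ.differentiable (by simp) x)
  · simp only [e, neg_mul, integral_neg, neg_neg] at h
    exact h
  · simp only [e, neg_mul]
    exact ((gaussBdd_pgauss i ht).integrable_mul hmΦ x).neg
  · exact (gaussBdd_gauss ht).integrable_mul hmd x
  · exact (gaussBdd_gauss ht).integrable_mul hmΦ x

/-- Oddness makes the convolution W satisfy W(x) = (W(x) - W(Rx))/2, a difference over the distance
2|x_n|. So W vanishes linearly at the hyperplane, with a square integrable coefficient. -/
lemma norm_gconv_gauss_le_of_odd {t : ℝ} (ht : 0 < t) {Φ : E n → ℂ} (hm : MemLp Φ 2)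
    (hodd : ∀ y, Φ (refl n y) = - Φ y) (x : E n) :
    ‖gconv (gauss t) Φ x‖ ≤ |lastCoord x| * (2 ^ (((n : ℝ) + 1) / 2) / √t *
      (‖gconv (gauss (2 * t)) (fun y => (‖Φ y‖ : ℂ)) x‖
        + ‖gconv (gauss (2 * t)) (fun y => (‖Φ y‖ : ℂ)) (refl n x)‖)) := by
  set N : E n → ℝ := fun x => ∫ y, gauss (2 * t) (x - y) * ‖Φ y‖ with hN
  have h2t : 0 < 2 * t := by positivity
  have hmn : MemLp (fun y => (‖Φ y‖ : ℂ)) 2 volume := hm.norm.ofReal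
  have eN : ∀ x, gconv (gauss (2 * t)) (fun y => (‖Φ y‖ : ℂ)) x = (N x : ℂ) := by
    intro x
    simp only [gconv, hN, ← integral_complex_ofReal]
    congr 1; ext y; push_cast; rfl
  have iN : ∀ x, Integrable (fun y => gauss (2 * t) (x - y) * ‖Φ y‖) := fun x =>
    ((gaussBdd_gauss h2t).memLp.comp_measurePreserving
      (Measure.measurePreserving_sub_left volume x)).integrable_mul hm.norm
  have hN0 : ∀ x, 0 ≤ N x := fun x =>
    integral_nonneg fun y => mul_nonneg (gauss_nonneg h2t _) (norm_nonneg _)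
  rw [eN, eN, Complex.norm_real, Complex.norm_real, Real.norm_of_nonneg (hN0 _),
    Real.norm_of_nonneg (hN0 _)]
  have hWR : gconv (gauss t) Φ (refl n x) = - gconv (gauss t) Φ x := by
    unfold gconv
    rw [← measurePreserving_refl.integral_comp measurableEmbedding_refl
      (fun y => ((gauss t (refl n x - y) : ℝ) : ℂ) * Φ y), ← integral_neg]
    congr 1; ext y
    rw [hodd, gauss_congr_norm t (norm_refl_sub_refl x y)]; ring
  have h1 : gconv (gauss t) Φ x = (1 / 2 : ℂ) * ∫ y,
      (((gauss t (x - y) : ℝ) : ℂ) * Φ y - ((gauss t (refl n x - y) : ℝ) : ℂ) * Φ y) := by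
    rw [integral_sub ((gaussBdd_gauss ht).integrable_mul hm x)
      ((gaussBdd_gauss ht).integrable_mul hm _)]
    change _ = (1 / 2 : ℂ) * (gconv (gauss t) Φ x - gconv (gauss t) Φ (refl n x))
    rw [hWR]; ring
  rw [h1, norm_mul]
  have h2 : ‖∫ y, (((gauss t (x - y) : ℝ) : ℂ) * Φ y - ((gauss t (refl n x - y) : ℝ) : ℂ) * Φ y)‖
      ≤ ∫ y, (2 ^ (((n : ℝ) + 1) / 2) * (2 * |lastCoord x| / √t)) *
        (gauss (2 * t) (x - y) * ‖Φ y‖ + gauss (2 * t) (refl n x - y) * ‖Φ y‖) := by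
    refine norm_integral_le_of_norm_le (((iN x).add (iN _)).const_mul _)
      (Filter.Eventually.of_forall fun y => ?_)
    rw [← sub_mul, norm_mul, ← Complex.ofReal_sub, Complex.norm_real, Real.norm_eq_abs, ← add_mul,
      ← mul_assoc]
    gcongr
    have := gauss_lip ht (x - y) (refl n x - y)
    rwa [sub_sub_sub_cancel_right, norm_sub_refl_self] at this
  rw [integral_const_mul, integral_add (iN x) (iN _)] at h2
  calc _ ≤ ‖(1 / 2 : ℂ)‖ * ((2 ^ (((n : ℝ) + 1) / 2) * (2 * |lastCoord x| / √t)) *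
        (N x + N (refl n x))) := by gcongr
    _ = _ := by norm_num; ring

lemma tendsto_eLpNorm_of_eventually_zero {μ : Measure (E n)} {f : ℕ → E n → ℂ} {b : E n → ℝ}
    (hf : ∀ k, AEStronglyMeasurable (f k) μ) (hb : MemLp b 2 μ) (hfb : ∀ k x, ‖f k x‖ ≤ |b x|)
    (h0 : ∀ᵐ x ∂μ, ∀ᶠ k in Filter.atTop, f k x = 0) :
    Filter.Tendsto (fun k => eLpNorm (f k) 2 μ) Filter.atTop (nhds 0) := by
  have h := tendsto_lintegral_of_dominated_convergence' (μ := μ)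
    (F := fun k x => ‖f k x‖ₑ ^ 2) (f := fun _ => 0) (fun x => ‖b x‖ₑ ^ 2)
    (fun k => (hf k).enorm.pow_const 2) (fun k => Filter.Eventually.of_forall fun x => by
      refine pow_le_pow_left' ?_ 2
      rw [enorm_le_iff_norm_le]; exact hfb k x)
    (by rw [← eLpNorm_two_sq]; exact ENNReal.pow_ne_top hb.eLpNorm_ne_top)
    (by
      filter_upwards [h0] with x hx
      refine Filter.Tendsto.congr' ?_ tendsto_const_nhds
      filter_upwards [hx] with k hk
      simp [hk])
  simp only [lintegral_zero, ← eLpNorm_two_sq] at h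
  have h2 := (ENNReal.continuous_rpow_const (y := 1 / 2)).tendsto _ |>.comp h
  rw [ENNReal.zero_rpow_of_pos (by norm_num)] at h2
  refine h2.congr fun k => ?_
  simp only [Function.comp_apply]
  rw [← ENNReal.rpow_two, ← ENNReal.rpow_mul]; norm_num

/-- F is replaced by an odd test function Φ, at a cost controlled by Young's inequality. The smooth
W = g_t * Φ is then cut off: the critical term W ∂ζ_k stays below a fixed square integrable function
because W vanishes linearly, and it is eventually 0 at each point of the half space. -/
lemma memW120_gconv {ε t : ℝ} (ht : 0 < t) {F : E n → ℂ}
    (hFm : Measurable F) (hF : MemLp F 2) (hsym : ∀ᵐ y, F (refl n y) = - F y) :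
    MemW120 (hs n ε) (gconv (gauss t) F) (fun i => gconv (pgauss i t) F) := by
  have hΩ := measurableSet_hs (n := n) ε
  have hg := gaussBdd_gauss (n := n) ht
  have hp := fun i => gaussBdd_pgauss (n := n) i ht
  refine ⟨memW12_gconv hg hp (contDiff_gauss t) (fun i z => partialDeriv_gauss i t z) hFm hF hΩ,
    fun δ hδ => ?_⟩
  -- A common bound for the L¹ norms of the Gaussian and its first derivatives; the summand 1 keeps
  -- it away from 0 for the division below.
  set c : ℝ≥0∞ := 1 + (∫⁻ z : E n, ‖gauss t z‖ₑ) + ∑ i, ∫⁻ z : E n, ‖pgauss i t z‖ₑ with hc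
  have hcg : ∫⁻ z : E n, ‖gauss t z‖ₑ ≤ c := le_self_add.trans' le_add_self
  have hcp : ∀ i, ∫⁻ z : E n, ‖pgauss i t z‖ₑ ≤ c := fun i =>
    (Finset.single_le_sum (f := fun i => ∫⁻ z : E n, ‖pgauss i t z‖ₑ) (fun _ _ => zero_le)
      (Finset.mem_univ i)).trans le_add_self
  have hct : c ≠ ⊤ := by
    refine ENNReal.add_ne_top.2 ⟨ENNReal.add_ne_top.2 ⟨by simp, hg.integrable.hasFiniteIntegral.ne⟩,
      ENNReal.sum_ne_top.2 fun i _ => (hp i).integrable.hasFiniteIntegral.ne⟩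
  have hc1 : 1 ≤ c.toReal := by
    rw [← ENNReal.toReal_one]
    exact ENNReal.toReal_mono hct (le_self_add.trans le_self_add)
  have hcp0 : 0 < c.toReal := by linarith
  obtain ⟨Φ, hΦs, hΦc, hodd, hΦF⟩ := exists_odd_test hF hsym
    (δ := δ / (2 * c.toReal)) (by positivity)
  have hΦ2 : MemLp Φ 2 volume := hΦs.continuous.memLp_of_hasCompactSupport hΦc
  have hΦm : Measurable Φ := hΦs.continuous.measurable
  have hcδ : c * ENNReal.ofReal (δ / (2 * c.toReal)) = ENNReal.ofReal (δ / 2) := by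
    nth_rw 1 [← ENNReal.ofReal_toReal hct]
    rw [← ENNReal.ofReal_mul hcp0.le]
    congr 1; field_simp
  have hdiff : ∀ {k : E n → ℝ} (_ : GaussBdd k) (_ : ∫⁻ z, ‖k z‖ₑ ≤ c),
      eLpNorm (fun x => gconv k F x - gconv k Φ x) 2 (volume.restrict (hs n ε))
        ≤ ENNReal.ofReal (δ / 2) := by
    intro k hk hkc
    simp only [← gconv_sub hk hF hΦ2]
    refine (eLpNorm_mono_measure _ Measure.restrict_le_self).trans ?_
    refine (eLpNorm_gconv_le hk.cont.measurable (hFm.sub hΦm)).trans ?_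
    rw [← hcδ]
    exact mul_le_mul' hkc hΦF
  obtain ⟨ζ, M, hM, hζt, hζ1, hζe, hζd⟩ := exists_cutoff n ε
  set W := gconv (gauss t) Φ with hW
  have hWs : ContDiff ℝ ∞ W := contDiff_gconv_gauss ht hΦs hΦc
  have hWd : ∀ i x, partialDeriv i W x = gconv (pgauss i t) Φ x :=
    partialDeriv_gconv_gauss ht hΦs hΦc
  have hW2 : MemLp W 2 volume := hg.memLp_gconv hΦm hΦ2
  have hP2 : ∀ i, MemLp (gconv (pgauss i t) Φ) 2 volume := fun i => (hp i).memLp_gconv hΦm hΦ2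
  set m : E n → ℝ := fun x => 2 ^ (((n : ℝ) + 1) / 2) / √t *
      (‖gconv (gauss (2 * t)) (fun y => (‖Φ y‖ : ℂ)) x‖
        + ‖gconv (gauss (2 * t)) (fun y => (‖Φ y‖ : ℂ)) (refl n x)‖) with hm
  have hm0 : ∀ x, 0 ≤ m x := fun x => by positivity
  have hm2 : MemLp m 2 volume := by
    have h1 : MemLp (gconv (gauss (2 * t)) (fun y => (‖Φ y‖ : ℂ))) 2 volume :=
      (gaussBdd_gauss (by positivity)).memLp_gconv
        (Complex.measurable_ofReal.comp hΦm.norm) hΦ2.norm.ofReal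
    exact (h1.norm.add (h1.comp_measurePreserving measurePreserving_refl).norm).const_mul _
  have hWm : ∀ x, ‖W x‖ ≤ |lastCoord x| * m x := norm_gconv_gauss_le_of_odd ht hΦ2 hodd
  have htest : ∀ k, IsTestFunction (hs n ε) (fun x => ζ k x • W x) := fun k =>
    ⟨(hζt k).1.smul hWs, (hζt k).2.1.smul_right, (closure_mono (by
      intro x hx h0; simp [h0] at hx)).trans (hζt k).2.2⟩
  have hpd : ∀ k i x, partialDeriv i (fun x => ζ k x • W x) x
      = ζ k x • gconv (pgauss i t) Φ x + partialDeriv i (ζ k) x • W x := by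
    intro k i x
    rw [← hWd]
    exact partialDeriv_smul i ((hζt k).1.differentiable (by simp) x)
      (hWs.differentiable (by simp) x)
  have hbd : ∀ k i x, ‖partialDeriv i (ζ k) x • W x‖ ≤ M * (‖W x‖ + m x) := by
    intro k i x
    rw [norm_smul, Real.norm_eq_abs]
    have h1 : |partialDeriv i (ζ k) x| ≤ M * (1 + |lastCoord x|⁻¹) := by
      refine (hζd k x i).trans ?_
      gcongr
      split_ifs
      · exact le_rfl
      · positivity
    have h3 : |lastCoord x|⁻¹ * ‖W x‖ ≤ m x := by
      rcases eq_or_ne (lastCoord x) 0 with h0 | h0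
      · simpa [h0] using hm0 x
      · rw [inv_mul_le_iff₀ (abs_pos.2 h0)]; exact hWm x
    calc _ ≤ M * (1 + |lastCoord x|⁻¹) * ‖W x‖ := by gcongr
      _ = M * (‖W x‖ + |lastCoord x|⁻¹ * ‖W x‖) := by ring
      _ ≤ _ := by gcongr
  have hζ2 : ∀ k x, |1 - ζ k x| ≤ 2 := fun k x => by
    have := abs_le.1 (hζ1 k x); rw [abs_le]; constructor <;> linarith
  have t1 : Filter.Tendsto (fun k => eLpNorm (fun x => W x - ζ k x • W x) 2
      (volume.restrict (hs n ε))) Filter.atTop (nhds 0) := by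
    refine tendsto_eLpNorm_of_eventually_zero (b := fun x => 2 * ‖W x‖)
      (fun k => (hWs.continuous.sub (htest k).1.continuous).aestronglyMeasurable)
      ((hW2.norm.const_mul 2).restrict _) (fun k x => ?_) ?_
    · rw [abs_of_nonneg (by positivity)]
      have : W x - ζ k x • W x = (1 - ζ k x) • W x := by rw [sub_smul, one_smul]
      rw [this, norm_smul, Real.norm_eq_abs]
      gcongr; exact hζ2 k x
    · filter_upwards [ae_restrict_mem hΩ] with x hx
      filter_upwards [hζe x hx] with k hk
      rw [hk.self_of_nhds]; simp
  have t2 : ∀ i, Filter.Tendsto (fun k => eLpNorm (fun x => gconv (pgauss i t) Φ x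
      - partialDeriv i (fun x => ζ k x • W x) x) 2 (volume.restrict (hs n ε)))
      Filter.atTop (nhds 0) := by
    intro i
    refine tendsto_eLpNorm_of_eventually_zero
      (b := fun x => 2 * ‖gconv (pgauss i t) Φ x‖ + M * (‖W x‖ + m x))
      (fun k => ((hP2 i).1.restrict).sub
        (continuous_partialDeriv i (htest k).1).aestronglyMeasurable)
      ((((hP2 i).norm.const_mul 2).add ((hW2.norm.add hm2).const_mul M)).restrict _)
      (fun k x => ?_) ?_
    · have hmx := hm0 x
      rw [abs_of_nonneg (by positivity), hpd]
      have : gconv (pgauss i t) Φ x - (ζ k x • gconv (pgauss i t) Φ x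
          + partialDeriv i (ζ k) x • W x) = (1 - ζ k x) • gconv (pgauss i t) Φ x
            - partialDeriv i (ζ k) x • W x := by rw [sub_smul, one_smul]; ring
      rw [this]
      refine (norm_sub_le _ _).trans (add_le_add ?_ (hbd k i x))
      rw [norm_smul, Real.norm_eq_abs]
      gcongr; exact hζ2 k x
    · filter_upwards [ae_restrict_mem hΩ] with x hx
      filter_upwards [hζe x hx] with k hk
      have : partialDeriv i (ζ k) x = 0 := by
        unfold partialDeriv; rw [hk.fderiv_eq]; simp
      rw [hpd, this, hk.self_of_nhds]; simp
  have hδ2 : 0 < ENNReal.ofReal (δ / 2) := ENNReal.ofReal_pos.2 (by positivity)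
  have ev1 := (ENNReal.tendsto_nhds_zero.1 t1) _ hδ2
  have ev2 : ∀ᶠ k in Filter.atTop, ∀ i, eLpNorm (fun x => gconv (pgauss i t) Φ x
      - partialDeriv i (fun x => ζ k x • W x) x) 2 (volume.restrict (hs n ε))
      ≤ ENNReal.ofReal (δ / 2) :=
    Filter.eventually_all.2 fun i => (ENNReal.tendsto_nhds_zero.1 (t2 i)) _ hδ2
  obtain ⟨k, hk1, hk2⟩ := (ev1.and ev2).exists
  have hsum : ENNReal.ofReal (δ / 2) + ENNReal.ofReal (δ / 2) = ENNReal.ofReal δ := by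
    rw [← ENNReal.ofReal_add (by positivity) (by positivity)]; congr 1; ring
  refine ⟨fun x => ζ k x • W x, htest k, ?_, fun i => ?_⟩
  · have e : (fun x => gconv (gauss t) F x - ζ k x • W x)
        = (fun x => gconv (gauss t) F x - W x) + fun x => W x - ζ k x • W x := by
      ext x; simp
    rw [e, ← hsum]
    refine (eLpNorm_add_le ?_ ?_ (by norm_num)).trans (add_le_add (hdiff hg hcg) hk1)
    · exact ((hg.memLp_gconv hFm hF).1.sub hW2.1).restrict
    · exact (hWs.continuous.sub (htest k).1.continuous).aestronglyMeasurable
  · have e : (fun x => gconv (pgauss i t) F x - partialDeriv i (fun x => ζ k x • W x) x)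
        = (fun x => gconv (pgauss i t) F x - gconv (pgauss i t) Φ x)
          + fun x => gconv (pgauss i t) Φ x - partialDeriv i (fun x => ζ k x • W x) x := by
      ext x; simp
    rw [e, ← hsum]
    refine (eLpNorm_add_le ?_ ?_ (by norm_num)).trans (add_le_add (hdiff (hp i) (hcp i)) (hk2 i))
    · exact (((hp i).memLp_gconv hFm hF).1.sub (hP2 i).1).restrict
    · exact ((hP2 i).1.restrict).sub (continuous_partialDeriv i (htest k).1).aestronglyMeasurable

lemma isFormOperator_dirichlet {ε t : ℝ} (ht : 0 < t) {F : E n → ℂ}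
    (hFm : Measurable F) (hF : MemLp F 2) (hsym : ∀ᵐ y, F (refl n y) = - F y) :
    IsFormOperator (hs n ε) (MemW120 (hs n ε)) (gconv (gauss t) F)
      (fun x => -gconv (dgauss t) F x) :=
  isFormOperator_dirichlet_of_memW120 ht hFm hF hsym (memW120_gconv ht hFm hF hsym)

end SplitBMO

end

/-! ### The explicit kernel of a split operator and uniqueness of its flow. -/

noncomputable section

namespace SplitBMO

variable {n : ℕ}

/-! ### Form domains on half spaces -/

/-- The properties of the form domains `W^{1,2}` and `W_0^{1,2}` of a half space used below. The
sign `σ` is the parity of the reflections which generate the heat semigroup. -/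
structure FormDom (ε σ : ℝ) (V : (E n → ℂ) → (Fin (n + 1) → E n → ℂ) → Prop) : Prop where
  memLp : ∀ {u G}, V u G → MemLp u 2 (volume.restrict (hs n ε))
  memLp_grad : ∀ {u G}, V u G → ∀ i, MemLp (G i) 2 (volume.restrict (hs n ε))
  congr : ∀ {u u' G}, u =ᵐ[volume.restrict (hs n ε)] u' → V u G → V u' G
  sub : ∀ {u u' G G'}, V u G → V u' G' → V (fun x => u x - u' x) (fun i x => G i x - G' i x)
  heat : ∀ {t : ℝ}, 0 < t → ∀ {F : E n → ℂ}, Measurable F → MemLp F 2 →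
    (∀ᵐ y, F (refl n y) = σ * F y) →
    IsFormOperator (hs n ε) V (gconv (gauss t) F) (fun x => -gconv (dgauss t) F x)

lemma MemW12.congr {Ω : Set (E n)} {u u' : E n → ℂ} {G : Fin (n + 1) → E n → ℂ}
    (h : u =ᵐ[volume.restrict Ω] u') (hu : MemW12 Ω u G) : MemW12 Ω u' G := by
  refine ⟨hu.1.ae_eq h, hu.2.1, fun i φ hφ => ?_⟩
  rw [← hu.2.2 i φ hφ]
  apply integral_congr_ae
  filter_upwards [h] with x hx
  rw [hx]

lemma MemW12.sub {Ω : Set (E n)} {u u' : E n → ℂ} {G G' : Fin (n + 1) → E n → ℂ}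
    (hu : MemW12 Ω u G) (hu' : MemW12 Ω u' G') :
    MemW12 Ω (fun x => u x - u' x) (fun i x => G i x - G' i x) := by
  refine ⟨hu.1.sub hu'.1, fun i => (hu.2.1 i).sub (hu'.2.1 i), fun i φ hφ => ?_⟩
  have m1 : MemLp (fun x => ((partialDeriv i φ x : ℝ) : ℂ)) 2 (volume.restrict Ω) :=
    (hφ.memLp_partialDeriv i volume).restrict Ω |>.ofReal
  have m2 : MemLp (fun x => (φ x : ℂ)) 2 (volume.restrict Ω) :=
    (hφ.memLp volume).restrict Ω |>.ofReal
  simp_rw [sub_mul]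
  rw [integral_sub (integrable_mul_of_memLp hu.1 m1) (integrable_mul_of_memLp hu'.1 m1),
    integral_sub (integrable_mul_of_memLp (hu.2.1 i) m2) (integrable_mul_of_memLp (hu'.2.1 i) m2),
    hu.2.2 i φ hφ, hu'.2.2 i φ hφ]
  ring

lemma MemW120.congr {Ω : Set (E n)} {u u' : E n → ℂ} {G : Fin (n + 1) → E n → ℂ}
    (h : u =ᵐ[volume.restrict Ω] u') (hu : MemW120 Ω u G) : MemW120 Ω u' G := by
  refine ⟨hu.1.congr h, fun ε hε => ?_⟩
  obtain ⟨φ, hφ, h1, h2⟩ := hu.2 ε hε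
  refine ⟨φ, hφ, le_of_eq_of_le (eLpNorm_congr_ae ?_) h1, h2⟩
  filter_upwards [h] with x hx
  rw [hx]

lemma IsTestFunction.sub {F : Type} [NormedAddCommGroup F] [NormedSpace ℝ F] {Ω : Set (E n)}
    {φ ψ : E n → F} (hφ : IsTestFunction Ω φ) (hψ : IsTestFunction Ω ψ) :
    IsTestFunction Ω (fun x => φ x - ψ x) := by
  refine ⟨hφ.1.sub hψ.1, hφ.2.1.sub hψ.2.1, ?_⟩
  exact (tsupport_sub φ ψ).trans (union_subset hφ.2.2 hψ.2.2)

lemma MemW120.sub {Ω : Set (E n)} {u u' : E n → ℂ} {G G' : Fin (n + 1) → E n → ℂ}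
    (hu : MemW120 Ω u G) (hu' : MemW120 Ω u' G') :
    MemW120 Ω (fun x => u x - u' x) (fun i x => G i x - G' i x) := by
  refine ⟨hu.1.sub hu'.1, fun ε hε => ?_⟩
  obtain ⟨φ, hφ, h1, h2⟩ := hu.2 (ε / 2) (half_pos hε)
  obtain ⟨ψ, hψ, h3, h4⟩ := hu'.2 (ε / 2) (half_pos hε)
  have hsum : ENNReal.ofReal (ε / 2) + ENNReal.ofReal (ε / 2) = ENNReal.ofReal ε := by
    rw [← ENNReal.ofReal_add (by positivity) (by positivity)]; congr 1; ring
  refine ⟨_, hφ.sub hψ, ?_, fun i => ?_⟩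
  · have e : (fun x => u x - u' x - (φ x - ψ x))
        = (fun x => u x - φ x) - fun x => u' x - ψ x := by ext x; simp; ring
    rw [e, ← hsum]
    exact (eLpNorm_sub_le (hu.1.1.1.sub (hφ.memLp _).1) (hu'.1.1.1.sub (hψ.memLp _).1)
      (by norm_num)).trans (add_le_add h1 h3)
  · have e : (fun x => G i x - G' i x - partialDeriv i (fun x => φ x - ψ x) x)
        = (fun x => G i x - partialDeriv i φ x) - fun x => G' i x - partialDeriv i ψ x := by
      ext x
      have : partialDeriv i (fun x => φ x - ψ x) x = partialDeriv i φ x - partialDeriv i ψ x := by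
        unfold partialDeriv
        rw [fderiv_fun_sub (hφ.1.differentiable (by simp) x) (hψ.1.differentiable (by simp) x)]
        simp
      simp only [Pi.sub_apply, this]; ring
    rw [e, ← hsum]
    exact (eLpNorm_sub_le ((hu.1.2.1 i).1.sub (hφ.memLp_partialDeriv i _).1)
      ((hu'.1.2.1 i).1.sub (hψ.memLp_partialDeriv i _).1)
      (by norm_num)).trans (add_le_add (h2 i) (h4 i))

lemma formDom_neumann (ε : ℝ) : FormDom ε 1 (MemW12 (hs n ε)) where
  memLp h := h.1
  memLp_grad h := h.2.1
  congr := MemW12.congr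
  sub := MemW12.sub
  heat ht _ hFm hF hs := isFormOperator_neumann ht hFm hF (by simpa using hs)

lemma formDom_dirichlet (ε : ℝ) : FormDom ε (-1) (MemW120 (hs n ε)) where
  memLp h := h.1.1
  memLp_grad h := h.1.2.1
  congr := MemW120.congr
  sub := MemW120.sub
  heat ht _ hFm hF hs := isFormOperator_dirichlet ht hFm hF (by simpa using hs)

/-- Operators which split across the hyperplane, with reflection parity `a` on the upper and `b`
on the lower half space. -/
structure IsSplit (a b : ℝ) (L : (E n → ℂ) → (E n → ℂ) → Prop) : Prop where
  sign_up : a = 1 ∨ a = -1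
  sign_low : b = 1 ∨ b = -1
  exists_dom : ∃ V₁ V₂, FormDom 1 a V₁ ∧ FormDom (-1) b V₂ ∧
    ∀ u g, L u g ↔ IsFormOperator (hs n 1) V₁ u g ∧ IsFormOperator (hs n (-1)) V₂ u g

lemma isSplit_lapN (n : ℕ) : IsSplit 1 1 (lapN n) :=
  ⟨Or.inl rfl, Or.inl rfl, _, _, formDom_neumann 1, formDom_neumann (-1), fun u g => by
    rw [lapN, neumannOn, neumannOn, upperHalf_eq, lowerHalf_eq]⟩

lemma isSplit_lapD (n : ℕ) : IsSplit (-1) (-1) (lapD n) :=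
  ⟨Or.inr rfl, Or.inr rfl, _, _, formDom_dirichlet 1, formDom_dirichlet (-1), fun u g => by
    rw [lapD, dirichletOn, dirichletOn, upperHalf_eq, lowerHalf_eq]⟩

lemma isSplit_lapDN (n : ℕ) : IsSplit 1 (-1) (lapDN n) :=
  ⟨Or.inl rfl, Or.inr rfl, _, _, formDom_neumann 1, formDom_dirichlet (-1), fun u g => by
    rw [lapDN, neumannOn, dirichletOn, upperHalf_eq, lowerHalf_eq]⟩

lemma IsFormOperator.congr {ε σ : ℝ} {V : (E n → ℂ) → (Fin (n + 1) → E n → ℂ) → Prop}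
    (hV : FormDom ε σ V) {u u' g g' : E n → ℂ} (hu : u =ᵐ[volume.restrict (hs n ε)] u')
    (hg : g =ᵐ[volume.restrict (hs n ε)] g') (h : IsFormOperator (hs n ε) V u g) :
    IsFormOperator (hs n ε) V u' g' := by
  obtain ⟨h1, G, h2, h3⟩ := h
  refine ⟨h1.ae_eq hg, G, hV.congr hu h2, fun v Gv hv => ?_⟩
  rw [h3 v Gv hv]
  apply integral_congr_ae
  filter_upwards [hg] with x hx
  rw [hx]

lemma IsFormOperator.sub {ε σ : ℝ} {V : (E n → ℂ) → (Fin (n + 1) → E n → ℂ) → Prop}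
    (hV : FormDom ε σ V) {u u' g g' : E n → ℂ}
    (h : IsFormOperator (hs n ε) V u g) (h' : IsFormOperator (hs n ε) V u' g') :
    IsFormOperator (hs n ε) V (fun x => u x - u' x) (fun x => g x - g' x) := by
  obtain ⟨h1, G, h2, h3⟩ := h
  obtain ⟨h1', G', h2', h3'⟩ := h'
  refine ⟨h1.sub h1', _, hV.sub h2 h2', fun v Gv hv => ?_⟩
  have mv : MemLp (fun x => star (v x)) 2 (volume.restrict (hs n ε)) := (hV.memLp hv).star
  have mG : ∀ i, MemLp (fun x => star (Gv i x)) 2 (volume.restrict (hs n ε)) :=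
    fun i => (hV.memLp_grad hv i).star
  simp_rw [sub_mul]
  rw [integral_sub (integrable_mul_of_memLp h1 mv) (integrable_mul_of_memLp h1' mv),
    ← h3 v Gv hv, ← h3' v Gv hv, ← Finset.sum_sub_distrib]
  refine Finset.sum_congr rfl fun i _ => ?_
  exact integral_sub (integrable_mul_of_memLp (hV.memLp_grad h2 i) (mG i))
    (integrable_mul_of_memLp (hV.memLp_grad h2' i) (mG i))

/-- The form is tested with u itself. -/
lemma IsFormOperator.re_nonneg {ε σ : ℝ} {V : (E n → ℂ) → (Fin (n + 1) → E n → ℂ) → Prop}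
    (hV : FormDom ε σ V) {u g : E n → ℂ} (h : IsFormOperator (hs n ε) V u g) :
    0 ≤ ∫ x in hs n ε, (g x * star (u x)).re := by
  obtain ⟨h1, G, h2, h3⟩ := h
  have e := h3 u G h2
  have hi := integrable_mul_of_memLp h1 (hV.memLp h2).star
  have h4 : ∫ x in hs n ε, (g x * star (u x)).re = (∫ x in hs n ε, g x * star (u x)).re :=
    integral_re hi
  rw [h4, ← e, Complex.re_sum]
  refine Finset.sum_nonneg fun i _ => ?_
  have hG := hV.memLp_grad h2 i
  have hi := integrable_mul_of_memLp hG hG.star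
  have h5 : ∫ x in hs n ε, (G i x * star (G i x)).re
      = (∫ x in hs n ε, G i x * star (G i x)).re := integral_re hi
  rw [← h5]
  refine integral_nonneg fun x => ?_
  rw [RCLike.star_def, Complex.mul_conj]
  exact_mod_cast Complex.normSq_nonneg _

/-! ### The explicit kernels -/

lemma volume_hyperplane (n : ℕ) : volume {x : E n | lastCoord x = 0} = 0 := by
  set S : Submodule ℝ (E n) := LinearMap.ker (EuclideanSpace.proj (𝕜 := ℝ) (Fin.last n)).toLinearMap
  have h : {x : E n | lastCoord x = 0} = S := by
    ext x; simp [S, lastCoord]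
  rw [h]
  refine Measure.addHaar_submodule _ _ fun htop => ?_
  have : EuclideanSpace.single (Fin.last n) (1 : ℝ) ∈ S := by rw [htop]; trivial
  simp [S] at this

lemma ae_mem_hs (n : ℕ) : ∀ᵐ x : E n, x ∈ hs n 1 ∨ x ∈ hs n (-1) := by
  have h : ∀ᵐ x : E n, lastCoord x ≠ 0 := by
    rw [ae_iff]; simpa using volume_hyperplane n
  filter_upwards [h] with x hx
  rcases lt_or_gt_of_ne hx with h | h
  · right; simpa [hs] using h
  · left; simpa [hs] using h

lemma disjoint_hs : Disjoint (hs n 1) (hs n (-1)) := by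
  rw [Set.disjoint_left]
  intro x h1 h2
  simp only [hs, mem_ofPred_eq] at h1 h2
  linarith

/-- The heat kernel of a half space, obtained by reflection. -/
def hkern (ε σ t : ℝ) (x y : E n) : ℝ :=
  (hs n ε).indicator (fun _ => (hs n ε).indicator
    (fun y => gauss t (x - y) + σ * gauss t (x - refl n y)) y) x

/-- The heat kernel of a split operator. -/
def pk (a b t : ℝ) (x y : E n) : ℝ := hkern 1 a t x y + hkern (-1) b t x y

lemma mem_hs_neg_of_mem {ε : ℝ} {x : E n} (h : x ∈ hs n ε) : x ∉ hs n (-ε) := by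
  simp only [hs, mem_ofPred_eq] at *; linarith

lemma mul_lastCoord_pos {ε : ℝ} {x y : E n} (hx : x ∈ hs n ε) (hy : y ∈ hs n ε) :
    0 < lastCoord x * lastCoord y := by
  have hx' : 0 < ε * lastCoord x := hx
  have hy' : 0 < ε * lastCoord y := hy
  have := mul_pos hx' hy'
  have h2 : 0 < ε ^ 2 := by
    have : ε ≠ 0 := by rintro rfl; simp [hs] at hx
    positivity
  nlinarith

/-- On one side of the hyperplane the mirror image is farther away, so the reflected Gaussian is at
most the direct one. -/
lemma abs_hkern_le {ε σ t : ℝ} (hσ : |σ| ≤ 1) (ht : 0 < t) (x y : E n) :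
    |hkern ε σ t x y| ≤ 2 * gauss t (x - y) := by
  have hg := gauss_nonneg ht (x - y)
  unfold hkern
  by_cases hx : x ∈ hs n ε
  · by_cases hy : y ∈ hs n ε
    · rw [indicator_of_mem hx, indicator_of_mem hy]
      have h2 := gauss_nonneg ht (x - refl n y)
      have h1 : gauss t (x - refl n y) ≤ gauss t (x - y) :=
        gauss_le_of_norm_le ht (norm_sub_le_norm_sub_refl (mul_lastCoord_pos hx hy).le)
      calc _ ≤ |gauss t (x - y)| + |σ * gauss t (x - refl n y)| := abs_add_le _ _
        _ ≤ gauss t (x - y) + 1 * gauss t (x - refl n y) := by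
          rw [abs_of_nonneg hg, abs_mul, abs_of_nonneg h2]; gcongr
        _ ≤ _ := by linarith
    · rw [indicator_of_mem hx, indicator_of_notMem hy]; simpa using hg
  · rw [indicator_of_notMem hx]; simpa using hg

lemma pk_of_mem_up {a b t : ℝ} {x : E n} (hx : x ∈ hs n 1) (y : E n) :
    pk a b t x y = hkern 1 a t x y := by
  unfold pk hkern
  rw [indicator_of_notMem (mem_hs_neg_of_mem hx), add_zero]

lemma pk_of_mem_low {a b t : ℝ} {x : E n} (hx : x ∈ hs n (-1)) (y : E n) :
    pk a b t x y = hkern (-1) b t x y := by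
  unfold pk hkern
  rw [indicator_of_notMem (by simpa using mem_hs_neg_of_mem hx), zero_add]

lemma pk_of_notMem {a b t : ℝ} {x : E n} (h1 : x ∉ hs n 1) (h2 : x ∉ hs n (-1)) (y : E n) :
    pk a b t x y = 0 := by
  unfold pk hkern
  rw [indicator_of_notMem h1, indicator_of_notMem h2, zero_add]

lemma abs_pk_le {a b t : ℝ} (ha : |a| ≤ 1) (hb : |b| ≤ 1) (ht : 0 < t) (x y : E n) :
    |pk a b t x y| ≤ 2 * gauss t (x - y) := by
  by_cases h1 : x ∈ hs n 1
  · rw [pk_of_mem_up h1]; exact abs_hkern_le ha ht x y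
  · by_cases h2 : x ∈ hs n (-1)
    · rw [pk_of_mem_low h2]; exact abs_hkern_le hb ht x y
    · rw [pk_of_notMem h1 h2]; simpa using gauss_nonneg ht (x - y)

lemma measurable_hkern (ε σ t : ℝ) : Measurable (fun z : E n × E n => hkern ε σ t z.1 z.2) := by
  have e : (fun z : E n × E n => hkern ε σ t z.1 z.2) = (hs n ε ×ˢ hs n ε).indicator
      (fun z => gauss t (z.1 - z.2) + σ * gauss t (z.1 - refl n z.2)) := by
    ext ⟨x, y⟩
    unfold hkern
    by_cases hx : x ∈ hs n ε <;> by_cases hy : y ∈ hs n ε <;> simp [indicator, hx, hy]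
  rw [e]
  refine Measurable.indicator ?_ ((measurableSet_hs ε).prod (measurableSet_hs ε))
  refine Continuous.measurable ?_
  have := continuous_gauss (n := n) t
  have h2 := (refl n).continuous
  exact (this.comp (by fun_prop)).add (continuous_const.mul (this.comp (by fun_prop)))

lemma measurable_pk (a b t : ℝ) : Measurable (fun z : E n × E n => pk a b t z.1 z.2) :=
  (measurable_hkern 1 a t).add (measurable_hkern (-1) b t)

/-- The even or odd extension of the restriction of `f` to a half space. -/
def hext (ε σ : ℝ) (f : E n → ℂ) (x : E n) : ℂ :=
  (hs n ε).indicator f x + σ * (hs n ε).indicator f (refl n x)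

lemma hext_of_mem {ε σ : ℝ} {f : E n → ℂ} {x : E n} (hx : x ∈ hs n ε) : hext ε σ f x = f x := by
  have : refl n x ∉ hs n ε := by
    simp only [hs, mem_ofPred_eq, lastCoord_refl] at *; linarith
  simp [hext, indicator_of_mem hx, indicator_of_notMem this]

lemma hext_refl {ε σ : ℝ} (hσ : σ = 1 ∨ σ = -1) (f : E n → ℂ) (x : E n) :
    hext ε σ f (refl n x) = σ * hext ε σ f x := by
  have hσ2 : (σ : ℂ) * σ = 1 := by rcases hσ with rfl | rfl <;> norm_num
  unfold hext
  rw [refl_refl]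
  linear_combination -(hs n ε).indicator f (refl n x) * hσ2

lemma memLp_hext (ε σ : ℝ) {f : E n → ℂ} (hf : MemLp f 2) : MemLp (hext ε σ f) 2 := by
  have h := hf.indicator (measurableSet_hs (n := n) ε)
  exact h.add ((h.comp_measurePreserving measurePreserving_refl).const_mul _)

/-- The method of images: the substitution y ↦ Ry moves the reflected term of the kernel onto the
other half space, where the extension of f lives. -/
lemma integral_hkern_mul {ε σ t : ℝ} (ht : 0 < t) {f : E n → ℂ} (hf : MemLp f 2) {x : E n}
    (hx : x ∈ hs n ε) :
    ∫ y, (hkern ε σ t x y : ℂ) * f y = gconv (gauss t) (hext ε σ f) x := by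
  have h := hf.indicator (measurableSet_hs (n := n) ε)
  have hR := h.comp_measurePreserving measurePreserving_refl
  have i1 := (gaussBdd_gauss ht).integrable_mul h x
  have i2 : Integrable (fun y => (gauss t (x - y) : ℂ) * (hs n ε).indicator f (refl n y)) :=
    (gaussBdd_gauss ht).integrable_mul hR x
  have i3 : Integrable (fun y => (gauss t (x - refl n y) : ℂ) * (hs n ε).indicator f y) := by
    have := (measurePreserving_refl.integrable_comp_emb measurableEmbedding_refl).2 i2
    simpa [Function.comp_def] using this
  have e3 : ∫ y, (gauss t (x - refl n y) : ℂ) * (hs n ε).indicator f y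
      = ∫ y, (gauss t (x - y) : ℂ) * (hs n ε).indicator f (refl n y) := by
    rw [← measurePreserving_refl.integral_comp measurableEmbedding_refl]
    simp
  unfold gconv hext
  have e1 : ∀ y, (gauss t (x - y) : ℂ) * ((hs n ε).indicator f y
      + σ * (hs n ε).indicator f (refl n y))
      = (gauss t (x - y) : ℂ) * (hs n ε).indicator f y
        + σ * ((gauss t (x - y) : ℂ) * (hs n ε).indicator f (refl n y)) := fun y => by ring
  simp_rw [e1]
  rw [integral_add i1 (i2.const_mul _), integral_const_mul, ← e3, ← integral_const_mul,
    ← integral_add i1 (i3.const_mul _)]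
  congr 1; ext y
  unfold hkern
  rw [indicator_of_mem hx]
  by_cases hy : y ∈ hs n ε
  · rw [indicator_of_mem hy, indicator_of_mem hy]; push_cast; ring
  · rw [indicator_of_notMem hy, indicator_of_notMem hy]; simp

/-- Restriction to a half space of an element of `L²`. -/
def halfFun (ε : ℝ) (f : L2 n) : L2 n :=
  ((Lp.memLp f).indicator (measurableSet_hs ε)).toLp

lemma coe_halfFun (ε : ℝ) (f : L2 n) :
    halfFun ε f =ᵐ[volume] (hs n ε).indicator f := MemLp.coeFn_toLp _

lemma halfFun_add (ε : ℝ) (f g : L2 n) : halfFun ε (f + g) = halfFun ε f + halfFun ε g := by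
  apply Lp.ext
  filter_upwards [coe_halfFun ε (f + g), coe_halfFun ε f, coe_halfFun ε g, Lp.coeFn_add f g,
    Lp.coeFn_add (halfFun ε f) (halfFun ε g)] with x h1 h2 h3 h4 h5
  rw [h1, h5, Pi.add_apply, h2, h3]
  by_cases hx : x ∈ hs n ε
  · rw [indicator_of_mem hx, indicator_of_mem hx, indicator_of_mem hx, h4, Pi.add_apply]
  · rw [indicator_of_notMem hx, indicator_of_notMem hx, indicator_of_notMem hx, add_zero]

lemma halfFun_smul (ε c : ℝ) (f : L2 n) : halfFun ε (c • f) = c • halfFun ε f := by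
  apply Lp.ext
  filter_upwards [coe_halfFun ε (c • f), coe_halfFun ε f, Lp.coeFn_smul c f,
    Lp.coeFn_smul c (halfFun ε f)] with x h1 h2 h3 h4
  rw [h1, h4, Pi.smul_apply, h2]
  by_cases hx : x ∈ hs n ε
  · rw [indicator_of_mem hx, indicator_of_mem hx, h3, Pi.smul_apply]
  · rw [indicator_of_notMem hx, indicator_of_notMem hx, smul_zero]

lemma norm_halfFun_le (ε : ℝ) (f : L2 n) : ‖halfFun ε f‖ ≤ ‖f‖ := by
  unfold halfFun
  rw [Lp.norm_toLp, Lp.norm_def]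
  exact ENNReal.toReal_mono (Lp.eLpNorm_ne_top f) (eLpNorm_indicator_le f)

/-- Restriction to a half space as an operator of `L²`. -/
def halfProj (n : ℕ) (ε : ℝ) : L2 n →L[ℝ] L2 n :=
  LinearMap.mkContinuous
    { toFun := halfFun ε
      map_add' := halfFun_add ε
      map_smul' := halfFun_smul ε }
    1 (fun f => by rw [one_mul]; exact norm_halfFun_le ε f)

lemma coe_halfProj (ε : ℝ) (f : L2 n) :
    halfProj n ε f =ᵐ[volume] (hs n ε).indicator f := coe_halfFun ε f

lemma halfProj_ae_self (ε : ℝ) (f : L2 n) :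
    halfProj n ε f =ᵐ[volume.restrict (hs n ε)] f := by
  filter_upwards [ae_restrict_of_ae (coe_halfProj ε f), ae_restrict_mem (measurableSet_hs ε)]
    with x h1 h2
  rw [h1, indicator_of_mem h2]

lemma halfProj_ae_zero {ε δ : ℝ} (h : Disjoint (hs n ε) (hs n δ)) (f : L2 n) :
    halfProj n ε f =ᵐ[volume.restrict (hs n δ)] 0 := by
  filter_upwards [ae_restrict_of_ae (coe_halfProj ε f), ae_restrict_mem (measurableSet_hs δ)]
    with x h1 h2
  rw [h1, indicator_of_notMem (Set.disjoint_right.1 h h2)]; rfl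

/-- The glued heat flow. -/
def splitFlow (F G : L2 n) (t : ℝ) : L2 n :=
  halfProj n 1 (heatLp F t) + halfProj n (-1) (heatLp G t)

lemma glue_ae_up (F G : L2 n) :
    (↑↑(halfProj n 1 F + halfProj n (-1) G) : E n → ℂ) =ᵐ[volume.restrict (hs n 1)] F := by
  filter_upwards [ae_restrict_of_ae (Lp.coeFn_add (halfProj n 1 F) (halfProj n (-1) G)),
    halfProj_ae_self 1 F, halfProj_ae_zero disjoint_hs.symm G] with x h1 h2 h3
  rw [h1, Pi.add_apply, h2, h3, Pi.zero_apply, add_zero]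

lemma glue_ae_low (F G : L2 n) :
    (↑↑(halfProj n 1 F + halfProj n (-1) G) : E n → ℂ) =ᵐ[volume.restrict (hs n (-1))] G := by
  filter_upwards [ae_restrict_of_ae (Lp.coeFn_add (halfProj n 1 F) (halfProj n (-1) G)),
    halfProj_ae_self (-1) G, halfProj_ae_zero disjoint_hs F] with x h1 h2 h3
  rw [h1, Pi.add_apply, h2, h3, Pi.zero_apply, zero_add]

lemma ae_of_ae_restrict_hs {p : E n → Prop} (h1 : ∀ᵐ x ∂volume.restrict (hs n 1), p x)
    (h2 : ∀ᵐ x ∂volume.restrict (hs n (-1)), p x) : ∀ᵐ x, p x := by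
  rw [ae_restrict_iff' (measurableSet_hs _)] at h1 h2
  filter_upwards [h1, h2, ae_mem_hs n] with x a b c
  exact c.elim a b

lemma gconv_congr_ae {k : E n → ℝ} {F G : E n → ℂ} (h : F =ᵐ[volume] G) : gconv k F = gconv k G := by
  ext x
  apply integral_congr_ae
  filter_upwards [h] with y hy
  rw [hy]

/-- The flow is glued from two flows of the whole space, started at the extensions of f from either
side and restricted to that side. Restriction is a bounded operator, so continuity and the
derivative in L² carry over, and `FormDom.heat` supplies the equation on each half. -/
theorem isHeatKernel_pk {a b : ℝ} {L : (E n → ℂ) → (E n → ℂ) → Prop} (hL : IsSplit a b L) :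
    IsHeatKernel L (pk a b) := by
  have ha : |a| ≤ 1 := by rcases hL.sign_up with rfl | rfl <;> simp
  have hb : |b| ≤ 1 := by rcases hL.sign_low with rfl | rfl <;> simp
  refine ⟨fun t _ => measurable_pk a b t, ⟨2 * (4 * Real.pi) ^ (-(((n : ℝ) + 1) / 2)), 1 / 4,
    by positivity, by norm_num, fun t ht x y => ?_⟩, fun f => ?_⟩
  · refine (abs_pk_le ha hb ht x y).trans (le_of_eq ?_)
    unfold gauss
    rw [Real.mul_rpow (by positivity) ht.le, Real.rpow_neg ht.le]
    rw [show -(‖x - y‖ ^ 2 / (4 * t)) = -(1 / 4 * ‖x - y‖ ^ 2 / t) by ring]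
    ring
  obtain ⟨V₁, V₂, hV₁, hV₂, hiff⟩ := hL.exists_dom
  set F : L2 n := (memLp_hext 1 a (Lp.memLp f)).toLp with hF
  set G : L2 n := (memLp_hext (-1) b (Lp.memLp f)).toLp with hG
  have cF : F =ᵐ[volume] hext 1 a f := MemLp.coeFn_toLp _
  have cG : G =ᵐ[volume] hext (-1) b f := MemLp.coeFn_toLp _
  have sym : ∀ {σ ε : ℝ} (_ : σ = 1 ∨ σ = -1) {F : L2 n}, F =ᵐ[volume] hext ε σ f →
      ∀ᵐ y, F (refl n y) = σ * F y := by
    intro σ ε hσ F hF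
    filter_upwards [hF, measurePreserving_refl.quasiMeasurePreserving.ae hF] with y h1 h2
    rw [h1, h2, hext_refl hσ]
  refine ⟨splitFlow F G, ⟨?_, ?_, fun t ht => ?_⟩, fun t ht => ?_⟩
  · exact ((halfProj n 1).continuous.comp_continuousOn (continuousOn_heatLp F)).add
      ((halfProj n (-1)).continuous.comp_continuousOn (continuousOn_heatLp G))
  · apply Lp.ext
    unfold splitFlow
    rw [heatLp_zero, heatLp_zero]
    refine ae_of_ae_restrict_hs ?_ ?_
    · filter_upwards [glue_ae_up F G, ae_restrict_of_ae cF, ae_restrict_mem (measurableSet_hs 1)]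
        with x h1 h2 h3
      rw [h1, h2, hext_of_mem h3]
    · filter_upwards [glue_ae_low F G, ae_restrict_of_ae cG, ae_restrict_mem (measurableSet_hs (-1))]
        with x h1 h2 h3
      rw [h1, h2, hext_of_mem h3]
  · set dF := gconvLp (gaussBdd_dgauss ht) F
    set dG := gconvLp (gaussBdd_dgauss ht) G
    refine ⟨-(halfProj n 1 dF + halfProj n (-1) dG), ?_, ?_⟩
    · rw [hiff]
      unfold splitFlow
      rw [heatLp_of_pos F ht, heatLp_of_pos G ht]
      constructor
      · refine (hV₁.heat ht F.measurable (Lp.memLp F) (sym hL.sign_up cF)).congr hV₁ ?_ ?_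
        · exact ((glue_ae_up _ _).trans (ae_restrict_of_ae (coe_gconvLp _ F))).symm
        · filter_upwards [ae_restrict_of_ae (Lp.coeFn_neg (halfProj n 1 dF + halfProj n (-1) dG)),
            glue_ae_up dF dG, ae_restrict_of_ae (coe_gconvLp (gaussBdd_dgauss ht) F)]
            with x h1 h2 h3
          rw [h1, Pi.neg_apply, h2, h3]
      · refine (hV₂.heat ht G.measurable (Lp.memLp G) (sym hL.sign_low cG)).congr hV₂ ?_ ?_
        · exact ((glue_ae_low _ _).trans (ae_restrict_of_ae (coe_gconvLp _ G))).symm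
        · filter_upwards [ae_restrict_of_ae (Lp.coeFn_neg (halfProj n 1 dF + halfProj n (-1) dG)),
            glue_ae_low dF dG, ae_restrict_of_ae (coe_gconvLp (gaussBdd_dgauss ht) G)]
            with x h1 h2 h3
          rw [h1, Pi.neg_apply, h2, h3]
    · rw [neg_neg]
      exact ((halfProj n 1).hasFDerivAt.comp_hasDerivAt t (hasDerivAt_heatLp F ht)).add
        ((halfProj n (-1)).hasFDerivAt.comp_hasDerivAt t (hasDerivAt_heatLp G ht))
  · unfold splitFlow
    rw [heatLp_of_pos F ht, heatLp_of_pos G ht]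
    refine ae_of_ae_restrict_hs ?_ ?_
    · filter_upwards [glue_ae_up (gconvLp (gaussBdd_gauss ht) F) (gconvLp (gaussBdd_gauss ht) G),
        ae_restrict_of_ae (coe_gconvLp (gaussBdd_gauss ht) F), ae_restrict_mem (measurableSet_hs 1)]
        with x h1 h2 h3
      rw [h1, h2, gconv_congr_ae cF, ← integral_hkern_mul ht (Lp.memLp f) h3]
      simp only [kernelApply, pk_of_mem_up h3]
    · filter_upwards [glue_ae_low (gconvLp (gaussBdd_gauss ht) F) (gconvLp (gaussBdd_gauss ht) G),
        ae_restrict_of_ae (coe_gconvLp (gaussBdd_gauss ht) G),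
        ae_restrict_mem (measurableSet_hs (-1))] with x h1 h2 h3
      rw [h1, h2, gconv_congr_ae cG, ← integral_hkern_mul ht (Lp.memLp f) h3]
      simp only [kernelApply, pk_of_mem_low h3]

/-! ### Uniqueness of the heat flow -/

/-- Positivity of the forms on the two sides is added up, the hyperplane being a null set. Taking
differences here avoids treating L as a linear map. -/
lemma IsSplit.re_inner_nonneg {a b : ℝ} {L : (E n → ℂ) → (E n → ℂ) → Prop} (hL : IsSplit a b L)
    {u u' g g' : L2 n} (h : L u g) (h' : L u' g') : 0 ≤ inner ℝ (u - u') (g - g') := by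
  obtain ⟨V₁, V₂, hV₁, hV₂, hiff⟩ := hL.exists_dom
  rw [hiff] at h h'
  have p1 := (h.1.sub hV₁ h'.1).re_nonneg hV₁
  have p2 := (h.2.sub hV₂ h'.2).re_nonneg hV₂
  rw [L2.inner_def]
  have e : ∫ x, inner ℝ ((u - u' : L2 n) x) ((g - g' : L2 n) x)
      = ∫ x, ((g x - g' x) * star (u x - u' x)).re := by
    apply integral_congr_ae
    filter_upwards [Lp.coeFn_sub u u', Lp.coeFn_sub g g'] with x h1 h2
    rw [h1, h2, Pi.sub_apply, Pi.sub_apply]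
    rfl
  rw [e]
  have mu : MemLp (fun x => star (u x - u' x)) 2 volume :=
    ((Lp.memLp u).sub (Lp.memLp u')).star
  have mg : MemLp (fun x => g x - g' x) 2 volume := (Lp.memLp g).sub (Lp.memLp g')
  have hi : Integrable (fun x => ((g x - g' x) * star (u x - u' x)).re) :=
    (integrable_mul_of_memLp mg mu).re
  generalize (fun x => ((g x - g' x) * star (u x - u' x)).re) = φ at p1 p2 hi ⊢
  have hr : (volume : Measure (E n)).restrict (hs n 1 ∪ hs n (-1)) = volume := by
    rw [Measure.restrict_eq_self_of_ae_mem]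
    filter_upwards [ae_mem_hs n] with x hx using hx
  have h3 : ∫ x in hs n 1 ∪ hs n (-1), φ x = ∫ x, φ x := by rw [hr]
  rw [← h3, setIntegral_union disjoint_hs (measurableSet_hs _) hi.integrableOn hi.integrableOn]
  exact add_nonneg p1 p2

/-- Energy argument: ‖u - v‖² starts at 0 and has derivative -2⟨u - v, Lu - Lv⟩ ≤ 0. -/
lemma IsHeatFlow.unique {a b : ℝ} {L : (E n → ℂ) → (E n → ℂ) → Prop} (hL : IsSplit a b L)
    {f : L2 n} {u v : ℝ → L2 n} (hu : IsHeatFlow L f u) (hv : IsHeatFlow L f v) {t : ℝ}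
    (ht : 0 < t) : u t = v t := by
  have hd : ∀ s : ℝ, 0 < s → ∃ d ≤ 0, HasDerivAt (fun s => ‖u s - v s‖ ^ 2) d s := by
    intro s hs
    obtain ⟨g, hg1, hg2⟩ := hu.2.2 s hs
    obtain ⟨g', hg1', hg2'⟩ := hv.2.2 s hs
    have h1 := (hg2.sub hg2').norm_sq
    refine ⟨_, ?_, h1⟩
    have h2 := hL.re_inner_nonneg hg1 hg1'
    have e : (-g - -g' : L2 n) = -(g - g') := by abel
    simp only [Pi.sub_apply]
    rw [e, inner_neg_right]
    linarith
  have hanti : AntitoneOn (fun s => ‖u s - v s‖ ^ 2) (Ici 0) := by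
    refine antitoneOn_of_deriv_nonpos (convex_Ici 0) ((hu.1.sub hv.1).norm.pow 2) ?_ ?_
    · intro s hs
      rw [interior_Ici] at hs
      obtain ⟨d, _, h⟩ := hd s hs
      exact h.differentiableAt.differentiableWithinAt
    · intro s hs
      rw [interior_Ici] at hs
      obtain ⟨d, h0, h⟩ := hd s hs
      rw [h.deriv]; exact h0
  have h := hanti (mem_Ici.2 le_rfl) (mem_Ici.2 ht.le) ht.le
  simp only [hu.2.1, hv.2.1, sub_self, norm_zero] at h
  have h2 : ‖u t - v t‖ ^ 2 = 0 := le_antisymm (by simpa using h) (by positivity)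
  exact sub_eq_zero.1 (norm_eq_zero.1 (pow_eq_zero_iff two_ne_zero |>.1 h2))

end SplitBMO

end

/-! ### Gaussian means and the functions on which the kernels act. -/

noncomputable section

namespace SplitBMO

variable {n : ℕ}

/-! ### Gaussian means of nonnegative functions -/

/-- The Gaussian mean of a nonnegative function. -/
def gmean (t : ℝ) (φ : E n → ℝ≥0∞) (x : E n) : ℝ≥0∞ :=
  ∫⁻ y, ENNReal.ofReal (gauss t (x - y)) * φ y

lemma measurable_ofReal_gauss (t : ℝ) (x : E n) :
    Measurable (fun y => ENNReal.ofReal (gauss t (x - y))) := by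
  have := (continuous_gauss (n := n) t).comp (continuous_const.sub continuous_id : Continuous (fun y => x - y))
  exact this.measurable.ennreal_ofReal

lemma gmean_mono {t : ℝ} {φ ψ : E n → ℝ≥0∞} (h : ∀ y, φ y ≤ ψ y) (x : E n) :
    gmean t φ x ≤ gmean t ψ x :=
  lintegral_mono fun y => by gcongr; exact h y

lemma gmean_congr_ae {t : ℝ} {φ ψ : E n → ℝ≥0∞} (h : φ =ᵐ[volume] ψ) (x : E n) :
    gmean t φ x = gmean t ψ x := by
  apply lintegral_congr_ae
  filter_upwards [h] with y hy
  rw [hy]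

lemma gmean_add {t : ℝ} {φ ψ : E n → ℝ≥0∞} (hφ : AEMeasurable φ) (x : E n) :
    gmean t (fun y => φ y + ψ y) x = gmean t φ x + gmean t ψ x := by
  unfold gmean
  simp_rw [mul_add]
  exact lintegral_add_left' ((measurable_ofReal_gauss t x).aemeasurable.mul hφ) _

lemma gmean_const_mul {t : ℝ} {c : ℝ≥0∞} (hc : c ≠ ⊤) (φ : E n → ℝ≥0∞) (x : E n) :
    gmean t (fun y => c * φ y) x = c * gmean t φ x := by
  unfold gmean
  rw [← lintegral_const_mul' _ _ hc]
  congr 1; ext y; ring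

lemma gmean_const {t : ℝ} (ht : 0 < t) (c : ℝ≥0∞) (x : E n) : gmean t (fun _ => c) x = c := by
  unfold gmean
  rw [lintegral_mul_const _ (measurable_ofReal_gauss t x),
    lintegral_sub_left_eq_self (fun z => ENNReal.ofReal (gauss t z)) x, lintegral_gauss ht, one_mul]

lemma measurable_gauss_prod (t : ℝ) :
    Measurable (fun p : E n × E n => ENNReal.ofReal (gauss t (p.1 - p.2))) := by
  have := (continuous_gauss (n := n) t).comp (continuous_fst.sub continuous_snd)
  exact this.measurable.ennreal_ofReal

lemma lintegral_gauss_mul_gauss {s t : ℝ} (hs : 0 < s) (ht : 0 < t) (x z : E n) :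
    ∫⁻ y, ENNReal.ofReal (gauss s (x - y)) * ENNReal.ofReal (gauss t (y - z))
      = ENNReal.ofReal (gauss (s + t) (x - z)) := by
  have h0 : ∀ y : E n, 0 ≤ gauss s (x - y) * gauss t (y - z) := fun y =>
    mul_nonneg (gauss_nonneg hs _) (gauss_nonneg ht _)
  have hi : Integrable (fun y : E n => gauss s (x - y) * gauss t (y - z)) := by
    by_contra h
    have h1 := gauss_semigroup_sub hs ht x z
    rw [integral_undef h] at h1
    exact (gauss_pos (add_pos hs ht) (x - z)).ne h1
  rw [← gauss_semigroup_sub hs ht x z,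
    ofReal_integral_eq_lintegral_ofReal hi (Filter.Eventually.of_forall h0)]
  congr 1; ext y
  rw [ENNReal.ofReal_mul (gauss_nonneg hs _)]

lemma measurable_ofReal_gauss_right (t : ℝ) (z : E n) :
    Measurable (fun y => ENNReal.ofReal (gauss t (y - z))) := by
  have := (continuous_gauss (n := n) t).comp (continuous_id.sub continuous_const : Continuous (fun y => y - z))
  exact this.measurable.ennreal_ofReal

lemma measurable_gauss_mul_gauss (s t : ℝ) (x : E n) {φ : E n → ℝ≥0∞} (hφ : Measurable φ) :
    Measurable (Function.uncurry fun y z : E n => ENNReal.ofReal (gauss s (x - y)) *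
      (ENNReal.ofReal (gauss t (y - z)) * φ z)) :=
  Measurable.mul ((measurable_ofReal_gauss s x).comp measurable_fst)
    (Measurable.mul (measurable_gauss_prod t) (hφ.comp measurable_snd))

lemma gmean_gmean_of_measurable {s t : ℝ} (hs : 0 < s) (ht : 0 < t) {φ : E n → ℝ≥0∞}
    (hφ : Measurable φ) (x : E n) : gmean s (gmean t φ) x = gmean (s + t) φ x := by
  have h1 : gmean s (gmean t φ) x = ∫⁻ y, ∫⁻ z, ENNReal.ofReal (gauss s (x - y)) *
      (ENNReal.ofReal (gauss t (y - z)) * φ z) := by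
    unfold gmean
    refine lintegral_congr fun y => ?_
    rw [lintegral_const_mul' _ _ ENNReal.ofReal_ne_top]
  have h2 : ∀ z : E n, ∫⁻ y, ENNReal.ofReal (gauss s (x - y)) *
      (ENNReal.ofReal (gauss t (y - z)) * φ z) = ENNReal.ofReal (gauss (s + t) (x - z)) * φ z := by
    intro z
    have hm : Measurable (fun y : E n => ENNReal.ofReal (gauss s (x - y)) *
        ENNReal.ofReal (gauss t (y - z))) :=
      (measurable_ofReal_gauss s x).mul (measurable_ofReal_gauss_right t z)
    rw [← lintegral_gauss_mul_gauss hs ht x z, ← lintegral_mul_const _ hm]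
    exact lintegral_congr fun y => (mul_assoc _ _ _).symm
  rw [h1, lintegral_lintegral_swap (measurable_gauss_mul_gauss s t x hφ).aemeasurable]
  exact lintegral_congr h2

lemma gmean_gmean {s t : ℝ} (hs : 0 < s) (ht : 0 < t) {φ : E n → ℝ≥0∞} (hφ : AEMeasurable φ)
    (x : E n) : gmean s (gmean t φ) x = gmean (s + t) φ x := by
  have e : ∀ r x, gmean r φ x = gmean r (hφ.mk φ) x := fun r x => gmean_congr_ae hφ.ae_eq_mk x
  rw [e (s + t) x, show gmean t φ = gmean t (hφ.mk φ) from funext (e t)]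
  exact gmean_gmean_of_measurable hs ht hφ.measurable_mk x

/-- The constant in the comparison of Gaussians at nearby points. -/
def shiftConst (n : ℕ) : ℝ := Real.exp (1 / 4) * 2 ^ (((n : ℝ) + 1) / 2)

lemma shiftConst_pos (n : ℕ) : 0 < shiftConst n := by unfold shiftConst; positivity

/-- Ball averages of a nonnegative function. -/
def ballAvg (r : ℝ) (φ : E n → ℝ≥0∞) (z : E n) : ℝ≥0∞ :=
  (volume (Metric.ball (0 : E n) r))⁻¹ * ∫⁻ y in Metric.ball z r, φ y

lemma volume_ball_eq (z : E n) (r : ℝ) :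
    volume (Metric.ball z r) = volume (Metric.ball (0 : E n) r) :=
  Measure.addHaar_ball_center _ _ _

/-- The value g_t(x - y) is at most a constant times the average of g_{2t}(x - z) over z in B(y, r),
by `gauss_shift`. Tonelli moves this averaging onto φ. -/
lemma gmean_le_ballAvg {t r : ℝ} (ht : 0 < t) (hr : 0 < r) (hrt : r ^ 2 ≤ t) {φ : E n → ℝ≥0∞}
    (hφ : AEMeasurable φ) (x : E n) :
    gmean t φ x ≤ ENNReal.ofReal (shiftConst n) * gmean (2 * t) (ballAvg r φ) x := by
  have e : gmean t φ x = gmean t (hφ.mk φ) x := gmean_congr_ae hφ.ae_eq_mk x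
  have e' : ballAvg r φ = ballAvg r (hφ.mk φ) := by
    ext z; unfold ballAvg
    rw [setLIntegral_congr_fun_ae Metric.isOpen_ball.measurableSet]
    filter_upwards [hφ.ae_eq_mk] with y hy _ using hy
  rw [e, e']
  have hm := hφ.measurable_mk
  set ψ := hφ.mk φ
  set V := volume (Metric.ball (0 : E n) r) with hV
  have hV0 : V ≠ 0 := (Metric.measure_ball_pos volume _ hr).ne'
  have hVt : V ≠ ⊤ := measure_ball_lt_top.ne
  have hms : MeasurableSet {p : E n × E n | dist p.2 p.1 < r} :=
    measurableSet_lt (measurable_snd.dist measurable_fst) measurable_const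
  set χ : E n × E n → ℝ≥0∞ := {p : E n × E n | dist p.2 p.1 < r}.indicator 1 with hχ
  have hχm : Measurable χ := measurable_one.indicator hms
  have h1 : gmean (2 * t) (ballAvg r ψ) x
      = V⁻¹ * ∫⁻ y, ψ y * ∫⁻ z in Metric.ball y r, ENNReal.ofReal (gauss (2 * t) (x - z)) := by
    unfold gmean ballAvg
    calc _ = V⁻¹ * ∫⁻ z, ∫⁻ y, ENNReal.ofReal (gauss (2 * t) (x - z)) * (χ (z, y) * ψ y) := by
          rw [← lintegral_const_mul' _ _ (ENNReal.inv_ne_top.2 hV0)]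
          congr 1; ext z
          rw [lintegral_const_mul' _ _ ENNReal.ofReal_ne_top,
            ← lintegral_indicator Metric.isOpen_ball.measurableSet]
          rw [mul_left_comm]
          congr 3; ext y
          by_cases hy : dist y z < r <;> simp [χ, indicator, hy]
      _ = V⁻¹ * ∫⁻ y, ∫⁻ z, ENNReal.ofReal (gauss (2 * t) (x - z)) * (χ (z, y) * ψ y) := by
          congr 1
          apply lintegral_lintegral_swap
          apply Measurable.aemeasurable
          exact ((measurable_ofReal_gauss _ x).comp measurable_fst).mul
            (hχm.mul (hm.comp measurable_snd))
      _ = _ := by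
          congr 2; ext y
          rw [← lintegral_indicator Metric.isOpen_ball.measurableSet, ← lintegral_const_mul]
          · congr 1; ext z
            by_cases hy : dist y z < r
            · have hy' : dist z y < r := by rwa [dist_comm]
              simp [χ, indicator, hy, hy', mul_comm]
            · have hy' : ¬ dist z y < r := by rwa [dist_comm]
              simp [χ, indicator, hy, hy']
          · exact (measurable_ofReal_gauss _ x).indicator Metric.isOpen_ball.measurableSet
  rw [h1]
  have h2 : ∀ y : E n, ENNReal.ofReal (gauss t (x - y)) ≤ ENNReal.ofReal (shiftConst n) *
      (V⁻¹ * ∫⁻ z in Metric.ball y r, ENNReal.ofReal (gauss (2 * t) (x - z))) := by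
    intro y
    have h3 : ∫⁻ z in Metric.ball y r, ENNReal.ofReal (gauss t (x - y))
        ≤ ∫⁻ z in Metric.ball y r,
          ENNReal.ofReal (shiftConst n) * ENNReal.ofReal (gauss (2 * t) (x - z)) := by
      refine setLIntegral_mono ((measurable_ofReal_gauss _ x).const_mul _) fun z hz => ?_
      rw [← ENNReal.ofReal_mul (shiftConst_pos n).le]
      refine ENNReal.ofReal_le_ofReal (gauss_shift ht ?_)
      refine le_trans ?_ hrt
      have h4 : ‖x - y - (x - z)‖ = dist z y := by rw [dist_eq_norm]; congr 1; abel
      rw [h4]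
      have h5 : dist z y < r := hz
      gcongr
    rw [setLIntegral_const, lintegral_const_mul' _ _ ENNReal.ofReal_ne_top, volume_ball_eq] at h3
    calc ENNReal.ofReal (gauss t (x - y))
        = V⁻¹ * (ENNReal.ofReal (gauss t (x - y)) * V) := by
          rw [mul_comm _ V, ← mul_assoc, ENNReal.inv_mul_cancel hV0 hVt, one_mul]
      _ ≤ V⁻¹ * (ENNReal.ofReal (shiftConst n) *
          ∫⁻ z in Metric.ball y r, ENNReal.ofReal (gauss (2 * t) (x - z))) := by gcongr
      _ = _ := by ring
  unfold gmean
  rw [← lintegral_const_mul' _ _ (ENNReal.inv_ne_top.2 hV0),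
    ← lintegral_const_mul' _ _ ENNReal.ofReal_ne_top]
  refine lintegral_mono fun y => ?_
  calc _ ≤ (ENNReal.ofReal (shiftConst n) *
      (V⁻¹ * ∫⁻ z in Metric.ball y r, ENNReal.ofReal (gauss (2 * t) (x - z)))) * ψ y := by
        gcongr; exact h2 y
    _ = _ := by ring

/-- With u = ‖x - z‖/√t, the inequality u^m ≤ 1 + u^(2m) reduces every moment to an even one. -/
lemma gmean_norm_pow (n m : ℕ) : ∃ C : ℝ, 0 < C ∧ ∀ t : ℝ, 0 < t → ∀ x : E n,
    gmean t (fun z => ENNReal.ofReal (‖z - x‖ ^ m)) x ≤ ENNReal.ofReal (C * √t ^ m) := by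
  obtain ⟨C, hC, h⟩ := gauss_moment n m
  refine ⟨1 + C, by positivity, fun t ht x => ?_⟩
  have hst : 0 < √t := Real.sqrt_pos.2 ht
  have key : ∀ z : E n, gauss t (x - z) * ‖z - x‖ ^ m
      ≤ √t ^ m * gauss t (x - z) + √t ^ m * C * gauss (2 * t) (x - z) := by
    intro z
    have h1 := h t ht (x - z)
    have hg := gauss_nonneg ht (x - z)
    set u := ‖x - z‖ / √t with hu
    have hu0 : 0 ≤ u := by positivity
    have h2 : ‖z - x‖ = √t * u := by rw [hu, norm_sub_rev]; field_simp
    have h3 : ‖x - z‖ ^ 2 / t = u ^ 2 := by rw [hu, div_pow, Real.sq_sqrt ht.le]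
    rw [h3] at h1
    have h4 : u ^ m ≤ 1 + (u ^ 2) ^ m := by
      rw [← pow_mul, mul_comm, pow_mul]
      nlinarith [sq_nonneg (u ^ m - 1), pow_nonneg hu0 m]
    rw [h2, mul_pow]
    have h5 : √t ^ m * (u ^ m * gauss t (x - z)) ≤
        √t ^ m * (gauss t (x - z) + C * gauss (2 * t) (x - z)) := by
      gcongr
      nlinarith
    nlinarith
  calc _ ≤ ∫⁻ z, (ENNReal.ofReal (√t ^ m) * ENNReal.ofReal (gauss t (x - z))
        + ENNReal.ofReal (√t ^ m * C) * ENNReal.ofReal (gauss (2 * t) (x - z))) := by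
        refine lintegral_mono fun z => ?_
        rw [← ENNReal.ofReal_mul (gauss_nonneg ht _), ← ENNReal.ofReal_mul (by positivity),
          ← ENNReal.ofReal_mul (by positivity), ← ENNReal.ofReal_add]
        · exact ENNReal.ofReal_le_ofReal (key z)
        · have := gauss_nonneg ht (x - z); positivity
        · have := gauss_nonneg (t := 2 * t) (by positivity) (x - z); positivity
    _ = _ := by
        rw [lintegral_add_left ((measurable_ofReal_gauss _ x).const_mul _),
          lintegral_const_mul' _ _ ENNReal.ofReal_ne_top,
          lintegral_const_mul' _ _ ENNReal.ofReal_ne_top]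
        have e : ∀ s : ℝ, 0 < s → ∫⁻ z, ENNReal.ofReal (gauss s (x - z)) = 1 := fun s hs => by
          rw [lintegral_sub_left_eq_self (fun z => ENNReal.ofReal (gauss s z)) x, lintegral_gauss hs]
        rw [e t ht, e (2 * t) (by positivity), mul_one, mul_one,
          ← ENNReal.ofReal_add (by positivity) (by positivity)]
        congr 1; ring

lemma gmean_norm_sub (n : ℕ) : ∃ C : ℝ, 0 < C ∧ ∀ t : ℝ, 0 < t → ∀ x y : E n,
    gmean t (fun z => ENNReal.ofReal ‖z - y‖) x ≤ ENNReal.ofReal (‖x - y‖ + C * √t) := by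
  obtain ⟨C, hC, h⟩ := gmean_norm_pow n 1
  simp only [pow_one] at h
  refine ⟨C, hC, fun t ht x y => ?_⟩
  calc _ ≤ gmean t (fun z => ENNReal.ofReal ‖x - y‖ + ENNReal.ofReal ‖z - x‖) x := by
        refine gmean_mono (fun z => ?_) x
        rw [← ENNReal.ofReal_add (norm_nonneg _) (norm_nonneg _)]
        refine ENNReal.ofReal_le_ofReal ?_
        have : z - y = (x - y) + (z - x) := by abel
        rw [this]; exact norm_add_le _ _
    _ = ENNReal.ofReal ‖x - y‖ + gmean t (fun z => ENNReal.ofReal ‖z - x‖) x := by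
        rw [gmean_add aemeasurable_const, gmean_const ht]
    _ ≤ _ := by
        rw [ENNReal.ofReal_add (norm_nonneg _) (by positivity)]
        gcongr; exact h t ht x

lemma gmean_poly_lt_top {t : ℝ} (ht : 0 < t) (m : ℕ) (x : E n) :
    gmean t (fun z => ENNReal.ofReal ((1 + ‖z‖) ^ m)) x < ⊤ := by
  obtain ⟨C, hC, h⟩ := gmean_norm_pow n m
  have h1 : ∀ z : E n, ENNReal.ofReal ((1 + ‖z‖) ^ m) ≤
      ENNReal.ofReal (2 ^ (m - 1) * (1 + ‖x‖) ^ m) +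
        ENNReal.ofReal (2 ^ (m - 1)) * ENNReal.ofReal (‖z - x‖ ^ m) := by
    intro z
    rw [← ENNReal.ofReal_mul (by positivity), ← ENNReal.ofReal_add (by positivity) (by positivity)]
    refine ENNReal.ofReal_le_ofReal ?_
    rw [← mul_add]
    refine le_trans ?_ (add_pow_le (by positivity) (by positivity) m)
    refine pow_le_pow_left₀ (by positivity) ?_ m
    have : z = x + (z - x) := by abel
    have h2 : ‖z‖ ≤ ‖x‖ + ‖z - x‖ := by
      conv_lhs => rw [this]
      exact norm_add_le _ _
    linarith
  refine (gmean_mono h1 x).trans_lt ?_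
  rw [gmean_add aemeasurable_const, gmean_const ht, gmean_const_mul ENNReal.ofReal_ne_top]
  refine ENNReal.add_lt_top.2 ⟨ENNReal.ofReal_lt_top, ENNReal.mul_lt_top ENNReal.ofReal_lt_top ?_⟩
  exact (h t ht x).trans_lt ENNReal.ofReal_lt_top

/-! ### Gaussian integrable functions -/

/-- Functions which are integrable against all Gaussians. -/
structure GInt (f : E n → ℂ) : Prop where
  aesm : AEStronglyMeasurable f volume
  lt_top : ∀ t : ℝ, 0 < t → ∀ x, gmean t (fun y => ‖f y‖ₑ) x < ⊤

/-- With the weight w = 1 + ‖y‖^p one has |f| ≤ |f|²/w + w. The first term is integrable and meets a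
bounded Gaussian, the second grows polynomially. -/
lemma gint_of_mem_classM {f : E n → ℂ} (hf : f ∈ classM n) : GInt f := by
  obtain ⟨hl, d, hd, hi⟩ := hf
  refine ⟨hl.aestronglyMeasurable, fun t ht x => ?_⟩
  set p : ℝ := (n : ℝ) + 1 + d
  have hp : 0 < p := by positivity
  set m := ⌈p⌉₊
  have hw : ∀ y : E n, 1 + ‖y‖ ^ p ≤ 2 * (1 + ‖y‖) ^ m := by
    intro y
    have h1 : (1 : ℝ) ≤ (1 + ‖y‖) ^ m := one_le_pow₀ (by linarith [norm_nonneg y])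
    have h2 : ‖y‖ ^ p ≤ (1 + ‖y‖) ^ m := by
      calc ‖y‖ ^ p ≤ (1 + ‖y‖) ^ p := by gcongr; linarith
        _ ≤ (1 + ‖y‖) ^ (m : ℝ) :=
          Real.rpow_le_rpow_of_exponent_le (by linarith [norm_nonneg y]) (Nat.le_ceil _)
        _ = _ := Real.rpow_natCast _ _
    linarith
  set M := (4 * Real.pi * t) ^ (-(((n : ℝ) + 1) / 2))
  have key : ∀ y, ENNReal.ofReal (gauss t (x - y)) * ‖f y‖ₑ ≤
      ENNReal.ofReal M * ‖‖f y‖ ^ 2 / (1 + ‖y‖ ^ p)‖ₑ +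
        ENNReal.ofReal (gauss t (x - y)) * (ENNReal.ofReal 2 * ENNReal.ofReal ((1 + ‖y‖) ^ m)) := by
    intro y
    set w := 1 + ‖y‖ ^ p
    have hw0 : 0 < w := by positivity
    have h1 : ‖f y‖ ≤ ‖f y‖ ^ 2 / w + w := by
      rw [div_add' _ _ _ hw0.ne', le_div_iff₀ hw0]
      nlinarith [sq_nonneg (‖f y‖ - w), norm_nonneg (f y)]
    have h2 : ‖f y‖ₑ ≤ ‖‖f y‖ ^ 2 / w‖ₑ + ENNReal.ofReal 2 * ENNReal.ofReal ((1 + ‖y‖) ^ m) := by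
      rw [← ENNReal.ofReal_mul (by norm_num), ← ofReal_norm, ← ofReal_norm,
        Real.norm_of_nonneg (by positivity), ← ENNReal.ofReal_add (by positivity) (by positivity)]
      refine ENNReal.ofReal_le_ofReal ?_
      linarith [hw y]
    calc _ ≤ ENNReal.ofReal (gauss t (x - y)) *
        (‖‖f y‖ ^ 2 / w‖ₑ + ENNReal.ofReal 2 * ENNReal.ofReal ((1 + ‖y‖) ^ m)) := by gcongr
      _ ≤ _ := by
        rw [mul_add]
        gcongr
        exact gauss_le_const t ht _
  refine (lintegral_mono key).trans_lt ?_
  have e := gmean_const_mul (t := t) (c := ENNReal.ofReal 2) ENNReal.ofReal_ne_top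
    (fun y : E n => ENNReal.ofReal ((1 + ‖y‖) ^ m)) x
  unfold gmean at e
  rw [lintegral_add_left' (hi.aestronglyMeasurable.enorm.const_mul _),
    lintegral_const_mul' _ _ ENNReal.ofReal_ne_top, e]
  refine ENNReal.add_lt_top.2 ⟨ENNReal.mul_lt_top ENNReal.ofReal_lt_top hi.2,
    ENNReal.mul_lt_top ENNReal.ofReal_lt_top (gmean_poly_lt_top ht m x)⟩

namespace GInt

variable {f g : E n → ℂ}

lemma aemeasurable_enorm (hf : GInt f) : AEMeasurable (fun y => ‖f y‖ₑ) := hf.aesm.enorm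

lemma add (hf : GInt f) (hg : GInt g) : GInt (fun x => f x + g x) := by
  refine ⟨hf.aesm.add hg.aesm, fun t ht x => ?_⟩
  refine (gmean_mono (fun y => enorm_add_le (f y) (g y)) x).trans_lt ?_
  rw [gmean_add hf.aemeasurable_enorm]
  exact ENNReal.add_lt_top.2 ⟨hf.lt_top t ht x, hg.lt_top t ht x⟩

lemma neg (hf : GInt f) : GInt (fun x => -f x) :=
  ⟨hf.aesm.neg, fun t ht x => by simpa using hf.lt_top t ht x⟩

lemma sub (hf : GInt f) (hg : GInt g) : GInt (fun x => f x - g x) := by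
  simpa [sub_eq_add_neg] using hf.add hg.neg

lemma mono (hf : GInt f) (hg : AEStronglyMeasurable g volume) {C : ℝ} (h : ∀ x, ‖g x‖ ≤ C * ‖f x‖) :
    GInt g := by
  refine ⟨hg, fun t ht x => ?_⟩
  have h1 : ∀ y, ‖g y‖ₑ ≤ ENNReal.ofReal C * ‖f y‖ₑ := by
    intro y
    rw [← ofReal_norm, ← ofReal_norm, ← ENNReal.ofReal_mul' (norm_nonneg _)]
    exact ENNReal.ofReal_le_ofReal (h y)
  refine (gmean_mono h1 x).trans_lt ?_
  rw [gmean_const_mul ENNReal.ofReal_ne_top]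
  exact ENNReal.mul_lt_top ENNReal.ofReal_lt_top (hf.lt_top t ht x)

lemma enorm_integral_le {K : E n → ℝ} {C t : ℝ} (hC : 0 ≤ C) {x : E n}
    (hb : ∀ y, |K y| ≤ C * gauss t (x - y)) :
    ∫⁻ y, ‖(K y : ℂ) * f y‖ₑ ≤ ENNReal.ofReal C * gmean t (fun y => ‖f y‖ₑ) x := by
  unfold gmean
  rw [← lintegral_const_mul' _ _ ENNReal.ofReal_ne_top]
  refine lintegral_mono fun y => ?_
  rw [← mul_assoc, ← ENNReal.ofReal_mul hC, enorm_mul]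
  gcongr
  rw [← ofReal_norm]
  refine ENNReal.ofReal_le_ofReal ?_
  rw [Complex.norm_real]
  exact hb y

lemma integrable_mul (hf : GInt f) {K : E n → ℝ} (hK : Measurable K) {C t : ℝ} (hC : 0 ≤ C)
    (ht : 0 < t) {x : E n} (hb : ∀ y, |K y| ≤ C * gauss t (x - y)) :
    Integrable (fun y => (K y : ℂ) * f y) :=
  ⟨(Complex.measurable_ofReal.comp hK).aestronglyMeasurable.mul hf.aesm,
    (enorm_integral_le hC hb).trans_lt (ENNReal.mul_lt_top ENNReal.ofReal_lt_top (hf.lt_top t ht x))⟩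

lemma locallyIntegrable (hf : GInt f) : LocallyIntegrable f volume := by
  intro x
  refine ⟨Metric.ball x 1, Metric.ball_mem_nhds x one_pos, hf.aesm.restrict, ?_⟩
  set c := (4 * Real.pi * 1) ^ (-(((n : ℝ) + 1) / 2)) * Real.exp (-(1 / (4 * 1)))
  have hc : 0 < c := by positivity
  have h1 : ∀ y ∈ Metric.ball x 1, ‖f y‖ₑ ≤
      ENNReal.ofReal c⁻¹ * (ENNReal.ofReal (gauss 1 (x - y)) * ‖f y‖ₑ) := by
    intro y hy
    rw [← mul_assoc, ← ENNReal.ofReal_mul (by positivity)]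
    refine le_mul_of_one_le_left' ?_
    rw [ENNReal.one_le_ofReal, ← div_eq_inv_mul, le_div_iff₀ hc, one_mul]
    have h2 : ‖x - y‖ < 1 := by rw [← dist_eq_norm, dist_comm]; exact hy
    unfold gauss
    simp only [c]
    gcongr
    exact pow_le_one₀ (norm_nonneg _) h2.le
  calc ∫⁻ y in Metric.ball x 1, ‖f y‖ₑ
      ≤ ∫⁻ y in Metric.ball x 1, ENNReal.ofReal c⁻¹ * (ENNReal.ofReal (gauss 1 (x - y)) * ‖f y‖ₑ) :=
        setLIntegral_mono' Metric.isOpen_ball.measurableSet h1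
    _ ≤ ∫⁻ y, ENNReal.ofReal c⁻¹ * (ENNReal.ofReal (gauss 1 (x - y)) * ‖f y‖ₑ) :=
        setLIntegral_le_lintegral _ _
    _ = ENNReal.ofReal c⁻¹ * gmean 1 (fun y => ‖f y‖ₑ) x :=
        lintegral_const_mul' _ _ ENNReal.ofReal_ne_top
    _ < ⊤ := ENNReal.mul_lt_top ENNReal.ofReal_lt_top (hf.lt_top 1 one_pos x)

end GInt

end SplitBMO

end

/-! ### Semigroup law and independence of the chosen heat kernel. -/

noncomputable section

namespace SplitBMO

variable {n : ℕ}

/-! ### The split heat semigroup on Gaussian integrable functions -/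

variable {a b s t : ℝ} {f g : E n → ℂ}

lemma abs_le_one_of_sign (h : a = 1 ∨ a = -1) : |a| ≤ 1 := by
  rcases h with rfl | rfl <;> simp

lemma measurable_pk_right (a b t : ℝ) (x : E n) : Measurable (pk a b t x) :=
  Measurable.of_uncurry_left (f := pk a b t) (measurable_pk a b t)

lemma GInt.integrable_pk (hf : GInt f) (ha : |a| ≤ 1) (hb : |b| ≤ 1) (ht : 0 < t) (x : E n) :
    Integrable (fun y => (pk a b t x y : ℂ) * f y) :=
  hf.integrable_mul (measurable_pk_right a b t x) zero_le_two ht (abs_pk_le ha hb ht x)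

lemma enorm_kernelApply_le (ha : |a| ≤ 1) (hb : |b| ≤ 1) (ht : 0 < t) (f : E n → ℂ) (x : E n) :
    ‖kernelApply (pk a b) t f x‖ₑ ≤ 2 * gmean t (fun y => ‖f y‖ₑ) x := by
  refine (enorm_integral_le_lintegral_enorm _).trans ?_
  refine (GInt.enorm_integral_le zero_le_two (abs_pk_le ha hb ht x)).trans ?_
  simp

lemma kernelApply_congr_ae {p : ℝ → E n → E n → ℝ} (h : f =ᵐ[volume] g) (t : ℝ) :
    kernelApply p t f = kernelApply p t g := by
  ext x
  apply integral_congr_ae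
  filter_upwards [h] with y hy
  rw [hy]

lemma stronglyMeasurable_kernelApply {p : ℝ → E n → E n → ℝ} (t : ℝ)
    (hp : Measurable (fun z : E n × E n => p t z.1 z.2)) (hf : AEStronglyMeasurable f volume) :
    StronglyMeasurable (kernelApply p t f) := by
  rw [kernelApply_congr_ae hf.ae_eq_mk]
  unfold kernelApply
  apply StronglyMeasurable.integral_prod_right'
    (f := fun z : E n × E n => (p t z.1 z.2 : ℂ) * hf.mk f z.2)
  exact ((Complex.measurable_ofReal.comp hp).mul
    (hf.stronglyMeasurable_mk.measurable.comp measurable_snd)).stronglyMeasurable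

lemma GInt.kernelApply (hf : GInt f) (ha : |a| ≤ 1) (hb : |b| ≤ 1) (ht : 0 < t) :
    GInt (kernelApply (pk a b) t f) := by
  refine ⟨(stronglyMeasurable_kernelApply t (measurable_pk a b t) hf.aesm).aestronglyMeasurable,
    fun s hs x => ?_⟩
  refine (gmean_mono (enorm_kernelApply_le ha hb ht f) x).trans_lt ?_
  rw [gmean_const_mul (by norm_num), gmean_gmean hs ht hf.aemeasurable_enorm]
  exact ENNReal.mul_lt_top (by norm_num) (hf.lt_top _ (add_pos hs ht) x)

lemma kernelApply_sub (hf : GInt f) (hg : GInt g) (ha : |a| ≤ 1) (hb : |b| ≤ 1) (ht : 0 < t)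
    (x : E n) : SplitBMO.kernelApply (pk a b) t (fun y => f y - g y) x
      = SplitBMO.kernelApply (pk a b) t f x - SplitBMO.kernelApply (pk a b) t g x := by
  unfold SplitBMO.kernelApply
  rw [← integral_sub (hf.integrable_pk ha hb ht x) (hg.integrable_pk ha hb ht x)]
  congr 1; ext y; ring

lemma kernelApply_add (hf : GInt f) (hg : GInt g) (ha : |a| ≤ 1) (hb : |b| ≤ 1) (ht : 0 < t)
    (x : E n) : SplitBMO.kernelApply (pk a b) t (fun y => f y + g y) x
      = SplitBMO.kernelApply (pk a b) t f x + SplitBMO.kernelApply (pk a b) t g x := by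
  unfold SplitBMO.kernelApply
  rw [← integral_add (hf.integrable_pk ha hb ht x) (hg.integrable_pk ha hb ht x)]
  congr 1; ext y; ring

/-! ### Integration over half spaces -/

lemma refl_preimage_hs (ε : ℝ) : refl n ⁻¹' hs n (-ε) = hs n ε := by
  ext x
  change 0 < -ε * lastCoord (refl n x) ↔ 0 < ε * lastCoord x
  rw [lastCoord_refl]; simp

lemma volume_eq_restrict (n : ℕ) :
    (volume : Measure (E n)).restrict (hs n 1 ∪ hs n (-1)) = volume := by
  rw [Measure.restrict_eq_self_of_ae_mem]
  filter_upwards [ae_mem_hs n] with x hx using hx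

/-- Folding along the hyperplane, a null set. -/
lemma setIntegral_hs_add {φ : E n → ℝ} (hφ : Integrable φ) {ε : ℝ} (hε : ε = 1 ∨ ε = -1) :
    ∫ y in hs n ε, (φ y + φ (refl n y)) = ∫ y, φ y := by
  have hR : Integrable (fun y => φ (refl n y)) :=
    (measurePreserving_refl.integrable_comp_emb measurableEmbedding_refl).2 hφ
  have h1 : ∫ y in hs n ε, φ (refl n y) = ∫ y in hs n (-ε), φ y := by
    have := measurePreserving_refl.setIntegral_preimage_emb measurableEmbedding_refl φ (hs n (-ε))
    rwa [refl_preimage_hs] at this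
  have h2 : (∫ y in hs n 1, φ y) + ∫ y in hs n (-1), φ y = ∫ y, φ y := by
    rw [← setIntegral_union disjoint_hs (measurableSet_hs _) hφ.integrableOn hφ.integrableOn,
      volume_eq_restrict]
  rw [integral_add hφ.integrableOn hR.integrableOn, h1, ← h2]
  rcases hε with rfl | rfl
  · rfl
  · rw [neg_neg]; exact add_comm _ _

lemma integral_hkern_eq {ε σ t : ℝ} {x : E n} (hx : x ∈ hs n ε) (φ : E n → ℝ) :
    ∫ y, hkern ε σ t x y * φ y
      = ∫ y in hs n ε, (gauss t (x - y) + σ * gauss t (x - refl n y)) * φ y := by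
  rw [← integral_indicator (measurableSet_hs ε)]
  congr 1; ext y
  unfold hkern
  rw [indicator_of_mem hx]
  by_cases hy : y ∈ hs n ε
  · rw [indicator_of_mem hy, indicator_of_mem hy]
  · rw [indicator_of_notMem hy, indicator_of_notMem hy, zero_mul]

lemma integrable_gauss_mul_gauss (hs0 : 0 < s) (ht : 0 < t) (x z : E n) :
    Integrable (fun y : E n => gauss s (x - y) * gauss t (y - z)) := by
  by_contra h
  have h1 := gauss_semigroup_sub hs0 ht x z
  rw [integral_undef h] at h1
  exact (gauss_pos (add_pos hs0 ht) (x - z)).ne h1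

lemma gauss_refl_sub (t : ℝ) (x y : E n) : gauss t (refl n x - y) = gauss t (x - refl n y) :=
  gauss_congr_norm t (norm_sub_refl x y).symm

lemma gauss_refl_sub_refl (t : ℝ) (x y : E n) : gauss t (refl n x - refl n y) = gauss t (x - y) :=
  gauss_congr_norm t (norm_refl_sub_refl x y)

lemma hkern_eq_zero_of_notMem_left {ε σ t : ℝ} {x : E n} (hx : x ∉ hs n ε) (y : E n) :
    hkern ε σ t x y = 0 := by
  unfold hkern; rw [indicator_of_notMem hx]

lemma hkern_eq_zero_of_notMem_right {ε σ t : ℝ} (x : E n) {y : E n} (hy : y ∉ hs n ε) :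
    hkern ε σ t x y = 0 := by
  unfold hkern
  by_cases hx : x ∈ hs n ε
  · rw [indicator_of_mem hx, indicator_of_notMem hy]
  · rw [indicator_of_notMem hx]

lemma hkern_of_mem {ε σ t : ℝ} {x y : E n} (hx : x ∈ hs n ε) (hy : y ∈ hs n ε) :
    hkern ε σ t x y = gauss t (x - y) + σ * gauss t (x - refl n y) := by
  unfold hkern
  rw [indicator_of_mem hx, indicator_of_mem hy]

/-- Because σ² = 1, the product of the two reflected kernels equals φ(y) + φ(Ry), where φ uses the
unreflected Gaussian in the left factor. Unfolding leaves Gaussian integrals over the whole space.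
-/
lemma hkern_semigroup {ε σ : ℝ} (hε : ε = 1 ∨ ε = -1) (hσ : σ = 1 ∨ σ = -1) (hs0 : 0 < s)
    (ht : 0 < t) (x z : E n) :
    ∫ y, hkern ε σ s x y * hkern ε σ t y z = hkern ε σ (s + t) x z := by
  by_cases hx : x ∈ hs n ε
  swap
  · simp [hkern_eq_zero_of_notMem_left hx]
  by_cases hz : z ∈ hs n ε
  swap
  · simp [hkern_eq_zero_of_notMem_right _ hz]
  have hσ2 : σ * σ = 1 := by rcases hσ with rfl | rfl <;> norm_num
  rw [integral_hkern_eq hx, hkern_of_mem hx hz]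
  set φ : E n → ℝ := fun y => gauss s (x - y) * gauss t (y - z)
    + σ * (gauss s (x - y) * gauss t (y - refl n z)) with hφ
  have i1 := integrable_gauss_mul_gauss hs0 ht x z
  have i2 := (integrable_gauss_mul_gauss hs0 ht x (refl n z)).const_mul σ
  have h1 : ∫ y, φ y = gauss (s + t) (x - z) + σ * gauss (s + t) (x - refl n z) := by
    rw [hφ, integral_add i1 i2, integral_const_mul, gauss_semigroup_sub hs0 ht,
      gauss_semigroup_sub hs0 ht]
  have i3 : Integrable φ := i1.add i2
  rw [← h1, ← setIntegral_hs_add i3 hε]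
  refine setIntegral_congr_fun (measurableSet_hs ε) fun y hy => ?_
  simp only [hφ]
  rw [hkern_of_mem hy hz, gauss_refl_sub t y z, gauss_refl_sub_refl]
  linear_combination (gauss s (x - refl n y) * gauss t (y - refl n z)) * hσ2

lemma pk_semigroup (ha : a = 1 ∨ a = -1) (hb : b = 1 ∨ b = -1) (hs0 : 0 < s) (ht : 0 < t)
    (x z : E n) : ∫ y, pk a b s x y * pk a b t y z = pk a b (s + t) x z := by
  have cross : ∀ {σ τ : ℝ} (y : E n), hkern 1 σ s x y * hkern (-1) τ t y z = 0 := fun y => by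
    by_cases hy : y ∈ hs n 1
    · rw [hkern_eq_zero_of_notMem_left (mem_hs_neg_of_mem hy), mul_zero]
    · rw [hkern_eq_zero_of_notMem_right x hy, zero_mul]
  have cross' : ∀ {σ τ : ℝ} (y : E n), hkern (-1) σ s x y * hkern 1 τ t y z = 0 := fun y => by
    by_cases hy : y ∈ hs n 1
    · rw [hkern_eq_zero_of_notMem_right x (mem_hs_neg_of_mem hy), zero_mul]
    · rw [hkern_eq_zero_of_notMem_left hy, mul_zero]
  have e : ∀ y, pk a b s x y * pk a b t y z = hkern 1 a s x y * hkern 1 a t y z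
      + hkern (-1) b s x y * hkern (-1) b t y z := fun y => by
    unfold pk
    linear_combination cross (σ := a) (τ := b) y + cross' (σ := b) (τ := a) y
  have int : ∀ {ε σ : ℝ}, |σ| ≤ 1 → Integrable (fun y => hkern ε σ s x y * hkern ε σ t y z) := by
    intro ε σ hσ
    refine ((integrable_gauss_mul_gauss hs0 ht x z).const_mul 4).mono' ?_ ?_
    · exact (((measurable_hkern ε σ s).comp measurable_prodMk_left).mul
        ((measurable_hkern ε σ t).comp measurable_prodMk_right)).aestronglyMeasurable
    · refine Filter.Eventually.of_forall fun y => ?_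
      rw [Real.norm_eq_abs, abs_mul]
      calc _ ≤ (2 * gauss s (x - y)) * (2 * gauss t (y - z)) :=
            mul_le_mul (abs_hkern_le hσ hs0 x y) (abs_hkern_le hσ ht y z) (abs_nonneg _)
              (by have := gauss_nonneg hs0 (x - y); positivity)
        _ = _ := by ring
  simp_rw [e]
  rw [integral_add (int (abs_le_one_of_sign ha)) (int (abs_le_one_of_sign hb)),
    hkern_semigroup (Or.inl rfl) ha hs0 ht, hkern_semigroup (Or.inr rfl) hb hs0 ht]
  rfl

lemma kernelApply_kernelApply (hf : GInt f) (ha : a = 1 ∨ a = -1) (hb : b = 1 ∨ b = -1)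
    (hs0 : 0 < s) (ht : 0 < t) (x : E n) :
    kernelApply (pk a b) s (kernelApply (pk a b) t f) x = kernelApply (pk a b) (s + t) f x := by
  have ha' := abs_le_one_of_sign ha
  have hb' := abs_le_one_of_sign hb
  have hm : AEStronglyMeasurable (Function.uncurry fun y z : E n =>
      (pk a b s x y : ℂ) * ((pk a b t y z : ℂ) * f z)) (volume.prod volume) := by
    refine AEStronglyMeasurable.mul ?_ (AEStronglyMeasurable.mul ?_ ?_)
    · exact (Complex.measurable_ofReal.comp
        ((measurable_pk_right a b s x).comp measurable_fst)).aestronglyMeasurable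
    · exact (Complex.measurable_ofReal.comp (measurable_pk a b t)).aestronglyMeasurable
    · exact hf.aesm.comp_snd
  have hfin : ∫⁻ y, ∫⁻ z, ‖(pk a b s x y : ℂ) * ((pk a b t y z : ℂ) * f z)‖ₑ < ⊤ := by
    have h1 : ∀ y, ∫⁻ z, ‖(pk a b s x y : ℂ) * ((pk a b t y z : ℂ) * f z)‖ₑ
        ≤ 4 * (ENNReal.ofReal (gauss s (x - y)) * gmean t (fun z => ‖f z‖ₑ) y) := by
      intro y
      simp_rw [enorm_mul (pk a b s x y : ℂ)]
      rw [lintegral_const_mul' _ _ enorm_ne_top]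
      have h2 : ‖(pk a b s x y : ℂ)‖ₑ ≤ 2 * ENNReal.ofReal (gauss s (x - y)) := by
        rw [← ofReal_norm, Complex.norm_real]
        refine (ENNReal.ofReal_le_ofReal (abs_pk_le ha' hb' hs0 x y)).trans (le_of_eq ?_)
        rw [ENNReal.ofReal_mul zero_le_two, ENNReal.ofReal_ofNat]
      have h3 := GInt.enorm_integral_le (f := f) zero_le_two (abs_pk_le ha' hb' ht y)
      calc _ ≤ (2 * ENNReal.ofReal (gauss s (x - y))) *
            (ENNReal.ofReal 2 * gmean t (fun z => ‖f z‖ₑ) y) := by gcongr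
        _ = _ := by rw [ENNReal.ofReal_ofNat]; ring
    refine (lintegral_mono h1).trans_lt ?_
    rw [lintegral_const_mul' _ _ (by norm_num)]
    refine ENNReal.mul_lt_top (by norm_num) ?_
    change gmean s (gmean t fun z => ‖f z‖ₑ) x < ⊤
    rw [gmean_gmean hs0 ht hf.aemeasurable_enorm]
    exact hf.lt_top _ (add_pos hs0 ht) x
  have hint : Integrable (Function.uncurry fun y z : E n =>
      (pk a b s x y : ℂ) * ((pk a b t y z : ℂ) * f z)) (volume.prod volume) := by
    refine ⟨hm, ?_⟩
    rw [HasFiniteIntegral, lintegral_prod _ hm.enorm]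
    exact hfin
  unfold kernelApply
  simp_rw [← integral_const_mul]
  rw [integral_integral_swap hint]
  congr 1; ext z
  rw [← pk_semigroup ha hb hs0 ht x z, ← integral_complex_ofReal, ← integral_mul_const]
  congr 1; ext y
  push_cast; ring

/-! ### Independence of the choice of the kernel -/

lemma IsHeatKernel.ae_eq_of_memLp {L : (E n → ℂ) → (E n → ℂ) → Prop} (hL : IsSplit a b L)
    {p : ℝ → E n → E n → ℝ} (hp : IsHeatKernel L p) (hf : MemLp f 2) (ht : 0 < t) :
    kernelApply p t f =ᵐ[volume] kernelApply (pk a b) t f := by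
  obtain ⟨u, hu, hu'⟩ := hp.2.2 hf.toLp
  obtain ⟨v, hv, hv'⟩ := (isHeatKernel_pk hL).2.2 hf.toLp
  have h1 := hu' t ht
  have h2 := hv' t ht
  rw [hu.unique hL hv ht] at h1
  rw [kernelApply_congr_ae hf.coeFn_toLp] at h1 h2
  exact h1.symm.trans h2

lemma memLp_indicator_ball_of_mem_classM (hf : f ∈ classM n) (N : ℕ) :
    MemLp ((Metric.ball 0 (N : ℝ)).indicator f) 2 := by
  obtain ⟨hl, d, hd, hi⟩ := hf
  have hm := hl.aestronglyMeasurable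
  rw [memLp_two_iff_integrable_sq_norm (hm.indicator Metric.isOpen_ball.measurableSet)]
  refine (hi.const_mul (1 + (N : ℝ) ^ ((n : ℝ) + 1 + d))).mono'
    ((hm.indicator Metric.isOpen_ball.measurableSet).norm.pow 2)
    (Filter.Eventually.of_forall fun x => ?_)
  rw [Real.norm_of_nonneg (by positivity)]
  by_cases hx : x ∈ Metric.ball (0 : E n) N
  · rw [indicator_of_mem hx]
    have h1 : ‖x‖ < N := by simpa using hx
    have h2 : ‖x‖ ^ ((n : ℝ) + 1 + d) ≤ (N : ℝ) ^ ((n : ℝ) + 1 + d) := by gcongr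
    rw [mul_div_assoc', le_div_iff₀ (by positivity), mul_comm]
    gcongr
  · rw [indicator_of_notMem hx]
    simp only [norm_zero, ne_eq, OfNat.ofNat_ne_zero, not_false_eq_true, zero_pow]
    positivity

lemma tendsto_integral_truncation {φ : E n → ℂ} (hφ : Integrable φ) :
    Filter.Tendsto (fun N : ℕ => ∫ y, (Metric.ball 0 (N : ℝ)).indicator φ y) Filter.atTop
      (nhds (∫ y, φ y)) := by
  refine tendsto_integral_of_dominated_convergence (fun y => ‖φ y‖)
    (fun N => hφ.aestronglyMeasurable.indicator Metric.isOpen_ball.measurableSet) hφ.norm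
    (fun N => Filter.Eventually.of_forall fun y => norm_indicator_le_norm_self _ _)
    (Filter.Eventually.of_forall fun y => ?_)
  refine tendsto_const_nhds.congr' ?_
  obtain ⟨N, hN⟩ := exists_nat_gt ‖y‖
  filter_upwards [Filter.eventually_ge_atTop N] with M hM
  rw [indicator_of_mem]
  simpa using hN.trans_le (Nat.cast_le.2 hM)

lemma IsHeatKernel.integrable {L : (E n → ℂ) → (E n → ℂ) → Prop}
    {p : ℝ → E n → E n → ℝ} (hp : IsHeatKernel L p) (hf : GInt f) (ht : 0 < t) (x : E n) :
    Integrable (fun y => (p t x y : ℂ) * f y) := by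
  obtain ⟨C, c, hC, hc, h⟩ := hp.2.1
  have hm : Measurable (p t x) := (hp.1 t ht).comp measurable_prodMk_left
  set s := t / (4 * c)
  set D := (4 * Real.pi * s) ^ (-(((n : ℝ) + 1) / 2))
  have hs : 0 < s := by positivity
  have hD : 0 < D := by positivity
  refine hf.integrable_mul hm (C := C / t ^ (((n : ℝ) + 1) / 2) / D) (t := s) (x := x)
    (by positivity) hs fun y => ?_
  refine (h t ht x y).trans (le_of_eq ?_)
  unfold gauss
  rw [show -(‖x - y‖ ^ 2 / (4 * s)) = -(c * ‖x - y‖ ^ 2 / t) by simp only [s]; field_simp]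
  rw [← mul_assoc, div_mul_cancel₀ _ hD.ne']

/-- Truncations of f to balls are square integrable, and on L² the kernel is determined by
uniqueness of the flow. The Gaussian bounds of both kernels pass the equality to f by dominated
convergence. -/
lemma IsHeatKernel.ae_eq {L : (E n → ℂ) → (E n → ℂ) → Prop} (hL : IsSplit a b L)
    {p : ℝ → E n → E n → ℝ} (hp : IsHeatKernel L p) (hf : f ∈ classM n) (ht : 0 < t) :
    kernelApply p t f =ᵐ[volume] kernelApply (pk a b) t f := by
  have hG := gint_of_mem_classM hf
  have h1 : ∀ᵐ x, ∀ N : ℕ, kernelApply p t ((Metric.ball 0 (N : ℝ)).indicator f) x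
      = kernelApply (pk a b) t ((Metric.ball 0 (N : ℝ)).indicator f) x :=
    ae_all_iff.2 fun N => hp.ae_eq_of_memLp hL (memLp_indicator_ball_of_mem_classM hf N) ht
  have lim : ∀ {q : ℝ → E n → E n → ℝ}, IsHeatKernel L q → ∀ x, Filter.Tendsto
      (fun N : ℕ => kernelApply q t ((Metric.ball 0 (N : ℝ)).indicator f) x) Filter.atTop
      (nhds (kernelApply q t f x)) := by
    intro q hq x
    refine (tendsto_integral_truncation (hq.integrable hG ht x)).congr fun N => ?_
    refine integral_congr_ae (Filter.Eventually.of_forall fun y => ?_)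
    by_cases hy : y ∈ Metric.ball (0 : E n) N
    · simp only [indicator_of_mem hy]
    · simp only [indicator_of_notMem hy, mul_zero]
  filter_upwards [h1] with x hx
  exact tendsto_nhds_unique (lim hp x) ((lim (isHeatKernel_pk hL) x).congr fun N => (hx N).symm)

/-- The kernel in the definition is existentially quantified; uniqueness lets the explicit one
represent it. -/
theorem mem_BMOL_iff {L : (E n → ℂ) → (E n → ℂ) → Prop} (hL : IsSplit a b L) :
    f ∈ BMOL L ↔ f ∈ classM n ∧ ∃ C : ℝ, ∀ (y : E n) (r : ℝ), 0 < r →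
      ⨍ x in Metric.ball y r, ‖f x - kernelApply (pk a b) (r ^ 2) f x‖ ≤ C := by
  constructor
  · rintro ⟨hf, p, hp, C, hC⟩
    refine ⟨hf, C, fun y r hr => le_of_eq_of_le ?_ (hC y r hr)⟩
    apply average_congr
    filter_upwards [ae_restrict_of_ae (hp.ae_eq hL hf (pow_pos hr 2))] with x hx
    rw [hx]
  · rintro ⟨hf, C, hC⟩
    exact ⟨hf, _, isHeatKernel_pk hL, C, hC⟩

theorem mem_kerL_iff {L : (E n → ℂ) → (E n → ℂ) → Prop} (hL : IsSplit a b L) :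
    f ∈ kerL L ↔ f ∈ classM n ∧
      ∀ t : ℝ, 0 < t → kernelApply (pk a b) t f =ᵐ[volume] f := by
  constructor
  · rintro ⟨hf, p, hp, h⟩
    exact ⟨hf, fun t ht => (hp.ae_eq hL hf ht).symm.trans (h t ht)⟩
  · rintro ⟨hf, h⟩
    exact ⟨hf, _, isHeatKernel_pk hL, h⟩

end SplitBMO

end

/-! ### Classical BMO: means over cubes and Gaussian means of the oscillation. -/

noncomputable section

namespace SplitBMO

variable {n : ℕ}

/-! ### Cubes -/

lemma cube_eq_preimage (c : E n) (l : ℝ) :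
    cube c l = (WithLp.ofLp : E n → Fin (n + 1) → ℝ) ⁻¹'
      Icc (fun i => c i - l / 2) (fun i => c i + l / 2) := by
  ext x
  simp only [cube, mem_preimage, mem_Icc, Pi.le_def, ← forall_and]
  refine forall_congr' fun i => ?_
  rw [abs_le]
  constructor <;> rintro ⟨h1, h2⟩ <;> constructor <;> linarith

lemma volume_cube (c : E n) {l : ℝ} (hl : 0 ≤ l) : volume (cube c l) = ENNReal.ofReal (l ^ (n + 1)) := by
  rw [cube_eq_preimage, (PiLp.volume_preserving_ofLp (Fin (n + 1))).measure_preimage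
    measurableSet_Icc.nullMeasurableSet, Real.volume_Icc_pi]
  have : ∀ i : Fin (n + 1), c i + l / 2 - (c i - l / 2) = l := fun i => by ring
  simp only [this, Finset.prod_const, Finset.card_univ, Fintype.card_fin]
  rw [ENNReal.ofReal_pow hl]

lemma measureReal_cube (c : E n) {l : ℝ} (hl : 0 ≤ l) : volume.real (cube c l) = l ^ (n + 1) := by
  rw [measureReal_def, volume_cube c hl, ENNReal.toReal_ofReal (by positivity)]

lemma isClosed_cube (c : E n) (l : ℝ) : IsClosed (cube c l) := by
  rw [cube_eq_preimage]
  exact isClosed_Icc.preimage (PiLp.continuous_ofLp 2 _)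

lemma measurableSet_cube (c : E n) (l : ℝ) : MeasurableSet (cube c l) :=
  (isClosed_cube c l).measurableSet

lemma norm_sub_le_of_mem_cube {c x : E n} {l : ℝ} (hx : x ∈ cube c l) :
    ‖x - c‖ ≤ (n + 1) * (l / 2) := by
  have h : ‖x - c‖ ≤ ∑ i, ‖(x - c) i‖ := by
    rw [EuclideanSpace.norm_eq]
    refine Real.sqrt_le_iff.2 ⟨by positivity, ?_⟩
    exact Finset.sum_sq_le_sq_sum_of_nonneg fun i _ => norm_nonneg _
  refine h.trans ?_
  calc ∑ i, ‖(x - c) i‖ ≤ ∑ _i : Fin (n + 1), l / 2 :=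
        Finset.sum_le_sum fun i _ => by simpa using hx i
    _ = _ := by simp

lemma cube_subset_closedBall (c : E n) (l : ℝ) : cube c l ⊆ Metric.closedBall c ((n + 1) * (l / 2)) :=
  fun x hx => by rw [Metric.mem_closedBall, dist_eq_norm]; exact norm_sub_le_of_mem_cube hx

lemma cube_subset_ball (c : E n) {l : ℝ} (hl : 0 < l) : cube c l ⊆ Metric.ball c ((n + 1) * l) := by
  refine (cube_subset_closedBall c l).trans (Metric.closedBall_subset_ball ?_)
  have : (0 : ℝ) < n + 1 := by positivity
  nlinarith

lemma isCompact_cube (c : E n) (l : ℝ) : IsCompact (cube c l) :=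
  (isCompact_closedBall c ((n + 1) * (l / 2))).of_isClosed_subset (isClosed_cube c l)
    (cube_subset_closedBall c l)

lemma ball_subset_cube (c : E n) (r : ℝ) : Metric.ball c r ⊆ cube c (2 * r) := by
  intro x hx i
  have h1 : ‖x - c‖ < r := by rw [← dist_eq_norm]; exact hx
  have h2 := abs_coord_le_norm (x - c) i
  have h3 : (x - c) i = x i - c i := rfl
  rw [h3] at h2
  linarith

lemma cube_subset_cube {c c' : E n} {l l' : ℝ} (h : ‖c - c'‖ + l / 2 ≤ l' / 2) :
    cube c l ⊆ cube c' l' := by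
  intro x hx i
  have h1 := abs_coord_le_norm (c - c') i
  have h2 : x i - c' i = (x i - c i) + (c - c') i := by
    rw [show (c - c') i = c i - c' i from rfl]; ring
  rw [h2]
  exact (abs_add_le _ _).trans (by have := hx i; linarith)

/-! ### Averages over cubes -/

/-- The mean of a function on a cube. -/
def cAvg (f : E n → ℂ) (c : E n) (l : ℝ) : ℂ := ⨍ y in cube c l, f y

variable {f : E n → ℂ}

lemma integrableOn_cube (hf : LocallyIntegrable f volume) (c : E n) (l : ℝ) :
    IntegrableOn f (cube c l) := hf.integrableOn_isCompact (isCompact_cube c l)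

lemma locallyIntegrable_sub_const (hf : LocallyIntegrable f volume) (a : ℂ) :
    LocallyIntegrable (fun x => f x - a) volume := hf.sub (locallyIntegrable_const a)

lemma integrableOn_cube_norm_sub (hf : LocallyIntegrable f volume) (a c) (l : ℝ) :
    IntegrableOn (fun x : E n => ‖f x - a‖) (cube c l) :=
  (integrableOn_cube (locallyIntegrable_sub_const hf a) c l).norm

lemma average_const_cube {F : Type*} [NormedAddCommGroup F] [NormedSpace ℝ F] [CompleteSpace F]
    (c : E n) {l : ℝ} (hl : 0 < l) (a : F) : ⨍ _x in cube c l, a = a := by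
  refine setAverage_const ?_ ?_ a
  · rw [volume_cube c hl.le]; positivity
  · rw [volume_cube c hl.le]; simp

lemma setAverage_cube_eq {F : Type*} [NormedAddCommGroup F] [NormedSpace ℝ F]
    (c : E n) {l : ℝ} (hl : 0 < l) (g : E n → F) :
    ⨍ x in cube c l, g x = (l ^ (n + 1))⁻¹ • ∫ x in cube c l, g x := by
  rw [setAverage_eq, measureReal_cube c hl.le]

lemma setAverage_cube_mono {c : E n} {l : ℝ} (hl : 0 < l) {g h : E n → ℝ} (h0 : ∀ x, 0 ≤ g x)
    (hi : IntegrableOn h (cube c l)) (hgh : ∀ x ∈ cube c l, g x ≤ h x) :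
    ⨍ x in cube c l, g x ≤ ⨍ x in cube c l, h x := by
  rw [setAverage_cube_eq c hl, setAverage_cube_eq c hl]
  simp only [smul_eq_mul]
  refine mul_le_mul_of_nonneg_left ?_ (by positivity)
  refine integral_mono_of_nonneg (Filter.Eventually.of_forall h0) hi ?_
  filter_upwards [ae_restrict_mem (measurableSet_cube c l)] with x hx using hgh x hx

lemma norm_cAvg_sub_le (hf : LocallyIntegrable f volume) (a : ℂ) (c : E n) {l : ℝ} (hl : 0 < l) :
    ‖cAvg f c l - a‖ ≤ ⨍ x in cube c l, ‖f x - a‖ := by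
  have h1 : cAvg f c l - a = ⨍ x in cube c l, (f x - a) := by
    rw [cAvg, setAverage_cube_eq c hl, setAverage_cube_eq c hl, integral_sub
      (integrableOn_cube hf c l) (integrableOn_cube (locallyIntegrable_const a) c l), smul_sub]
    congr 1
    rw [← setAverage_cube_eq c hl (fun _ => a), average_const_cube c hl]
  rw [h1, setAverage_cube_eq c hl, setAverage_cube_eq c hl, norm_smul, smul_eq_mul, norm_inv,
    norm_pow, Real.norm_of_nonneg hl.le]
  gcongr
  exact norm_integral_le_integral_norm _

lemma setAverage_cube_le_of_subset {c c' : E n} {l l' : ℝ} (hl : 0 < l) (hl' : 0 < l')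
    (hsub : cube c l ⊆ cube c' l') {g : E n → ℝ} (h0 : ∀ x, 0 ≤ g x)
    (hi : IntegrableOn g (cube c' l')) :
    ⨍ x in cube c l, g x ≤ (l' / l) ^ (n + 1) * ⨍ x in cube c' l', g x := by
  rw [setAverage_cube_eq c hl, setAverage_cube_eq c' hl', smul_eq_mul, smul_eq_mul, div_pow]
  have h1 : ∫ x in cube c l, g x ≤ ∫ x in cube c' l', g x :=
    setIntegral_mono_set hi (Filter.Eventually.of_forall h0) hsub.eventuallyLE
  have h2 : l' ^ (n + 1) / l ^ (n + 1) * ((l' ^ (n + 1))⁻¹ * ∫ x in cube c' l', g x)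
      = (l ^ (n + 1))⁻¹ * ∫ x in cube c' l', g x := by field_simp
  rw [h2]
  gcongr

/-! ### Functions of bounded mean oscillation -/

/-- `f` is locally integrable with mean oscillation at most `C` on cubes. -/
structure HasOsc (f : E n → ℂ) (C : ℝ) : Prop where
  locallyIntegrable : LocallyIntegrable f volume
  osc_le : ∀ (c : E n) (l : ℝ), 0 < l → ⨍ x in cube c l, ‖f x - cAvg f c l‖ ≤ C

lemma mem_BMO_iff : f ∈ BMO n ↔ ∃ C, HasOsc f C :=
  ⟨fun ⟨h, C, hC⟩ => ⟨C, h, hC⟩, fun ⟨C, h⟩ => ⟨h.1, C, h.2⟩⟩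

lemma HasOsc.nonneg {C : ℝ} (hf : HasOsc f C) : 0 ≤ C := by
  refine le_trans ?_ (hf.osc_le 0 1 one_pos)
  rw [setAverage_cube_eq 0 one_pos]
  exact smul_nonneg (by positivity) (integral_nonneg fun x => norm_nonneg _)

lemma setAverage_add_const {g : E n → ℝ} {c : E n} {l : ℝ} (hl : 0 < l)
    (hg : IntegrableOn g (cube c l)) (a : ℝ) :
    ⨍ x in cube c l, (g x + a) = (⨍ x in cube c l, g x) + a := by
  rw [setAverage_cube_eq c hl, setAverage_cube_eq c hl, integral_add hg
    ((locallyIntegrable_const a).integrableOn_isCompact (isCompact_cube c l)), smul_add]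
  congr 1
  rw [← setAverage_cube_eq c hl (fun _ => a), average_const_cube c hl]

/-- The mean is nearly the best constant: it is within C of m, so replacing m by it costs another C.
-/
lemma mem_BMO_of_forall_exists (hf : LocallyIntegrable f volume) {C : ℝ}
    (h : ∀ (c : E n) (l : ℝ), 0 < l → ∃ m : ℂ, ⨍ x in cube c l, ‖f x - m‖ ≤ C) : f ∈ BMO n := by
  refine ⟨hf, C + C, fun c l hl => ?_⟩
  obtain ⟨m, hm⟩ := h c l hl
  have h1 := norm_cAvg_sub_le hf m c hl
  calc ⨍ x in cube c l, ‖f x - cAvg f c l‖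
      ≤ ⨍ x in cube c l, (‖f x - m‖ + ‖cAvg f c l - m‖) := by
        refine setAverage_cube_mono hl (fun x => norm_nonneg _)
          ((integrableOn_cube_norm_sub hf m c l).add
            ((locallyIntegrable_const _).integrableOn_isCompact (isCompact_cube c l)))
          fun x _ => ?_
        have : f x - cAvg f c l = (f x - m) - (cAvg f c l - m) := by ring
        rw [this]; exact norm_sub_le _ _
    _ = (⨍ x in cube c l, ‖f x - m‖) + ‖cAvg f c l - m‖ :=
        setAverage_add_const hl (integrableOn_cube_norm_sub hf m c l) _
    _ ≤ C + C := by linarith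

namespace HasOsc

variable {C : ℝ}

lemma norm_cAvg_sub_cAvg_le (hf : HasOsc f C) {c c' : E n} {l l' : ℝ} (hl : 0 < l) (hl' : 0 < l')
    (hsub : cube c l ⊆ cube c' l') :
    ‖cAvg f c l - cAvg f c' l'‖ ≤ (l' / l) ^ (n + 1) * C := by
  refine (norm_cAvg_sub_le hf.1 _ c hl).trans ?_
  refine (setAverage_cube_le_of_subset hl hl' hsub (fun x => norm_nonneg _)
    (integrableOn_cube_norm_sub hf.1 _ c' l')).trans ?_
  gcongr
  exact hf.osc_le c' l' hl'

/-- Telescoping: each doubling of the cube moves the mean by at most 2^(n+1) C. -/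
lemma norm_cAvg_double (hf : HasOsc f C) (c : E n) {l : ℝ} (hl : 0 < l) (k : ℕ) :
    ‖cAvg f c l - cAvg f c (2 ^ k * l)‖ ≤ k * (2 ^ (n + 1) * C) := by
  induction k with
  | zero => simp
  | succ k ih =>
    have hk : 0 < 2 ^ k * l := by positivity
    have h1 := hf.norm_cAvg_sub_cAvg_le (c := c) (c' := c) hk (l' := 2 ^ (k + 1) * l) (by positivity)
      (cube_subset_cube (by simp; rw [pow_succ]; linarith))
    have h2 : 2 ^ (k + 1) * l / (2 ^ k * l) = 2 := by rw [pow_succ]; field_simp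
    rw [h2] at h1
    have e : cAvg f c l - cAvg f c (2 ^ (k + 1) * l) = (cAvg f c l - cAvg f c (2 ^ k * l))
        + (cAvg f c (2 ^ k * l) - cAvg f c (2 ^ (k + 1) * l)) := by ring
    rw [e]
    refine (norm_add_le _ _).trans ?_
    push_cast
    linarith

/-- Replaces the logarithmic growth of means by square root growth, which is easier to handle and is
all that is needed. -/
lemma sq_le_four_mul_two_pow (k : ℕ) : (k : ℝ) ^ 2 ≤ 4 * 2 ^ k := by
  have : k ^ 2 ≤ 4 * 2 ^ k := by
    induction k with
    | zero => simp
    | succ k ih =>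
      rcases Nat.lt_or_ge k 3 with h | h
      · interval_cases k <;> norm_num
      · rw [pow_succ 2 k]; nlinarith
  exact_mod_cast this

/-- The means of a function of bounded mean oscillation have (less than) square root growth. -/
lemma norm_cAvg_sub_cAvg_le_sqrt (hf : HasOsc f C) (z y : E n) {l : ℝ} (hl : 0 < l) :
    ‖cAvg f z l - cAvg f y l‖ ≤ 16 * 2 ^ (n + 1) * C * √(1 + ‖z - y‖ / l) := by
  set ρ := ‖z - y‖ / l with hρ
  have hρ0 : 0 ≤ ρ := by positivity
  -- This k makes ρ < 2^k, so the cube of side 2^(k+2) l about y contains the one of side 2^(k+1) l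
  -- about z; also 2^k ≤ 1 + 2ρ, which bounds the number of doublings.
  obtain ⟨k, hk1, hk2⟩ := exists_nat_pow_near (x := 1 + 2 * ρ) (y := 2) (by linarith) (by norm_num)
  have hz := hf.norm_cAvg_double z hl (k + 1)
  have hy := hf.norm_cAvg_double y hl (k + 2)
  have hm := hf.norm_cAvg_sub_cAvg_le (c := z) (c' := y) (l := 2 ^ (k + 1) * l)
    (l' := 2 ^ (k + 2) * l) (by positivity) (by positivity) (cube_subset_cube (by
      have h1 : ‖z - y‖ = ρ * l := by rw [hρ]; field_simp
      rw [h1, pow_succ _ (k + 1)]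
      nlinarith))
  have h2 : 2 ^ (k + 2) * l / (2 ^ (k + 1) * l) = 2 := by rw [pow_succ _ (k + 1)]; field_simp
  rw [h2] at hm
  have hC := hf.nonneg
  set A := 2 ^ (n + 1) * C with hA
  have hA0 : 0 ≤ A := by positivity
  have hsum : ‖cAvg f z l - cAvg f y l‖ ≤ (2 * k + 4) * A := by
    have e : cAvg f z l - cAvg f y l = (cAvg f z l - cAvg f z (2 ^ (k + 1) * l))
        + (cAvg f z (2 ^ (k + 1) * l) - cAvg f y (2 ^ (k + 2) * l))
        - (cAvg f y l - cAvg f y (2 ^ (k + 2) * l)) := by ring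
    rw [e]
    refine (norm_sub_le _ _).trans ((add_le_add_left (norm_add_le _ _) _).trans ?_)
    push_cast at hz hy
    linarith
  have h3 : (k : ℝ) ≤ 4 * √(1 + ρ) := by
    have h5 := sq_le_four_mul_two_pow k
    have h6 : (k : ℝ) ≤ √(4 ^ 2 * (1 + ρ)) := Real.le_sqrt_of_sq_le (by linarith)
    rwa [Real.sqrt_mul (by norm_num), Real.sqrt_sq (by norm_num)] at h6
  have h4 : 1 ≤ √(1 + ρ) := Real.one_le_sqrt.2 (by linarith)
  calc _ ≤ (2 * k + 4) * A := hsum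
    _ ≤ (16 * √(1 + ρ)) * A := by gcongr; linarith
    _ = _ := by rw [hA]; ring

end HasOsc

/-! ### Ball averages -/

lemma ofReal_setAverage_cube (c : E n) {l : ℝ} (hl : 0 < l) {g : E n → ℝ} (h0 : ∀ x, 0 ≤ g x)
    (hi : IntegrableOn g (cube c l)) :
    ∫⁻ x in cube c l, ENNReal.ofReal (g x) = ENNReal.ofReal (l ^ (n + 1) * ⨍ x in cube c l, g x) := by
  rw [← ofReal_integral_eq_lintegral_ofReal hi (Filter.Eventually.of_forall h0),
    setAverage_cube_eq c hl, smul_eq_mul, mul_inv_cancel_left₀ (by positivity)]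

lemma measureReal_ball (z : E n) {r : ℝ} (hr : 0 ≤ r) :
    volume.real (Metric.ball z r) = r ^ (n + 1) * volume.real (Metric.ball (0 : E n) 1) := by
  rw [measureReal_def, Measure.addHaar_ball volume z hr, ENNReal.toReal_mul,
    ENNReal.toReal_ofReal (by positivity), measureReal_def]
  simp

lemma measureReal_unitBall_pos (n : ℕ) : 0 < volume.real (Metric.ball (0 : E n) 1) :=
  ENNReal.toReal_pos (Metric.measure_ball_pos volume _ one_pos).ne' measure_ball_lt_top.ne

/-- The ratio of the volumes of the cube of side `2 r` and the ball of radius `r`. -/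
def ballConst (n : ℕ) : ℝ := 2 ^ (n + 1) / volume.real (Metric.ball (0 : E n) 1)

lemma ballConst_pos (n : ℕ) : 0 < ballConst n :=
  div_pos (by positivity) (measureReal_unitBall_pos n)

lemma volume_ball_eq_ofReal (z : E n) {r : ℝ} (hr : 0 ≤ r) :
    volume (Metric.ball z r)
      = ENNReal.ofReal (r ^ (n + 1) * volume.real (Metric.ball (0 : E n) 1)) := by
  rw [← measureReal_ball z hr, measureReal_def, ENNReal.ofReal_toReal measure_ball_lt_top.ne]

lemma ballAvg_le_of_lintegral_cube_le {φ : E n → ℝ≥0∞} {z : E n} {r B : ℝ} (hr : 0 < r)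
    (h : ∫⁻ x in cube z (2 * r), φ x ≤ ENNReal.ofReal ((2 * r) ^ (n + 1) * B)) :
    ballAvg r φ z ≤ ENNReal.ofReal (ballConst n * B) := by
  have hω := measureReal_unitBall_pos n
  unfold ballAvg
  rw [volume_ball_eq_ofReal 0 hr.le, ← ENNReal.ofReal_inv_of_pos (by positivity)]
  have h1 : ∫⁻ y in Metric.ball z r, φ y ≤ ∫⁻ x in cube z (2 * r), φ x :=
    lintegral_mono_set (ball_subset_cube z r)
  refine (mul_le_mul_right (h1.trans h) _).trans ?_
  rw [← ENNReal.ofReal_mul (by positivity)]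
  refine ENNReal.ofReal_le_ofReal (le_of_eq ?_)
  unfold ballConst
  rw [mul_pow]
  field_simp

lemma HasOsc.ballAvg_le {C : ℝ} (hf : HasOsc f C) (a : ℂ) (z : E n) {r : ℝ} (hr : 0 < r) :
    ballAvg r (fun x => ‖f x - a‖ₑ) z
      ≤ ENNReal.ofReal (ballConst n * (C + ‖cAvg f z (2 * r) - a‖)) := by
  have h2r : 0 < 2 * r := by positivity
  refine ballAvg_le_of_lintegral_cube_le hr ?_
  have e : ∀ x, ‖f x - a‖ₑ = ENNReal.ofReal ‖f x - a‖ := fun x => (ofReal_norm _).symm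
  simp_rw [e]
  rw [ofReal_setAverage_cube z h2r (fun x => norm_nonneg _) (integrableOn_cube_norm_sub hf.1 a z _)]
  refine ENNReal.ofReal_le_ofReal ?_
  gcongr
  have hi := integrableOn_cube_norm_sub hf.1 (cAvg f z (2 * r)) z (2 * r)
  calc _ ≤ ⨍ x in cube z (2 * r), (‖f x - cAvg f z (2 * r)‖ + ‖cAvg f z (2 * r) - a‖) := by
        refine setAverage_cube_mono h2r (fun x => norm_nonneg _)
          (hi.add ((locallyIntegrable_const _).integrableOn_isCompact (isCompact_cube z _)))
          fun x _ => ?_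
        have : f x - a = (f x - cAvg f z (2 * r)) + (cAvg f z (2 * r) - a) := by ring
        rw [this]; exact norm_add_le _ _
    _ = _ := setAverage_add_const h2r hi _
    _ ≤ _ := by gcongr; exact hf.osc_le z _ h2r

/-- Gaussian means of the oscillation at the matching scale are bounded. -/
lemma HasOsc.gmean_le {C : ℝ} (hf : HasOsc f C) : ∃ D : ℝ, 0 ≤ D ∧ ∀ (y : E n) (r : ℝ), 0 < r →
    ∀ x ∈ Metric.ball y r,
      gmean (r ^ 2) (fun z => ‖f z - cAvg f y (2 * r)‖ₑ) x ≤ ENNReal.ofReal D := by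
  obtain ⟨M, hM, hmom⟩ := gmean_norm_sub n
  have hC := hf.nonneg
  set A := 16 * 2 ^ (n + 1) * C with hA
  have hA0 : 0 ≤ A := by positivity
  have hκ := ballConst_pos n
  have hS := shiftConst_pos n
  refine ⟨shiftConst n * (ballConst n * (C + A) + ballConst n * A * (1 + M * √2)), by positivity,
    fun y r hr x hx => ?_⟩
  have hm : AEMeasurable (fun z => ‖f z - cAvg f y (2 * r)‖ₑ) :=
    (locallyIntegrable_sub_const hf.1 _).aestronglyMeasurable.enorm
  refine (gmean_le_ballAvg (pow_pos hr 2) hr le_rfl hm x).trans ?_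
  rw [ENNReal.ofReal_mul hS.le]
  gcongr
  -- The averages over balls of radius r grow at most linearly in ‖z - y‖/r. A Gaussian mean at a
  -- time of order r², taken at a point of B(y, r), keeps this bounded.
  have h1 : ∀ z, ballAvg r (fun z => ‖f z - cAvg f y (2 * r)‖ₑ) z ≤
      ENNReal.ofReal (ballConst n * (C + A)) +
        ENNReal.ofReal (ballConst n * A / r) * ENNReal.ofReal ‖z - y‖ := by
    intro z
    refine (hf.ballAvg_le _ z hr).trans ?_
    rw [← ENNReal.ofReal_mul (by positivity), ← ENNReal.ofReal_add (by positivity) (by positivity)]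
    refine ENNReal.ofReal_le_ofReal ?_
    have h2 := hf.norm_cAvg_sub_cAvg_le_sqrt z y (l := 2 * r) (by positivity)
    have h3 : √(1 + ‖z - y‖ / (2 * r)) ≤ 1 + ‖z - y‖ / r := by
      refine Real.sqrt_le_iff.2 ⟨by positivity, ?_⟩
      have : ‖z - y‖ / (2 * r) ≤ ‖z - y‖ / r := by gcongr; linarith
      have h0 : 0 ≤ ‖z - y‖ / r := by positivity
      nlinarith
    have h4 : ‖cAvg f z (2 * r) - cAvg f y (2 * r)‖ ≤ A * (1 + ‖z - y‖ / r) :=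
      h2.trans (by gcongr)
    calc _ ≤ ballConst n * (C + A * (1 + ‖z - y‖ / r)) := by gcongr
      _ = _ := by field_simp; ring
  refine (gmean_mono h1 x).trans ?_
  rw [gmean_add aemeasurable_const, gmean_const (by positivity),
    gmean_const_mul ENNReal.ofReal_ne_top]
  have h5 := hmom (2 * r ^ 2) (by positivity) x y
  have hxy : ‖x - y‖ < r := by rw [← dist_eq_norm]; exact hx
  have h6 : √(2 * r ^ 2) = √2 * r := by rw [Real.sqrt_mul zero_le_two, Real.sqrt_sq hr.le]
  calc _ ≤ ENNReal.ofReal (ballConst n * (C + A)) + ENNReal.ofReal (ballConst n * A / r) *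
        ENNReal.ofReal (‖x - y‖ + M * √(2 * r ^ 2)) := by gcongr
    _ ≤ _ := by
        rw [← ENNReal.ofReal_mul (by positivity), ← ENNReal.ofReal_add (by positivity) (by positivity)]
        refine ENNReal.ofReal_le_ofReal (add_le_add_right ?_ _)
        rw [h6]
        calc _ ≤ ballConst n * A / r * (r + M * (√2 * r)) := by gcongr
          _ = _ := by field_simp

end SplitBMO

end

/-! ### Quadratic oscillation bound and polynomial growth of BMO functions. -/

noncomputable section

namespace SplitBMO

variable {n : ℕ}

/-! ### An `L²` form of the John-Nirenberg inequality -/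

section Tree

variable {κ ι : Type*} [Fintype ι] (child : κ → ι → κ) (m : κ → ℂ)

/-- The mean square deviation from `a` of the values `m` at the `k`-th generation of
descendants. -/
def treeVar : ℕ → κ → ℂ → ℝ
  | 0, Q, a => ‖m Q - a‖ ^ 2
  | k + 1, Q, a => (Fintype.card ι : ℝ)⁻¹ * ∑ e, treeVar k (child Q e) a

lemma treeVar_le_two_mul [Nonempty ι] (k : ℕ) (Q : κ) (a b : ℂ) :
    treeVar child m k Q a ≤ 2 * treeVar child m k Q b + 2 * ‖b - a‖ ^ 2 := by
  induction k generalizing Q with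
  | zero =>
    simp only [treeVar]
    have h : ‖m Q - a‖ ≤ ‖m Q - b‖ + ‖b - a‖ := by
      have := norm_add_le (m Q - b) (b - a); simpa using this
    nlinarith [norm_nonneg (m Q - a), sq_nonneg (‖m Q - b‖ - ‖b - a‖)]
  | succ k ih =>
    simp only [treeVar]
    have hN : (0 : ℝ) < Fintype.card ι := by exact_mod_cast Fintype.card_pos
    calc _ ≤ (Fintype.card ι : ℝ)⁻¹ *
          ∑ e, (2 * treeVar child m k (child Q e) b + 2 * ‖b - a‖ ^ 2) := by
          gcongr with e; exact ih _
      _ = _ := by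
          rw [Finset.sum_add_distrib, ← Finset.mul_sum, Finset.sum_const, Finset.card_univ,
            nsmul_eq_mul]
          field_simp

variable {child m}

/-- A Calderón-Zygmund stopping argument in the form of an induction over generations. Here M Q a
stands for the mean of |f - a| over Q, which averages exactly over the children. As long as the mean
of a child is within 4C of a, the induction continues with the same a. Otherwise the child is
recentred at its own mean, and the cost is charged to M/(4C), which exceeds 1 there. -/
lemma treeVar_le [Nonempty ι] {M : κ → ℂ → ℝ}
    (hM : ∀ Q a, ∑ e, M (child Q e) a = Fintype.card ι * M Q a)
    (hm : ∀ Q a, ‖m Q - a‖ ≤ M Q a) {C c : ℝ} (hC0 : 0 < C) (hc0 : 0 ≤ c)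
    (hC : ∀ Q, M Q (m Q) ≤ C) (hc : ∀ Q e, ‖m (child Q e) - m Q‖ ≤ c) (k : ℕ) (Q : κ) (a : ℂ)
    (ha : ‖m Q - a‖ ≤ 4 * C) :
    treeVar child m k Q a
      ≤ (4 * C) ^ 2 + (4 * (4 * C) ^ 2 + 4 * (4 * C + c) ^ 2) * (M Q a / (4 * C)) := by
  set K := 4 * C with hK
  set D := 4 * K ^ 2 + 4 * (K + c) ^ 2 with hD
  have hK0 : 0 < K := by positivity
  have hN : (0 : ℝ) < Fintype.card ι := by exact_mod_cast Fintype.card_pos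
  have hM0 : ∀ Q a, 0 ≤ M Q a := fun Q a => (norm_nonneg _).trans (hm Q a)
  induction k generalizing Q a with
  | zero =>
    simp only [treeVar]
    have h1 : ‖m Q - a‖ ^ 2 ≤ K ^ 2 := by gcongr
    have h2 : 0 ≤ D * (M Q a / K) := by have := hM0 Q a; positivity
    linarith
  | succ k ih =>
    have key : ∀ e, treeVar child m k (child Q e) a ≤ K ^ 2 + D * (M (child Q e) a / K) := by
      intro e
      by_cases h : ‖m (child Q e) - a‖ ≤ K
      · exact ih _ _ h
      · push Not at h
        set R := child Q e
        -- Restart at the stopped child R with its own mean, where M/K ≤ 1/4. The constant D is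
        -- chosen to close the recursion: 2(K² + D/4) + 2(K + c)² = D.
        have h1 := ih R (m R) (by simp [hK0.le])
        have h2 : M R (m R) / K ≤ 1 / 4 := by
          rw [div_le_iff₀ hK0]; have := hC R; linarith
        have h3 : treeVar child m k R (m R) ≤ K ^ 2 + D * (1 / 4) :=
          h1.trans (by gcongr)
        have h4 := treeVar_le_two_mul child m k R a (m R)
        have h5 : ‖m R - a‖ ≤ K + c := by
          have e1 : m R - a = (m R - m Q) + (m Q - a) := by ring
          rw [e1]
          refine (norm_add_le _ _).trans ?_
          have := hc Q e
          linarith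
        have h6 : ‖m R - a‖ ^ 2 ≤ (K + c) ^ 2 := by gcongr
        have h7 : 1 ≤ M R a / K := by
          rw [le_div_iff₀ hK0]; linarith [hm R a]
        have h8 : D ≤ D * (M R a / K) := le_mul_of_one_le_right (by positivity) h7
        nlinarith [sq_nonneg K]
    simp only [treeVar]
    calc _ ≤ (Fintype.card ι : ℝ)⁻¹ * ∑ e, (K ^ 2 + D * (M (child Q e) a / K)) := by
          gcongr with e; exact key e
      _ = _ := by
          rw [Finset.sum_add_distrib, ← Finset.mul_sum, ← Finset.sum_div, hM, Finset.sum_const,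
            Finset.card_univ, nsmul_eq_mul]
          field_simp

end Tree

/-! ### Half open cubes -/

/-- The half open cube with centre `c` and side `l`. -/
def hcube (c : E n) (l : ℝ) : Set (E n) := {x | ∀ i, -(l / 2) ≤ x i - c i ∧ x i - c i < l / 2}

lemma hcube_eq_preimage (c : E n) (l : ℝ) :
    hcube c l = (WithLp.ofLp : E n → Fin (n + 1) → ℝ) ⁻¹'
      (Set.pi univ fun i => Ico (c i - l / 2) (c i + l / 2)) := by
  ext x
  simp only [hcube, mem_preimage, mem_pi, mem_univ, true_implies, mem_Ico]
  refine forall_congr' fun i => ?_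
  constructor <;> rintro ⟨h1, h2⟩ <;> constructor <;> linarith

lemma measurableSet_hcube (c : E n) (l : ℝ) : MeasurableSet (hcube c l) := by
  rw [hcube_eq_preimage]
  exact (WithLp.measurable_ofLp 2 _) (MeasurableSet.univ_pi fun i => measurableSet_Ico)

lemma hcube_subset_cube (c : E n) (l : ℝ) : hcube c l ⊆ cube c l := fun _ hx i =>
  abs_le.2 ⟨(hx i).1, (hx i).2.le⟩

lemma hcube_ae_eq_cube (c : E n) (l : ℝ) : hcube c l =ᵐ[volume] cube c l := by
  rw [hcube_eq_preimage, cube_eq_preimage]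
  refine (PiLp.volume_preserving_ofLp (Fin (n + 1))).quasiMeasurePreserving.preimage_ae_eq ?_
  exact Measure.univ_pi_Ico_ae_eq_Icc

/-- The centres of the dyadic children of a cube. -/
def childCentre (c : E n) (l : ℝ) (e : Fin (n + 1) → Bool) : E n :=
  WithLp.toLp 2 fun i => c i + if e i then l / 4 else -(l / 4)

/-- The child containing a given point. -/
def childIndex (c x : E n) (i : Fin (n + 1)) : Bool := decide (c i ≤ x i)

/-- Half open sides make the children a genuine partition, so that `dyadicAvg` is defined at every
point and not just almost everywhere. -/
lemma mem_hcube_child {c x : E n} {l : ℝ} {e : Fin (n + 1) → Bool} :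
    x ∈ hcube (childCentre c l e) (l / 2) ↔ x ∈ hcube c l ∧ childIndex c x = e := by
  have : childIndex c x = e ↔ ∀ i, (c i ≤ x i ↔ e i = true) := by
    rw [funext_iff]
    refine forall_congr' fun i => ?_
    unfold childIndex
    by_cases h : c i ≤ x i <;> cases e i <;> simp [h]
  rw [this]
  simp only [hcube, childCentre, mem_ofPred_eq, ← forall_and]
  refine forall_congr' fun i => ?_
  cases e i
  · simp only [Bool.false_eq_true, if_false, iff_false, not_le]
    constructor
    · rintro ⟨h1, h2⟩; refine ⟨⟨?_, ?_⟩, ?_⟩ <;> linarith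
    · rintro ⟨⟨h1, h2⟩, h3⟩; constructor <;> linarith
  · simp only [if_true, iff_true]
    constructor
    · rintro ⟨h1, h2⟩; refine ⟨⟨?_, ?_⟩, ?_⟩ <;> linarith
    · rintro ⟨⟨h1, h2⟩, h3⟩; constructor <;> linarith

lemma hcube_eq_iUnion (c : E n) (l : ℝ) :
    hcube c l = ⋃ e, hcube (childCentre c l e) (l / 2) := by
  ext x
  simp [mem_hcube_child]

lemma pairwise_disjoint_child (c : E n) (l : ℝ) :
    Pairwise (Function.onFun Disjoint fun e => hcube (childCentre c l e) (l / 2)) := by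
  intro e e' hne
  rw [Function.onFun, Set.disjoint_left]
  intro x h1 h2
  exact hne ((mem_hcube_child.1 h1).2.symm.trans (mem_hcube_child.1 h2).2)

lemma measurable_childIndex (c : E n) : Measurable (childIndex c) := by
  rw [measurable_pi_iff]
  intro i
  refine measurable_to_bool ?_
  have : (fun x : E n => childIndex c x i) ⁻¹' {true} = {x | c i ≤ x i} := by
    ext x; simp [childIndex]
  rw [this]
  exact measurableSet_le measurable_const (by fun_prop)

/-- Centre and side of a cube. -/
abbrev CubeData (n : ℕ) : Type := {q : E n × ℝ // 0 < q.2}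

/-- The dyadic children of a cube. -/
def cubeChild (Q : CubeData n) (e : Fin (n + 1) → Bool) : CubeData n :=
  ⟨(childCentre Q.1.1 Q.1.2 e, Q.1.2 / 2), half_pos Q.2⟩

variable {f : E n → ℂ}

/-- The mean of a function on a cube. -/
def cubeMean (f : E n → ℂ) (Q : CubeData n) : ℂ := cAvg f Q.1.1 Q.1.2

/-- The dyadic averages of `f` of generation `k` in a cube. -/
def dyadicAvg (f : E n → ℂ) : ℕ → CubeData n → E n → ℂ
  | 0, Q, _ => cubeMean f Q
  | k + 1, Q, x => dyadicAvg f k (cubeChild Q (childIndex Q.1.1 x)) x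

lemma measurable_dyadicAvg (f : E n → ℂ) (k : ℕ) (Q : CubeData n) :
    Measurable (dyadicAvg f k Q) := by
  induction k generalizing Q with
  | zero => exact measurable_const
  | succ k ih =>
    have h : Measurable (fun p : (Fin (n + 1) → Bool) × E n => dyadicAvg f k (cubeChild Q p.1) p.2) :=
      measurable_from_prod_countable_right fun e => ih (cubeChild Q e)
    exact h.comp ((measurable_childIndex Q.1.1).prodMk measurable_id)

lemma lintegral_dyadicAvg (f : E n → ℂ) (a : ℂ) (k : ℕ) (Q : CubeData n) :
    ∫⁻ x in hcube Q.1.1 Q.1.2, ‖dyadicAvg f k Q x - a‖ₑ ^ 2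
      = ENNReal.ofReal (Q.1.2 ^ (n + 1) * treeVar cubeChild (cubeMean f) k Q a) := by
  have hpos : ∀ k (Q : CubeData n), 0 ≤ treeVar cubeChild (cubeMean f) k Q a := by
    intro k
    induction k with
    | zero => intro Q; simp only [treeVar]; positivity
    | succ k ih =>
      intro Q; simp only [treeVar]
      exact mul_nonneg (by positivity) (Finset.sum_nonneg fun e _ => ih _)
  induction k generalizing Q with
  | zero =>
    simp only [dyadicAvg, treeVar]
    rw [setLIntegral_const, measure_congr (hcube_ae_eq_cube _ _), volume_cube _ Q.2.le, mul_comm,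
      ENNReal.ofReal_mul (pow_nonneg Q.2.le _), ← ofReal_norm, ENNReal.ofReal_pow (norm_nonneg _)]
  | succ k ih =>
    have h2 : 0 < Q.1.2 := Q.2
    rw [hcube_eq_iUnion, lintegral_iUnion (fun e => measurableSet_hcube _ _)
      (pairwise_disjoint_child _ _), tsum_fintype]
    have h1 : ∀ e, ∫⁻ x in hcube (childCentre Q.1.1 Q.1.2 e) (Q.1.2 / 2),
        ‖dyadicAvg f (k + 1) Q x - a‖ₑ ^ 2 = ENNReal.ofReal ((Q.1.2 / 2) ^ (n + 1) *
          treeVar cubeChild (cubeMean f) k (cubeChild Q e) a) := by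
      intro e
      refine Eq.trans ?_ (ih (cubeChild Q e))
      refine setLIntegral_congr_fun (measurableSet_hcube _ _) fun x hx => ?_
      simp only [dyadicAvg, (mem_hcube_child.1 hx).2]
    simp_rw [h1]
    rw [← ENNReal.ofReal_sum_of_nonneg fun e _ => mul_nonneg (by positivity) (hpos _ _),
      ← Finset.mul_sum]
    congr 1
    simp only [treeVar, Fintype.card_fun, Fintype.card_bool, Fintype.card_fin, div_pow]
    push_cast
    field_simp

lemma exists_dyadicAvg_eq (f : E n → ℂ) (k : ℕ) (Q : CubeData n) {x : E n}
    (hx : x ∈ hcube Q.1.1 Q.1.2) :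
    ∃ c, x ∈ cube c (Q.1.2 / 2 ^ k) ∧ dyadicAvg f k Q x = cAvg f c (Q.1.2 / 2 ^ k) := by
  induction k generalizing Q with
  | zero => exact ⟨Q.1.1, by simpa using hcube_subset_cube _ _ hx, by simp [dyadicAvg, cubeMean]⟩
  | succ k ih =>
    obtain ⟨c, h1, h2⟩ := ih (cubeChild Q (childIndex Q.1.1 x)) (mem_hcube_child.2 ⟨hx, rfl⟩)
    have e : Q.1.2 / 2 ^ (k + 1) = Q.1.2 / 2 / 2 ^ k := by rw [pow_succ]; field_simp
    exact ⟨c, by rw [e]; exact h1, by rw [e]; exact h2⟩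

/-- Lebesgue differentiation along cubes. -/
lemma ae_tendsto_cAvg (hf : LocallyIntegrable f volume) : ∀ᵐ x, ∀ (c : ℕ → E n) (l : ℕ → ℝ),
    (∀ k, 0 < l k) → Filter.Tendsto l Filter.atTop (nhds 0) → (∀ k, x ∈ cube (c k) (l k)) →
    Filter.Tendsto (fun k => cAvg f (c k) (l k)) Filter.atTop (nhds (f x)) := by
  filter_upwards [IsUnifLocDoublingMeasure.ae_tendsto_average_norm_sub volume hf 1] with x hx c l
    hl0 hl hxc
  have hδ : Filter.Tendsto (fun k => ((n : ℝ) + 1) * (l k / 2)) Filter.atTop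
      (nhdsWithin 0 (Ioi 0)) := by
    refine tendsto_nhdsWithin_iff.2 ⟨?_, Filter.Eventually.of_forall fun k => ?_⟩
    · simpa using (hl.div_const 2).const_mul ((n : ℝ) + 1)
    · have := hl0 k; exact mem_Ioi.2 (by positivity)
  have h1 := hx c (fun k => ((n : ℝ) + 1) * (l k / 2)) hδ (Filter.Eventually.of_forall fun k => by
    rw [one_mul]; exact cube_subset_closedBall _ _ (hxc k))
  rw [tendsto_iff_norm_sub_tendsto_zero]
  set w₀ := volume.real (Metric.closedBall (0 : E n) 1)
  have h2 := h1.const_mul ((((n : ℝ) + 1) / 2) ^ (n + 1) * w₀)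
  rw [mul_zero] at h2
  refine squeeze_zero (fun k => norm_nonneg _) (fun k => ?_) h2
  have hlk := hl0 k
  refine (norm_cAvg_sub_le hf (f x) (c k) hlk).trans ?_
  have hB : volume.real (Metric.closedBall (c k) (((n : ℝ) + 1) * (l k / 2)))
      = (((n : ℝ) + 1) * (l k / 2)) ^ (n + 1) * w₀ := by
    rw [measureReal_def, Measure.addHaar_closedBall' volume _ (by positivity), ENNReal.toReal_mul,
      ENNReal.toReal_ofReal (by positivity)]
    simp [w₀, measureReal_def]
  have hw₀ : 0 < w₀ := ENNReal.toReal_pos (Metric.measure_closedBall_pos volume _ one_pos).ne'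
    (isCompact_closedBall _ _).measure_lt_top.ne
  rw [setAverage_cube_eq _ hlk, setAverage_eq, hB, smul_eq_mul, smul_eq_mul]
  have h3 : ∫ y in cube (c k) (l k), ‖f y - f x‖
      ≤ ∫ y in Metric.closedBall (c k) (((n : ℝ) + 1) * (l k / 2)), ‖f y - f x‖ :=
    setIntegral_mono_set
      ((locallyIntegrable_sub_const hf (f x)).integrableOn_isCompact (isCompact_closedBall _ _)).norm
      (Filter.Eventually.of_forall fun y => norm_nonneg _) (cube_subset_closedBall _ _).eventuallyLE
  calc _ ≤ (l k ^ (n + 1))⁻¹ *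
      ∫ y in Metric.closedBall (c k) (((n : ℝ) + 1) * (l k / 2)), ‖f y - f x‖ := by gcongr
    _ = _ := by
      have e : ((n : ℝ) + 1) * (l k / 2) = ((n : ℝ) + 1) / 2 * l k := by ring
      rw [e, mul_pow]
      field_simp

/-- The `L²` form of the John-Nirenberg inequality. -/
lemma HasOsc.exists_sq_bound {C : ℝ} (hf : HasOsc f C) : ∃ A : ℝ, 0 ≤ A ∧ ∀ (c : E n) (l : ℝ),
    0 < l → ∫⁻ x in cube c l, ‖f x - cAvg f c l‖ₑ ^ 2 ≤ ENNReal.ofReal (l ^ (n + 1) * A) := by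
  have hC := hf.nonneg
  -- `treeVar_le` requires a positive constant, whereas C may be 0.
  set C' := C + 1
  have hC' : 0 < C' := by positivity
  set M : CubeData n → ℂ → ℝ := fun Q a => ⨍ x in cube Q.1.1 Q.1.2, ‖f x - a‖ with hM
  set D := 2 ^ (n + 1) * C
  set A := (4 * C') ^ 2 + (4 * (4 * C') ^ 2 + 4 * (4 * C' + D) ^ 2) * (1 / 4)
  have hvar : ∀ k (Q : CubeData n), treeVar cubeChild (cubeMean f) k Q (cubeMean f Q) ≤ A := by
    intro k Q
    have hMm : ∀ Q, M Q (cubeMean f Q) ≤ C' := fun Q =>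
      (hf.osc_le _ _ Q.2).trans (le_add_of_nonneg_right zero_le_one)
    refine (treeVar_le (M := M) ?_ (fun Q a => norm_cAvg_sub_le hf.1 a _ Q.2) hC' (c := D)
      (by positivity) hMm ?_ k Q _ (by rw [cubeMean, sub_self, norm_zero]; positivity)).trans ?_
    · intro Q a
      have h2 : 0 < Q.1.2 := Q.2
      have hi : IntegrableOn (fun x => ‖f x - a‖) (hcube Q.1.1 Q.1.2) :=
        (integrableOn_cube_norm_sub hf.1 a Q.1.1 Q.1.2).mono_set (hcube_subset_cube _ _)
      have h3 : ∫ x in cube Q.1.1 Q.1.2, ‖f x - a‖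
          = ∑ e, ∫ x in cube (childCentre Q.1.1 Q.1.2 e) (Q.1.2 / 2), ‖f x - a‖ := by
        rw [← setIntegral_congr_set (hcube_ae_eq_cube Q.1.1 Q.1.2)]
        rw [hcube_eq_iUnion] at hi ⊢
        rw [integral_iUnion (fun e => measurableSet_hcube _ _) (pairwise_disjoint_child _ _) hi,
          tsum_fintype]
        exact Finset.sum_congr rfl fun e _ => setIntegral_congr_set (hcube_ae_eq_cube _ _)
      simp only [hM, cubeChild]
      rw [setAverage_cube_eq _ h2, h3]
      have h4 : ∀ e, ⨍ x in cube (childCentre Q.1.1 Q.1.2 e) (Q.1.2 / 2), ‖f x - a‖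
          = ((Q.1.2 / 2) ^ (n + 1))⁻¹ *
            ∫ x in cube (childCentre Q.1.1 Q.1.2 e) (Q.1.2 / 2), ‖f x - a‖ := fun e =>
        setAverage_cube_eq _ (half_pos h2) _
      simp_rw [h4]
      rw [← Finset.mul_sum, smul_eq_mul, ← mul_assoc]
      congr 1
      simp only [Fintype.card_fun, Fintype.card_bool, Fintype.card_fin, div_pow]
      push_cast
      field_simp
    · intro Q e
      have h2 : 0 < Q.1.2 := Q.2
      have h := hf.norm_cAvg_sub_cAvg_le (c := childCentre Q.1.1 Q.1.2 e) (c' := Q.1.1)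
        (half_pos h2) h2 ?_
      · rwa [div_div_cancel₀ h2.ne'] at h
      · intro x hx i
        have h5 := hx i
        have h6 : x i - Q.1.1 i = (x i - childCentre Q.1.1 Q.1.2 e i)
            + if e i then Q.1.2 / 4 else -(Q.1.2 / 4) := by
          simp only [childCentre]; ring
        rw [h6]
        refine (abs_add_le _ _).trans ?_
        have h7 : |if e i then Q.1.2 / 4 else -(Q.1.2 / 4)| = Q.1.2 / 4 := by
          split_ifs
          · exact abs_of_pos (by positivity)
          · rw [abs_neg, abs_of_pos (by positivity)]
        rw [h7]; linarith
    · have h8 : M Q (cubeMean f Q) / (4 * C') ≤ 1 / 4 := by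
        rw [div_le_iff₀ (by positivity)]; linarith [hMm Q]
      simp only [A]
      gcongr
  refine ⟨A, by positivity, fun c l hl => ?_⟩
  set Q : CubeData n := ⟨(c, l), hl⟩
  rw [← setLIntegral_congr (hcube_ae_eq_cube c l)]
  -- Dyadic averages converge to f almost everywhere, and Fatou's lemma transfers to f the bound
  -- that is uniform in the generation.
  have hlim : ∀ᵐ x ∂volume.restrict (hcube c l), ‖f x - cAvg f c l‖ₑ ^ 2
      = Filter.liminf (fun k => ‖dyadicAvg f k Q x - cAvg f c l‖ₑ ^ 2) Filter.atTop := by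
    filter_upwards [ae_restrict_of_ae (ae_tendsto_cAvg hf.1),
      ae_restrict_mem (measurableSet_hcube c l)] with x h1 h2
    choose p hp1 hp2 using fun k => exists_dyadicAvg_eq f k Q h2
    have hl0 : Filter.Tendsto (fun k => l / 2 ^ k) Filter.atTop (nhds 0) := by
      have := (tendsto_pow_atTop_nhds_zero_of_lt_one (r := (1 / 2 : ℝ)) (by norm_num)
        (by norm_num)).const_mul l
      rw [mul_zero] at this
      refine this.congr fun k => ?_
      rw [one_div, inv_pow, div_eq_mul_inv]
    have h3 := h1 p (fun k => l / 2 ^ k) (fun k => by positivity) hl0 hp1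
    have h4 : Filter.Tendsto (fun k => dyadicAvg f k Q x) Filter.atTop (nhds (f x)) :=
      h3.congr fun k => (hp2 k).symm
    have h5 := ((ENNReal.continuous_pow 2).tendsto _).comp ((h4.sub_const (cAvg f c l)).enorm)
    exact h5.liminf_eq.symm
  rw [lintegral_congr_ae hlim]
  refine (lintegral_liminf_le fun k =>
    ((measurable_dyadicAvg f k Q).sub_const _).enorm.pow_const 2).trans ?_
  refine Filter.liminf_le_of_le (by isBoundedDefault) fun b hb => ?_
  obtain ⟨k, hk⟩ := hb.exists
  refine hk.trans ?_
  rw [lintegral_dyadicAvg f _ k Q]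
  refine ENNReal.ofReal_le_ofReal ?_
  gcongr
  exact hvar k Q

/-- Functions of bounded mean oscillation have polynomial growth in quadratic mean. -/
theorem BMO_subset_classM : BMO n ⊆ classM n := by
  intro f hf
  obtain ⟨C, hf⟩ := mem_BMO_iff.1 hf
  have hC := hf.nonneg
  obtain ⟨A, hA, hsq⟩ := hf.exists_sq_bound
  -- With d = 2 the dyadic sum converges: the integral of |f|² over a cube of side 4·2^k is
  -- O(2^(k(n+2))), since the squared mean grows at most like k², and the weight is of order
  -- 2^(-k(n+3)).
  refine ⟨hf.1, 2, by norm_num, ?_⟩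
  set m₀ := ‖cAvg f 0 4‖
  set D := 2 ^ (n + 1) * C
  set B := 4 ^ (n + 1) * (2 * A + 4 * m₀ ^ 2 + 16 * D ^ 2)
  have hm : ∀ k : ℕ, ‖cAvg f 0 (2 ^ k * 4)‖ ^ 2 ≤ 2 * m₀ ^ 2 + 8 * D ^ 2 * 2 ^ k := by
    intro k
    have h1 := hf.norm_cAvg_double 0 (l := 4) (by norm_num) k
    have h2 : ‖cAvg f 0 (2 ^ k * 4)‖ ≤ m₀ + k * D := by
      have e : cAvg f 0 (2 ^ k * 4) = cAvg f 0 4 - (cAvg f 0 4 - cAvg f 0 (2 ^ k * 4)) := by ring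
      rw [e]
      exact (norm_sub_le _ _).trans (by gcongr)
    have h3 := HasOsc.sq_le_four_mul_two_pow k
    calc _ ≤ (m₀ + k * D) ^ 2 := by gcongr
      _ ≤ 2 * m₀ ^ 2 + 2 * ((k : ℝ) ^ 2 * D ^ 2) := by nlinarith [sq_nonneg (m₀ - k * D)]
      _ ≤ 2 * m₀ ^ 2 + 2 * ((4 * 2 ^ k) * D ^ 2) := by gcongr
      _ = _ := by ring
  have hcube : ∀ k : ℕ, ∫⁻ x in cube (0 : E n) (2 ^ k * 4), ‖f x‖ₑ ^ 2
      ≤ ENNReal.ofReal (B * (2 ^ k) ^ (n + 2)) := by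
    intro k
    set l : ℝ := 2 ^ k * 4
    have hl : 0 < l := by positivity
    set a := cAvg f 0 l
    have h1 : ∀ x, ‖f x‖ₑ ^ 2 ≤ 2 * ‖f x - a‖ₑ ^ 2 + ENNReal.ofReal (2 * ‖a‖ ^ 2) := by
      intro x
      rw [← ofReal_norm, ← ofReal_norm, ← ENNReal.ofReal_pow (norm_nonneg _),
        ← ENNReal.ofReal_pow (norm_nonneg _), ← ENNReal.ofReal_ofNat,
        ← ENNReal.ofReal_mul zero_le_two, ← ENNReal.ofReal_add (by positivity) (by positivity)]
      refine ENNReal.ofReal_le_ofReal ?_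
      have h2 : ‖f x‖ ≤ ‖f x - a‖ + ‖a‖ := by simpa using norm_add_le (f x - a) a
      nlinarith [norm_nonneg (f x), sq_nonneg (‖f x - a‖ - ‖a‖)]
    calc _ ≤ ∫⁻ x in cube (0 : E n) l, (2 * ‖f x - a‖ₑ ^ 2 + ENNReal.ofReal (2 * ‖a‖ ^ 2)) :=
          lintegral_mono h1
      _ = 2 * (∫⁻ x in cube (0 : E n) l, ‖f x - a‖ₑ ^ 2)
          + ENNReal.ofReal (2 * ‖a‖ ^ 2) * ENNReal.ofReal (l ^ (n + 1)) := by
          rw [lintegral_add_right _ measurable_const, lintegral_const_mul' _ _ (by norm_num),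
            setLIntegral_const, volume_cube _ hl.le]
      _ ≤ 2 * ENNReal.ofReal (l ^ (n + 1) * A)
          + ENNReal.ofReal (2 * ‖a‖ ^ 2) * ENNReal.ofReal (l ^ (n + 1)) := by
          gcongr; exact hsq 0 l hl
      _ = ENNReal.ofReal (l ^ (n + 1) * (2 * A + 2 * ‖a‖ ^ 2)) := by
          rw [← ENNReal.ofReal_ofNat, ← ENNReal.ofReal_mul zero_le_two,
            ← ENNReal.ofReal_mul (by positivity), ← ENNReal.ofReal_add (by positivity)
            (by positivity)]
          congr 1; ring
      _ ≤ _ := by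
          refine ENNReal.ofReal_le_ofReal ?_
          have h3 : (1 : ℝ) ≤ 2 ^ k := one_le_pow₀ (by norm_num)
          have h4 : 2 * A + 2 * ‖a‖ ^ 2 ≤ (2 * A + 4 * m₀ ^ 2 + 16 * D ^ 2) * 2 ^ k := by
            have h5 := hm k
            have h6 : 2 * A + 4 * m₀ ^ 2 ≤ (2 * A + 4 * m₀ ^ 2) * 2 ^ k :=
              le_mul_of_one_le_right (by positivity) h3
            nlinarith
          calc _ ≤ l ^ (n + 1) * ((2 * A + 4 * m₀ ^ 2 + 16 * D ^ 2) * 2 ^ k) := by gcongr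
            _ = _ := by simp only [l, B]; ring
  have hpt : ∀ x : E n, ‖‖f x‖ ^ 2 / (1 + ‖x‖ ^ ((n : ℝ) + 1 + 2))‖ₑ ≤
      ∑' k : ℕ, ENNReal.ofReal (2 ^ (n + 2) / (2 ^ k) ^ (n + 3)) *
        (cube (0 : E n) (2 ^ k * 4)).indicator (fun x => ‖f x‖ₑ ^ 2) x := by
    intro x
    obtain ⟨k, hk1, hk2⟩ := exists_nat_pow_near (x := 1 + ‖x‖) (y := 2) (by simp) (by norm_num)
    refine le_trans ?_ (ENNReal.le_tsum k)
    have hmem : x ∈ cube (0 : E n) (2 ^ k * 4) := by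
      intro i
      have := abs_coord_le_norm x i
      rw [pow_succ] at hk2
      simp only [PiLp.zero_apply, sub_zero]
      linarith
    rw [indicator_of_mem hmem, ← ofReal_norm, ← ofReal_norm, Real.norm_of_nonneg (by positivity),
      ← ENNReal.ofReal_pow (norm_nonneg _), ← ENNReal.ofReal_mul (by positivity)]
    refine ENNReal.ofReal_le_ofReal ?_
    have hp : ‖x‖ ^ ((n : ℝ) + 1 + 2) = ‖x‖ ^ (n + 3) := by
      rw [← Real.rpow_natCast]; congr 1; push_cast; ring
    rw [hp]
    have h1 : (2 ^ k : ℝ) ^ (n + 3) ≤ 2 ^ (n + 2) * (1 + ‖x‖ ^ (n + 3)) := by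
      calc _ ≤ (1 + ‖x‖) ^ (n + 3) := by gcongr
        _ ≤ 2 ^ (n + 3 - 1) * (1 ^ (n + 3) + ‖x‖ ^ (n + 3)) :=
          add_pow_le zero_le_one (norm_nonneg _) _
        _ = _ := by simp
    rw [div_le_iff₀ (by positivity)]
    have h2 : 1 ≤ 2 ^ (n + 2) / (2 ^ k : ℝ) ^ (n + 3) * (1 + ‖x‖ ^ (n + 3)) := by
      rw [div_mul_eq_mul_div, le_div_iff₀ (by positivity), one_mul]; exact h1
    nlinarith [sq_nonneg ‖f x‖]
  have haes : AEMeasurable (fun x => ‖f x‖ₑ ^ 2) := hf.1.aestronglyMeasurable.enorm.pow_const 2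
  have hmeas : AEStronglyMeasurable (fun x => ‖f x‖ ^ 2 / (1 + ‖x‖ ^ ((n : ℝ) + 1 + 2))) volume :=
    ((hf.1.aestronglyMeasurable.norm.aemeasurable.pow_const 2).div
      (by fun_prop : Measurable fun x : E n => 1 + ‖x‖ ^ ((n : ℝ) + 1 + 2)).aemeasurable).aestronglyMeasurable
  refine ⟨hmeas, ?_⟩
  have hsum : Summable fun k : ℕ => 2 ^ (n + 2) * B * (1 / 2 : ℝ) ^ k :=
    (summable_geometric_of_lt_one (by norm_num) (by norm_num)).mul_left _
  calc ∫⁻ x, ‖‖f x‖ ^ 2 / (1 + ‖x‖ ^ ((n : ℝ) + 1 + 2))‖ₑ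
      ≤ ∫⁻ x, ∑' k : ℕ, ENNReal.ofReal (2 ^ (n + 2) / (2 ^ k) ^ (n + 3)) *
        (cube (0 : E n) (2 ^ k * 4)).indicator (fun x => ‖f x‖ₑ ^ 2) x := lintegral_mono hpt
    _ = ∑' k : ℕ, ENNReal.ofReal (2 ^ (n + 2) / (2 ^ k) ^ (n + 3)) *
        ∫⁻ x in cube (0 : E n) (2 ^ k * 4), ‖f x‖ₑ ^ 2 := by
        rw [lintegral_tsum fun k => (haes.indicator (measurableSet_cube _ _)).const_mul _]
        congr 1; ext k
        rw [lintegral_const_mul' _ _ ENNReal.ofReal_ne_top, lintegral_indicator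
          (measurableSet_cube _ _)]
    _ ≤ ∑' k : ℕ, ENNReal.ofReal (2 ^ (n + 2) * B * (1 / 2 : ℝ) ^ k) := by
        refine ENNReal.tsum_le_tsum fun k => ?_
        refine (mul_le_mul_right (hcube k) _).trans ?_
        rw [← ENNReal.ofReal_mul (by positivity)]
        refine ENNReal.ofReal_le_ofReal (le_of_eq ?_)
        rw [one_div, inv_pow, pow_succ (2 ^ k : ℝ) (n + 2)]
        field_simp
    _ < ⊤ := hsum.tsum_ofReal_lt_top

end SplitBMO

end

/-! ### Regularity of the split semigroups; BMO inside the Neumann space. -/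

noncomputable section

namespace SplitBMO

variable {n : ℕ} {a b t : ℝ} {f : E n → ℂ}

/-! ### Regularity estimates for the split semigroup -/

lemma gauss_sub_refl_le (ht : 0 < t) {ε : ℝ} {x y : E n} (hx : x ∈ hs n ε) (hy : y ∈ hs n ε) :
    gauss t (x - refl n y) ≤ gauss t (x - y) :=
  gauss_le_of_norm_le ht (norm_sub_le_norm_sub_refl (mul_lastCoord_pos hx hy).le)

/-- The constant in the Lipschitz estimates. -/
def lipConst (n : ℕ) : ℝ := 2 ^ (((n : ℝ) + 1) / 2)

lemma lipConst_pos (n : ℕ) : 0 < lipConst n := by unfold lipConst; positivity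

lemma abs_hkern_sub_le {ε σ : ℝ} (hσ : |σ| ≤ 1) (ht : 0 < t) {x x' : E n} (hx : x ∈ hs n ε)
    (hx' : x' ∈ hs n ε) (y : E n) :
    |hkern ε σ t x y - hkern ε σ t x' y| ≤ 2 * lipConst n * (‖x - x'‖ / √t) *
      (gauss (2 * t) (x - y) + gauss (2 * t) (x' - y)) := by
  have h2t : 0 < 2 * t := by positivity
  have hL := lipConst_pos n
  have g1 := gauss_nonneg h2t (x - y)
  have g2 := gauss_nonneg h2t (x' - y)
  by_cases hy : y ∈ hs n ε
  swap
  · rw [hkern_eq_zero_of_notMem_right _ hy, hkern_eq_zero_of_notMem_right _ hy, sub_zero, abs_zero]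
    positivity
  rw [hkern_of_mem hx hy, hkern_of_mem hx' hy]
  have e1 : (x - y) - (x' - y) = x - x' := by abel
  have e2 : (x - refl n y) - (x' - refl n y) = x - x' := by abel
  have h1 := gauss_lip ht (x - y) (x' - y)
  have h2 := gauss_lip ht (x - refl n y) (x' - refl n y)
  rw [e1] at h1
  rw [e2] at h2
  have h3 := gauss_sub_refl_le h2t hx hy
  have h4 := gauss_sub_refl_le h2t hx' hy
  have e : gauss t (x - y) + σ * gauss t (x - refl n y)
      - (gauss t (x' - y) + σ * gauss t (x' - refl n y))
      = (gauss t (x - y) - gauss t (x' - y))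
        + σ * (gauss t (x - refl n y) - gauss t (x' - refl n y)) := by ring
  rw [e]
  change _ ≤ lipConst n * (‖x - x'‖ / √t) * _ at h1 h2
  set B := lipConst n * (‖x - x'‖ / √t)
  have hB : 0 ≤ B := by positivity
  calc _ ≤ |gauss t (x - y) - gauss t (x' - y)|
        + |σ| * |gauss t (x - refl n y) - gauss t (x' - refl n y)| := by
        rw [← abs_mul]; exact abs_add_le _ _
    _ ≤ B * (gauss (2 * t) (x - y) + gauss (2 * t) (x' - y))
        + 1 * (B * (gauss (2 * t) (x - y) + gauss (2 * t) (x' - y))) := by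
        gcongr
        refine h2.trans ?_
        gcongr
    _ = _ := by simp only [B]; ring

lemma enorm_integral_mul_le_of_abs_le {K g : E n → ℝ} (hg : ∀ y, |K y| ≤ g y) (f : E n → ℂ) :
    ‖∫ y, (K y : ℂ) * f y‖ₑ ≤ ∫⁻ y, ENNReal.ofReal (g y) * ‖f y‖ₑ := by
  refine (enorm_integral_le_lintegral_enorm _).trans (lintegral_mono fun y => ?_)
  rw [enorm_mul]
  gcongr
  rw [← ofReal_norm, Complex.norm_real]
  exact ENNReal.ofReal_le_ofReal (hg y)

/-- Both terms of the kernel are Lipschitz at scale √t. The two points must lie on the same side,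
since the kernel may jump across the hyperplane. -/
lemma enorm_kernelApply_sub_le (hf : GInt f) (ha : |a| ≤ 1) (hb : |b| ≤ 1) (ht : 0 < t)
    {x x' : E n} (h : (x ∈ hs n 1 ∧ x' ∈ hs n 1) ∨ (x ∈ hs n (-1) ∧ x' ∈ hs n (-1))) :
    ‖kernelApply (pk a b) t f x - kernelApply (pk a b) t f x'‖ₑ
      ≤ ENNReal.ofReal (2 * lipConst n * (‖x - x'‖ / √t)) *
        (gmean (2 * t) (fun y => ‖f y‖ₑ) x + gmean (2 * t) (fun y => ‖f y‖ₑ) x') := by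
  have h2t : 0 < 2 * t := by positivity
  have hL := lipConst_pos n
  have hb : ∀ y, |pk a b t x y - pk a b t x' y| ≤ 2 * lipConst n * (‖x - x'‖ / √t) *
      (gauss (2 * t) (x - y) + gauss (2 * t) (x' - y)) := by
    intro y
    rcases h with ⟨h1, h2⟩ | ⟨h1, h2⟩
    · rw [pk_of_mem_up h1, pk_of_mem_up h2]; exact abs_hkern_sub_le ha ht h1 h2 y
    · rw [pk_of_mem_low h1, pk_of_mem_low h2]; exact abs_hkern_sub_le hb ht h1 h2 y
  have e : kernelApply (pk a b) t f x - kernelApply (pk a b) t f x'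
      = ∫ y, ((pk a b t x y - pk a b t x' y : ℝ) : ℂ) * f y := by
    unfold kernelApply
    rw [← integral_sub (hf.integrable_pk ha ‹|b| ≤ 1› ht x) (hf.integrable_pk ha ‹|b| ≤ 1› ht x')]
    congr 1; ext y; push_cast; ring
  rw [e]
  refine (enorm_integral_mul_le_of_abs_le hb f).trans (le_of_eq ?_)
  have hm : AEMeasurable (fun y => ENNReal.ofReal (gauss (2 * t) (x - y)) * ‖f y‖ₑ) volume :=
    (measurable_ofReal_gauss _ x).aemeasurable.mul hf.aemeasurable_enorm
  unfold gmean
  rw [← lintegral_add_left' hm, ← lintegral_const_mul' _ _ ENNReal.ofReal_ne_top]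
  congr 1; ext y
  rw [ENNReal.ofReal_mul (by positivity), ENNReal.ofReal_add (gauss_nonneg h2t _)
    (gauss_nonneg h2t _), mul_assoc, add_mul]

/-- The Dirichlet kernel is the difference of the Gaussians centred at x and at its mirror image,
2|x_n| apart; this is its decay at the boundary. -/
lemma abs_hkern_neg_one_le {ε : ℝ} (ht : 0 < t) (x y : E n) :
    |hkern ε (-1) t x y| ≤ 4 * lipConst n * (|lastCoord x| / √t) * gauss (2 * t) (x - y) := by
  have h2t : 0 < 2 * t := by positivity
  have hL := lipConst_pos n
  have g1 := gauss_nonneg h2t (x - y)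
  by_cases hx : x ∈ hs n ε
  swap
  · rw [hkern_eq_zero_of_notMem_left hx, abs_zero]; positivity
  by_cases hy : y ∈ hs n ε
  swap
  · rw [hkern_eq_zero_of_notMem_right _ hy, abs_zero]; positivity
  rw [hkern_of_mem hx hy]
  have h1 := gauss_lip ht (x - y) (refl n x - y)
  have e1 : (x - y) - (refl n x - y) = x - refl n x := by abel
  rw [e1, norm_sub_refl_self, gauss_refl_sub, gauss_refl_sub] at h1
  change _ ≤ lipConst n * _ * _ at h1
  have h3 := gauss_sub_refl_le h2t hx hy
  rw [neg_one_mul, ← sub_eq_add_neg]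
  calc _ ≤ _ := h1
    _ ≤ lipConst n * (2 * |lastCoord x| / √t) * (gauss (2 * t) (x - y) + gauss (2 * t) (x - y)) := by
        gcongr
    _ = _ := by ring

lemma enorm_kernelApply_dirichlet_le (ht : 0 < t) (f : E n → ℂ) (x : E n) :
    ‖kernelApply (pk (-1) (-1)) t f x‖ₑ
      ≤ ENNReal.ofReal (4 * lipConst n * (|lastCoord x| / √t)) * gmean (2 * t) (fun y => ‖f y‖ₑ) x := by
  have hL := lipConst_pos n
  have h2t : 0 < 2 * t := by positivity
  have hb : ∀ y, |pk (-1) (-1) t x y|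
      ≤ 4 * lipConst n * (|lastCoord x| / √t) * gauss (2 * t) (x - y) := by
    intro y
    by_cases h1 : x ∈ hs n 1
    · rw [pk_of_mem_up h1]; exact abs_hkern_neg_one_le ht x y
    · by_cases h2 : x ∈ hs n (-1)
      · rw [pk_of_mem_low h2]; exact abs_hkern_neg_one_le ht x y
      · rw [pk_of_notMem h1 h2, abs_zero]
        have := gauss_nonneg h2t (x - y); positivity
  refine (enorm_integral_le_lintegral_enorm _).trans ?_
  exact GInt.enorm_integral_le (by positivity) hb

/-! ### The Neumann semigroup and bounded mean oscillation -/

lemma gint_const (c : ℂ) : GInt (fun _ : E n => c) :=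
  ⟨aestronglyMeasurable_const, fun t ht x => by rw [gmean_const ht]; exact enorm_lt_top⟩

/-- The even reflection folds the whole mass of the Gaussian back into the half space. -/
lemma integral_pk_neumann (ht : 0 < t) {x : E n} (hx : x ∈ hs n 1 ∨ x ∈ hs n (-1)) :
    ∫ y, pk 1 1 t x y = 1 := by
  have key : ∀ ε : ℝ, (ε = 1 ∨ ε = -1) → x ∈ hs n ε → ∫ y, hkern ε 1 t x y = 1 := by
    intro ε hε hx
    have h1 := integral_hkern_eq (σ := 1) (t := t) hx (fun _ => 1)
    simp only [mul_one, one_mul] at h1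
    rw [h1, setIntegral_hs_add (φ := fun y => gauss t (x - y)) (integrable_gauss_sub ht x) hε,
      integral_gauss_sub ht]
  rcases hx with h | h
  · simp_rw [pk_of_mem_up h]; exact key 1 (Or.inl rfl) h
  · simp_rw [pk_of_mem_low h]; exact key (-1) (Or.inr rfl) h

lemma kernelApply_neumann_const (ht : 0 < t) (c : ℂ) {x : E n} (hx : x ∈ hs n 1 ∨ x ∈ hs n (-1)) :
    kernelApply (pk 1 1) t (fun _ => c) x = c := by
  unfold kernelApply
  rw [integral_mul_const, integral_complex_ofReal, integral_pk_neumann ht hx]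
  simp

/-- Constants are preserved, so c may be subtracted from f on both occurrences. -/
lemma enorm_sub_kernelApply_neumann_le (hf : GInt f) (ht : 0 < t) (c : ℂ) {x : E n}
    (hx : x ∈ hs n 1 ∨ x ∈ hs n (-1)) :
    ‖f x - kernelApply (pk 1 1) t f x‖ₑ
      ≤ ‖f x - c‖ₑ + 2 * gmean t (fun y => ‖f y - c‖ₑ) x := by
  have h1 : |(1 : ℝ)| ≤ 1 := by simp
  have h2 := kernelApply_sub hf (gint_const c) h1 h1 ht x
  rw [kernelApply_neumann_const ht c hx] at h2
  have e : f x - kernelApply (pk 1 1) t f x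
      = (f x - c) - kernelApply (pk 1 1) t (fun y => f y - c) x := by rw [h2]; ring
  rw [e]
  refine (enorm_sub_le).trans ?_
  gcongr
  exact enorm_kernelApply_le h1 h1 ht _ x

lemma HasOsc.norm_sub_kernelApply_neumann_le {C : ℝ} (hf : HasOsc f C) : ∃ D : ℝ, 0 ≤ D ∧
    ∀ (y : E n) (r : ℝ), 0 < r → ∀ x ∈ Metric.ball y r, (x ∈ hs n 1 ∨ x ∈ hs n (-1)) →
      ‖f x - kernelApply (pk 1 1) (r ^ 2) f x‖ ≤ ‖f x - cAvg f y (2 * r)‖ + D := by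
  obtain ⟨D, hD, h⟩ := hf.gmean_le
  have hG := gint_of_mem_classM (BMO_subset_classM (mem_BMO_iff.2 ⟨C, hf⟩))
  refine ⟨2 * D, by positivity, fun y r hr x hx hx' => ?_⟩
  have h1 := enorm_sub_kernelApply_neumann_le hG (pow_pos hr 2) (cAvg f y (2 * r)) hx'
  have h2 : ‖f x - kernelApply (pk 1 1) (r ^ 2) f x‖ₑ
      ≤ ENNReal.ofReal (‖f x - cAvg f y (2 * r)‖ + 2 * D) := by
    refine h1.trans ?_
    rw [ENNReal.ofReal_add (norm_nonneg _) (by positivity), ofReal_norm,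
      ENNReal.ofReal_mul zero_le_two, ENNReal.ofReal_ofNat]
    gcongr
    exact h y r hr x hx
  rw [← ofReal_norm] at h2
  exact (ENNReal.ofReal_le_ofReal_iff (by positivity)).1 h2

lemma HasOsc.setAverage_ball_le {C : ℝ} (hf : HasOsc f C) {D : ℝ} {g : E n → ℂ} {y : E n}
    {r : ℝ} (hr : 0 < r)
    (hg : ∀ᵐ x, x ∈ Metric.ball y r → ‖g x‖ ≤ ‖f x - cAvg f y (2 * r)‖ + D) :
    ⨍ x in Metric.ball y r, ‖g x‖ ≤ ballConst n * C + D := by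
  have h2r : 0 < 2 * r := by positivity
  set m := cAvg f y (2 * r)
  have hi := integrableOn_cube_norm_sub hf.1 m y (2 * r)
  have hib : IntegrableOn (fun x => ‖f x - m‖) (Metric.ball y r) := hi.mono_set (ball_subset_cube y r)
  have hV : volume.real (Metric.ball y r) = r ^ (n + 1) * volume.real (Metric.ball (0 : E n) 1) :=
    measureReal_ball y hr.le
  have hω := measureReal_unitBall_pos n
  have hV0 : 0 < volume.real (Metric.ball y r) := by rw [hV]; positivity
  have hc : IntegrableOn (fun _ : E n => D) (Metric.ball y r) :=
    integrableOn_const measure_ball_lt_top.ne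
  have h1 : ∫ x in Metric.ball y r, ‖g x‖ ≤ ∫ x in Metric.ball y r, (‖f x - m‖ + D) := by
    refine integral_mono_of_nonneg (Filter.Eventually.of_forall fun x => norm_nonneg _)
      (hib.add hc) ?_
    rw [Filter.EventuallyLE, ae_restrict_iff' Metric.isOpen_ball.measurableSet]
    exact hg
  have h2 : ∫ x in Metric.ball y r, ‖f x - m‖ ≤ (2 * r) ^ (n + 1) * C := by
    calc _ ≤ ∫ x in cube y (2 * r), ‖f x - m‖ :=
          setIntegral_mono_set hi (Filter.Eventually.of_forall fun x => norm_nonneg _)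
            (ball_subset_cube y r).eventuallyLE
      _ = (2 * r) ^ (n + 1) * ⨍ x in cube y (2 * r), ‖f x - m‖ := by
          rw [setAverage_cube_eq y h2r, smul_eq_mul, mul_inv_cancel_left₀ (by positivity)]
      _ ≤ _ := by gcongr; exact hf.osc_le y _ h2r
  rw [integral_add hib hc, setIntegral_const, smul_eq_mul] at h1
  rw [setAverage_eq, smul_eq_mul]
  calc _ ≤ (volume.real (Metric.ball y r))⁻¹ *
        ((2 * r) ^ (n + 1) * C + volume.real (Metric.ball y r) * D) := by
        refine mul_le_mul_of_nonneg_left ?_ (by positivity)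
        linarith
    _ = _ := by
        rw [mul_add, inv_mul_cancel_left₀ hV0.ne', hV, ballConst, mul_pow]
        field_simp

lemma ae_mem_hs_imp {p : E n → Prop} (h : ∀ x, (x ∈ hs n 1 ∨ x ∈ hs n (-1)) → p x) : ∀ᵐ x, p x := by
  filter_upwards [ae_mem_hs n] with x hx using h x hx

theorem BMO_subset_BMOL_lapN : BMO n ⊆ BMOL (lapN n) := by
  intro f hf
  rw [mem_BMOL_iff (isSplit_lapN n)]
  refine ⟨BMO_subset_classM hf, ?_⟩
  obtain ⟨C, hf⟩ := mem_BMO_iff.1 hf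
  obtain ⟨D, hD, h⟩ := hf.norm_sub_kernelApply_neumann_le
  exact ⟨_, fun y r hr => hf.setAverage_ball_le hr
    (ae_mem_hs_imp fun x hx hxb => h y r hr x hxb hx)⟩

lemma classM_add {f g : E n → ℂ} (hf : f ∈ classM n) (hg : g ∈ classM n) : f + g ∈ classM n := by
  obtain ⟨hl, d, hd, hi⟩ := hf
  obtain ⟨hl', d', hd', hi'⟩ := hg
  refine ⟨hl.add hl', max d d', lt_max_of_lt_left hd, ?_⟩
  have hm : AEStronglyMeasurable (fun x => ‖(f + g) x‖ ^ 2 /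
      (1 + ‖x‖ ^ ((n : ℝ) + 1 + max d d'))) volume :=
    (((hl.add hl').aestronglyMeasurable.norm.aemeasurable.pow_const 2).div
      (by fun_prop : Measurable fun x : E n =>
        1 + ‖x‖ ^ ((n : ℝ) + 1 + max d d')).aemeasurable).aestronglyMeasurable
  refine ((hi.const_mul 4).add (hi'.const_mul 4)).mono' hm (Filter.Eventually.of_forall fun x => ?_)
  rw [Real.norm_of_nonneg (by positivity)]
  have hw : ∀ e : ℝ, 0 < e → e ≤ max d d' →
      1 + ‖x‖ ^ ((n : ℝ) + 1 + e) ≤ 2 * (1 + ‖x‖ ^ ((n : ℝ) + 1 + max d d')) := by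
    intro e he hle
    have h0 : 0 ≤ ‖x‖ ^ ((n : ℝ) + 1 + max d d') := by positivity
    rcases le_total ‖x‖ 1 with h | h
    · have : ‖x‖ ^ ((n : ℝ) + 1 + e) ≤ 1 := Real.rpow_le_one (norm_nonneg _) h (by positivity)
      linarith
    · have : ‖x‖ ^ ((n : ℝ) + 1 + e) ≤ ‖x‖ ^ ((n : ℝ) + 1 + max d d') :=
        Real.rpow_le_rpow_of_exponent_le h (by linarith)
      linarith
  have h1 : ‖(f + g) x‖ ^ 2 ≤ 2 * ‖f x‖ ^ 2 + 2 * ‖g x‖ ^ 2 := by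
    have : ‖(f + g) x‖ ≤ ‖f x‖ + ‖g x‖ := norm_add_le _ _
    nlinarith [norm_nonneg ((f + g) x), sq_nonneg (‖f x‖ - ‖g x‖)]
  have key : ∀ (u e : ℝ), 0 ≤ u → 0 < e → e ≤ max d d' →
      2 * u / (1 + ‖x‖ ^ ((n : ℝ) + 1 + max d d')) ≤ 4 * (u / (1 + ‖x‖ ^ ((n : ℝ) + 1 + e))) := by
    intro u e hu he hle
    rw [mul_div_assoc', div_le_div_iff₀ (by positivity) (by positivity)]
    have := hw e he hle
    nlinarith
  calc _ ≤ (2 * ‖f x‖ ^ 2 + 2 * ‖g x‖ ^ 2) / (1 + ‖x‖ ^ ((n : ℝ) + 1 + max d d')) := by gcongr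
    _ = _ := add_div _ _ _
    _ ≤ _ := add_le_add (key _ d (by positivity) hd (le_max_left _ _))
        (key _ d' (by positivity) hd' (le_max_right _ _))

lemma classM_mono {f g : E n → ℂ} (hf : f ∈ classM n) (hg : AEStronglyMeasurable g volume)
    (h : ∀ x, ‖g x‖ ≤ ‖f x‖) : g ∈ classM n := by
  obtain ⟨hl, d, hd, hi⟩ := hf
  refine ⟨hl.mono hg (Filter.Eventually.of_forall h), d, hd, hi.mono' ?_ ?_⟩
  · exact ((hg.norm.aemeasurable.pow_const 2).div
      (by fun_prop : Measurable fun x : E n =>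
        1 + ‖x‖ ^ ((n : ℝ) + 1 + d)).aemeasurable).aestronglyMeasurable
  · refine Filter.Eventually.of_forall fun x => ?_
    rw [Real.norm_of_nonneg (by positivity)]
    gcongr
    exact h x

lemma classM_sub {f g : E n → ℂ} (hf : f ∈ classM n) (hg : g ∈ classM n) : f - g ∈ classM n := by
  rw [sub_eq_add_neg]
  exact classM_add hf (classM_mono hg hg.1.aestronglyMeasurable.neg fun x => by simp)

/-- A function fixed by the semigroup drops out of f - exp(-r²L)f. -/
theorem BMOmod_lapN_subset : BMOmod (lapN n) ⊆ BMOL (lapN n) := by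
  rintro _ ⟨f, hf, k, hk, rfl⟩
  have hfL := BMO_subset_BMOL_lapN hf
  rw [mem_BMOL_iff (isSplit_lapN n)] at hfL ⊢
  rw [mem_kerL_iff (isSplit_lapN n)] at hk
  obtain ⟨hfM, C, hC⟩ := hfL
  refine ⟨classM_add hfM hk.1, C, fun y r hr => le_of_eq_of_le ?_ (hC y r hr)⟩
  apply average_congr
  have h1 : |(1 : ℝ)| ≤ 1 := by simp
  filter_upwards [ae_restrict_of_ae (hk.2 (r ^ 2) (pow_pos hr 2))] with x hx
  have e := kernelApply_add (gint_of_mem_classM hfM) (gint_of_mem_classM hk.1) h1 h1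
    (pow_pos hr 2) x
  have e' : kernelApply (pk 1 1) (r ^ 2) (f + k) x = kernelApply (pk 1 1) (r ^ 2) f x + k x := by
    rw [← hx]; exact e
  rw [e', Pi.add_apply, add_sub_add_right_eq_sub]

/-- The restriction to the upper half space of a function of bounded mean oscillation belongs to
the space of an operator with Neumann condition there. -/
theorem indicator_mem_BMOL {L : (E n → ℂ) → (E n → ℂ) → Prop} (hL : IsSplit 1 b L)
    (hf : f ∈ BMO n) : (hs n 1).indicator f ∈ BMOL L := by
  have hM := BMO_subset_classM hf
  rw [mem_BMOL_iff hL]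
  refine ⟨classM_mono hM (hM.1.aestronglyMeasurable.indicator (measurableSet_hs 1))
    fun x => norm_indicator_le_norm_self _ _, ?_⟩
  obtain ⟨C, hf⟩ := mem_BMO_iff.1 hf
  obtain ⟨D, hD, h⟩ := hf.norm_sub_kernelApply_neumann_le
  refine ⟨_, fun y r hr => hf.setAverage_ball_le (D := D) hr
    (ae_mem_hs_imp fun x hx hxb => ?_)⟩
  -- On the upper side only values from that side enter, and the kernel is the Neumann one; on the
  -- lower side the truncated function and its evolution vanish.
  rcases hx with hx | hx
  · refine le_of_eq_of_le ?_ (h y r hr x hxb (Or.inl hx))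
    rw [indicator_of_mem hx]
    congr 2
    unfold kernelApply
    congr 1; ext z
    rw [pk_of_mem_up hx, pk_of_mem_up hx]
    by_cases hz : z ∈ hs n 1
    · rw [indicator_of_mem hz]
    · rw [hkern_eq_zero_of_notMem_right x hz]; simp
  · have hx1 : x ∉ hs n 1 := Set.disjoint_right.1 disjoint_hs hx
    have e : kernelApply (pk 1 b) (r ^ 2) ((hs n 1).indicator f) x = 0 := by
      unfold kernelApply
      rw [← integral_zero (E n) ℂ (μ := volume)]
      congr 1; ext z
      rw [pk_of_mem_low hx]
      by_cases hz : z ∈ hs n 1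
      · rw [hkern_eq_zero_of_notMem_right x (mem_hs_neg_of_mem hz)]; simp
      · rw [indicator_of_notMem hz]; simp
    rw [e, indicator_of_notMem hx1, sub_zero, norm_zero]
    positivity

end SplitBMO

end

/-! ### The logarithms as members of the spaces. -/

noncomputable section

namespace SplitBMO

variable {n : ℕ}

/-! ### The logarithm has bounded mean oscillation -/

lemma lintegral_cube_lastCoord (c : E n) {l : ℝ} (hl : 0 < l) {φ : ℝ → ℝ≥0∞} (hφ : Measurable φ) :
    ∫⁻ x in cube c l, φ (lastCoord x)
      = ENNReal.ofReal (l ^ n) * ∫⁻ u in Icc (lastCoord c - l / 2) (lastCoord c + l / 2), φ u := by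
  have h1 := (PiLp.volume_preserving_ofLp (Fin (n + 1))).setLIntegral_comp_preimage
    (s := Icc (fun i => c i - l / 2) (fun i => c i + l / 2)) measurableSet_Icc
    (f := fun b => φ (b (Fin.last n))) (hφ.comp (measurable_pi_apply _))
  rw [← cube_eq_preimage] at h1
  change ∫⁻ x in cube c l, φ (lastCoord x) = _ at h1
  rw [h1, ← pi_univ_Icc, volume_pi, Measure.restrict_pi_pi]
  have h2 : ∫⁻ b, φ (b (Fin.last n)) ∂(Measure.pi fun i : Fin (n + 1) =>
      (volume : Measure ℝ).restrict (Icc (c i - l / 2) (c i + l / 2)))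
      = ∫⁻ u, φ u ∂((Measure.pi fun i : Fin (n + 1) =>
      (volume : Measure ℝ).restrict (Icc (c i - l / 2) (c i + l / 2))).map
        (Function.eval (Fin.last n))) :=
    (lintegral_map hφ (measurable_pi_apply _)).symm
  rw [h2, Measure.pi_map_eval, lintegral_smul_measure]
  have h3 : ∀ i : Fin (n + 1), ((volume : Measure ℝ).restrict (Icc (c i - l / 2) (c i + l / 2))) univ
      = ENNReal.ofReal l := by
    intro i
    rw [Measure.restrict_apply_univ, Real.volume_Icc]
    congr 1; ring
  simp only [h3, Finset.prod_const, Finset.card_erase_of_mem (Finset.mem_univ _), Finset.card_univ,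
    Fintype.card_fin, Nat.add_sub_cancel, smul_eq_mul]
  rw [ENNReal.ofReal_pow hl.le]
  rfl

lemma ae_ne_zero : ∀ᵐ u : ℝ, u ≠ 0 := by
  rw [ae_iff]; simp

lemma abs_log_le_one {w : ℝ} (h1 : 1 / 2 ≤ w) (h2 : w ≤ 3 / 2) : |Real.log w| ≤ 1 := by
  have hw : 0 < w := by linarith
  have h3 := Real.log_le_sub_one_of_pos hw
  have h4 := Real.one_sub_inv_le_log_of_pos hw
  have h5 : w⁻¹ ≤ 2 := by rw [inv_le_comm₀ hw two_pos]; linarith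
  rw [abs_le]; constructor <;> linarith

/-- Two regimes. If l ≤ |a| the interval stays away from 0, and log u differs from log a by at most
1. Otherwise it lies in [-3l/2, 3l/2], and dilation by l leaves the integral of |log| near 0.
`Real.log` is even, so negative u need no separate treatment. -/
lemma lintegral_log_oscillation : ∃ K : ℝ, 0 ≤ K ∧ ∀ a l : ℝ, 0 < l → ∃ m : ℝ,
    ∫⁻ u in Icc (a - l / 2) (a + l / 2), ENNReal.ofReal |Real.log u - m| ≤ ENNReal.ofReal (l * K) := by
  set J := ∫ v in (-(3 / 2) : ℝ)..(3 / 2), |Real.log v| with hJ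
  have hJ0 : 0 ≤ J := intervalIntegral.integral_nonneg (by norm_num) fun u _ => abs_nonneg _
  refine ⟨1 + J, by positivity, fun a l hl => ?_⟩
  rcases le_or_gt l |a| with ha | ha
  · refine ⟨Real.log a, ?_⟩
    have ha0 : a ≠ 0 := by rintro rfl; simp at ha; linarith
    have ha' : 0 < |a| := abs_pos.2 ha0
    have h1 : ∀ u ∈ Icc (a - l / 2) (a + l / 2), ENNReal.ofReal |Real.log u - Real.log a| ≤ 1 := by
      intro u hu
      rw [ENNReal.ofReal_le_one]
      have h2 : |u / a - 1| ≤ 1 / 2 := by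
        have e : u / a - 1 = (u - a) / a := by field_simp
        rw [e, abs_div, div_le_iff₀ ha']
        have : |u - a| ≤ l / 2 := abs_le.2 ⟨by linarith [hu.1], by linarith [hu.2]⟩
        linarith
      have h3 := abs_le.1 h2
      have hu0 : u ≠ 0 := by rintro rfl; simp at h2; linarith
      rw [← Real.log_div hu0 ha0]
      exact abs_log_le_one (by linarith) (by linarith)
    calc _ ≤ ∫⁻ _u in Icc (a - l / 2) (a + l / 2), 1 := setLIntegral_mono' measurableSet_Icc h1
      _ = ENNReal.ofReal l := by
          rw [setLIntegral_const, one_mul, Real.volume_Icc]; congr 1; ring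
      _ ≤ _ := ENNReal.ofReal_le_ofReal (le_mul_of_one_le_right hl.le (by linarith))
  · refine ⟨Real.log l, ?_⟩
    set φ : ℝ → ℝ := fun u => |Real.log u - Real.log l| with hφ
    have hsub : Icc (a - l / 2) (a + l / 2) ⊆ Icc (l * (-(3 / 2))) (l * (3 / 2)) := by
      have := abs_lt.1 ha
      exact Icc_subset_Icc (by linarith) (by linarith)
    have hint : IntervalIntegrable φ volume (l * (-(3 / 2))) (l * (3 / 2)) :=
      (intervalIntegral.intervalIntegrable_log'.sub intervalIntegrable_const).abs
    have hle : l * (-(3 / 2)) ≤ l * (3 / 2) := by linarith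
    rw [intervalIntegrable_iff_integrableOn_Icc_of_le hle] at hint
    have hval : ∫ u in Icc (l * (-(3 / 2))) (l * (3 / 2)), φ u = l * J := by
      rw [integral_Icc_eq_integral_Ioc, ← intervalIntegral.integral_of_le hle,
        ← intervalIntegral.smul_integral_comp_mul_left, smul_eq_mul, hJ]
      congr 1
      apply intervalIntegral.integral_congr_ae
      filter_upwards [ae_ne_zero] with v hv _
      simp only [hφ]
      rw [Real.log_mul hl.ne' hv, add_sub_cancel_left]
    calc _ ≤ ∫⁻ u in Icc (l * (-(3 / 2))) (l * (3 / 2)), ENNReal.ofReal (φ u) :=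
          lintegral_mono_set hsub
      _ = ENNReal.ofReal (l * J) := by
          rw [← hval, ofReal_integral_eq_lintegral_ofReal hint
            (Filter.Eventually.of_forall fun u => abs_nonneg _)]
      _ ≤ _ := ENNReal.ofReal_le_ofReal (by nlinarith)

lemma logE_eq (x : E n) : logE n x = (Real.log (lastCoord x) : ℂ) := by
  rw [logE, Real.log_abs]

lemma measurable_logE : Measurable (logE n) := by
  have : logE n = fun x => (Real.log (lastCoord x) : ℂ) := funext logE_eq
  rw [this]
  exact Complex.measurable_ofReal.comp (Real.measurable_log.comp measurable_lastCoord)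

lemma lintegral_logE_oscillation (n : ℕ) : ∃ K : ℝ, 0 ≤ K ∧ ∀ (c : E n) (l : ℝ), 0 < l → ∃ m : ℝ,
    ∫⁻ x in cube c l, ‖logE n x - m‖ₑ ≤ ENNReal.ofReal (l ^ (n + 1) * K) := by
  obtain ⟨K, hK, h⟩ := lintegral_log_oscillation
  refine ⟨K, hK, fun c l hl => ?_⟩
  obtain ⟨m, hm⟩ := h (lastCoord c) l hl
  refine ⟨m, ?_⟩
  have e : ∀ x : E n, ‖logE n x - m‖ₑ = ENNReal.ofReal |Real.log (lastCoord x) - m| := by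
    intro x
    rw [logE_eq, ← Complex.ofReal_sub, ← ofReal_norm, Complex.norm_real, Real.norm_eq_abs]
  simp_rw [e]
  have hmeas : Measurable fun u : ℝ => ENNReal.ofReal |Real.log u - m| :=
    (measurable_norm.comp (Real.measurable_log.sub_const m)).ennreal_ofReal
  rw [lintegral_cube_lastCoord c hl hmeas]
  refine (mul_le_mul_right hm _).trans ?_
  rw [← ENNReal.ofReal_mul (by positivity)]
  refine ENNReal.ofReal_le_ofReal (le_of_eq ?_)
  ring

lemma cube_mem_nhds (x : E n) {l : ℝ} (hl : 0 < l) : cube x l ∈ nhds x := by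
  have := ball_subset_cube x (l / 2)
  rw [mul_div_cancel₀ l two_ne_zero] at this
  exact Filter.mem_of_superset (Metric.ball_mem_nhds x (half_pos hl)) this

lemma setAverage_cube_le_of_lintegral_le {g : E n → ℂ} (hg : AEStronglyMeasurable g volume)
    (c : E n) {l K : ℝ} (hl : 0 < l) (hK : 0 ≤ K)
    (h : ∫⁻ x in cube c l, ‖g x‖ₑ ≤ ENNReal.ofReal (l ^ (n + 1) * K)) :
    ⨍ x in cube c l, ‖g x‖ ≤ K := by
  rw [setAverage_cube_eq c hl, smul_eq_mul, inv_mul_le_iff₀ (by positivity),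
    integral_norm_eq_lintegral_enorm hg.restrict]
  exact ENNReal.toReal_le_of_le_ofReal (by positivity) h

theorem logE_mem_BMO (n : ℕ) : logE n ∈ BMO n := by
  obtain ⟨K, hK, h⟩ := lintegral_logE_oscillation n
  have hm : AEStronglyMeasurable (logE n) volume := measurable_logE.aestronglyMeasurable
  refine mem_BMO_of_forall_exists (C := K) (fun x => ?_) fun c l hl => ?_
  · obtain ⟨m, hmK⟩ := h x 1 one_pos
    refine ⟨cube x 1, cube_mem_nhds x one_pos, ?_⟩
    have h1 : IntegrableOn (fun x => logE n x - m) (cube x 1) :=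
      ⟨(hm.sub aestronglyMeasurable_const).restrict, hmK.trans_lt ENNReal.ofReal_lt_top⟩
    have h2 := h1.add ((locallyIntegrable_const (m : ℂ)).integrableOn_isCompact (isCompact_cube x 1))
    refine h2.congr (Filter.Eventually.of_forall fun y => ?_)
    simp
  · obtain ⟨m, hmK⟩ := h c l hl
    exact ⟨m, setAverage_cube_le_of_lintegral_le (hm.sub aestronglyMeasurable_const) c hl hK hmK⟩

lemma logH_eq_indicator (n : ℕ) : logH n = (hs n 1).indicator (logE n) := by
  ext x
  rcases lt_trichotomy (lastCoord x) 0 with h | h | h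
  · have hx : x ∉ hs n 1 := fun h' : 0 < 1 * lastCoord x => by linarith
    rw [indicator_of_notMem hx]
    simp [logH, not_le.2 h]
  · have hx : x ∉ hs n 1 := fun h' : 0 < 1 * lastCoord x => by linarith
    rw [indicator_of_notMem hx]
    simp [logH, h]
  · have hx : x ∈ hs n 1 := show 0 < 1 * lastCoord x by linarith
    rw [indicator_of_mem hx]
    simp [logH, logE, h.le]

theorem logH_mem_BMOL {b : ℝ} {L : (E n → ℂ) → (E n → ℂ) → Prop} (hL : IsSplit 1 b L) :
    logH n ∈ BMOL L := by
  rw [logH_eq_indicator]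
  exact indicator_mem_BMOL hL (logE_mem_BMO n)

end SplitBMO

end

/-! ### Exclusion of the logarithm by a Dirichlet condition. -/

noncomputable section

namespace SplitBMO

variable {n : ℕ} {a b : ℝ}

/-! ### The logarithm and the Dirichlet condition -/

lemma gauss_smul {r : ℝ} (hr : 0 < r) (z : E n) :
    gauss (r ^ 2) (r • z) = (r ^ (n + 1))⁻¹ * gauss 1 z := by
  have h1 : (4 * Real.pi * r ^ 2) ^ (-(((n : ℝ) + 1) / 2))
      = (r ^ (n + 1))⁻¹ * (4 * Real.pi * 1) ^ (-(((n : ℝ) + 1) / 2)) := by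
    rw [mul_one, Real.mul_rpow (by positivity) (by positivity), mul_comm]
    congr 1
    rw [← Real.rpow_natCast r 2, ← Real.rpow_mul hr.le, ← Real.rpow_natCast r (n + 1),
      ← Real.rpow_neg hr.le]
    congr 1; push_cast; ring
  unfold gauss
  rw [h1, norm_smul, Real.norm_of_nonneg hr.le, mul_assoc]
  congr 3
  field_simp

lemma smul_mem_hs {r : ℝ} (hr : 0 < r) {ε : ℝ} {x : E n} : r • x ∈ hs n ε ↔ x ∈ hs n ε := by
  change 0 < ε * lastCoord (r • x) ↔ 0 < ε * lastCoord x
  rw [lastCoord_smul, mul_left_comm, mul_pos_iff_of_pos_left hr]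

lemma hkern_smul {r : ℝ} (hr : 0 < r) (ε σ : ℝ) (x y : E n) :
    hkern ε σ (r ^ 2) (r • x) (r • y) = (r ^ (n + 1))⁻¹ * hkern ε σ 1 x y := by
  by_cases hx : x ∈ hs n ε
  swap
  · rw [hkern_eq_zero_of_notMem_left hx, hkern_eq_zero_of_notMem_left (mt (smul_mem_hs hr).1 hx),
      mul_zero]
  by_cases hy : y ∈ hs n ε
  swap
  · rw [hkern_eq_zero_of_notMem_right _ hy,
      hkern_eq_zero_of_notMem_right _ (mt (smul_mem_hs hr).1 hy), mul_zero]
  rw [hkern_of_mem hx hy, hkern_of_mem ((smul_mem_hs hr).2 hx) ((smul_mem_hs hr).2 hy), map_smul,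
    ← smul_sub, ← smul_sub, gauss_smul hr, gauss_smul hr]
  ring

lemma pk_smul {r : ℝ} (hr : 0 < r) (a b : ℝ) (x y : E n) :
    pk a b (r ^ 2) (r • x) (r • y) = (r ^ (n + 1))⁻¹ * pk a b 1 x y := by
  unfold pk
  rw [hkern_smul hr, hkern_smul hr, mul_add]

/-- Parabolic scaling; the half spaces are invariant under dilations. -/
lemma kernelApply_smul {r : ℝ} (hr : 0 < r) (a b : ℝ) (f : E n → ℂ) (x : E n) :
    kernelApply (pk a b) (r ^ 2) f (r • x) = kernelApply (pk a b) 1 (fun y => f (r • y)) x := by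
  have h := Measure.integral_comp_smul_of_nonneg (volume : Measure (E n))
    (fun y => (pk a b (r ^ 2) (r • x) y : ℂ) * f y) r (hR := hr.le)
  have hd : Module.finrank ℝ (E n) = n + 1 := by simp
  rw [hd] at h
  have h2 : kernelApply (pk a b) (r ^ 2) f (r • x) = ((r ^ (n + 1) : ℝ) : ℂ) *
      ∫ y, (pk a b (r ^ 2) (r • x) (r • y) : ℂ) * f (r • y) := by
    rw [h, Complex.real_smul, ← mul_assoc, ← Complex.ofReal_mul,
      mul_inv_cancel₀ (by positivity), Complex.ofReal_one, one_mul]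
    rfl
  rw [h2, ← integral_const_mul]
  unfold kernelApply
  congr 1; ext y
  rw [pk_smul hr]
  have : ((r ^ (n + 1) : ℝ) : ℂ) ≠ 0 := by
    rw [Complex.ofReal_ne_zero]; positivity
  push_cast at this ⊢
  field_simp

lemma ae_lastCoord_ne_zero (n : ℕ) : ∀ᵐ x : E n, lastCoord x ≠ 0 := by
  rw [ae_iff]; simpa using volume_hyperplane n

lemma logE_smul {r : ℝ} (hr : 0 < r) {x : E n} (hx : lastCoord x ≠ 0) :
    logE n (r • x) = (Real.log r : ℂ) + logE n x := by
  rw [logE_eq, logE_eq, lastCoord_smul, Real.log_mul hr.ne' hx]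
  push_cast; ring

lemma gint_logE (n : ℕ) : GInt (logE n) :=
  gint_of_mem_classM (BMO_subset_classM (logE_mem_BMO n))

/-- Dilation adds the constant log r to the logarithm, and a semigroup that does not preserve
constants leaves a defect proportional to log r. -/
lemma sub_kernelApply_logE_smul (ha : |a| ≤ 1) (hb : |b| ≤ 1) {r : ℝ} (hr : 0 < r) {x : E n}
    (hx : lastCoord x ≠ 0) :
    logE n (r • x) - kernelApply (pk a b) (r ^ 2) (logE n) (r • x)
      = (Real.log r : ℂ) * (1 - kernelApply (pk a b) 1 (fun _ => 1) x)
        + (logE n x - kernelApply (pk a b) 1 (logE n) x) := by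
  rw [kernelApply_smul hr, logE_smul hr hx]
  have h1 : kernelApply (pk a b) 1 (fun y => logE n (r • y))
      = kernelApply (pk a b) 1 (fun y => (Real.log r : ℂ) + logE n y) := by
    apply kernelApply_congr_ae
    filter_upwards [ae_lastCoord_ne_zero n] with y hy using logE_smul hr hy
  have h2 : kernelApply (pk a b) 1 (fun _ => (Real.log r : ℂ)) x
      = (Real.log r : ℂ) * kernelApply (pk a b) 1 (fun _ => 1) x := by
    unfold kernelApply
    rw [← integral_const_mul]
    congr 1; ext y; ring
  rw [h1, kernelApply_add (gint_const _) (gint_logE n) ha hb one_pos, h2]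
  ring

lemma volume_hs_pos (n : ℕ) {ε : ℝ} (hε : ε = 1 ∨ ε = -1) {r : ℝ} (hr : 0 < r) :
    0 < volume (hs n ε ∩ Metric.ball 0 r) := by
  refine ((isOpen_hs ε).inter Metric.isOpen_ball).measure_pos volume
    ⟨EuclideanSpace.single (Fin.last n) (ε * (r / 2)), ?_, ?_⟩
  · change 0 < ε * lastCoord _
    rcases hε with rfl | rfl <;> simp [lastCoord, hr]
  · rcases hε with rfl | rfl <;> simp [abs_of_pos hr, hr]

/-- The direct and the reflected Gaussian have total mass one on the half space. The Dirichlet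
kernel takes their difference, and the reflected part is positive. -/
lemma kernelApply_dirichlet_one_ne {x : E n} (hx : x ∈ hs n (-1)) :
    kernelApply (pk a (-1)) 1 (fun _ => 1) x ≠ 1 := by
  have h1 : kernelApply (pk a (-1)) 1 (fun _ => 1) x
      = ((∫ y, hkern (-1) (-1) 1 x y : ℝ) : ℂ) := by
    unfold kernelApply
    simp_rw [mul_one, pk_of_mem_low hx]
    exact integral_complex_ofReal
  have h2 := integral_hkern_eq (σ := -1) (t := 1) hx (fun _ => 1)
  simp only [mul_one] at h2
  set φ : E n → ℝ := fun y => gauss 1 (x - y)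
  have hφ : Integrable φ := integrable_gauss_sub one_pos x
  have hR : Integrable (fun y => φ (refl n y)) :=
    (measurePreserving_refl.integrable_comp_emb measurableEmbedding_refl).2 hφ
  have h3 := setIntegral_hs_add hφ (ε := -1) (Or.inr rfl)
  rw [integral_add hφ.integrableOn hR.integrableOn, integral_gauss_sub one_pos] at h3
  have h4 : ∫ y in hs n (-1), (gauss 1 (x - y) + -1 * gauss 1 (x - refl n y))
      = (∫ y in hs n (-1), φ y) - ∫ y in hs n (-1), φ (refl n y) := by
    rw [← integral_sub hφ.integrableOn hR.integrableOn]
    congr 1; ext y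
    simp only [φ]; ring
  have h5 : 0 < ∫ y in hs n (-1), φ (refl n y) := by
    rw [setIntegral_pos_iff_support_of_nonneg_ae
      (Filter.Eventually.of_forall fun y => gauss_nonneg one_pos _) hR.integrableOn]
    have : Function.support (fun y => φ (refl n y)) = univ :=
      eq_univ_of_forall fun y => (gauss_pos one_pos _).ne'
    rw [this, univ_inter]
    exact (volume_hs_pos n (Or.inr rfl) one_pos).trans_le (measure_mono inter_subset_left)
  intro h
  rw [h1, h2, h4] at h
  have h6 : (∫ y in hs n (-1), φ y) - ∫ y in hs n (-1), φ (refl n y) = 1 := by exact_mod_cast h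
  linarith

/-- The logarithm does not belong to the space of an operator with Dirichlet condition on the
lower half space. -/
theorem logE_notMem_BMOL {L : (E n → ℂ) → (E n → ℂ) → Prop} (hL : IsSplit a (-1) L) :
    logE n ∉ BMOL L := by
  rw [mem_BMOL_iff hL]
  rintro ⟨-, C, hC⟩
  have ha := abs_le_one_of_sign hL.sign_up
  have hb := abs_le_one_of_sign hL.sign_low
  set W : E n → ℂ := fun x => 1 - kernelApply (pk a (-1)) 1 (fun _ => 1) x with hW
  set g : E n → ℂ := fun x => logE n x - kernelApply (pk a (-1)) 1 (logE n) x with hg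
  set B : Set (E n) := Metric.ball 0 1
  set V := volume.real B
  have hWl : LocallyIntegrable W volume :=
    ((gint_const 1).sub ((gint_const 1).kernelApply ha hb one_pos)).locallyIntegrable
  have hgl : LocallyIntegrable g volume :=
    ((gint_logE n).sub ((gint_logE n).kernelApply ha hb one_pos)).locallyIntegrable
  have onB : ∀ {u : E n → ℂ}, LocallyIntegrable u volume → IntegrableOn u B := fun hu =>
    (hu.integrableOn_isCompact (isCompact_closedBall 0 1)).mono_set Metric.ball_subset_closedBall
  have hV : 0 < V := measureReal_unitBall_pos n
  -- The average over B(0, r) is rescaled to the unit ball, where W and g do not depend on r.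
  have key : ∀ r : ℝ, 0 < r → ∫ x in B, ‖(Real.log r : ℂ) * W x + g x‖ ≤ V * C := by
    intro r hr
    have h1 := hC 0 r hr
    rw [setAverage_eq, smul_eq_mul, measureReal_ball 0 hr.le, inv_mul_le_iff₀ (by positivity)] at h1
    have h2 := Measure.setIntegral_comp_smul_of_pos (volume : Measure (E n))
      (fun x => ‖logE n x - kernelApply (pk a (-1)) (r ^ 2) (logE n) x‖) B hr
    have hd : Module.finrank ℝ (E n) = n + 1 := by simp
    rw [smul_unitBall_of_pos hr, hd, smul_eq_mul] at h2
    have h3 : ∫ x in B, ‖(Real.log r : ℂ) * W x + g x‖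
        = ∫ x in B, ‖logE n (r • x) - kernelApply (pk a (-1)) (r ^ 2) (logE n) (r • x)‖ := by
      apply integral_congr_ae
      filter_upwards [ae_restrict_of_ae (ae_lastCoord_ne_zero n)] with x hx
      rw [sub_kernelApply_logE_smul ha hb hr hx]
    rw [h3, h2, inv_mul_le_iff₀ (by positivity)]
    calc _ ≤ _ := h1
      _ = _ := by ring
  set I := ∫ x in B, ‖W x‖
  set J := ∫ x in B, ‖g x‖
  have hI0 : 0 ≤ I := integral_nonneg fun x => norm_nonneg _
  have key2 : ∀ s : ℝ, 0 < s → s * I ≤ V * C + J := by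
    intro s hs
    have h1 := key (Real.exp s) (Real.exp_pos s)
    rw [Real.log_exp] at h1
    have i1 : IntegrableOn (fun x => ‖(s : ℂ) * W x + g x‖) B :=
      (((onB hWl).const_mul (s : ℂ)).add (onB hgl)).norm
    have i2 := (onB hgl).norm
    have h2 : s * I ≤ ∫ x in B, (‖(s : ℂ) * W x + g x‖ + ‖g x‖) := by
      rw [← integral_const_mul]
      refine integral_mono ((onB hWl).norm.const_mul s) (i1.add i2) fun x => ?_
      have e : ((s : ℂ) * W x) = ((s : ℂ) * W x + g x) - g x := by ring
      have h3 : s * ‖W x‖ = ‖(s : ℂ) * W x‖ := by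
        rw [norm_mul, Complex.norm_real, Real.norm_of_nonneg hs.le]
      simp only
      rw [h3]
      conv_lhs => rw [e]
      exact norm_sub_le _ _
    rw [integral_add i1 i2] at h2
    linarith
  -- With s = log r arbitrarily large, the bound sI ≤ VC + J forces I = 0, hence W = 0 almost
  -- everywhere in the ball.
  have hI : I = 0 := by
    by_contra hne
    have hpos : 0 < I := lt_of_le_of_ne hI0 (Ne.symm hne)
    have h1 := key2 ((|V * C + J| + 1) / I) (by positivity)
    rw [div_mul_cancel₀ _ hne] at h1
    linarith [le_abs_self (V * C + J)]
  rw [integral_eq_zero_iff_of_nonneg (fun x => norm_nonneg _) (onB hWl).norm] at hI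
  rw [Filter.EventuallyEq, ae_restrict_iff' Metric.isOpen_ball.measurableSet] at hI
  have h0 : volume (hs n (-1) ∩ B) = 0 := by
    refine measure_mono_null ?_ (ae_iff.1 hI)
    rintro x ⟨hx1, hx2⟩ h
    have h1 : W x = 0 := norm_eq_zero.1 (h hx2)
    exact kernelApply_dirichlet_one_ne (a := a) hx1 (sub_eq_zero.1 h1).symm
  exact (volume_hs_pos n (Or.inr rfl) one_pos).ne' h0

end SplitBMO

end

/-! ### A Liouville property and the truncated logarithm. -/

noncomputable section

namespace SplitBMO

variable {n : ℕ} {a b : ℝ} {f k : E n → ℂ}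

/-! ### Elements of the kernel space with sublinear growth -/

/-- The means of `f` over unit balls have at most square root growth. -/
def SqrtGrowth (f : E n → ℂ) : Prop :=
  ∃ α β : ℝ, 0 ≤ α ∧ 0 ≤ β ∧ ∀ z, ballAvg 1 (fun x => ‖f x‖ₑ) z ≤ ENNReal.ofReal (α + β * √(1 + ‖z‖))

lemma HasOsc.sqrtGrowth {C : ℝ} (hf : HasOsc f C) : SqrtGrowth f := by
  have hκ := ballConst_pos n
  have hC := hf.nonneg
  refine ⟨ballConst n * (C + ‖cAvg f 0 2‖), ballConst n * (16 * 2 ^ (n + 1) * C), by positivity,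
    by positivity, fun z => ?_⟩
  have h1 := hf.ballAvg_le 0 z one_pos
  simp only [sub_zero, mul_one] at h1
  refine h1.trans (ENNReal.ofReal_le_ofReal ?_)
  have h2 := hf.norm_cAvg_sub_cAvg_le_sqrt z 0 (l := 2) two_pos
  have h3 : √(1 + ‖z - 0‖ / 2) ≤ √(1 + ‖z‖) := by
    rw [sub_zero]
    refine Real.sqrt_le_sqrt ?_
    linarith [norm_nonneg z]
  have h4 : ‖cAvg f z 2‖ ≤ ‖cAvg f 0 2‖ + 16 * 2 ^ (n + 1) * C * √(1 + ‖z‖) := by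
    have e : cAvg f z 2 = cAvg f 0 2 + (cAvg f z 2 - cAvg f 0 2) := by ring
    rw [e]
    refine (norm_add_le _ _).trans ?_
    gcongr
    exact h2.trans (by gcongr)
  calc _ ≤ ballConst n * (C + (‖cAvg f 0 2‖ + 16 * 2 ^ (n + 1) * C * √(1 + ‖z‖))) := by gcongr
    _ = _ := by ring

lemma SqrtGrowth.of_le {g h : E n → ℂ} (hg : SqrtGrowth g) (hh : SqrtGrowth h)
    (hgm : AEStronglyMeasurable g volume) (hle : ∀ x, ‖k x‖ ≤ ‖g x‖ + ‖h x‖) : SqrtGrowth k := by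
  obtain ⟨α, β, hα, hβ, h1⟩ := hg
  obtain ⟨α', β', hα', hβ', h2⟩ := hh
  refine ⟨α + α', β + β', by positivity, by positivity, fun z => ?_⟩
  have h3 : ∀ x, ‖k x‖ₑ ≤ ‖g x‖ₑ + ‖h x‖ₑ := by
    intro x
    rw [← ofReal_norm, ← ofReal_norm, ← ofReal_norm, ← ENNReal.ofReal_add (norm_nonneg _)
      (norm_nonneg _)]
    exact ENNReal.ofReal_le_ofReal (hle x)
  calc ballAvg 1 (fun x => ‖k x‖ₑ) z
      ≤ ballAvg 1 (fun x => ‖g x‖ₑ) z + ballAvg 1 (fun x => ‖h x‖ₑ) z := by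
        unfold ballAvg
        rw [← mul_add, ← lintegral_add_left' hgm.enorm.restrict]
        gcongr with x
        exact h3 x
    _ ≤ ENNReal.ofReal (α + β * √(1 + ‖z‖)) + ENNReal.ofReal (α' + β' * √(1 + ‖z‖)) :=
        add_le_add (h1 z) (h2 z)
    _ = _ := by
        rw [← ENNReal.ofReal_add (by positivity) (by positivity)]
        congr 1; ring

/-- From βv ≤ β²/δ + δv², square root growth is linear growth with arbitrarily small slope δ, at the
price of a larger constant A. It matters that M does not depend on δ. -/
lemma SqrtGrowth.gmean_le (hk : SqrtGrowth k) (hm : AEStronglyMeasurable k volume) :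
    ∃ M : ℝ, 0 ≤ M ∧ ∀ δ : ℝ, 0 < δ → ∃ A : ℝ, 0 ≤ A ∧ ∀ t : ℝ, 1 ≤ t → ∀ x,
      gmean (2 * t) (fun y => ‖k y‖ₑ) x ≤ ENNReal.ofReal (A + M * δ * (‖x‖ + √t)) := by
  obtain ⟨α, β, hα, hβ, h⟩ := hk
  obtain ⟨M, hM, hmom⟩ := gmean_norm_sub n
  have hS := shiftConst_pos n
  refine ⟨shiftConst n * (1 + 2 * M), by positivity, fun δ hδ => ?_⟩
  refine ⟨shiftConst n * (α + β ^ 2 / δ + δ), by positivity, fun t ht x => ?_⟩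
  have ht0 : 0 < t := by linarith
  have h1 : ∀ z, ballAvg 1 (fun x => ‖k x‖ₑ) z ≤ ENNReal.ofReal (α + β ^ 2 / δ + δ) +
      ENNReal.ofReal δ * ENNReal.ofReal ‖z - 0‖ := by
    intro z
    refine (h z).trans ?_
    rw [← ENNReal.ofReal_mul hδ.le, ← ENNReal.ofReal_add (by positivity) (by positivity)]
    refine ENNReal.ofReal_le_ofReal ?_
    rw [sub_zero]
    have h2 : √(1 + ‖z‖) ^ 2 = 1 + ‖z‖ := Real.sq_sqrt (by positivity)
    set v := √(1 + ‖z‖)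
    have h3 : β * v ≤ β ^ 2 / δ + δ * v ^ 2 := by
      rw [div_add' _ _ _ hδ.ne', le_div_iff₀ hδ]
      nlinarith [sq_nonneg (β - δ * v), mul_nonneg hβ (Real.sqrt_nonneg (1 + ‖z‖))]
    rw [h2] at h3
    linarith
  refine (gmean_le_ballAvg (r := 1) (by positivity) one_pos (by linarith) hm.enorm x).trans ?_
  refine (mul_le_mul_right (gmean_mono h1 x) _).trans ?_
  rw [gmean_add aemeasurable_const, gmean_const (by positivity),
    gmean_const_mul ENNReal.ofReal_ne_top]
  have h4 := hmom (2 * (2 * t)) (by positivity) x 0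
  have h5 : √(2 * (2 * t)) = 2 * √t := by
    rw [← mul_assoc, show (2 : ℝ) * 2 = 2 ^ 2 by norm_num, Real.sqrt_mul (by positivity),
      Real.sqrt_sq (by norm_num)]
  rw [h5, sub_zero] at h4
  calc _ ≤ ENNReal.ofReal (shiftConst n) * (ENNReal.ofReal (α + β ^ 2 / δ + δ)
        + ENNReal.ofReal δ * ENNReal.ofReal (‖x‖ + M * (2 * √t))) := by gcongr
    _ ≤ _ := by
        rw [← ENNReal.ofReal_mul hδ.le, ← ENNReal.ofReal_add (by positivity) (by positivity),
          ← ENNReal.ofReal_mul hS.le]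
        refine ENNReal.ofReal_le_ofReal ?_
        have h6 : 0 ≤ shiftConst n * δ * (2 * M * ‖x‖ + √t) := by positivity
        nlinarith

/-- Functions of sublinear growth in the kernel space are constant on both half spaces. -/
theorem exists_ae_eq_const_of_mem_kerL {L : (E n → ℂ) → (E n → ℂ) → Prop} (hL : IsSplit a b L)
    (hk : k ∈ kerL L) (hg : SqrtGrowth k) {ε : ℝ} (hε : ε = 1 ∨ ε = -1) :
    ∃ c : ℂ, ∀ᵐ x, x ∈ hs n ε → k x = c := by
  rw [mem_kerL_iff hL] at hk
  have hG := gint_of_mem_classM hk.1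
  have ha := abs_le_one_of_sign hL.sign_up
  have hb := abs_le_one_of_sign hL.sign_low
  -- Only integer times are used, so that a single null set serves them all and the base point x₀
  -- can be fixed.
  have hae : ∀ᵐ x, ∀ m : ℕ, kernelApply (pk a b) ((m : ℝ) + 1) k x = k x :=
    ae_all_iff.2 fun m => hk.2 _ (by positivity)
  obtain ⟨x₀, hx₀, hx₀'⟩ : ∃ x₀ ∈ hs n ε, ∀ m : ℕ, kernelApply (pk a b) ((m : ℝ) + 1) k x₀ = k x₀ := by
    by_contra hne
    push Not at hne
    have : volume (hs n ε) = 0 := by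
      refine measure_mono_null (fun x hx => ?_) (ae_iff.1 hae)
      obtain ⟨m, hm⟩ := hne x hx
      exact fun h => hm (h m)
    exact ((volume_hs_pos n hε one_pos).trans_le (measure_mono inter_subset_left)).ne' this
  refine ⟨k x₀, ?_⟩
  filter_upwards [hae] with x hx hxε
  obtain ⟨M, hM, hgr⟩ := hg.gmean_le hG.aesm
  have hlip := lipConst_pos n
  set P := 2 * lipConst n * ‖x - x₀‖
  have hP : 0 ≤ P := by positivity
  have hcase : (x ∈ hs n 1 ∧ x₀ ∈ hs n 1) ∨ (x ∈ hs n (-1) ∧ x₀ ∈ hs n (-1)) := by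
    rcases hε with rfl | rfl
    · exact Or.inl ⟨hxε, hx₀⟩
    · exact Or.inr ⟨hxε, hx₀⟩
  -- The Lipschitz constant t^(-1/2) meets Gaussian means of size A + Mδ(‖x‖ + √t); as t grows only
  -- the term with Mδ survives.
  have main : ∀ δ : ℝ, 0 < δ → ‖k x - k x₀‖ ≤ P * (2 * M) * δ := by
    intro δ hδ
    obtain ⟨A, hA, hbd⟩ := hgr δ hδ
    set A' := P * (2 * A + M * δ * (‖x‖ + ‖x₀‖))
    have h1 : ∀ m : ℕ, ‖k x - k x₀‖ ≤ A' / √((m : ℝ) + 1) + P * (2 * M) * δ := by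
      intro m
      have ht : (1 : ℝ) ≤ (m : ℝ) + 1 := by linarith [(Nat.cast_nonneg m : (0 : ℝ) ≤ m)]
      set t := (m : ℝ) + 1
      have hst : 0 < √t := Real.sqrt_pos.2 (by linarith)
      have h2 := enorm_kernelApply_sub_le hG ha hb (by linarith : 0 < t) hcase
      rw [hx m, hx₀' m] at h2
      have h3 : ‖k x - k x₀‖ₑ ≤ ENNReal.ofReal (2 * lipConst n * (‖x - x₀‖ / √t) *
          ((A + M * δ * (‖x‖ + √t)) + (A + M * δ * (‖x₀‖ + √t)))) := by
        refine h2.trans ?_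
        rw [ENNReal.ofReal_mul (p := 2 * lipConst n * (‖x - x₀‖ / √t)) (by positivity),
          ENNReal.ofReal_add (by positivity) (by positivity)]
        gcongr
        · exact hbd t ht x
        · exact hbd t ht x₀
      rw [← ofReal_norm, ENNReal.ofReal_le_ofReal_iff (by positivity)] at h3
      refine h3.trans (le_of_eq ?_)
      simp only [A', P]
      field_simp
      ring
    have hlim : Filter.Tendsto (fun m : ℕ => A' / √((m : ℝ) + 1) + P * (2 * M) * δ) Filter.atTop
        (nhds (0 + P * (2 * M) * δ)) := by
      refine Filter.Tendsto.add_const _ (Filter.Tendsto.div_atTop tendsto_const_nhds ?_)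
      exact Real.tendsto_sqrt_atTop.comp
        (Filter.tendsto_atTop_add_const_right _ _ tendsto_natCast_atTop_atTop)
    rw [zero_add] at hlim
    exact ge_of_tendsto' hlim h1
  have h0 : ‖k x - k x₀‖ ≤ 0 := by
    have hlim : Filter.Tendsto (fun δ : ℝ => P * (2 * M) * δ) (nhdsWithin 0 (Ioi 0)) (nhds 0) := by
      have := (continuous_const_mul (P * (2 * M))).tendsto (0 : ℝ)
      rw [mul_zero] at this
      exact this.mono_left nhdsWithin_le_nhds
    exact ge_of_tendsto hlim (Filter.eventually_of_mem self_mem_nhdsWithin fun δ hδ => main δ hδ)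
  exact sub_eq_zero.1 (norm_le_zero_iff.1 h0)

/-! ### The truncated logarithm -/

lemma refl_mem_cube_zero {l : ℝ} {x : E n} : refl n x ∈ cube 0 l ↔ x ∈ cube 0 l := by
  refine forall_congr' fun i => ?_
  by_cases h : i = Fin.last n
  · subst h; simp [refl_apply_last]
  · rw [refl_apply_ne x h]

lemma measureReal_cube_inter_hs {l : ℝ} (hl : 0 < l) {ε : ℝ} (hε : ε = 1 ∨ ε = -1) :
    volume.real (cube (0 : E n) l ∩ hs n ε) = l ^ (n + 1) / 2 := by
  set φ : E n → ℝ := (cube (0 : E n) l).indicator 1 with hφ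
  have hi : Integrable φ := (integrable_indicator_iff (measurableSet_cube _ _)).2
    (integrableOn_const (isCompact_cube _ _).measure_lt_top.ne)
  have h1 := setIntegral_hs_add hi hε
  have h2 : ∀ y, φ (refl n y) = φ y := by
    intro y
    by_cases hy : y ∈ cube (0 : E n) l
    · rw [hφ, indicator_of_mem hy, indicator_of_mem (refl_mem_cube_zero.2 hy)]; rfl
    · rw [hφ, indicator_of_notMem hy, indicator_of_notMem (mt refl_mem_cube_zero.1 hy)]
  simp_rw [h2] at h1
  have h3 : ∫ y, φ y = l ^ (n + 1) := by
    rw [hφ, integral_indicator_one (measurableSet_cube _ _), measureReal_cube _ hl.le]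
  have h4 : ∫ y in hs n ε, φ y = volume.real (cube (0 : E n) l ∩ hs n ε) := by
    rw [hφ, integral_indicator_one (measurableSet_cube _ _), measureReal_restrict_apply
      (measurableSet_cube _ _)]
  rw [integral_add hi.integrableOn hi.integrableOn, h3, h4] at h1
  linarith

/-- The hyperplane halves a cube centred at the origin, whence the factor 2. -/
lemma le_of_ae_le_on_half {g : E n → ℝ} (h0 : ∀ x, 0 ≤ g x) {l C κ : ℝ} (hl : 0 < l)
    (hi : IntegrableOn g (cube 0 l)) (hC : ⨍ x in cube (0 : E n) l, g x ≤ C) {ε : ℝ}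
    (hε : ε = 1 ∨ ε = -1) (hκ : ∀ᵐ x, x ∈ hs n ε → x ∈ cube (0 : E n) l → κ ≤ g x) :
    κ ≤ 2 * C := by
  have hm : MeasurableSet (cube (0 : E n) l ∩ hs n ε) :=
    (measurableSet_cube _ _).inter (measurableSet_hs _)
  have h1 : κ * (l ^ (n + 1) / 2) ≤ ∫ x in cube (0 : E n) l, g x := by
    calc κ * (l ^ (n + 1) / 2) = ∫ _x in cube (0 : E n) l ∩ hs n ε, κ := by
          rw [setIntegral_const, measureReal_cube_inter_hs hl hε, smul_eq_mul, mul_comm]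
      _ ≤ ∫ x in cube (0 : E n) l ∩ hs n ε, g x := by
          refine setIntegral_mono_on_ae ?_ (hi.mono_set inter_subset_left) hm ?_
          · exact integrableOn_const
              ((measure_mono inter_subset_left).trans_lt (isCompact_cube _ _).measure_lt_top).ne
          · filter_upwards [hκ] with x hx hxm using hx hxm.2 hxm.1
      _ ≤ _ := setIntegral_mono_set hi (Filter.Eventually.of_forall h0) inter_subset_left.eventuallyLE
  rw [setAverage_cube_eq _ hl, smul_eq_mul, inv_mul_le_iff₀ (by positivity)] at hC
  have h2 : κ * (l ^ (n + 1) / 2) ≤ l ^ (n + 1) * C := h1.trans hC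
  have h3 : 0 < l ^ (n + 1) := by positivity
  nlinarith

/-- The truncated logarithm is not congruent to a function of bounded mean oscillation. -/
theorem logH_notMem_BMOmod {L : (E n → ℂ) → (E n → ℂ) → Prop} (hL : IsSplit a b L) :
    logH n ∉ BMOmod L := by
  rintro ⟨h, hh, k, hk, hsum⟩
  obtain ⟨C, hh⟩ := mem_BMO_iff.1 hh
  obtain ⟨C', hE⟩ := mem_BMO_iff.1 (logE_mem_BMO n)
  have hC0 := hh.nonneg
  have hadd : ∀ x, h x + k x = logH n x := fun x => congrFun hsum x
  have hgrow : SqrtGrowth k := by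
    refine SqrtGrowth.of_le hh.sqrtGrowth hE.sqrtGrowth hh.1.aestronglyMeasurable fun x => ?_
    have e : k x = logH n x - h x := by rw [← hadd x]; ring
    have h1 : ‖logH n x‖ ≤ ‖logE n x‖ := by
      rw [logH_eq_indicator]; exact norm_indicator_le_norm_self _ _
    rw [e]
    linarith [norm_sub_le (logH n x) (h x)]
  obtain ⟨cp, hcp⟩ := exists_ae_eq_const_of_mem_kerL hL hk hgrow (Or.inl rfl)
  obtain ⟨cm, hcm⟩ := exists_ae_eq_const_of_mem_kerL hL hk hgrow (Or.inr rfl)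
  -- On the upper half of the cube of half side exp(-s) the logarithm is at most -s. The lower half
  -- keeps the mean of h within 2C of -cm, so the upper half yields s ≤ ‖cp - cm‖ + 4C, which this s
  -- violates.
  set s := ‖cp - cm‖ + 4 * C + 1
  set l := 2 * Real.exp (-s)
  have hl : 0 < l := by positivity
  set m := cAvg h 0 l
  have hi := integrableOn_cube_norm_sub hh.1 m 0 l
  have hosc := hh.osc_le 0 l hl
  have low : ‖cm + m‖ ≤ 2 * C := by
    refine le_of_ae_le_on_half (fun x => norm_nonneg _) hl hi hosc (Or.inr rfl) ?_
    filter_upwards [hcm] with x hx hxh _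
    have hx1 : x ∉ hs n 1 := Set.disjoint_right.1 disjoint_hs hxh
    have h1 : h x = -cm := by
      have := hadd x
      rw [hx hxh, logH_eq_indicator, indicator_of_notMem hx1] at this
      exact eq_neg_of_add_eq_zero_left this
    rw [h1, ← norm_neg, neg_add']
  have up : s - ‖cp - cm‖ - 2 * C ≤ 2 * C := by
    refine le_of_ae_le_on_half (fun x => norm_nonneg _) hl hi hosc (Or.inl rfl) ?_
    filter_upwards [hcp] with x hx hxh hxq
    have hpos : 0 < lastCoord x := by
      have : 0 < 1 * lastCoord x := hxh
      linarith
    have h1 : h x = (Real.log (lastCoord x) : ℂ) - cp := by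
      have := hadd x
      rw [hx hxh, logH_eq_indicator, indicator_of_mem hxh, logE_eq] at this
      rw [← this]; ring
    have h2 : Real.log (lastCoord x) ≤ -s := by
      have h3 := hxq (Fin.last n)
      simp only [PiLp.zero_apply, sub_zero] at h3
      have h4 : lastCoord x ≤ Real.exp (-s) := by
        refine (le_abs_self _).trans (h3.trans (le_of_eq ?_))
        simp only [l]; ring
      calc _ ≤ Real.log (Real.exp (-s)) := Real.log_le_log hpos h4
        _ = _ := Real.log_exp _
    have h5 : s ≤ ‖(Real.log (lastCoord x) : ℂ)‖ := by
      rw [Complex.norm_real, Real.norm_eq_abs]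
      linarith [neg_abs_le (Real.log (lastCoord x))]
    have e : (Real.log (lastCoord x) : ℂ) = (h x - m) + ((cp - cm) + (cm + m)) := by
      rw [h1]; ring
    have h6 : ‖(Real.log (lastCoord x) : ℂ)‖ ≤ ‖h x - m‖ + (‖cp - cm‖ + ‖cm + m‖) := by
      rw [e]
      exact (norm_add_le _ _).trans (by gcongr; exact norm_add_le _ _)
    linarith
  simp only [s] at up
  linarith

end SplitBMO

end

/-! ### Large time limits and increments of the Dirichlet semigroup. -/

noncomputable section

namespace SplitBMO

variable {n : ℕ} {f : E n → ℂ}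

/-! ### Limits of functions with small increments -/

/-- Along doublings of s the increments decay geometrically with ratio 1/√2. The constant 4 closes
the induction because 1 + 4/√2 ≤ 4, that is √2 ≥ 4/3. -/
lemma norm_sub_le_of_increments {q : ℝ → ℂ} {B : ℝ} (hB : 0 ≤ B)
    (hq : ∀ s δ, 0 < δ → δ ≤ s → ‖q (s + δ) - q s‖ ≤ B / √s) {s s' : ℝ} (hs : 0 < s)
    (hss' : s ≤ s') : ‖q s' - q s‖ ≤ 4 * B / √s := by
  obtain ⟨k, hk⟩ := pow_unbounded_of_one_lt (s' / s) (one_lt_two : (1 : ℝ) < 2)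
  rw [div_lt_iff₀ hs] at hk
  replace hk := hk.le
  induction k generalizing s with
  | zero =>
    have : s' = s := le_antisymm (by simpa using hk) hss'
    rw [this, sub_self, norm_zero]; positivity
  | succ k ih =>
    have hst : 0 < √s := Real.sqrt_pos.2 hs
    rcases eq_or_lt_of_le hss' with h | h
    · rw [h, sub_self, norm_zero]; positivity
    rcases le_or_gt s' (2 * s) with h2 | h2
    · have h3 := hq s (s' - s) (by linarith) (by linarith)
      rw [add_sub_cancel] at h3
      refine h3.trans ?_
      gcongr
      linarith
    · have h3 := hq s s hs le_rfl
      have h4 := ih (s := 2 * s) (by positivity) h2.le (by rw [pow_succ] at hk; linarith)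
      rw [← two_mul] at h3
      have h5 : 4 * B / √(2 * s) ≤ 3 * (B / √s) := by
        rw [Real.sqrt_mul zero_le_two, mul_div_assoc', div_le_div_iff₀ (by positivity) hst]
        have h6 : (4 : ℝ) / 3 ≤ √2 := Real.le_sqrt_of_sq_le (by norm_num)
        have h7 : 0 ≤ B * √s := by positivity
        nlinarith
      have e : q s' - q s = (q s' - q (2 * s)) + (q (2 * s) - q s) := by ring
      rw [e]
      refine (norm_add_le _ _).trans ?_
      rw [mul_div_assoc]
      linarith

lemma tendsto_div_sqrt_nat (c : ℝ) :
    Filter.Tendsto (fun m : ℕ => c / √((m : ℝ) + 1)) Filter.atTop (nhds 0) :=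
  Filter.Tendsto.div_atTop tendsto_const_nhds (Real.tendsto_sqrt_atTop.comp
    (Filter.tendsto_atTop_add_const_right _ _ tendsto_natCast_atTop_atTop))

lemma eventually_nat_ge (s : ℝ) : ∀ᶠ m : ℕ in Filter.atTop, s ≤ (m : ℝ) + 1 := by
  obtain ⟨N, hN⟩ := exists_nat_ge s
  filter_upwards [Filter.eventually_ge_atTop N] with m hm
  have : (N : ℝ) ≤ m := Nat.cast_le.2 hm
  linarith

lemma norm_limit_sub_le {q : ℝ → ℂ} {B : ℝ} (hB : 0 ≤ B)
    (hq : ∀ s δ, 0 < δ → δ ≤ s → ‖q (s + δ) - q s‖ ≤ B / √s) {z : ℂ}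
    (hz : Filter.Tendsto (fun m : ℕ => q ((m : ℝ) + 1)) Filter.atTop (nhds z)) {s : ℝ} (hs : 0 < s) :
    ‖z - q s‖ ≤ 4 * B / √s := by
  refine le_of_tendsto (hz.sub_const (q s)).norm ?_
  filter_upwards [eventually_nat_ge s] with m hm
  exact norm_sub_le_of_increments hB hq hs hm

lemma exists_limit_of_increments {q : ℝ → ℂ} {B : ℝ} (hB : 0 ≤ B)
    (hq : ∀ s δ, 0 < δ → δ ≤ s → ‖q (s + δ) - q s‖ ≤ B / √s) :
    ∃ z, Filter.Tendsto (fun m : ℕ => q ((m : ℝ) + 1)) Filter.atTop (nhds z) := by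
  have hc : CauchySeq (fun m : ℕ => q ((m : ℝ) + 1)) := by
    refine cauchySeq_of_le_tendsto_0 (fun N : ℕ => 8 * B / √((N : ℝ) + 1)) (fun m m' N hm hm' => ?_)
      (tendsto_div_sqrt_nat _)
    have h0 : (0 : ℝ) < (N : ℝ) + 1 := by positivity
    have hm1 : (N : ℝ) + 1 ≤ (m : ℝ) + 1 := by gcongr
    have hm2 : (N : ℝ) + 1 ≤ (m' : ℝ) + 1 := by gcongr
    have h1 := norm_sub_le_of_increments hB hq h0 hm1
    have h2 := norm_sub_le_of_increments hB hq h0 hm2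
    rw [dist_eq_norm]
    have e : q ((m : ℝ) + 1) - q ((m' : ℝ) + 1)
        = (q ((m : ℝ) + 1) - q ((N : ℝ) + 1)) - (q ((m' : ℝ) + 1) - q ((N : ℝ) + 1)) := by ring
    rw [e]
    refine (norm_sub_le _ _).trans ((add_le_add h1 h2).trans (le_of_eq ?_))
    ring
  exact cauchySeq_tendsto_of_complete hc

/-! ### The Dirichlet space -/

/-- The Dirichlet heat semigroup. -/
abbrev dsg (t : ℝ) (f : E n → ℂ) : E n → ℂ := kernelApply (pk (-1) (-1)) t f

lemma abs_neg_one_le : |(-1 : ℝ)| ≤ 1 := by simp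

lemma gint_dsg (hf : GInt f) {t : ℝ} (ht : 0 < t) : GInt (dsg t f) :=
  hf.kernelApply abs_neg_one_le abs_neg_one_le ht

lemma integrableOn_ball (hf : LocallyIntegrable f volume) (z : E n) (r : ℝ) :
    IntegrableOn f (Metric.ball z r) :=
  (hf.integrableOn_isCompact (isCompact_closedBall z r)).mono_set Metric.ball_subset_closedBall

lemma ballAvg_eq_ofReal (hf : LocallyIntegrable f volume) (z : E n) {r : ℝ} (hr : 0 < r) :
    ballAvg r (fun x => ‖f x‖ₑ) z = ENNReal.ofReal (⨍ x in Metric.ball z r, ‖f x‖) := by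
  have hω := measureReal_unitBall_pos n
  unfold ballAvg
  rw [setAverage_eq, measureReal_ball z hr.le, volume_ball_eq_ofReal 0 hr.le, smul_eq_mul,
    ← ENNReal.ofReal_inv_of_pos (by positivity),
    ← ofReal_integral_norm_eq_lintegral_enorm (integrableOn_ball hf z r),
    ← ENNReal.ofReal_mul (by positivity)]

/-- The increments of the Dirichlet semigroup. -/
lemma dsg_increment (hf : GInt f) {s δ : ℝ} (hs0 : 0 < s) (hδ : 0 < δ) (x : E n) :
    dsg s f x - dsg (s + δ) f x = dsg s (fun y => f y - dsg δ f y) x := by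
  rw [dsg, dsg, dsg, kernelApply_sub hf (gint_dsg hf hδ) abs_neg_one_le abs_neg_one_le hs0,
    kernelApply_kernelApply hf (Or.inr rfl) (Or.inr rfl) hs0 hδ]

lemma gint_of_norm_le {g : E n → ℂ} (hg : AEStronglyMeasurable g volume) {C : ℝ} (hC : 0 ≤ C)
    (h : ∀ x, ‖g x‖ ≤ C * ‖x‖) : GInt g := by
  refine ⟨hg, fun t ht x => ?_⟩
  have h1 : ∀ y, ‖g y‖ₑ ≤ ENNReal.ofReal C * ENNReal.ofReal ((1 + ‖y‖) ^ 1) := by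
    intro y
    rw [← ofReal_norm, ← ENNReal.ofReal_mul hC]
    refine ENNReal.ofReal_le_ofReal ((h y).trans ?_)
    gcongr
    linarith
  refine (gmean_mono h1 x).trans_lt ?_
  rw [gmean_const_mul ENNReal.ofReal_ne_top]
  exact ENNReal.mul_lt_top ENNReal.ofReal_lt_top (gmean_poly_lt_top ht 1 x)

/-- The hypothesis at radius √δ bounds the averages of f - exp(-δL)f over all balls of that radius.
A Gaussian mean at a time of at least δ is dominated by a Gaussian mean of such averages. -/
lemma gmean_sub_dsg_le {C : ℝ}
    (hC : ∀ (y : E n) (r : ℝ), 0 < r → ⨍ x in Metric.ball y r, ‖f x - dsg (r ^ 2) f x‖ ≤ C)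
    (hf : GInt f) {s δ : ℝ} (hδ : 0 < δ) (hδs : δ ≤ s) (x : E n) :
    gmean (2 * s) (fun y => ‖f y - dsg δ f y‖ₑ) x ≤ ENNReal.ofReal (shiftConst n * C) := by
  have hS := shiftConst_pos n
  have hst : 0 < √δ := Real.sqrt_pos.2 hδ
  have hsq : √δ ^ 2 = δ := Real.sq_sqrt hδ.le
  have hG := hf.sub (gint_dsg hf hδ)
  have h1 : ∀ z, ballAvg (√δ) (fun y => ‖f y - dsg δ f y‖ₑ) z ≤ ENNReal.ofReal C := by
    intro z
    rw [ballAvg_eq_ofReal hG.locallyIntegrable z hst]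
    have := hC z _ hst
    rw [hsq] at this
    exact ENNReal.ofReal_le_ofReal this
  refine (gmean_le_ballAvg (by linarith) hst (by rw [hsq]; linarith) hG.aemeasurable_enorm x).trans ?_
  rw [ENNReal.ofReal_mul hS.le]
  gcongr
  refine (gmean_mono h1 x).trans (le_of_eq ?_)
  exact gmean_const (by linarith) _ x

end SplitBMO

end

/-! ### Decomposition of the Dirichlet space into BMO and the kernel space. -/

noncomputable section

namespace SplitBMO

variable {n : ℕ} {f : E n → ℂ}

lemma norm_le_of_enorm_le {z : ℂ} {r : ℝ} (hr : 0 ≤ r) (h : ‖z‖ₑ ≤ ENNReal.ofReal r) : ‖z‖ ≤ r := by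
  rwa [← ofReal_norm, ENNReal.ofReal_le_ofReal_iff hr] at h

lemma sameHalf_of_pos_mul {x y : E n} (h : 0 < lastCoord x * lastCoord y) :
    (x ∈ hs n 1 ∧ y ∈ hs n 1) ∨ (x ∈ hs n (-1) ∧ y ∈ hs n (-1)) := by
  simp only [hs, mem_ofPred_eq]
  rcases mul_pos_iff.1 h with h | h
  · left; constructor <;> linarith
  · right; constructor <;> linarith

/-- The increment is -exp(-sL) applied to f - exp(-δL)f, whose Gaussian means are bounded; the
factor |x_n|/√s is the vanishing of the Dirichlet kernel at the hyperplane. -/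
lemma dsg_increment_norm_le {C : ℝ} (hC0 : 0 ≤ C)
    (hC : ∀ (y : E n) (r : ℝ), 0 < r → ⨍ x in Metric.ball y r, ‖f x - dsg (r ^ 2) f x‖ ≤ C)
    (hf : GInt f) (x : E n) {s δ : ℝ} (hδ : 0 < δ) (hδs : δ ≤ s) :
    ‖dsg (s + δ) f x - dsg s f x‖
      ≤ 4 * lipConst n * (shiftConst n * C) * |lastCoord x| / √s := by
  have hS := shiftConst_pos n
  have hL := lipConst_pos n
  have hs0 : 0 < s := hδ.trans_le hδs
  rw [norm_sub_rev, dsg_increment hf hs0 hδ]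
  refine norm_le_of_enorm_le (by positivity) ?_
  refine (enorm_kernelApply_dirichlet_le hs0 _ x).trans ?_
  refine (mul_le_mul_right (gmean_sub_dsg_le hC hf hδ hδs x) _).trans (le_of_eq ?_)
  rw [← ENNReal.ofReal_mul (by positivity)]
  congr 1; ring

/-- The companion estimate for cubes far from the hyperplane, where |x_n| is too large to be useful:
the distance of two points replaces it. -/
lemma dsg_increment_lipschitz {C : ℝ} (hC0 : 0 ≤ C)
    (hC : ∀ (y : E n) (r : ℝ), 0 < r → ⨍ x in Metric.ball y r, ‖f x - dsg (r ^ 2) f x‖ ≤ C)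
    (hf : GInt f) {x x' : E n} (hx : 0 < lastCoord x * lastCoord x') {s δ : ℝ} (hδ : 0 < δ)
    (hδs : δ ≤ s) :
    ‖(dsg (s + δ) f x - dsg (s + δ) f x') - (dsg s f x - dsg s f x')‖
      ≤ 4 * lipConst n * (shiftConst n * C) * ‖x - x'‖ / √s := by
  have hS := shiftConst_pos n
  have hL := lipConst_pos n
  have hs0 : 0 < s := hδ.trans_le hδs
  have e : (dsg (s + δ) f x - dsg (s + δ) f x') - (dsg s f x - dsg s f x')
      = -((dsg s f x - dsg (s + δ) f x) - (dsg s f x' - dsg (s + δ) f x')) := by ring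
  rw [e, norm_neg, dsg_increment hf hs0 hδ, dsg_increment hf hs0 hδ]
  refine norm_le_of_enorm_le (by positivity) ?_
  refine (enorm_kernelApply_sub_le (hf.sub (gint_dsg hf hδ)) abs_neg_one_le abs_neg_one_le hs0
    (sameHalf_of_pos_mul hx)).trans ?_
  refine (mul_le_mul_right (add_le_add (gmean_sub_dsg_le hC hf hδ hδs x)
    (gmean_sub_dsg_le hC hf hδ hδs x')) _).trans (le_of_eq ?_)
  rw [← ENNReal.ofReal_add (by positivity) (by positivity), ← ENNReal.ofReal_mul (by positivity)]
  congr 1; ring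

/-- The large time limit of the Dirichlet semigroup on a function of its `BMO` space. -/
lemma exists_dsg_limit {C : ℝ} (hC0 : 0 ≤ C)
    (hC : ∀ (y : E n) (r : ℝ), 0 < r → ⨍ x in Metric.ball y r, ‖f x - dsg (r ^ 2) f x‖ ≤ C)
    (hf : GInt f) : ∃ (k : E n → ℂ) (B : ℝ), 0 ≤ B ∧ GInt k ∧
      (∀ s, 0 < s → ∀ x, ‖k x - dsg s f x‖ ≤ B * |lastCoord x| / √s) ∧
      ∀ s, 0 < s → ∀ x x', 0 < lastCoord x * lastCoord x' →
        ‖(k x - k x') - (dsg s f x - dsg s f x')‖ ≤ B * ‖x - x'‖ / √s := by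
  have hS := shiftConst_pos n
  have hL := lipConst_pos n
  have h1 := fun x s δ (hδ : 0 < δ) (hδs : δ ≤ s) => dsg_increment_norm_le hC0 hC hf x hδ hδs
  choose k hk using fun x => exists_limit_of_increments (q := fun s => dsg s f x)
    (by positivity) (h1 x)
  have hb : ∀ s, 0 < s → ∀ x, ‖k x - dsg s f x‖
      ≤ 4 * (4 * lipConst n * (shiftConst n * C)) * |lastCoord x| / √s := by
    intro s hs0 x
    rw [mul_assoc 4 _ |lastCoord x|]
    exact norm_limit_sub_le (q := fun s => dsg s f x) (by positivity) (h1 x) (hk x) hs0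
  have hkm : AEStronglyMeasurable k volume :=
    aestronglyMeasurable_of_tendsto_ae Filter.atTop
      (fun m : ℕ => (gint_dsg hf (by positivity : (0 : ℝ) < (m : ℝ) + 1)).aesm)
      (Filter.Eventually.of_forall hk)
  refine ⟨k, 4 * (4 * lipConst n * (shiftConst n * C)), by positivity, ?_, hb,
    fun s hs0 x x' hx => ?_⟩
  · have hg := gint_dsg hf one_pos
    have h2 : GInt (fun x => k x - dsg 1 f x) := by
      refine gint_of_norm_le (hkm.sub hg.aesm)
        (C := 4 * (4 * lipConst n * (shiftConst n * C))) (by positivity) fun x => ?_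
      have := hb 1 one_pos x
      rw [Real.sqrt_one, div_one] at this
      refine this.trans ?_
      gcongr
      exact abs_lastCoord_le x
    have h3 := h2.add hg
    simpa using h3
  · rw [mul_assoc 4 _ ‖x - x'‖]
    exact norm_limit_sub_le (q := fun s => dsg s f x - dsg s f x') (by positivity)
      (fun s δ hδ hδs => dsg_increment_lipschitz hC0 hC hf hx hδ hδs) ((hk x).sub (hk x')) hs0

/-- Both exp(-tL)k and k are within O(1/√s) of exp(-(t + s)L)f at the point x. For the former the
error |y_n|/√s is integrated against the kernel at time t, which is finite and independent of s. -/
lemma dsg_eq_self_of_limit (hf : GInt f) {k : E n → ℂ} (hk : GInt k) {B : ℝ} (hB : 0 ≤ B)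
    (h : ∀ s, 0 < s → ∀ x, ‖k x - dsg s f x‖ ≤ B * |lastCoord x| / √s) {t : ℝ} (ht : 0 < t)
    (x : E n) : dsg t k x = k x := by
  set G := gmean t (fun y => ENNReal.ofReal ((1 + ‖y‖) ^ 1)) x
  have hG : G < ⊤ := gmean_poly_lt_top ht 1 x
  have key : ∀ m : ℕ, ‖dsg t k x - k x‖
      ≤ (2 * (B * G.toReal) + B * |lastCoord x|) / √((m : ℝ) + 1) := by
    intro m
    have hs0 : (0 : ℝ) < (m : ℝ) + 1 := by positivity
    have hst : 0 < √((m : ℝ) + 1) := Real.sqrt_pos.2 hs0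
    have h1 : ‖dsg t k x - dsg (t + ((m : ℝ) + 1)) f x‖
        ≤ 2 * (B / √((m : ℝ) + 1) * G.toReal) := by
      have e : dsg t k x - dsg (t + ((m : ℝ) + 1)) f x
          = dsg t (fun y => k y - dsg ((m : ℝ) + 1) f y) x := by
        rw [dsg, dsg, dsg, kernelApply_sub hk (gint_dsg hf hs0) abs_neg_one_le abs_neg_one_le ht,
          kernelApply_kernelApply hf (Or.inr rfl) (Or.inr rfl) ht hs0]
      rw [e]
      refine norm_le_of_enorm_le (by positivity) ?_
      refine (enorm_kernelApply_le abs_neg_one_le abs_neg_one_le ht _ x).trans ?_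
      have h2 : ∀ y, ‖k y - dsg ((m : ℝ) + 1) f y‖ₑ
          ≤ ENNReal.ofReal (B / √((m : ℝ) + 1)) * ENNReal.ofReal ((1 + ‖y‖) ^ 1) := by
        intro y
        rw [← ofReal_norm, ← ENNReal.ofReal_mul (by positivity)]
        refine ENNReal.ofReal_le_ofReal ((h _ hs0 y).trans ?_)
        rw [mul_div_right_comm, pow_one]
        gcongr
        linarith [abs_lastCoord_le y]
      refine (mul_le_mul_right (gmean_mono h2 x) 2).trans (le_of_eq ?_)
      rw [gmean_const_mul ENNReal.ofReal_ne_top, ENNReal.ofReal_mul zero_le_two,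
        ENNReal.ofReal_mul (by positivity), ENNReal.ofReal_toReal hG.ne,
        ENNReal.ofReal_ofNat]
    have h2 : ‖k x - dsg (t + ((m : ℝ) + 1)) f x‖ ≤ B * |lastCoord x| / √((m : ℝ) + 1) := by
      refine (h _ (by positivity) x).trans ?_
      exact div_le_div_of_nonneg_left (by positivity) hst (Real.sqrt_le_sqrt (by linarith))
    have e : dsg t k x - k x = (dsg t k x - dsg (t + ((m : ℝ) + 1)) f x)
        - (k x - dsg (t + ((m : ℝ) + 1)) f x) := by ring
    rw [e]
    refine (norm_sub_le _ _).trans ((add_le_add h1 h2).trans (le_of_eq ?_))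
    ring
  have := ge_of_tendsto' (tendsto_div_sqrt_nat _) key
  exact sub_eq_zero.1 (norm_le_zero_iff.1 this)

lemma setAverage_cube_le_of_ball {g : E n → ℝ} (h0 : ∀ x, 0 ≤ g x) (c : E n) {l : ℝ} (hl : 0 < l)
    (hi : IntegrableOn g (Metric.ball c ((n + 1) * l))) :
    ⨍ x in cube c l, g x ≤ ((n + 1) ^ (n + 1) * volume.real (Metric.ball (0 : E n) 1)) *
      ⨍ x in Metric.ball c ((n + 1) * l), g x := by
  have hω := measureReal_unitBall_pos n
  have h1 : ∫ x in cube c l, g x ≤ ∫ x in Metric.ball c ((n + 1) * l), g x :=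
    setIntegral_mono_set hi (Filter.Eventually.of_forall h0)
      (Filter.Eventually.of_forall (cube_subset_ball c hl))
  rw [setAverage_cube_eq c hl, setAverage_eq, measureReal_ball c (by positivity), smul_eq_mul,
    smul_eq_mul, mul_pow]
  calc (l ^ (n + 1))⁻¹ * ∫ x in cube c l, g x
      ≤ (l ^ (n + 1))⁻¹ * ∫ x in Metric.ball c ((n + 1) * l), g x := by gcongr
    _ = _ := by field_simp

/-- On a cube of side l take √s = (n + 1)l, the radius of a ball containing it. The part f -
exp(-sL)f is controlled by the seminorm. The part k - exp(-sL)f is bounded if the centre is within l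
of the hyperplane, and otherwise the cube lies on one side and the function is within a bounded
distance of its value at the centre. -/
lemma sub_limit_mem_BMO {C : ℝ}
    (hC : ∀ (y : E n) (r : ℝ), 0 < r → ⨍ x in Metric.ball y r, ‖f x - dsg (r ^ 2) f x‖ ≤ C)
    (hf : GInt f) {k : E n → ℂ} (hk : GInt k) {B : ℝ} (hB : 0 ≤ B)
    (h : ∀ s, 0 < s → ∀ x, ‖k x - dsg s f x‖ ≤ B * |lastCoord x| / √s)
    (h' : ∀ s, 0 < s → ∀ x x', 0 < lastCoord x * lastCoord x' →
        ‖(k x - k x') - (dsg s f x - dsg s f x')‖ ≤ B * ‖x - x'‖ / √s) :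
    (fun x => f x - k x) ∈ BMO n := by
  refine mem_BMO_of_forall_exists (hf.sub hk).locallyIntegrable
    (C := ((n + 1) ^ (n + 1) * volume.real (Metric.ball (0 : E n) 1)) * C + 2 * B)
    fun c l hl => ?_
  have hr : 0 < ((n : ℝ) + 1) * l := by positivity
  have hs0 := pow_pos hr 2
  have hsq : √((((n : ℝ) + 1) * l) ^ 2) = ((n : ℝ) + 1) * l := Real.sqrt_sq hr.le
  have hG := hf.sub (gint_dsg hf hs0)
  have hln : l ≤ ((n : ℝ) + 1) * l := le_mul_of_one_le_left hl.le (by simp)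
  have hlc : ∀ x ∈ cube c l, |lastCoord x - lastCoord c| ≤ l / 2 := fun x hx => hx (Fin.last n)
  obtain ⟨m, hm⟩ : ∃ m : ℂ, ∀ x ∈ cube c l,
      ‖(k x - dsg ((((n : ℝ) + 1) * l) ^ 2) f x) - m‖ ≤ 2 * B := by
    rcases le_or_gt |lastCoord c| l with hcl | hcl
    · refine ⟨0, fun x hx => ?_⟩
      rw [sub_zero]
      refine (h _ hs0 x).trans ?_
      rw [hsq, div_le_iff₀ hr]
      have h1 : |lastCoord x| ≤ 2 * l := by
        have := abs_sub_abs_le_abs_sub (lastCoord x) (lastCoord c)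
        linarith [hlc x hx]
      nlinarith
    · refine ⟨k c - dsg ((((n : ℝ) + 1) * l) ^ 2) f c, fun x hx => ?_⟩
      have h1 : 0 < lastCoord x * lastCoord c := by
        have h2 := abs_le.1 (hlc x hx)
        rcases lt_abs.1 hcl with h3 | h3
        · exact mul_pos (by linarith) (by linarith)
        · exact mul_pos_of_neg_of_neg (by linarith) (by linarith)
      have e : (k x - dsg ((((n : ℝ) + 1) * l) ^ 2) f x) - (k c - dsg ((((n : ℝ) + 1) * l) ^ 2) f c)
          = (k x - k c) - (dsg ((((n : ℝ) + 1) * l) ^ 2) f x - dsg ((((n : ℝ) + 1) * l) ^ 2) f c) := by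
        ring
      rw [e]
      refine (h' _ hs0 x c h1).trans ?_
      rw [hsq, div_le_iff₀ hr]
      have := norm_sub_le_of_mem_cube hx
      nlinarith
  have hcube : IntegrableOn (fun x => ‖f x - dsg ((((n : ℝ) + 1) * l) ^ 2) f x‖) (cube c l) :=
    (integrableOn_cube hG.locallyIntegrable c l).norm
  have hcst : IntegrableOn (fun _ : E n => 2 * B) (cube c l) :=
    integrableOn_const (isCompact_cube c l).measure_lt_top.ne
  refine ⟨-m, ?_⟩
  calc ⨍ x in cube c l, ‖(f x - k x) - -m‖
      ≤ ⨍ x in cube c l, (‖f x - dsg ((((n : ℝ) + 1) * l) ^ 2) f x‖ + 2 * B) := by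
        refine setAverage_cube_mono hl (fun x => norm_nonneg _) (hcube.add hcst) fun x hx => ?_
        have e : (f x - k x) - -m = (f x - dsg ((((n : ℝ) + 1) * l) ^ 2) f x)
          - ((k x - dsg ((((n : ℝ) + 1) * l) ^ 2) f x) - m) := by ring
        rw [e]
        exact (norm_sub_le _ _).trans (add_le_add_right (hm x hx) _)
    _ = (⨍ x in cube c l, ‖f x - dsg ((((n : ℝ) + 1) * l) ^ 2) f x‖) + 2 * B :=
        setAverage_add_const hl hcube _
    _ ≤ _ := by
        gcongr
        refine (setAverage_cube_le_of_ball (fun x => norm_nonneg _) c hl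
          (integrableOn_ball hG.locallyIntegrable c _).norm).trans ?_
        gcongr
        exact hC c _ hr

theorem BMOL_lapD_subset_BMOmod : BMOL (lapD n) ⊆ BMOmod (lapD n) := by
  intro f hfL
  obtain ⟨hfM, C, hC⟩ := (mem_BMOL_iff (isSplit_lapD n)).1 hfL
  have hf := gint_of_mem_classM hfM
  have hC0 : 0 ≤ C := by
    refine le_trans ?_ (hC 0 1 one_pos)
    rw [setAverage_eq]
    exact mul_nonneg (by positivity) (integral_nonneg fun x => norm_nonneg _)
  obtain ⟨k, B, hB, hk, h, h'⟩ := exists_dsg_limit hC0 hC hf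
  have hb := sub_limit_mem_BMO hC hf hk hB h h'
  refine ⟨_, hb, k, (mem_kerL_iff (isSplit_lapD n)).2 ⟨?_, fun t ht => ?_⟩, by ext x; simp⟩
  -- Membership of k in the growth class is inherited from f and f - k.
  · have := classM_sub hfM (BMO_subset_classM hb)
    convert this using 1
    ext x; simp
  · exact Filter.Eventually.of_forall fun x => dsg_eq_self_of_limit hf hk hB h ht x

lemma zero_mem_kerL {a b : ℝ} {L : (E n → ℂ) → (E n → ℂ) → Prop} (hL : IsSplit a b L) :
    (0 : E n → ℂ) ∈ kerL L := by
  refine (mem_kerL_iff hL).2 ⟨⟨locallyIntegrable_const 0, 1, one_pos, by simp⟩, fun t ht => ?_⟩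
  refine Filter.Eventually.of_forall fun x => ?_
  simp [kernelApply]

lemma BMO_subset_BMOmod {a b : ℝ} {L : (E n → ℂ) → (E n → ℂ) → Prop} (hL : IsSplit a b L) :
    BMO n ⊆ BMOmod L :=
  fun f hf => ⟨f, hf, 0, zero_mem_kerL hL, add_zero f⟩

end SplitBMO

end

/-! ### The comparison of the spaces. -/

theorem theorem4p1 (n : ℕ) :
    -- the Dirichlet space is a proper subspace of BMO, modulo the kernel space of the Laplacian
    BMOL (lapD n) ⊂ BMOmod (lapD n) ∧
    logE n ∈ BMO n ∧ logE n ∉ BMOL (lapD n) ∧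
    -- BMO is a proper subspace of the Neumann space, again modulo the kernel space
    BMO n ⊆ BMOL (lapN n) ∧
    BMOmod (lapN n) ⊂ BMOL (lapN n) ∧
    logH n ∈ BMOL (lapN n) ∧ logH n ∉ BMOmod (lapN n) ∧
    -- neither inclusion holds for the mixed Laplacian
    ¬ BMO n ⊆ BMOL (lapDN n) ∧ logE n ∉ BMOL (lapDN n) ∧
    ¬ BMOL (lapDN n) ⊆ BMOmod (lapDN n) ∧
    logH n ∈ BMOL (lapDN n) ∧ logH n ∉ BMOmod (lapDN n) := by
  have hD := logE_notMem_BMOL (isSplit_lapD n)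
  have hN := logH_mem_BMOL (isSplit_lapN n)
  have hN' := logH_notMem_BMOmod (isSplit_lapN n)
  have hDN := logE_notMem_BMOL (isSplit_lapDN n)
  have hDN1 := logH_mem_BMOL (isSplit_lapDN n)
  have hDN2 := logH_notMem_BMOmod (isSplit_lapDN n)
  exact ⟨⟨BMOL_lapD_subset_BMOmod,
      fun h => hD (h (BMO_subset_BMOmod (isSplit_lapD n) (logE_mem_BMO n)))⟩,
    logE_mem_BMO n, hD, BMO_subset_BMOL_lapN, ⟨BMOmod_lapN_subset, fun h => hN' (h hN)⟩, hN, hN',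
    fun h => hDN (h (logE_mem_BMO n)), hDN, fun h => hDN2 (h hDN1), hDN1, hDN2⟩
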